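/- Let $k$ be an algebraically closed field of characteristic $0$, let $X$ be a smooth projective connected curve over $k$, and let $r\ge 0$, $n\ge 1$ be integers. For a $k$-algebra $S$ put $X_S=X\times_k\operatorname{Spec}S$. An $S$-point of $\mathrm{Nil}^n_{X,\mathrm{Sp}_{2r}}$ is a quadruple $(E,h,\theta,F)$ where - $E$ is a vector bundle of rank $2r$ on $X_S$ and $h:E\xrightarrow{\sim}E^\vee$ is a symplectic structure, i.e. $Q(s,t)=h(s)(t)$ is a non-degenerate alternating form; - $\theta:E\to E$ is an endomorphism with $Q(s,\theta t)=-Q(\theta s,t)$ ("self-adjoint"), $\theta^n=0$ and $\theta^{n-1}\neq 0$; - $0=F^{-n}(E)\subseteq\dots\subseteq F^{n-1}(E)=E$ is a filtration by subsheaves with all $\mathrm{Gr}^i_F(E)=F^i(E)/F^{i-1}(E)$ locally free of finite rank, such that $F^{-1-i}(E)=F^i(E)^\perp$ for all $i$ (where $F^i(E)=0$ for $i<-n$ and $F^i(E)=E$ for $i\ge n$), $\theta(F^i(E))\subseteq F^{i-2}(E)$ for all $i$, and the induced maps $\theta^i:\mathrm{Gr}^i_F(E)\to\mathrm{Gr}^{-i}_F(E)$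 are injective for $0\le i\le n-1$. Given a $k$-point $(E_0,h_0,\theta_0,F_0)$, let $F_h^j\mathcal{H}om_s(E_0,E_0)$ be the sheaf of self-adjoint endomorphisms $\varphi$ of $E_0$ with $\varphi(F_0^i(E_0))\subseteq F_0^{i+j}(E_0)$ for all $i$, and let $P$ be the two-term complex, in degrees $0$ and $1$, $$P=\Big(F_h^0\mathcal{H}om_s(E_0,E_0)\xrightarrow{\ [\theta_0,-]\ }F_h^{-2}\mathcal{H}om_s(E_0,E_0)\Big),\qquad [\theta_0,\varphi]=\theta_0\varphi-\varphi\theta_0 .$$ Let $0\to I\to B\to A\to 0$ be an extension of local artinian $k$-algebras with residue field $k$ such that $\mathfrak m_B I=0$ (in particular $I^2=0$), and let $(E,h,\theta,F)$ be an $A$-point of $\mathrm{Nil}^n_{X,\mathrm{Sp}_{2r}}$ lifting $(E_0,h_0,\theta_0,F_0)$. A lift of $(E,h,\theta,F)$ to $B$ is a $B$-point together with an isomorphism of its pullback to $X_A$ with $(E,h,\theta,F)$; isomorphisms and automorphisms of lifts are those inducing the identity on $(E,h,\theta,F)$. A section of $\mathcal{E}nd(E_0)\otimes_k I$ acts on a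 (local) lift $E'$ through $E'\to E_0\to E_0\otimes_k I\cong IE'\subseteq E'$. Let $\{U_\alpha\}$ be any affine open cover of $X$, and compute the hypercohomology groups $H^i(X,P\otimes_k I)$ by the Čech complex of this cover. Then: 1. There is an obstruction class $o\in H^2(X,P\otimes_k I)$ that vanishes if and only if $(E,h,\theta,F)$ has a lift to $B$. Moreover, there are lifts $(E_\alpha,h_\alpha,\theta_\alpha,F_\alpha)$ of the restrictions to the $U_\alpha$, with isomorphisms $g_{\alpha\beta}:E_\beta\to E_\alpha$ over $U_\alpha\cap U_\beta$ of lifts of filtered symplectic bundles, and for any choice of these, $c_{\alpha\beta\gamma}=g_{\alpha\beta}g_{\beta\gamma}g_{\alpha\gamma}^{-1}-1$ and $\tau_{\alpha\beta}=g_{\alpha\beta}\theta_\beta g_{\alpha\beta}^{-1}-\theta_\alpha$ form a Čech $2$-cocycle of $P\otimes_k I$ with class $o$. 2. If $o=0$, the set of isomorphism classes of lifts is a torsor under $H^1(X,P\otimes_k I)$: for lifts $y_1,y_2$ and a Čech $1$-cocycle $(c,\tau)$ one has $[(c,\tau)]+[y_1]=[y_2]$ if and only if there are isomorphisms $\varphi_\alpha:y_1|_{U_\alpha}\to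 y_2|_{U_\alpha}$ of lifts of filtered symplectic bundles with $c_{\alpha\beta}=\varphi_\alpha^{-1}\varphi_\beta-1$ and $\tau_\alpha=\varphi_\alpha^{-1}\theta_2\varphi_\alpha-\theta_1$. 3. For every lift, $z\mapsto 1+z$ is an isomorphism from $H^0(X,P\otimes_k I)$ onto the automorphism group of the lift. -/

import Mathlib

open CategoryTheory Limits TopologicalSpace AlgebraicGeometry
open scoped TensorProduct

universe u

noncomputable section

namespace NilDef

/-! ## Sections of sheaves of modules -/

/-- Restriction of sections of a sheaf of modules. -/
def res {Y : Scheme.{u}} (E : Y.Modules) {W W' : Y.Opens} (h : W' ≤ W) : Γ(E, W) →+ Γ(E, W') :=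
  (E.presheaf.map (homOfLE h).op).hom

/-- Restriction of functions. -/
def resO (Y : Scheme.{u}) {W W' : Y.Opens} (h : W' ≤ W) : Γ(Y, W) →+* Γ(Y, W') :=
  (Y.presheaf.map (homOfLE h).op).hom

/-- The ring homomorphism `R → Γ(Y, W)` given by a morphism `Y ⟶ Spec R`. -/
def scalar {Y : Scheme.{u}} {R : Type u} [CommRing R] (g : Y ⟶ Spec (CommRingCat.of R))
    (W : Y.Opens) : R →+* Γ(Y, W) :=
  (resO Y (le_top : W ≤ ⊤)).comp
    ((Scheme.ΓSpecIso (CommRingCat.of R)).inv ≫ g.appTop).hom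

/-- Families of linear maps on the sections over the open subsets of `V`. Those satisfying
`IsNat` are the sections over `V` of the sheaf of homomorphisms from `E` to `E'`. -/
abbrev Fam {Y : Scheme.{u}} (E E' : Y.Modules) (V : Y.Opens) : Type u :=
  ∀ W : Y.Opens, W ≤ V → (Γ(E, W) →ₗ[Γ(Y, W)] Γ(E', W))

/-- Compatibility with restriction. -/
def IsNat {Y : Scheme.{u}} {E E' : Y.Modules} {V : Y.Opens} (φ : Fam E E' V) : Prop :=
  ∀ (W W' : Y.Opens) (h : W ≤ V) (h' : W' ≤ W) (s : Γ(E, W)),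
    res E' h' (φ W h s) = φ W' (h'.trans h) (res E h' s)

/-! ## Filtered symplectic bundles and their nilpotent endomorphisms -/

/-- A filtered symplectic vector bundle of rank `2r` on the open subscheme `V` of `Y`, with
filtration `0 = F^{-n} ⊆ ⋯ ⊆ F^{n-1} = E`.  A sheaf of modules on `V` is given as (the restriction
of) a sheaf of modules `E` on `Y`, for instance its pushforward; only the sections over open subsets
of `V` are used.  For `V = ⊤` this is a filtered symplectic bundle on `Y`. -/
structure FilSymp (Y : Scheme.{u}) (V : Y.Opens) (r n : ℕ) where
  /-- the sheaf of modules -/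
  E : Y.Modules
  /-- `E` is locally free of rank `2r` -/
  locallyFree : ∀ x ∈ V, ∃ W : Y.Opens, x ∈ W ∧ W ≤ V ∧ ∃ e : Fin (2 * r) → Γ(E, W),
    ∀ (W' : Y.Opens) (h : W' ≤ W),
      Function.Bijective (fun a : Fin (2 * r) → Γ(Y, W') => ∑ j, a j • res E h (e j))
  /-- the bilinear form `Q(s, t) = h(s)(t)` -/
  form : ∀ W : Y.Opens, W ≤ V → (Γ(E, W) →ₗ[Γ(Y, W)] Γ(E, W) →ₗ[Γ(Y, W)] Γ(Y, W))
  form_res : ∀ (W W' : Y.Opens) (h : W ≤ V) (h' : W' ≤ W) (s t : Γ(E, W)),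
    resO Y h' (form W h s t) = form W' (h'.trans h) (res E h' s) (res E h' t)
  form_alt : ∀ (W : Y.Opens) (h : W ≤ V) (s : Γ(E, W)), form W h s s = 0
  /-- `h : E → E^∨` is an isomorphism: every section of the dual sheaf over `W` is `Q(s, -)` for a
  unique section `s` of `E` over `W` -/
  form_nondeg : ∀ (W : Y.Opens) (h : W ≤ V)
    (l : ∀ W' : Y.Opens, W' ≤ W → (Γ(E, W') →ₗ[Γ(Y, W')] Γ(Y, W'))),
    (∀ (W₁ W₂ : Y.Opens) (h₁ : W₁ ≤ W) (h₂ : W₂ ≤ W₁) (t : Γ(E, W₁)),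
      resO Y h₂ (l W₁ h₁ t) = l W₂ (h₂.trans h₁) (res E h₂ t)) →
    ∃! s : Γ(E, W), ∀ (W' : Y.Opens) (h' : W' ≤ W) (t : Γ(E, W')),
      l W' h' t = form W' (h'.trans h) (res E h' s) t
  /-- the filtration `F^i(E)` -/
  fil : ℤ → ∀ W : Y.Opens, W ≤ V → Submodule Γ(Y, W) Γ(E, W)
  fil_res : ∀ (i : ℤ) (W W' : Y.Opens) (h : W ≤ V) (h' : W' ≤ W) (s : Γ(E, W)),
    s ∈ fil i W h → res E h' s ∈ fil i W' (h'.trans h)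
  /-- `F^i(E)` is a subsheaf -/
  fil_local : ∀ (i : ℤ) (W : Y.Opens) (h : W ≤ V) (s : Γ(E, W)),
    (∀ x ∈ W, ∃ (W' : Y.Opens) (h' : W' ≤ W), x ∈ W' ∧ res E h' s ∈ fil i W' (h'.trans h)) →
    s ∈ fil i W h
  fil_mono : ∀ (i : ℤ) (W : Y.Opens) (h : W ≤ V), fil (i - 1) W h ≤ fil i W h
  fil_bot : ∀ i : ℤ, i ≤ -(n : ℤ) → ∀ (W : Y.Opens) (h : W ≤ V), fil i W h = ⊥
  fil_top : ∀ i : ℤ, (n : ℤ) - 1 ≤ i → ∀ (W : Y.Opens) (h : W ≤ V), fil i W h = ⊤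
  /-- `Gr^i = F^i / F^{i-1}` is locally free of finite rank -/
  gr_free : ∀ (i : ℤ), ∀ x ∈ V, ∃ (W : Y.Opens) (hW : W ≤ V), x ∈ W ∧
    ∃ (m : ℕ) (e : Fin m → Γ(E, W)), (∀ j, e j ∈ fil i W hW) ∧
      ∀ (W' : Y.Opens) (h' : W' ≤ W), ∀ s ∈ fil i W' (h'.trans hW),
        ∃! a : Fin m → Γ(Y, W'),
          s - ∑ j, a j • res E h' (e j) ∈ fil (i - 1) W' (h'.trans hW)
  /-- `F^{-1-i} = (F^i)^⊥` -/
  fil_perp : ∀ (i : ℤ) (W : Y.Opens) (h : W ≤ V) (s : Γ(E, W)),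
    s ∈ fil (-1 - i) W h ↔ ∀ (W' : Y.Opens) (h' : W' ≤ W), ∀ t ∈ fil i W' (h'.trans h),
      form W' (h'.trans h) (res E h' s) t = 0

/-- A filtered symplectic bundle `(E, h, F)` on the open subscheme `V` of `Y` with a self-adjoint
endomorphism `θ` such that `θ^n = 0`, `θ(F^i) ⊆ F^{i-2}` and `θ^i : Gr^i → Gr^{-i}` is injective
for `i ≥ 0`. -/
structure NilBundle (Y : Scheme.{u}) (V : Y.Opens) (r n : ℕ) extends FilSymp Y V r n where
  /-- the endomorphism -/
  θ : Fam E E V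
  θ_nat : IsNat θ
  θ_adj : ∀ (W : Y.Opens) (h : W ≤ V) (s t : Γ(E, W)),
    form W h s (θ W h t) = -form W h (θ W h s) t
  θ_pow : ∀ (W : Y.Opens) (h : W ≤ V), θ W h ^ n = 0
  θ_fil : ∀ (i : ℤ) (W : Y.Opens) (h : W ≤ V), ∀ s ∈ fil i W h, θ W h s ∈ fil (i - 2) W h
  θ_inj : ∀ (i : ℕ) (W : Y.Opens) (h : W ≤ V), ∀ s ∈ fil i W h,
    (θ W h ^ i) s ∈ fil (-(i : ℤ) - 1) W h → s ∈ fil ((i : ℤ) - 1) W h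

/-- `θ^{n-1} ≠ 0`.  A `NilBundle X_S ⊤ r n` with this property, `n > 0`, is an object over `S` of
the stack of filtered self-adjoint nilpotent endomorphisms with order of nilpotency `n`. -/
def NilBundle.HasOrder {Y : Scheme.{u}} {V : Y.Opens} {r n : ℕ} (x : NilBundle Y V r n) : Prop :=
  ∃ (W : Y.Opens) (h : W ≤ V), x.θ W h ^ (n - 1) ≠ 0

/-! ## Lifts -/

/-- An identification of the pullback of `y` along a closed immersion `i` with (the restriction to
`i⁻¹(V)` of) `x`.  The isomorphism `i^*(y.E) ≅ x.E` is given by the adjoint map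
`red : y.E → i_*(x.E)`: on every affine open `W`, it exhibits the sections of `x.E` as the quotient
of the sections of `y.E` by the ideal of `i`, and the sections of `F^j` as the image of those of
`F^j`. -/
structure Reduction {Y Y' : Scheme.{u}} {r n : ℕ} (i : Y ⟶ Y') {V : Y'.Opens}
    (y : NilBundle Y' V r n) (x : NilBundle Y ⊤ r n) where
  /-- the map on sections -/
  red : ∀ W : Y'.Opens, W ≤ V → (Γ(y.E, W) →+ Γ(x.E, i ⁻¹ᵁ W))
  red_smul : ∀ (W : Y'.Opens) (h : W ≤ V) (a : Γ(Y', W)) (s : Γ(y.E, W)),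
    red W h (a • s) = (i.app W).hom a • red W h s
  red_res : ∀ (W W' : Y'.Opens) (h : W ≤ V) (h' : W' ≤ W) (s : Γ(y.E, W)),
    red W' (h'.trans h) (res y.E h' s) = res x.E (i.preimage_mono h') (red W h s)
  red_surj : ∀ (W : Y'.Opens) (h : W ≤ V), IsAffineOpen W → Function.Surjective (red W h)
  red_ker : ∀ (W : Y'.Opens) (h : W ≤ V), IsAffineOpen W → ∀ s : Γ(y.E, W),
    red W h s = 0 ↔ s ∈ RingHom.ker (i.app W).hom • (⊤ : Submodule Γ(Y', W) Γ(y.E, W))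
  red_form : ∀ (W : Y'.Opens) (h : W ≤ V) (s t : Γ(y.E, W)),
    (i.app W).hom (y.form W h s t) = x.form (i ⁻¹ᵁ W) le_top (red W h s) (red W h t)
  red_θ : ∀ (W : Y'.Opens) (h : W ≤ V) (s : Γ(y.E, W)),
    red W h (y.θ W h s) = x.θ (i ⁻¹ᵁ W) le_top (red W h s)
  red_fil : ∀ (j : ℤ) (W : Y'.Opens) (h : W ≤ V), ∀ s ∈ y.fil j W h,
    red W h s ∈ x.fil j (i ⁻¹ᵁ W) le_top
  red_fil_surj : ∀ (j : ℤ) (W : Y'.Opens) (h : W ≤ V), IsAffineOpen W →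
    ∀ t ∈ x.fil j (i ⁻¹ᵁ W) le_top, ∃ s ∈ y.fil j W h, red W h s = t

/-- Lifts of (the restriction of) `x` to the open subscheme `V` of `Y'`. -/
structure LiftOn {Y Y' : Scheme.{u}} {r n : ℕ} (i : Y ⟶ Y') (x : NilBundle Y ⊤ r n)
    (V : Y'.Opens) where
  /-- the lifted object -/
  obj : NilBundle Y' V r n
  /-- the identification of its pullback -/
  ρ : Reduction i obj x

/-- Isomorphisms over `V₀` between lifts on `V₁` and `V₂`, as lifts of filtered symplectic bundles:
compatible with the form, the filtration and the reduction maps, but not necessarily with `θ`. -/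
structure FilIso {Y Y' : Scheme.{u}} {r n : ℕ} {i : Y ⟶ Y'} {x : NilBundle Y ⊤ r n}
    {V₁ V₂ : Y'.Opens} (y₁ : LiftOn i x V₁) (y₂ : LiftOn i x V₂) (V₀ : Y'.Opens)
    (h₁ : V₀ ≤ V₁) (h₂ : V₀ ≤ V₂) where
  /-- the isomorphism on sections -/
  app : ∀ W : Y'.Opens, W ≤ V₀ → (Γ(y₁.obj.E, W) ≃ₗ[Γ(Y', W)] Γ(y₂.obj.E, W))
  nat : IsNat (fun W h => (app W h).toLinearMap)
  form_eq : ∀ (W : Y'.Opens) (h : W ≤ V₀) (s t : Γ(y₁.obj.E, W)),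
    y₂.obj.form W (h.trans h₂) (app W h s) (app W h t) = y₁.obj.form W (h.trans h₁) s t
  fil_iff : ∀ (j : ℤ) (W : Y'.Opens) (h : W ≤ V₀) (s : Γ(y₁.obj.E, W)),
    app W h s ∈ y₂.obj.fil j W (h.trans h₂) ↔ s ∈ y₁.obj.fil j W (h.trans h₁)
  red_eq : ∀ (W : Y'.Opens) (h : W ≤ V₀) (s : Γ(y₁.obj.E, W)),
    y₂.ρ.red W (h.trans h₂) (app W h s) = y₁.ρ.red W (h.trans h₁) s

/-- Compatibility of an isomorphism with the endomorphisms `θ`. -/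
def FilIso.CommutesWithθ {Y Y' : Scheme.{u}} {r n : ℕ} {i : Y ⟶ Y'} {x : NilBundle Y ⊤ r n}
    {V₁ V₂ : Y'.Opens} {y₁ : LiftOn i x V₁} {y₂ : LiftOn i x V₂} {V₀ : Y'.Opens}
    {h₁ : V₀ ≤ V₁} {h₂ : V₀ ≤ V₂} (φ : FilIso y₁ y₂ V₀ h₁ h₂) : Prop :=
  ∀ (W : Y'.Opens) (h : W ≤ V₀) (s : Γ(y₁.obj.E, W)),
    φ.app W h (y₁.obj.θ W (h.trans h₁) s) = y₂.obj.θ W (h.trans h₂) (φ.app W h s)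

/-- Global lifts of `x` along `i`, as objects of the stack. -/
def Lift {Y Y' : Scheme.{u}} {r n : ℕ} (i : Y ⟶ Y') (x : NilBundle Y ⊤ r n) : Type (u + 1) :=
  { y : LiftOn i x ⊤ // y.obj.HasOrder }

/-- Lifts are isomorphic if there is an isomorphism of the objects that is the identity on `x`. -/
def Lift.Iso {Y Y' : Scheme.{u}} {r n : ℕ} {i : Y ⟶ Y'} {x : NilBundle Y ⊤ r n}
    (y₁ y₂ : Lift i x) : Prop :=
  ∃ φ : FilIso y₁.1 y₂.1 ⊤ le_rfl le_rfl, φ.CommutesWithθ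

/-- Isomorphism of lifts is an equivalence relation. -/
theorem Lift.iso_equivalence {Y Y' : Scheme.{u}} {r n : ℕ} {i : Y ⟶ Y'}
    {x : NilBundle Y ⊤ r n} : Equivalence (Lift.Iso (i := i) (x := x)) where
  refl y := ⟨⟨fun _ _ => LinearEquiv.refl _ _, fun _ _ _ _ _ => rfl, fun _ _ _ _ => rfl,
    fun _ _ _ _ => Iff.rfl, fun _ _ _ => rfl⟩, fun _ _ _ => rfl⟩
  symm := by
    rintro y₁ y₂ ⟨φ, hφ⟩
    refine ⟨⟨fun W h => (φ.app W h).symm, ?_, ?_, ?_, ?_⟩, ?_⟩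
    · intro W W' h h' s
      obtain ⟨t, rfl⟩ := (φ.app W h).surjective s
      have := φ.nat W W' h h' t
      simp only [LinearEquiv.coe_coe] at this ⊢
      simp [this]
    · intro W h s t
      rw [← φ.form_eq W h]; simp
    · intro j W h s
      rw [← φ.fil_iff j W h]; simp
    · intro W h s
      rw [← φ.red_eq W h]; simp
    · intro W h s
      apply (φ.app W h).injective
      change φ.app W h ((φ.app W h).symm _) = φ.app W h (y₁.1.obj.θ W _ ((φ.app W h).symm s))
      rw [hφ W h]; simp
  trans := by
    rintro y₁ y₂ y₃ ⟨φ, hφ⟩ ⟨ψ, hψ⟩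
    refine ⟨⟨fun W h => (φ.app W h).trans (ψ.app W h), ?_, ?_, ?_, ?_⟩, ?_⟩
    · intro W W' h h' s
      have h1 := φ.nat W W' h h' s
      have h2 := ψ.nat W W' h h' (φ.app W h s)
      simp only [LinearEquiv.coe_coe, LinearEquiv.trans_apply] at h1 h2 ⊢
      rw [h2, h1]
    · intro W h s t
      rw [← φ.form_eq W h, ← ψ.form_eq W h]; rfl
    · intro j W h s
      rw [← φ.fil_iff j W h, ← ψ.fil_iff j W h]; rfl
    · intro W h s
      rw [← φ.red_eq W h, ← ψ.red_eq W h]; rfl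
    · intro W h s
      change ψ.app W h (φ.app W h _) = y₃.1.obj.θ W _ (ψ.app W h (φ.app W h s))
      rw [hφ W h, hψ W h]

/-- The set of isomorphism classes of lifts. -/
def LiftClass {Y Y' : Scheme.{u}} {r n : ℕ} (i : Y ⟶ Y') (x : NilBundle Y ⊤ r n) : Type (u + 1) :=
  Quotient (⟨Lift.Iso, Lift.iso_equivalence⟩ : Setoid (Lift i x))

/-- The isomorphism class of a lift. -/
def Lift.cls {Y Y' : Scheme.{u}} {r n : ℕ} {i : Y ⟶ Y'} {x : NilBundle Y ⊤ r n} (y : Lift i x) :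
    LiftClass i x :=
  Quotient.mk _ y

/-- The automorphism group of a lift: automorphisms of the object inducing the identity on `x`. -/
def Lift.aut {Y Y' : Scheme.{u}} {r n : ℕ} {i : Y ⟶ Y'} {x : NilBundle Y ⊤ r n} (y : Lift i x) :
    Subgroup (∀ W : Y'.Opens, Γ(y.1.obj.E, W) ≃ₗ[Γ(Y', W)] Γ(y.1.obj.E, W)) where
  carrier := { g | ∃ φ : FilIso y.1 y.1 ⊤ le_rfl le_rfl, φ.CommutesWithθ ∧
    ∀ W, φ.app W le_top = g W }
  one_mem' := ⟨⟨fun _ _ => LinearEquiv.refl _ _, fun _ _ _ _ _ => rfl, fun _ _ _ _ => rfl,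
    fun _ _ _ _ => Iff.rfl, fun _ _ _ => rfl⟩, fun _ _ _ => rfl, fun _ => rfl⟩
  mul_mem' := by
    rintro _ _ ⟨φ, hφ, h1⟩ ⟨ψ, hψ, h2⟩
    refine ⟨⟨fun W h => (ψ.app W h).trans (φ.app W h), ?_, ?_, ?_, ?_⟩, ?_, ?_⟩
    · intro W W' h h' s
      have h1 := ψ.nat W W' h h' s
      have h2 := φ.nat W W' h h' (ψ.app W h s)
      simp only [LinearEquiv.coe_coe, LinearEquiv.trans_apply] at h1 h2 ⊢
      rw [h2, h1]
    · intro W h s t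
      exact (φ.form_eq W h _ _).trans (ψ.form_eq W h s t)
    · intro j W h s
      exact (φ.fil_iff j W h _).trans (ψ.fil_iff j W h s)
    · intro W h s
      exact (φ.red_eq W h _).trans (ψ.red_eq W h s)
    · intro W h s
      change φ.app W h (ψ.app W h _) = y.1.obj.θ W _ (φ.app W h (ψ.app W h s))
      rw [hψ W h, hφ W h]
    · intro W
      rw [Pi.mul_apply, ← h1, ← h2]; rfl
  inv_mem' := by
    rintro _ ⟨φ, hφ, h1⟩
    refine ⟨⟨fun W h => (φ.app W h).symm, ?_, ?_, ?_, ?_⟩, ?_, ?_⟩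
    · intro W W' h h' s
      obtain ⟨t, rfl⟩ := (φ.app W h).surjective s
      have := φ.nat W W' h h' t
      simp only [LinearEquiv.coe_coe] at this ⊢
      simp [this]
    · intro W h s t
      rw [← φ.form_eq W h]; simp
    · intro j W h s
      rw [← φ.fil_iff j W h]; simp
    · intro W h s
      rw [← φ.red_eq W h]; simp
    · intro W h s
      apply (φ.app W h).injective
      change φ.app W h ((φ.app W h).symm _) = φ.app W h (y.1.obj.θ W _ ((φ.app W h).symm s))
      rw [hφ W h]; simp
    · intro W
      rw [Pi.inv_apply, ← h1]; rfl

/-! ## The complex `P` -/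

section Complex

variable {k : Type u} [Field k] {X : Scheme.{u}} (f : X ⟶ Spec (CommRingCat.of k)) {r n : ℕ}

/-- Families of endomorphisms of `E` over the open subsets of `U`, as a `k`-vector space. -/
def EndFam (_ : X ⟶ Spec (CommRingCat.of k)) (E : X.Modules) (U : X.Opens) : Type u :=
  ∀ W : {W : X.Opens // W ≤ U}, Γ(E, W.1) →ₗ[Γ(X, W.1)] Γ(E, W.1)

/-- The members of a family. -/
def EndFam.app {f : X ⟶ Spec (CommRingCat.of k)} {E : X.Modules} {U : X.Opens}
    (φ : EndFam f E U) : Fam E E U :=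
  fun W h => φ ⟨W, h⟩

instance (E : X.Modules) (U : X.Opens) : AddCommGroup (EndFam f E U) :=
  inferInstanceAs (AddCommGroup
    (∀ W : {W : X.Opens // W ≤ U}, Γ(E, W.1) →ₗ[Γ(X, W.1)] Γ(E, W.1)))

instance (E : X.Modules) (U : X.Opens) : Module k (EndFam f E U) :=
  letI : ∀ W : X.Opens, Module k (Γ(E, W) →ₗ[Γ(X, W)] Γ(E, W)) :=
    fun W => Module.compHom _ (scalar f W)
  inferInstanceAs (Module k (∀ W : {W : X.Opens // W ≤ U}, Γ(E, W.1) →ₗ[Γ(X, W.1)] Γ(E, W.1)))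

@[simp] lemma EndFam.add_apply {E : X.Modules} {U : X.Opens} (φ ψ : EndFam f E U) (W : X.Opens)
    (h : W ≤ U) (s : Γ(E, W)) : (φ + ψ).app W h s = φ.app W h s + ψ.app W h s := rfl

@[simp] lemma EndFam.zero_apply {E : X.Modules} {U : X.Opens} (W : X.Opens)
    (h : W ≤ U) (s : Γ(E, W)) : (0 : EndFam f E U).app W h s = 0 := rfl

@[simp] lemma EndFam.smul_apply {E : X.Modules} {U : X.Opens} (c : k) (φ : EndFam f E U)
    (W : X.Opens) (h : W ≤ U) (s : Γ(E, W)) : (c • φ).app W h s = scalar f W c • φ.app W h s := rfl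

lemma res_smul {Y : Scheme.{u}} (E : Y.Modules) {W W' : Y.Opens} (h : W' ≤ W) (a : Γ(Y, W))
    (s : Γ(E, W)) : res E h (a • s) = resO Y h a • res E h s :=
  E.map_smul _ _ _

lemma resO_scalar {W W' : X.Opens} (h : W' ≤ W) (c : k) :
    resO X h (scalar f W c) = scalar f W' c := by
  simp only [scalar, resO, RingHom.comp_apply, ← CommRingCat.comp_apply, ← Functor.map_comp]
  rfl

/-- The sections over `U` of `F_h^j Hom_s(E, E)`: self-adjoint endomorphisms `φ` with
`φ(F^i) ⊆ F^{i+j}`. -/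
def PSec (x : NilBundle X ⊤ r n) (j : ℤ) (U : X.Opens) : Submodule k (EndFam f x.E U) where
  carrier := { φ | IsNat φ.app ∧
    (∀ (W : X.Opens) (h : W ≤ U) (s t : Γ(x.E, W)),
      x.form W le_top s (φ.app W h t) = -x.form W le_top (φ.app W h s) t) ∧
    ∀ (i : ℤ) (W : X.Opens) (h : W ≤ U), ∀ s ∈ x.fil i W le_top,
      φ.app W h s ∈ x.fil (i + j) W le_top }
  zero_mem' := by
    refine ⟨?_, ?_, ?_⟩
    · intro W W' h h' s; simp
    · intro W h s t; simp
    · intro i W h s _; simp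
  add_mem' := by
    rintro φ ψ ⟨h1, h2, h3⟩ ⟨g1, g2, g3⟩
    refine ⟨?_, ?_, ?_⟩
    · intro W W' h h' s
      simp [h1 W W' h h' s, g1 W W' h h' s]
    · intro W h s t
      simp [h2 W h s t, g2 W h s t]; abel
    · intro i W h s hs
      simpa using add_mem (h3 i W h s hs) (g3 i W h s hs)
  smul_mem' := by
    rintro c φ ⟨h1, h2, h3⟩
    refine ⟨?_, ?_, ?_⟩
    · intro W W' h h' s
      simp [res_smul, h1 W W' h h' s, resO_scalar]
    · intro W h s t
      simp [h2 W h s t]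
    · intro i W h s hs
      simpa using Submodule.smul_mem _ _ (h3 i W h s hs)

/-- Restriction of sections of `F_h^j Hom_s(E, E)`. -/
def PSec.restrict (x : NilBundle X ⊤ r n) (j : ℤ) {U U' : X.Opens} (hU : U' ≤ U) :
    PSec f x j U →ₗ[k] PSec f x j U' where
  toFun φ := ⟨fun W => φ.1 ⟨W.1, W.2.trans hU⟩, fun W W' h h' s => φ.2.1 W W' (h.trans hU) h' s,
    fun W h s t => φ.2.2.1 W (h.trans hU) s t, fun i W h s hs => φ.2.2.2 i W (h.trans hU) s hs⟩
  map_add' _ _ := rfl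
  map_smul' _ _ := rfl

/-- The differential `[θ, -] : F_h^0 Hom_s(E, E) → F_h^{-2} Hom_s(E, E)`,
`[θ, φ] = θφ - φθ`. -/
def bracket (x : NilBundle X ⊤ r n) (U : X.Opens) : PSec f x 0 U →ₗ[k] PSec f x (-2) U where
  toFun φ := ⟨fun W => x.θ W.1 le_top ∘ₗ φ.1 W - φ.1 W ∘ₗ x.θ W.1 le_top, by
    obtain ⟨φ, h1, h2, h3⟩ := φ
    refine ⟨?_, ?_, ?_⟩
    · intro W W' h h' s
      have e1 := x.θ_nat W W' le_top h'
      have e2 := h1 W W' h h'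
      change res x.E h' (x.θ W le_top (φ.app W h s) - φ.app W h (x.θ W le_top s)) =
        x.θ W' le_top (φ.app W' _ (res x.E h' s)) - φ.app W' _ (x.θ W' le_top (res x.E h' s))
      rw [map_sub, e1, e2, e2, e1]
    · intro W h s t
      change x.form W le_top s (x.θ W le_top (φ.app W h t) - φ.app W h (x.θ W le_top t)) =
        -x.form W le_top (x.θ W le_top (φ.app W h s) - φ.app W h (x.θ W le_top s)) t
      simp [h2 W h, x.θ_adj]
    · intro i W h s hs
      refine Submodule.sub_mem _ ?_ ?_
      · have := x.θ_fil _ W le_top _ (h3 i W h s hs)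
        rw [show i + 0 - 2 = i + -2 by ring] at this
        exact this
      · have := h3 _ W h _ (x.θ_fil i W le_top s hs)
        rw [show i - 2 + 0 = i + -2 by ring] at this
        exact this⟩
  map_add' φ ψ := by
    apply Subtype.ext
    funext ⟨W, h⟩
    ext s
    change x.θ W le_top (φ.1 ⟨W, h⟩ s + ψ.1 ⟨W, h⟩ s) - (φ.1 ⟨W, h⟩ (x.θ W le_top s) +
      ψ.1 ⟨W, h⟩ (x.θ W le_top s)) = (x.θ W le_top (φ.1 ⟨W, h⟩ s) - φ.1 ⟨W, h⟩ (x.θ W le_top s)) +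
      (x.θ W le_top (ψ.1 ⟨W, h⟩ s) - ψ.1 ⟨W, h⟩ (x.θ W le_top s))
    rw [map_add]; abel
  map_smul' c φ := by
    apply Subtype.ext
    funext ⟨W, h⟩
    ext s
    change x.θ W le_top (scalar f W c • φ.1 ⟨W, h⟩ s) - scalar f W c • φ.1 ⟨W, h⟩ (x.θ W le_top s) =
      scalar f W c • (x.θ W le_top (φ.1 ⟨W, h⟩ s) - φ.1 ⟨W, h⟩ (x.θ W le_top s))
    rw [map_smul, smul_sub]

/-! ## Čech hypercohomology of `P ⊗ I` -/

variable (x : NilBundle X ⊤ r n) (I : Type u) [AddCommGroup I] [Module k I]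
  {ι : Type u} (U : ι → X.Opens)

/-- The sections over `U` of `F_h^j Hom_s(E, E) ⊗ I`. -/
def PTensor (j : ℤ) (U : X.Opens) : Type u := PSec f x j U ⊗[k] I

instance (j : ℤ) (U : X.Opens) : AddCommGroup (PTensor f x I j U) :=
  inferInstanceAs (AddCommGroup (PSec f x j U ⊗[k] I))

instance (j : ℤ) (U : X.Opens) : Module k (PTensor f x I j U) :=
  inferInstanceAs (Module k (PSec f x j U ⊗[k] I))

/-- The pure tensor `φ ⊗ b`. -/
def PTensor.tmul {j : ℤ} {U : X.Opens} (φ : PSec f x j U) (b : I) : PTensor f x I j U := φ ⊗ₜ[k] b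

/-- The map `L ⊗ id_I` induced by a linear map `L`. -/
def PTensor.map {j j' : ℤ} {U U' : X.Opens} (L : PSec f x j U →ₗ[k] PSec f x j' U') :
    PTensor f x I j U →ₗ[k] PTensor f x I j' U' :=
  LinearMap.rTensor I L

/-- Čech `p`-cochains of `F_h^j Hom_s(E, E) ⊗ I` for the open cover `U`. -/
abbrev Cochain (j : ℤ) (p : ℕ) : Type u :=
  ∀ a : Fin (p + 1) → ι, PTensor f x I j (⨅ l, U (a l))

/-- The Čech differential. -/
def cechD (j : ℤ) (p : ℕ) : Cochain f x I U j p →ₗ[k] Cochain f x I U j (p + 1) :=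
  LinearMap.pi fun a => ∑ m : Fin (p + 2), ((-1 : k) ^ (m : ℕ)) •
    (PTensor.map f x I (PSec.restrict f x j
      (le_iInf fun l => iInf_le (fun l => U (a l)) (m.succAbove l) :
        (⨅ l, U (a l)) ≤ ⨅ l, U ((a ∘ m.succAbove) l)))) ∘ₗ
      LinearMap.proj (a ∘ m.succAbove)

/-- The differential of `P ⊗ I` on Čech cochains. -/
def cochainBracket (p : ℕ) : Cochain f x I U 0 p →ₗ[k] Cochain f x I U (-2) p :=
  LinearMap.pi fun a => PTensor.map f x I (bracket f x (⨅ l, U (a l))) ∘ₗ LinearMap.proj a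

/-- The term of degree `p + 1` of the total complex of the Čech double complex of the two-term
complex `P ⊗ I` (in degrees `0` and `1`); the term of degree `0` is `Cochain f x I U 0 0`. -/
abbrev Tot (p : ℕ) : Type u := Cochain f x I U 0 (p + 1) × Cochain f x I U (-2) p

/-- The total differential from degree `0` to degree `1`. -/
def totD₀ : Cochain f x I U 0 0 →ₗ[k] Tot f x I U 0 :=
  (cechD f x I U 0 0).prod (cochainBracket f x I U 0)

/-- The total differential from degree `p + 1` to degree `p + 2`:
`(c, τ) ↦ (dc, (-1)^{p+1} [θ, c] + dτ)`. -/
def totD (p : ℕ) : Tot f x I U p →ₗ[k] Tot f x I U (p + 1) :=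
  (cechD f x I U 0 (p + 1) ∘ₗ LinearMap.fst k _ _).prod
    (((-1 : k) ^ (p + 1)) • (cochainBracket f x I U (p + 1) ∘ₗ LinearMap.fst k _ _) +
      cechD f x I U (-2) p ∘ₗ LinearMap.snd k _ _)

/-- `H⁰(X, P ⊗ I)`. For a cover of a separated scheme by affine open subsets, Čech hypercohomology
computes the hypercohomology of the complex of quasi-coherent sheaves `P ⊗ I`. -/
abbrev HH0 : Type u := LinearMap.ker (totD₀ f x I U)

/-- `H¹(X, P ⊗ I)`. -/
abbrev HH1 : Type u :=
  LinearMap.ker (totD f x I U 0) ⧸ (LinearMap.range (totD₀ f x I U)).submoduleOf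
    (LinearMap.ker (totD f x I U 0))

/-- `H²(X, P ⊗ I)`. -/
abbrev HH2 : Type u :=
  LinearMap.ker (totD f x I U 1) ⧸ (LinearMap.range (totD f x I U 0)).submoduleOf
    (LinearMap.ker (totD f x I U 1))

/-- The class of a 1-cocycle. -/
def HH1.mk (z : LinearMap.ker (totD f x I U 0)) : HH1 f x I U := Submodule.Quotient.mk z

/-- The class of a 2-cocycle. -/
def HH2.mk (z : LinearMap.ker (totD f x I U 1)) : HH2 f x I U := Submodule.Quotient.mk z

end Complex

/-! ## Base change of the curve to artinian rings -/

section BaseChange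

variable {k : Type u} [Field k] {X : Scheme.{u}} (f : X ⟶ Spec (CommRingCat.of k))

/-- `X_A = X ×_k Spec A`. -/
abbrev XBase (A : Type u) [CommRing A] [Algebra k A] : Scheme.{u} :=
  pullback f (Spec.map (CommRingCat.ofHom (algebraMap k A)))

/-- The projection `X_A ⟶ X`. -/
abbrev toX (A : Type u) [CommRing A] [Algebra k A] : XBase f A ⟶ X :=
  pullback.fst f (Spec.map (CommRingCat.ofHom (algebraMap k A)))

/-- The projection `X_A ⟶ Spec A`. -/
abbrev toSpec (A : Type u) [CommRing A] [Algebra k A] : XBase f A ⟶ Spec (CommRingCat.of A) :=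
  pullback.snd f (Spec.map (CommRingCat.ofHom (algebraMap k A)))

variable {A B : Type u} [CommRing A] [Algebra k A] [CommRing B] [Algebra k B]

/-- The morphism `X_A ⟶ X_B` induced by `q : B → A`. -/
def baseMap (q : B →ₐ[k] A) : XBase f A ⟶ XBase f B :=
  pullback.lift (toX f A) (toSpec f A ≫ Spec.map (CommRingCat.ofHom q.toRingHom)) (by
    rw [Category.assoc, ← Spec.map_comp, ← CommRingCat.ofHom_comp, pullback.condition]
    congr 3
    exact q.comp_algebraMap.symm)

/-- The morphism `X ⟶ X_A` induced by an augmentation `ε : A → k`. -/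
def specialFibre (ε : A →ₐ[k] k) : X ⟶ XBase f A :=
  pullback.lift (𝟙 X) (f ≫ Spec.map (CommRingCat.ofHom ε.toRingHom)) (by
    rw [Category.assoc, ← Spec.map_comp, ← CommRingCat.ofHom_comp]
    have : ε.toRingHom.comp (algebraMap k A) = RingHom.id k := ε.comp_algebraMap
    rw [this, Category.id_comp]
    exact (Category.comp_id f).symm.trans (congrArg (f ≫ ·) (Spec.map_id _).symm))

lemma preimage_le (ε : A →ₐ[k] k) (q : B →ₐ[k] A) (U : X.Opens) :
    specialFibre f ε ⁻¹ᵁ (baseMap f q ⁻¹ᵁ (toX f B ⁻¹ᵁ U)) ≤ U := by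
  rw [← Scheme.Hom.comp_preimage, ← Scheme.Hom.comp_preimage, Category.assoc]
  have : specialFibre f ε ≫ baseMap f q ≫ toX f B = 𝟙 X := by
    rw [baseMap, pullback.lift_fst, specialFibre, pullback.lift_fst]
  rw [this]
  simp

end BaseChange

/-! ## Cocycles attached to lifts -/

section Cocycles

variable {k : Type u} [Field k] {X : Scheme.{u}} (f : X ⟶ Spec (CommRingCat.of k)) {r n : ℕ}
  {A B : Type u} [CommRing A] [Algebra k A] [CommRing B] [Algebra k B]
  {ε : A →ₐ[k] k} (q : B →ₐ[k] A)
  {x₀ : NilBundle X ⊤ r n} {x : NilBundle (XBase f A) ⊤ r n}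
  (ρ₀ : Reduction (specialFibre f ε) x x₀)

/-- Let `y` be a lift of `x` over an open set containing `U_B`, `U ⊆ X`, and let `ρ` be the
reduction map from sections of `y` to sections of `x₀`.  A section
`z = ∑ g_l ⊗ b_l` of `F_h^j Hom_s(E₀, E₀) ⊗ I` over `U` acts on sections of `y` over `U_B` through
`E → E₀ → E₀ ⊗ I ≅ I E ⊆ E`, that is, `s ↦ ∑ b_l t_l` where `t_l` is any section with
`ρ(t_l) = g_l(ρ(s))`.  `Acts` says that `δ` is this map. -/
def Acts {V : (XBase f B).Opens} (y : LiftOn (baseMap f q) x V) {j : ℤ} (U : X.Opens)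
    (hU : toX f B ⁻¹ᵁ U ≤ V) (z : PTensor f x₀ (RingHom.ker q) j U)
    (δ : Γ(y.obj.E, toX f B ⁻¹ᵁ U) → Γ(y.obj.E, toX f B ⁻¹ᵁ U)) : Prop :=
  ∃ (m : ℕ) (g : Fin m → PSec f x₀ j U) (b : Fin m → RingHom.ker q),
    z = ∑ l, PTensor.tmul f x₀ (RingHom.ker q) (g l) (b l) ∧
    ∀ s, ∃ t : Fin m → Γ(y.obj.E, toX f B ⁻¹ᵁ U),
      (∀ l, ρ₀.red _ le_top (y.ρ.red _ hU (t l)) =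
        (g l).1.app _ (preimage_le f ε q U) (ρ₀.red _ le_top (y.ρ.red _ hU s))) ∧
      δ s = ∑ l, scalar (toSpec f B) (toX f B ⁻¹ᵁ U) (b l : B) • t l

variable {ι : Type u} (U : ι → X.Opens)

lemma inter_le {p : ℕ} (a : Fin p → ι) (l : Fin p) :
    toX f B ⁻¹ᵁ (⨅ l, U (a l)) ≤ toX f B ⁻¹ᵁ U (a l) :=
  (toX f B).preimage_mono (iInf_le (fun l => U (a l)) l)

/-- Local lifts `y_α` of `x` over the members of the cover, with isomorphisms
`g_αβ : y_β → y_α` of lifts of filtered symplectic bundles on the double intersections. -/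
structure LocalLifts (x : NilBundle (XBase f A) ⊤ r n) where
  /-- the local lifts -/
  y : ∀ α, LiftOn (baseMap f q) x (toX f B ⁻¹ᵁ U α)
  /-- the isomorphisms -/
  g : ∀ α β, FilIso (y β) (y α) (toX f B ⁻¹ᵁ U α ⊓ toX f B ⁻¹ᵁ U β) inf_le_right inf_le_left

/-- `(c, τ)` is the 2-cochain with `c_αβγ = g_αβ g_βγ g_αγ⁻¹ - 1` and
`τ_αβ = g_αβ θ_β g_αβ⁻¹ - θ_α`. -/
def LocalLifts.IsObstructionCochain (L : LocalLifts f q U x)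
    (z : Tot f x₀ (RingHom.ker q) U 1) : Prop :=
  (∀ a : Fin 3 → ι, Acts f q ρ₀ (L.y (a 0)) (⨅ l, U (a l)) (inter_le f U a 0) (z.1 a)
    (fun s =>
      (L.g (a 0) (a 1)).app _ (le_inf (inter_le f U a 0) (inter_le f U a 1))
        ((L.g (a 1) (a 2)).app _ (le_inf (inter_le f U a 1) (inter_le f U a 2))
          (((L.g (a 0) (a 2)).app _ (le_inf (inter_le f U a 0) (inter_le f U a 2))).symm s)) -
      s)) ∧
  ∀ a : Fin 2 → ι, Acts f q ρ₀ (L.y (a 0)) (⨅ l, U (a l)) (inter_le f U a 0) (z.2 a)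
    (fun s =>
      (L.g (a 0) (a 1)).app _ (le_inf (inter_le f U a 0) (inter_le f U a 1))
        ((L.y (a 1)).obj.θ _ (inter_le f U a 1)
          (((L.g (a 0) (a 1)).app _ (le_inf (inter_le f U a 0) (inter_le f U a 1))).symm s)) -
      (L.y (a 0)).obj.θ _ (inter_le f U a 0) s)

/-- `(c, τ)` is the 1-cochain with `c_αβ = φ_α⁻¹ φ_β - 1` and `τ_α = φ_α⁻¹ θ₂ φ_α - θ₁`, for local
isomorphisms `φ_α : y₁ → y₂` of lifts of filtered symplectic bundles. -/
def IsDifferenceCochain (y₁ y₂ : Lift (baseMap f q) x)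
    (φ : ∀ α, FilIso y₁.1 y₂.1 (toX f B ⁻¹ᵁ U α) le_top le_top)
    (z : Tot f x₀ (RingHom.ker q) U 0) : Prop :=
  (∀ a : Fin 2 → ι, Acts f q ρ₀ y₁.1 (⨅ l, U (a l)) le_top (z.1 a)
    (fun s =>
      ((φ (a 0)).app _ (inter_le f U a 0)).symm ((φ (a 1)).app _ (inter_le f U a 1) s) - s)) ∧
  ∀ a : Fin 1 → ι, Acts f q ρ₀ y₁.1 (⨅ l, U (a l)) le_top (z.2 a)
    (fun s =>
      ((φ (a 0)).app _ (inter_le f U a 0)).symm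
        (y₂.1.obj.θ _ le_top ((φ (a 0)).app _ (inter_le f U a 0) s)) -
      y₁.1.obj.θ _ le_top s)

/-- The automorphism `g` of `y` is `1 + z`. -/
def IsOneAdd (y : Lift (baseMap f q) x) (g : y.aut)
    (z : Cochain f x₀ (RingHom.ker q) U 0 0) : Prop :=
  ∀ a : Fin 1 → ι, Acts f q ρ₀ y.1 (⨅ l, U (a l)) le_top (z a) (fun s => g.1 _ s - s)

end Cocycles

end NilDef

end

open NilDef

noncomputable section

namespace NilDef

/-! ## Gluing of sections -/

section Gluing

variable {Y : Scheme.{u}} (E : Y.Modules)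

/-! Since `A` and `B` are local artinian with residue field `k`, the schemes X, X_A and X_B have the
same underlying space. If β is a `k`-basis of the base ring S, every function on X_S is uniquely a
sum Σ β_l c_l with c_l functions on X (`Thick.exists_eq_sum`). With a basis of `B` made of a basis
of I and lifts of a basis of `A` (`SmallExt`), reduction from X_B to X_A becomes a projection onto
coordinates.

The main local fact is `exists_triv`: over an affine open, a filtered symplectic bundle on X_S that
reduces to a trivial one is isomorphic to E₀ ⊗ S, by an isomorphism that lifts the given one of its
reduction. The sections of Gr over an affine open are projective (`FilSymp.gr_projective`), so the
trivialization of the reduction lifts to a filtered map (`exists_filtered_lift`). Its defect from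
being an isometry is a skew form with values in a nilpotent ideal, and this form vanishes on F^i ×
F^{-1-i}. Read as an endomorphism through the form of E₀, it therefore respects the filtration, and
subtracting half of it improves the isometry by one power of the ideal (`exists_isometric_step`;
this is where 1/2 is used). Finitely many steps give an isometry, and Nakayama's lemma shows that it
is an isomorphism.

In such coordinates the deformation theory is linear algebra. Because m_B I = 0, multiplication by
elements of I factors through the special fibre, so sections of F_h^j Hom_s(E₀, E₀) ⊗ I act on
lifts, products of two of them act as zero (`act_act`), and the action identifies them with the
filtered skew endomorphisms of a lift that vanish on the reduction (`act_injective`,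
`exists_act_eq`). Hence two isomorphisms of lifts of filtered symplectic bundles differ by a factor
1 + w with w in P⁰ ⊗ I, two filtered skew lifts of θ differ by an element of P¹ ⊗ I, and conjugation
by 1 + w changes θ by -[θ₀, w] (`Conj.differ`). On affine opens lifts exist (`nonempty_liftOn`) and
any two are isomorphic if θ is disregarded (`nonempty_filIso`). The remaining conditions on θ are
automatic: θ^n = 0 and injectivity on Gr follow in `mkLift`, and the order of nilpotency is
inherited from the reduction (`SmallExt.hasOrder`).

The rest is a Čech argument. X is separated, so all finite intersections of members of the cover are
affine and the local results hold there. Comparing one isomorphism, or one transported endomorphism,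
in two ways and using faithfulness of the action gives the cocycle identities, and shows that other
choices change cochains by coboundaries. Conversely, isomorphisms and endomorphisms of local lifts
can be changed by a given cochain, and the results glue when the cocycle conditions hold
(`exists_lift_of_conj`). The obstruction class, the torsor structure and the description of
automorphisms are the cases of total degree 2, 1 and 0. -/

lemma res_res {W W' W'' : Y.Opens} (h : W' ≤ W) (h' : W'' ≤ W') (s : Γ(E, W)) :
    res E h' (res E h s) = res E (h'.trans h) s := by
  simp only [res, ← ConcreteCategory.comp_apply, ← Functor.map_comp]
  rfl

@[simp] lemma res_self {W : Y.Opens} (h : W ≤ W) (s : Γ(E, W)) : res E h s = s := by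
  simp [res]

lemma resO_resO {W W' W'' : Y.Opens} (h : W' ≤ W) (h' : W'' ≤ W') (s : Γ(Y, W)) :
    resO Y h' (resO Y h s) = resO Y (h'.trans h) s := by
  simp only [resO, ← CommRingCat.comp_apply, ← Functor.map_comp]
  rfl

@[simp] lemma resO_self {W : Y.Opens} (h : W ≤ W) (s : Γ(Y, W)) : resO Y h s = s := by
  simp [resO]

variable {E}

lemma eq_of_locally {V : Y.Opens} {s t : Γ(E, V)}
    (h : ∀ x ∈ V, ∃ (W : Y.Opens) (hW : W ≤ V), x ∈ W ∧ res E hW s = res E hW t) : s = t := by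
  choose W hW hx h using h
  refine TopCat.Sheaf.eq_of_locally_eq' (F := ⟨E.presheaf, E.isSheaf⟩)
    (U := fun x : V => W x.1 x.2) V (fun x => homOfLE (hW x.1 x.2)) ?_ s t fun x => h x.1 x.2
  intro x hxV
  exact Opens.mem_iSup.mpr ⟨⟨x, hxV⟩, hx x hxV⟩

lemma eq_of_locallyO {V : Y.Opens} {s t : Γ(Y, V)}
    (h : ∀ x ∈ V, ∃ (W : Y.Opens) (hW : W ≤ V), x ∈ W ∧ resO Y hW s = resO Y hW t) : s = t := by
  choose W hW hx h using h
  refine TopCat.Sheaf.eq_of_locally_eq' (F := Y.sheaf)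
    (U := fun x : V => W x.1 x.2) V (fun x => homOfLE (hW x.1 x.2)) ?_ s t fun x => h x.1 x.2
  intro x hxV
  exact Opens.mem_iSup.mpr ⟨⟨x, hxV⟩, hx x hxV⟩

variable (E)

lemma exists_glue {ι : Type*} (W : ι → Y.Opens) (V : Y.Opens) (hW : ∀ j, W j ≤ V)
    (hV : V ≤ ⨆ j, W j) (s : ∀ j, Γ(E, W j))
    (hs : ∀ j l, res E (inf_le_left : W j ⊓ W l ≤ W j) (s j) =
      res E (inf_le_right : W j ⊓ W l ≤ W l) (s l)) :
    ∃ t : Γ(E, V), ∀ j, res E (hW j) t = s j := by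
  obtain ⟨t, ht, -⟩ := TopCat.Sheaf.existsUnique_gluing' (F := ⟨E.presheaf, E.isSheaf⟩)
    W V (fun j => homOfLE (hW j)) hV s (fun j l => hs j l)
  exact ⟨t, ht⟩

lemma exists_glueO {ι : Type*} (W : ι → Y.Opens) (V : Y.Opens) (hW : ∀ j, W j ≤ V)
    (hV : V ≤ ⨆ j, W j) (s : ∀ j, Γ(Y, W j))
    (hs : ∀ j l, resO Y (inf_le_left : W j ⊓ W l ≤ W j) (s j) =
      resO Y (inf_le_right : W j ⊓ W l ≤ W l) (s l)) :
    ∃ t : Γ(Y, V), ∀ j, resO Y (hW j) t = s j := by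
  obtain ⟨t, ht, -⟩ := TopCat.Sheaf.existsUnique_gluing' (F := Y.sheaf)
    W V (fun j => homOfLE (hW j)) hV s (fun j l => hs j l)
  exact ⟨t, ht⟩

end Gluing

/-! ## Sheaves of modules from sections -/

/-- A sheaf of modules given by its sections and restriction maps. -/
structure SecData (Y : Scheme.{u}) where
  obj : Y.Opens → Type u
  [grp : ∀ W, AddCommGroup (obj W)]
  [mod : ∀ W, Module Γ(Y, W) (obj W)]
  res : ∀ {W W' : Y.Opens}, W' ≤ W → (obj W →+ obj W')
  res_self : ∀ {W : Y.Opens} (h : W ≤ W) (s : obj W), res h s = s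
  res_res : ∀ {W W' W'' : Y.Opens} (h : W' ≤ W) (h' : W'' ≤ W') (s : obj W),
    res h' (res h s) = res (h'.trans h) s
  res_smul : ∀ {W W' : Y.Opens} (h : W' ≤ W) (a : Γ(Y, W)) (s : obj W),
    res h (a • s) = resO Y h a • res h s
  sep : ∀ {ι : Type u} (W : ι → Y.Opens) (s t : obj (⨆ j, W j)),
    (∀ j, res (le_iSup W j) s = res (le_iSup W j) t) → s = t
  glue : ∀ {ι : Type u} (W : ι → Y.Opens) (s : ∀ j, obj (W j)),
    (∀ j l, res (inf_le_left : W j ⊓ W l ≤ W j) (s j) =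
      res (inf_le_right : W j ⊓ W l ≤ W l) (s l)) →
    ∃ t : obj (⨆ j, W j), ∀ j, res (le_iSup W j) t = s j

attribute [instance] SecData.grp SecData.mod

/-- The presheaf of abelian groups. -/
def SecData.presheaf {Y : Scheme.{u}} (D : SecData Y) : TopCat.Presheaf Ab.{u} Y where
  obj W := AddCommGrpCat.of (D.obj W.unop)
  map g := AddCommGrpCat.ofHom (D.res g.unop.le)
  map_id W := by ext s; exact D.res_self _ s
  map_comp g h := by ext s; exact (D.res_res g.unop.le h.unop.le s).symm

instance {Y : Scheme.{u}} (D : SecData Y) (W : (Opens Y)ᵒᵖ) :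
    Module (Y.ringCatSheaf.obj.obj W) (D.presheaf.obj W) :=
  D.mod W.unop

/-- The sheaf of modules with the given sections. -/
def SecData.toModules {Y : Scheme.{u}} (D : SecData Y) : Y.Modules where
  val := PresheafOfModules.ofPresheaf D.presheaf fun _ _ g r m => D.res_smul g.unop.le r m
  isSheaf := by
    change TopCat.Presheaf.IsSheaf D.presheaf
    rw [TopCat.Presheaf.isSheaf_iff_isSheafUniqueGluing]
    intro ι W s hs
    obtain ⟨t, ht⟩ := D.glue W s hs
    exact ⟨t, ht, fun t' ht' => D.sep W t' t fun j => (ht' j).trans (ht j).symm⟩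

/-! ## Locally free subsheaves on affine opens -/

section LocFree

variable {Y : Scheme.{u}}

/-- The kernel of localization at `f`. The smaller open set is a variable with an equation because
in use it is an intersection or an inverse image that is only propositionally a basic open. -/
lemma exists_pow_mul_eq_zero {W W' : Y.Opens} (hW : IsAffineOpen W) (f : Γ(Y, W))
    (hW' : W' = Y.basicOpen f) (h : W' ≤ W) (a : Γ(Y, W)) (ha : resO Y h a = 0) :
    ∃ n : ℕ, f ^ n * a = 0 := by
  subst hW'
  have := hW.isLocalization_basicOpen f
  have h0 : algebraMap Γ(Y, W) Γ(Y, Y.basicOpen f) a = 0 := ha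
  rw [IsLocalization.map_eq_zero_iff (Submonoid.powers f)] at h0
  obtain ⟨⟨_, n, rfl⟩, hm⟩ := h0
  exact ⟨n, hm⟩

lemma exists_pow_mul_eq_resO {W W' : Y.Opens} (hW : IsAffineOpen W) (f : Γ(Y, W))
    (hW' : W' = Y.basicOpen f) (h : W' ≤ W) (a : Γ(Y, W')) :
    ∃ (n : ℕ) (b : Γ(Y, W)), resO Y h b = resO Y h f ^ n * a := by
  subst hW'
  have := hW.isLocalization_basicOpen f
  obtain ⟨⟨b, ⟨_, n, rfl⟩⟩, hb⟩ := IsLocalization.surj (Submonoid.powers f) a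
  refine ⟨n, b, ?_⟩
  rw [mul_comm, ← map_pow]
  exact hb.symm

lemma isUnit_resO_basicOpen {W W' : Y.Opens} (f : Γ(Y, W)) (hW' : W' ≤ Y.basicOpen f)
    (h : W' ≤ W) : IsUnit (resO Y h f) := by
  have : IsUnit (resO Y (Y.basicOpen_le f) f) := Y.toRingedSpace.isUnit_res_basicOpen f
  rw [← resO_resO (Y.basicOpen_le f) hW']
  exact this.map _

/-- If a property holds on a neighbourhood of every point of an affine open `W`, then `W` has a finite
cover by basic opens contained in such neighbourhoods. -/
lemma exists_basicOpen_cover {W : Y.Opens} (hW : IsAffineOpen W) (P : Y.Opens → Prop)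
    (hP : ∀ x ∈ W, ∃ W₁ : Y.Opens, x ∈ W₁ ∧ P W₁) :
    ∃ t : Finset Γ(Y, W), (W ≤ ⨆ g : t, Y.basicOpen g.1) ∧
      ∀ g ∈ t, ∃ W₁ : Y.Opens, Y.basicOpen g ≤ W₁ ∧ P W₁ := by
  choose W₁ hx hP using hP
  have key : ∀ x : W, ∃ g : Γ(Y, W), Y.basicOpen g ≤ W₁ x.1 x.2 ∧ x.1 ∈ Y.basicOpen g :=
    fun x => hW.exists_basicOpen_le ⟨x.1, hx x.1 x.2⟩ x.2
  choose g hg hxg using key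
  obtain ⟨t, ht⟩ := hW.isCompact.elim_finite_subcover (fun x : W => (Y.basicOpen (g x) : Set Y))
    (fun x => (Y.basicOpen (g x)).2) (fun x hxW => Set.mem_iUnion.mpr ⟨⟨x, hxW⟩, hxg ⟨x, hxW⟩⟩)
  classical
  refine ⟨t.image g, ?_, ?_⟩
  · intro x hxW
    obtain ⟨y, hy, hxy⟩ := Set.mem_iUnion₂.mp (ht hxW)
    exact Opens.mem_iSup.mpr ⟨⟨g y, Finset.mem_image_of_mem g hy⟩, hxy⟩
  · intro g' hg'
    obtain ⟨y, -, rfl⟩ := Finset.mem_image.mp hg'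
    exact ⟨W₁ y.1 y.2, hg y, hP _ _⟩

/-- A subsheaf of the restriction to `V` of a sheaf of modules that is locally free of finite
rank. -/
structure LocFree (E : Y.Modules) (V : Y.Opens)
    (N : ∀ W : Y.Opens, W ≤ V → Submodule Γ(Y, W) Γ(E, W)) : Prop where
  res_mem : ∀ {W W' : Y.Opens} (h : W ≤ V) (h' : W' ≤ W) {s : Γ(E, W)},
    s ∈ N W h → res E h' s ∈ N W' (h'.trans h)
  local_mem : ∀ {W : Y.Opens} (h : W ≤ V) (s : Γ(E, W)),
    (∀ x ∈ W, ∃ (W' : Y.Opens) (h' : W' ≤ W), x ∈ W' ∧ res E h' s ∈ N W' (h'.trans h)) →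
    s ∈ N W h
  frame : ∀ x ∈ V, ∃ (W : Y.Opens) (hW : W ≤ V), x ∈ W ∧ ∃ (m : ℕ) (e : Fin m → Γ(E, W)),
    (∀ j, e j ∈ N W hW) ∧ ∀ (W' : Y.Opens) (h : W' ≤ W), ∀ s ∈ N W' (h.trans hW),
      ∃! a : Fin m → Γ(Y, W'), s = ∑ j, a j • res E h (e j)

variable {E : Y.Modules} {V : Y.Opens} {N : ∀ W : Y.Opens, W ≤ V → Submodule Γ(Y, W) Γ(E, W)}

lemma LocFree.exists_cover (hN : LocFree E V N) {W : Y.Opens} (hW : IsAffineOpen W) (h : W ≤ V) :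
    ∃ t : Finset Γ(Y, W), (W ≤ ⨆ g : t, Y.basicOpen g.1) ∧ ∀ g ∈ t, ∃ W₁ : Y.Opens,
      Y.basicOpen g ≤ W₁ ∧ ∃ (hW₁ : W₁ ≤ V) (m : ℕ) (e : Fin m → Γ(E, W₁)),
      (∀ j, e j ∈ N W₁ hW₁) ∧ ∀ (W' : Y.Opens) (h : W' ≤ W₁), ∀ s ∈ N W' (h.trans hW₁),
        ∃! a : Fin m → Γ(Y, W'), s = ∑ j, a j • res E h (e j) := by
  refine exists_basicOpen_cover hW _ fun x hx => ?_
  obtain ⟨W₁, hW₁, hx, h⟩ := hN.frame x (h hx)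
  exact ⟨W₁, hx, hW₁, h⟩

/-- Each coefficient in the frame is killed by a power of `f`, and the sum of the exponents serves
for all of them. -/
lemma exists_pow_smul_eq_zero_of_frame {W W' W₁ : Y.Opens} (hW : IsAffineOpen W) (hW₁ : W₁ ≤ V)
    {m : ℕ} {e : Fin m → Γ(E, W₁)} (hf : ∀ (W' : Y.Opens) (h : W' ≤ W₁), ∀ s ∈ N W' (h.trans hW₁),
        ∃! a : Fin m → Γ(Y, W'), s = ∑ j, a j • res E h (e j)) (hWW : W ≤ W₁)
    (f : Γ(Y, W)) (hW' : W' = Y.basicOpen f) (h : W' ≤ W)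
    {s : Γ(E, W)} (hs : s ∈ N W (hWW.trans hW₁)) (h0 : res E h s = 0) : ∃ n : ℕ, f ^ n • s = 0 := by
  obtain ⟨a, rfl, -⟩ := hf W hWW s hs
  have ha : ∀ j, resO Y h (a j) = 0 := by
    -- Over `W'` the zero section has the restricted coefficients as well as zero ones, and
    -- coefficients in a frame are unique.
    obtain ⟨b, hb, hb'⟩ := hf W' (h.trans hWW) 0 (zero_mem _)
    have h1 := hb' (fun j => resO Y h (a j)) (by
      rw [← h0, map_sum]; simp only [res_smul, res_res])
    have h2 := hb' 0 (by simp)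
    exact fun j => congrFun (h1.trans h2.symm) j
  choose n hn using fun j => exists_pow_mul_eq_zero hW f hW' h (a j) (ha j)
  refine ⟨∑ j, n j, ?_⟩
  rw [Finset.smul_sum]
  refine Finset.sum_eq_zero fun j _ => ?_
  rw [smul_smul, ← Finset.sum_erase_add _ _ (Finset.mem_univ j), pow_add, mul_assoc, hn j]
  simp

/-- A section of a locally free sheaf on an affine open that vanishes on `D(f)` is killed by a power
of `f`. -/
lemma LocFree.exists_pow_smul_eq_zero (hN : LocFree E V N) {W W' : Y.Opens} (hW : IsAffineOpen W)
    (hV : W ≤ V) (f : Γ(Y, W)) (hW' : W' = Y.basicOpen f) (h : W' ≤ W)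
    {s : Γ(E, W)} (hs : s ∈ N W hV) (h0 : res E h s = 0) : ∃ n : ℕ, f ^ n • s = 0 := by
  obtain ⟨t, ht, hfr⟩ := hN.exists_cover hW hV
  -- On D(g) the basic open of the restriction of `f` is D(g) ∩ D(f), so the framed case applies.
  have key : ∀ g : t, ∃ n : ℕ, res E (Y.basicOpen_le g.1) (f ^ n • s) = 0 := by
    intro g
    obtain ⟨W₁, hle, hW₁, m, e, -, he⟩ := hfr g.1 g.2
    obtain ⟨n, hn⟩ := exists_pow_smul_eq_zero_of_frame (N := N) (W' := Y.basicOpen g.1 ⊓ W')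
      (hW.basicOpen g.1) hW₁ he hle
      (resO Y (Y.basicOpen_le g.1) f) (by rw [hW']; exact (Y.basicOpen_res _ _).symm) inf_le_left
      (hN.res_mem hV (Y.basicOpen_le g.1) hs) (by
        rw [res_res, ← res_res E h inf_le_right, h0, map_zero])
    exact ⟨n, by rw [res_smul, map_pow, hn]⟩
  choose n hn using key
  classical
  refine ⟨∑ g, n g, eq_of_locally fun x hx => ?_⟩
  obtain ⟨g, hg⟩ := Opens.mem_iSup.mp (ht hx)
  refine ⟨_, Y.basicOpen_le g.1, hg, ?_⟩
  rw [← Finset.sum_erase_add _ _ (Finset.mem_univ g), pow_add, mul_smul, res_smul, hn g]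
  simp

/-- Denominators of the coefficients are cleared. All exponents from some point on are allowed, so
that one exponent can be taken for all members of a finite cover. -/
lemma exists_pow_smul_eq_res_of_frame {W W' W₁ : Y.Opens} (hW : IsAffineOpen W) (hW₁ : W₁ ≤ V)
    (hN : LocFree E V N)
    {m : ℕ} {e : Fin m → Γ(E, W₁)} (heN : ∀ j, e j ∈ N W₁ hW₁)
    (hf : ∀ (W' : Y.Opens) (h : W' ≤ W₁), ∀ s ∈ N W' (h.trans hW₁),
        ∃! a : Fin m → Γ(Y, W'), s = ∑ j, a j • res E h (e j)) (hWW : W ≤ W₁)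
    (f : Γ(Y, W)) (hW' : W' = Y.basicOpen f) (h : W' ≤ W)
    {s : Γ(E, W')} (hs : s ∈ N W' (h.trans (hWW.trans hW₁))) :
    ∃ n : ℕ, ∀ N₀ ≥ n, ∃ t ∈ N W (hWW.trans hW₁), res E h t = resO Y h f ^ N₀ • s := by
  obtain ⟨a, rfl, -⟩ := hf W' (h.trans hWW) s hs
  choose n b hb using fun j => exists_pow_mul_eq_resO hW f hW' h (a j)
  refine ⟨∑ j, n j, fun N₀ hN₀ => ⟨∑ j, (f ^ (N₀ - n j) * b j) • res E hWW (e j), ?_, ?_⟩⟩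
  · exact Submodule.sum_mem _ fun j _ => Submodule.smul_mem _ _ (hN.res_mem hW₁ hWW (heN j))
  · rw [map_sum, Finset.smul_sum]
    refine Finset.sum_congr rfl fun j _ => ?_
    have : n j ≤ N₀ := (Finset.single_le_sum (fun _ _ => Nat.zero_le _) (Finset.mem_univ j)).trans hN₀
    rw [res_smul, res_res, map_mul, map_pow, hb, ← mul_assoc, ← pow_add, smul_smul,
      Nat.sub_add_cancel this]

/-- A section of a locally free sheaf on `D(f)` extends after multiplication by a power of `f`. -/
lemma LocFree.exists_pow_smul_eq_res (hN : LocFree E V N) {W W' : Y.Opens} (hW : IsAffineOpen W)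
    (hV : W ≤ V) (f : Γ(Y, W)) (hW' : W' = Y.basicOpen f) (h : W' ≤ W)
    {s : Γ(E, W')} (hs : s ∈ N W' (h.trans hV)) :
    ∃ n : ℕ, ∃ t ∈ N W hV, res E h t = resO Y h f ^ n • s := by
  obtain ⟨T, hT, hfr⟩ := hN.exists_cover hW hV
  have key : ∀ g : T, ∃ n : ℕ, ∀ N₀ ≥ n, ∃ t ∈ N _ ((Y.basicOpen_le g.1).trans hV),
      res E (inf_le_left : Y.basicOpen g.1 ⊓ W' ≤ _) t =
        resO Y (inf_le_left.trans (Y.basicOpen_le g.1) : Y.basicOpen g.1 ⊓ W' ≤ W) f ^ N₀ •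
          res E (inf_le_right : Y.basicOpen g.1 ⊓ W' ≤ W') s := by
    intro g
    obtain ⟨W₁, hle, hW₁, m, e, heN, he⟩ := hfr g.1 g.2
    obtain ⟨n, hn⟩ := exists_pow_smul_eq_res_of_frame (N := N) (W' := Y.basicOpen g.1 ⊓ W')
      (hW.basicOpen g.1) hW₁ hN heN he hle
      (resO Y (Y.basicOpen_le g.1) f) (by rw [hW']; exact (Y.basicOpen_res _ _).symm) inf_le_left
      (hN.res_mem (h.trans hV) inf_le_right hs)
    refine ⟨n, fun N₀ h₀ => ?_⟩
    obtain ⟨t, ht, ht'⟩ := hn N₀ h₀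
    exact ⟨t, ht, by rw [ht', resO_resO]⟩
  choose n hn using key
  -- The sum of the exponents is used on every member of the cover.
  choose t ht htn using fun g : T => hn g (∑ g, n g)
    (Finset.single_le_sum (fun _ _ => Nat.zero_le _) (Finset.mem_univ g))
  set n₀ := ∑ g, n g
  -- Two of the local extensions agree on D(f), so on the overlap their difference is killed by a
  -- power of `f`; multiplying all of them by a large power makes them glue.
  have key2 : ∀ g g' : T, ∃ m : ℕ, ∀ M ≥ m, resO Y (inf_le_left.trans (Y.basicOpen_le g.1) :
      Y.basicOpen g.1 ⊓ Y.basicOpen g'.1 ≤ W) f ^ M •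
      (res E (inf_le_left : Y.basicOpen g.1 ⊓ Y.basicOpen g'.1 ≤ _) (t g) -
        res E (inf_le_right : Y.basicOpen g.1 ⊓ Y.basicOpen g'.1 ≤ _) (t g')) = 0 := by
    intro g g'
    have hle : Y.basicOpen g.1 ⊓ Y.basicOpen g'.1 ≤ W := inf_le_left.trans (Y.basicOpen_le g.1)
    obtain ⟨m, hm⟩ := hN.exists_pow_smul_eq_zero (W := Y.basicOpen g.1 ⊓ Y.basicOpen g'.1)
      (W' := Y.basicOpen g.1 ⊓ Y.basicOpen g'.1 ⊓ W')
      (by rw [← Y.basicOpen_mul]; exact hW.basicOpen _) (hle.trans hV) (resO Y hle f)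
      (by rw [hW']; exact (Y.basicOpen_res _ _).symm) inf_le_left
      (Submodule.sub_mem _ (hN.res_mem _ inf_le_left (ht g)) (hN.res_mem _ inf_le_right (ht g')))
      (by
        have h1 : Y.basicOpen g.1 ⊓ Y.basicOpen g'.1 ⊓ W' ≤ Y.basicOpen g.1 ⊓ W' :=
          inf_le_inf_right _ inf_le_left
        have h2 : Y.basicOpen g.1 ⊓ Y.basicOpen g'.1 ⊓ W' ≤ Y.basicOpen g'.1 ⊓ W' :=
          inf_le_inf_right _ inf_le_right
        rw [map_sub, res_res, res_res, ← res_res E inf_le_left h1, ← res_res E inf_le_left h2,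
          htn, htn, res_smul, res_smul, map_pow, map_pow, resO_resO, resO_resO, res_res, res_res,
          sub_self])
    refine ⟨m, fun M hM => ?_⟩
    rw [← Nat.sub_add_cancel hM, pow_add, mul_smul, hm, smul_zero]
  choose m hm using key2
  set m₀ := ∑ g, ∑ g', m g g'
  have hm₀ : ∀ g g', m g g' ≤ m₀ := fun g g' =>
    (Finset.single_le_sum (f := fun g' => m g g') (fun _ _ => Nat.zero_le _)
      (Finset.mem_univ g')).trans
    (Finset.single_le_sum (f := fun g => ∑ g', m g g') (fun _ _ => Nat.zero_le _)
      (Finset.mem_univ g))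
  obtain ⟨u, hu⟩ := exists_glue E (fun g : T => Y.basicOpen g.1) W (fun g => Y.basicOpen_le g.1) hT
    (fun g => resO Y (Y.basicOpen_le g.1) f ^ m₀ • t g) (fun g g' => by
      have := hm g g' m₀ (hm₀ g g')
      rw [smul_sub, sub_eq_zero] at this
      rw [res_smul, res_smul, map_pow, map_pow, resO_resO, resO_resO]
      exact this)
  refine ⟨m₀ + n₀, u, hN.local_mem hV u fun x hx => ?_, eq_of_locally fun x hx => ?_⟩
  · obtain ⟨g, hg⟩ := Opens.mem_iSup.mp (hT hx)
    exact ⟨_, Y.basicOpen_le g.1, hg, by rw [hu]; exact Submodule.smul_mem _ _ (ht g)⟩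
  · obtain ⟨g, hg⟩ := Opens.mem_iSup.mp (hT (h hx))
    refine ⟨Y.basicOpen g.1 ⊓ W', inf_le_right, ⟨hg, hx⟩, ?_⟩
    rw [res_res, ← res_res E (Y.basicOpen_le g.1) inf_le_left, hu, res_smul, htn, res_smul,
      map_pow, map_pow, resO_resO, resO_resO, pow_add, mul_smul]

end LocFree

/-! ## Filtered symplectic bundles on affine opens -/

section Algebra

/-- A module that is free of finite rank on an open cover of the spectrum is projective. -/
theorem projective_of_free_localization {R M : Type*} [CommRing R] [AddCommGroup M] [Module R M]
    (s : Set R) (hs : Ideal.span s = ⊤)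
    {Mₚ : s → Type*} [∀ g, AddCommGroup (Mₚ g)] [∀ g, Module R (Mₚ g)]
    {Rₚ : s → Type*} [∀ g, CommRing (Rₚ g)] [∀ g, Algebra R (Rₚ g)]
    [∀ g : s, IsLocalization.Away g.val (Rₚ g)]
    [∀ g : s, Module (Rₚ g) (Mₚ g)] [∀ g : s, IsScalarTower R (Rₚ g) (Mₚ g)]
    (ϕ : ∀ g : s, M →ₗ[R] Mₚ g) [∀ g : s, IsLocalizedModule (Submonoid.powers g.val) (ϕ g)]
    (h : ∀ g, Module.Free (Rₚ g) (Mₚ g)) (h' : ∀ g, Module.Finite (Rₚ g) (Mₚ g)) :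
    Module.Projective R M := by
  -- Finite presentation and flatness are both local, and together they imply projectivity.
  have : Module.FinitePresentation R M :=
    Module.FinitePresentation.of_localizationSpan' (Rₚ := Rₚ) s hs ϕ
      fun g => Module.finitePresentation_of_projective _ _
  have : Module.Flat R M := by
    refine Module.flat_of_isLocalized_span R M s hs Mₚ ϕ fun g => ?_
    rw [← Module.flat_iff_of_isLocalization (Rₚ g) (Submonoid.powers g.val)]
    infer_instance
  exact Module.Flat.projective_of_finitePresentation

/-- Lifting of filtered maps from a module with projective graded pieces along a strictly
surjective filtered map. -/
theorem exists_filtered_lift {R M P N : Type*} [CommRing R] [AddCommGroup M] [Module R M]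
    [AddCommGroup P] [Module R P] [AddCommGroup N] [Module R N] (n : ℕ)
    (F : ℤ → Submodule R M) (FP : ℤ → Submodule R P) (FN : ℤ → Submodule R N)
    (hF : ∀ i, F (i - 1) ≤ F i) (hFP : ∀ i, FP (i - 1) ≤ FP i)
    (hbot : ∀ i : ℤ, i ≤ -(n : ℤ) → F i = ⊥) (htop : ∀ i : ℤ, (n : ℤ) - 1 ≤ i → F i = ⊤)
    (hproj : ∀ i, Module.Projective R (F i ⧸ (F (i - 1)).submoduleOf (F i)))
    (π : P →ₗ[R] N) (hπ : ∀ i, ∀ t ∈ FN i, ∃ s ∈ FP i, π s = t)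
    (ρ : M →ₗ[R] N) (hρ : ∀ i, ∀ s ∈ F i, ρ s ∈ FN i) :
    ∃ σ : M →ₗ[R] P, (∀ s, π (σ s) = ρ s) ∧ ∀ i, ∀ s ∈ F i, σ s ∈ FP i := by
  have hPm : Monotone FP := monotone_int_of_le_succ fun i => by simpa using hFP (i + 1)
  have hMm : Monotone F := monotone_int_of_le_succ fun i => by simpa using hF (i + 1)
  -- Induction along the filtration: F^{i+1} is F^i plus a copy of the projective module Gr^{i+1},
  -- embedded by `c`, and on the second summand a lift is chosen inside `FP (i + 1)`.
  have key : ∀ i : ℤ, -(n : ℤ) ≤ i → ∃ σ : F i →ₗ[R] P, (∀ s, π (σ s) = ρ s) ∧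
      ∀ j, ∀ s : F i, s.1 ∈ F j → σ s ∈ FP j := by
    intro i hi
    induction i, hi using Int.leInduction with
    | base =>
      have hz : ∀ s : F (-(n : ℤ)), s = 0 := fun s => by
        have h1 : s.1 ∈ (⊥ : Submodule R M) := hbot _ le_rfl ▸ s.2
        exact Subtype.ext ((Submodule.mem_bot R).mp h1)
      refine ⟨0, fun s => ?_, fun j s _ => by simp⟩
      rw [hz s]; simp
    | succ i hi ih =>
      obtain ⟨σ, h1, h2⟩ := ih
      have hp := hproj (i + 1)
      let K := (F (i + 1 - 1)).submoduleOf (F (i + 1))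
      obtain ⟨c, hc⟩ := K.mkQ.exists_rightInverse_of_surjective (Submodule.range_mkQ K)
      let π' : FP (i + 1) →ₗ[R] N := π.domRestrict _
      let FN' : FP (i + 1) →ₗ[R] LinearMap.range π' := π'.rangeRestrict
      -- Strict surjectivity of `π` puts the values of `ρ` on the complement of F^i into the image
      -- of `FP (i + 1)`.
      have hmem : ∀ g, (ρ.domRestrict (F (i + 1)) ∘ₗ c) g ∈ LinearMap.range π' := fun g => by
        obtain ⟨s, hs, hs'⟩ := hπ (i + 1) _ (hρ (i + 1) _ (c g).2)
        exact ⟨⟨s, hs⟩, hs'⟩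
      obtain ⟨d, hd⟩ := Module.projective_lifting_property FN'
        ((ρ.domRestrict (F (i + 1)) ∘ₗ c).codRestrict _ hmem) π'.surjective_rangeRestrict
      have hd' : ∀ g, π (d g) = ρ (c g) := fun g => congrArg Subtype.val (LinearMap.congr_fun hd g)
      have hker : ∀ s : F (i + 1), (s - c (K.mkQ s)).1 ∈ F i := fun s => by
        have : s - c (K.mkQ s) ∈ K := by
          refine (Submodule.Quotient.mk_eq_zero K).mp ?_
          change K.mkQ _ = 0
          rw [map_sub]
          have := LinearMap.congr_fun hc (K.mkQ s)
          simp only [LinearMap.comp_apply, LinearMap.id_apply] at this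
          rw [this, sub_self]
        have h3 : (s - c (K.mkQ s)).1 ∈ F (i + 1 - 1) := this
        rwa [add_sub_cancel_right] at h3
      let e : F (i + 1) →ₗ[R] F i :=
        ((F (i + 1)).subtype ∘ₗ (LinearMap.id - c ∘ₗ K.mkQ)).codRestrict _ hker
      have he : ∀ s, (e s).1 = s.1 - (c (K.mkQ s)).1 := fun _ => rfl
      refine ⟨σ ∘ₗ e + (FP (i + 1)).subtype ∘ₗ d ∘ₗ K.mkQ, fun s => ?_, fun j s hs => ?_⟩
      · simp only [LinearMap.add_apply, LinearMap.comp_apply, map_add, h1, Submodule.subtype_apply,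
          hd']
        rw [← map_add]
        congr 1
        rw [he, sub_add_cancel]
      -- For j > i both summands lie in `FP j` by monotonicity; for j ≤ i the class in Gr^{i+1} is
      -- zero and only the old map contributes.
      · rcases lt_or_ge i j with hij | hij
        · exact add_mem (hPm hij.le (h2 i _ (e s).2)) (hPm hij (d _).2)
        · have hz : K.mkQ s = 0 := by
            refine (Submodule.Quotient.mk_eq_zero K).mpr ?_
            change s.1 ∈ F (i + 1 - 1)
            rw [add_sub_cancel_right]
            exact hMm hij hs
          simp only [LinearMap.add_apply, LinearMap.comp_apply, hz, map_zero, add_zero]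
          refine h2 j _ ?_
          rw [he, hz]; simpa using hs
  -- The maximum covers the case n = 0, where n - 1 lies below -n.
  obtain ⟨σ, h1, h2⟩ := key (max (-(n : ℤ)) ((n : ℤ) - 1)) (le_max_left _ _)
  have ht := htop (max (-(n : ℤ)) ((n : ℤ) - 1)) (le_max_right _ _)
  refine ⟨σ ∘ₗ LinearMap.codRestrict _ LinearMap.id (fun s => by rw [ht]; trivial), fun s => h1 _,
    fun i s hs => h2 i _ hs⟩

end Algebra

section Frames

variable {Y : Scheme.{u}} {V : Y.Opens} {r n : ℕ} (y : FilSymp Y V r n)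

lemma FilSymp.locFree : LocFree y.E V (fun _ _ => ⊤) where
  res_mem := fun _ _ _ _ => trivial
  local_mem := fun _ _ _ => trivial
  frame x hx := by
    obtain ⟨W, hxW, hW, e, he⟩ := y.locallyFree x hx
    refine ⟨W, hW, hxW, 2 * r, e, fun _ => trivial, fun W' h s _ => ?_⟩
    obtain ⟨a, ha⟩ := (he W' h).2 s
    exact ⟨a, ha.symm, fun b hb => (he W' h).1 (hb.symm.trans ha.symm)⟩

lemma FilSymp.fil_mono' (W : Y.Opens) (h : W ≤ V) : Monotone (fun i => y.fil i W h) :=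
  monotone_int_of_le_succ fun i => by simpa using y.fil_mono (i + 1) W h

/-- Induction from F^{-n} = 0: a local frame of F^i together with lifts of a local frame of Gr^{i+1}
is a local frame of F^{i+1}. -/
lemma FilSymp.locFree_fil (i : ℤ) : LocFree y.E V (y.fil i) := by
  have base : ∀ i : ℤ, i ≤ -(n : ℤ) → LocFree y.E V (y.fil i) := fun i hi =>
    { res_mem := fun {W W'} h h' {s} hs => y.fil_res i W W' h h' s hs
      local_mem := fun {W} h s hs => y.fil_local i W h s hs
      frame := fun x hx => ⟨V, le_rfl, hx, 0, Fin.elim0, fun j => j.elim0, fun W' h s hs => by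
        rw [y.fil_bot i hi, Submodule.mem_bot] at hs
        exact ⟨Fin.elim0, by simp [hs], fun _ _ => Subsingleton.elim _ _⟩⟩ }
  rcases le_total i (-(n : ℤ)) with hi | hi
  · exact base i hi
  induction i, hi using Int.leInduction with
  | base => exact base _ le_rfl
  | succ i hi ih =>
    refine { res_mem := fun {W W'} h h' {s} hs => y.fil_res _ W W' h h' s hs
             local_mem := fun {W} h s hs => y.fil_local _ W h s hs
             frame := fun x hx => ?_ }
    obtain ⟨W₁, hW₁, hx₁, m₁, e₁, he₁, hf₁⟩ := ih.frame x hx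
    obtain ⟨W₂, hW₂, hx₂, m₂, e₂, he₂, hf₂⟩ := y.gr_free (i + 1) x hx
    have hle : ∀ (W : Y.Opens) (h : W ≤ V), y.fil i W h ≤ y.fil (i + 1) W h := fun W h =>
      y.fil_mono' W h (by omega)
    refine ⟨W₁ ⊓ W₂, inf_le_left.trans hW₁, ⟨hx₁, hx₂⟩, m₁ + m₂,
      Fin.append (fun j => res y.E inf_le_left (e₁ j)) (fun j => res y.E inf_le_right (e₂ j)),
      fun j => ?_, fun W' h s hs => ?_⟩
    · refine Fin.addCases (fun j => ?_) (fun j => ?_) j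
      · rw [Fin.append_left]
        exact hle _ _ (y.fil_res i _ _ _ _ _ (he₁ j))
      · rw [Fin.append_right]
        exact y.fil_res _ _ _ _ _ _ (he₂ j)
    · obtain ⟨a₂, ha₂, hu₂⟩ := hf₂ W' (h.trans inf_le_right) s hs
      simp only [add_sub_cancel_right] at ha₂ hu₂
      obtain ⟨a₁, ha₁, hu₁⟩ := hf₁ W' (h.trans inf_le_left) _ ha₂
      refine ⟨Fin.append a₁ a₂, ?_, fun b hb => ?_⟩
      · simp only [Fin.sum_univ_add, Fin.append_left, Fin.append_right, res_res]
        rw [← ha₁]; abel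
      · simp only [Fin.sum_univ_add, Fin.append_left, Fin.append_right, res_res] at hb
        have h2 : (fun j => b (Fin.natAdd m₁ j)) = a₂ := hu₂ _ (by
          simp only [hb, add_sub_cancel_right]
          exact Submodule.sum_mem _ fun j _ => Submodule.smul_mem _ _
            (y.fil_res i _ _ hW₁ (h.trans inf_le_left) _ (he₁ j)))
        have h1 : (fun j => b (Fin.castAdd m₂ j)) = a₁ := hu₁ _ (by
          rw [← h2, hb]; abel)
        rw [← h1, ← h2]
        exact (Fin.append_castAdd_natAdd).symm

variable {y}

/-- Local sections of a locally free sheaf on an affine open are locally multiples of global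
ones. -/
lemma LocFree.exists_smul_eq {E : Y.Modules}
    {N : ∀ W : Y.Opens, W ≤ V → Submodule Γ(Y, W) Γ(E, W)} (hN : LocFree E V N) {U W : Y.Opens}
    (hU : IsAffineOpen U) (hUV : U ≤ V) (hW : W ≤ U) {s : Γ(E, W)} (hs : s ∈ N W (hW.trans hUV))
    {x : Y} (hx : x ∈ W) : ∃ (W' : Y.Opens) (h' : W' ≤ W) (a : Γ(Y, U)), x ∈ W' ∧
      (∃ f : Γ(Y, U), W' = Y.basicOpen f) ∧
      IsUnit (resO Y (h'.trans hW) a) ∧ ∃ t ∈ N U hUV,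
        res E (h'.trans hW) t = resO Y (h'.trans hW) a • res E h' s := by
  obtain ⟨f, hf, hxf⟩ := hU.exists_basicOpen_le ⟨x, hx⟩ (hW hx)
  obtain ⟨n, t, ht, h⟩ := hN.exists_pow_smul_eq_res hU hUV f rfl (hf.trans hW)
    (hN.res_mem _ hf hs)
  exact ⟨Y.basicOpen f, hf, f ^ n, hxf, ⟨f, rfl⟩, by
    rw [map_pow]; exact (isUnit_resO_basicOpen f le_rfl _).pow n, t, ht, by rw [map_pow]; exact h⟩


lemma isUnit_algebraMap_end {R R' M : Type*} [CommRing R] [CommRing R'] [Algebra R R']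
    [AddCommGroup M] [Module R M] [Module R' M] [IsScalarTower R R' M] {a : R}
    (ha : IsUnit (algebraMap R R' a)) : IsUnit (algebraMap R (Module.End R M) a) := by
  rw [Module.End.isUnit_iff]
  obtain ⟨v, hv⟩ := ha
  have h1 : ∀ m : M, algebraMap R (Module.End R M) a m = v • m := fun m => by
    rw [Module.algebraMap_end_apply, Units.smul_def, hv, algebraMap_smul]
  refine ⟨fun m m' h => ?_, fun m => ⟨v⁻¹ • m, by rw [h1, smul_inv_smul]⟩⟩
  rw [h1, h1] at h
  exact smul_left_cancel v h

variable (y)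

/-- The sections of `Gr^i` over an affine open form a projective module. -/
lemma FilSymp.gr_projective (i : ℤ) {U : Y.Opens} (hU : IsAffineOpen U) (hUV : U ≤ V) :
    Module.Projective Γ(Y, U)
      (y.fil i U hUV ⧸ (y.fil (i - 1) U hUV).submoduleOf (y.fil i U hUV)) := by
  obtain ⟨t, ht, hfr⟩ := exists_basicOpen_cover hU
    (fun W => ∃ hW : W ≤ V, ∃ (m : ℕ) (e : Fin m → Γ(y.E, W)), (∀ j, e j ∈ y.fil i W hW) ∧
      ∀ (W' : Y.Opens) (h' : W' ≤ W), ∀ s ∈ y.fil i W' (h'.trans hW),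
        ∃! a : Fin m → Γ(Y, W'),
          s - ∑ j, a j • res y.E h' (e j) ∈ y.fil (i - 1) W' (h'.trans hW))
    (fun x hx => by
      obtain ⟨W, hW, hx, h⟩ := y.gr_free i x (hUV hx)
      exact ⟨W, hx, hW, h⟩)
  have hspan : Ideal.span (t : Set Γ(Y, U)) = ⊤ := by
    rw [← hU.iSup_basicOpen_eq_self_iff]
    exact le_antisymm (iSup_le fun g => Y.basicOpen_le g.1) ht
  have hle : ∀ g : (t : Set Γ(Y, U)), Y.basicOpen g.1 ≤ V := fun g => (Y.basicOpen_le g.1).trans hUV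
  let Mₚ : ↥(t : Set Γ(Y, U)) → Type u := fun g =>
    y.fil i (Y.basicOpen g.1) (hle g) ⧸
      (y.fil (i - 1) (Y.basicOpen g.1) (hle g)).submoduleOf (y.fil i (Y.basicOpen g.1) (hle g))
  let _ : ∀ g, Module Γ(Y, U) (Mₚ g) := fun g =>
    Module.compHom (Mₚ g) (algebraMap Γ(Y, U) Γ(Y, Y.basicOpen g.1))
  have : ∀ g, IsScalarTower Γ(Y, U) Γ(Y, Y.basicOpen g.1) (Mₚ g) := fun g =>
    IsScalarTower.of_algebraMap_smul fun _ _ => rfl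
  have : ∀ g : (t : Set Γ(Y, U)), IsLocalization.Away g.1 Γ(Y, Y.basicOpen g.1) := fun g =>
    hU.isLocalization_basicOpen g.1
  let φ₀ : ∀ g : (t : Set Γ(Y, U)), y.fil i U hUV →ₗ[Γ(Y, U)] Mₚ g := fun g =>
    { toFun := fun s => Submodule.Quotient.mk
        ⟨res y.E (Y.basicOpen_le g.1) s.1, y.fil_res i _ _ _ _ _ s.2⟩
      map_add' := fun s s' => by
        rw [← Submodule.Quotient.mk_add]
        congr 1
        exact Subtype.ext (map_add _ _ _)
      map_smul' := fun a s => by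
        change _ = algebraMap Γ(Y, U) Γ(Y, Y.basicOpen g.1) a • (Submodule.Quotient.mk
          ⟨res y.E (Y.basicOpen_le g.1) s.1, y.fil_res i _ _ _ _ _ s.2⟩ : Mₚ g)
        rw [← Submodule.Quotient.mk_smul]
        congr 1
        exact Subtype.ext (res_smul _ _ _ _) }
  have hker : ∀ (g : (t : Set Γ(Y, U))) (s : y.fil i U hUV), φ₀ g s = 0 ↔
      res y.E (Y.basicOpen_le g.1) s.1 ∈ y.fil (i - 1) (Y.basicOpen g.1) (hle g) := fun g s => by
    change Submodule.Quotient.mk _ = 0 ↔ _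
    rw [Submodule.Quotient.mk_eq_zero]
    rfl
  let ϕ : ∀ g : (t : Set Γ(Y, U)),
      (y.fil i U hUV ⧸ (y.fil (i - 1) U hUV).submoduleOf (y.fil i U hUV)) →ₗ[Γ(Y, U)] Mₚ g :=
    fun g => Submodule.liftQ _ (φ₀ g) fun s hs =>
      (hker g s).mpr (y.fil_res _ _ _ _ _ _ hs)
  -- The quotient over D(g) is the localization of the quotient over `U`. Extension of sections of
  -- F^i gives surjectivity up to powers of g. Injectivity up to powers of g comes from extending a
  -- section of F^{i-1} and then killing the remaining difference.
  have : ∀ g : (t : Set Γ(Y, U)), IsLocalizedModule (Submonoid.powers g.1) (ϕ g) := by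
    intro g
    refine ⟨?_, ?_, ?_⟩
    · rintro ⟨_, n, rfl⟩
      refine isUnit_algebraMap_end (R' := Γ(Y, Y.basicOpen g.1)) ?_
      rw [map_pow]
      exact (isUnit_resO_basicOpen g.1 le_rfl (Y.basicOpen_le g.1)).pow n
    · intro z
      obtain ⟨⟨s, hs⟩, rfl⟩ := Submodule.Quotient.mk_surjective _ z
      obtain ⟨n, s', hs', h⟩ := (y.locFree_fil i).exists_pow_smul_eq_res hU hUV g.1 rfl
        (Y.basicOpen_le g.1) hs
      refine ⟨⟨Submodule.Quotient.mk ⟨s', hs'⟩, ⟨_, n, rfl⟩⟩, ?_⟩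
      change algebraMap Γ(Y, U) Γ(Y, Y.basicOpen g.1) (g.1 ^ n) •
        (Submodule.Quotient.mk ⟨s, hs⟩ : Mₚ g) = Submodule.Quotient.mk
          ⟨res y.E (Y.basicOpen_le g.1) s', y.fil_res i _ _ _ _ _ hs'⟩
      rw [← Submodule.Quotient.mk_smul]
      congr 1
      refine Subtype.ext ?_
      change algebraMap Γ(Y, U) Γ(Y, Y.basicOpen g.1) (g.1 ^ n) • s = res y.E _ s'
      rw [h, map_pow]
      rfl
    · intro z₁ z₂ h
      suffices ∃ c : Submonoid.powers g.1, c • (z₁ - z₂) = 0 by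
        obtain ⟨c, hc⟩ := this
        exact ⟨c, by rwa [smul_sub, sub_eq_zero] at hc⟩
      have h0 : ϕ g (z₁ - z₂) = 0 := by rw [map_sub, h, sub_self]
      obtain ⟨⟨s, hs⟩, hz⟩ := Submodule.Quotient.mk_surjective _ (z₁ - z₂)
      rw [← hz] at h0 ⊢
      have h1 := (hker g ⟨s, hs⟩).mp h0
      obtain ⟨n, s', hs', h2⟩ := (y.locFree_fil (i - 1)).exists_pow_smul_eq_res hU hUV g.1 rfl
        (Y.basicOpen_le g.1) h1
      obtain ⟨m, hm⟩ := (y.locFree).exists_pow_smul_eq_zero hU hUV g.1 rfl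
        (Y.basicOpen_le g.1) (s := g.1 ^ n • s - s') trivial (by
          rw [map_sub, res_smul, h2, map_pow, sub_self])
      refine ⟨⟨_, m + n, rfl⟩, ?_⟩
      change (g.1 ^ (m + n)) • (Submodule.Quotient.mk ⟨s, hs⟩ : y.fil i U hUV ⧸
        (y.fil (i - 1) U hUV).submoduleOf (y.fil i U hUV)) = 0
      rw [← Submodule.Quotient.mk_smul, Submodule.Quotient.mk_eq_zero]
      change g.1 ^ (m + n) • s ∈ y.fil (i - 1) U hUV
      rw [smul_sub, sub_eq_zero, smul_smul, ← pow_add] at hm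
      rw [hm]
      exact Submodule.smul_mem _ _ hs'
  have hequiv : ∀ g : (t : Set Γ(Y, U)), ∃ m : ℕ,
      Nonempty ((Fin m → Γ(Y, Y.basicOpen g.1)) ≃ₗ[Γ(Y, Y.basicOpen g.1)] Mₚ g) := by
    intro g
    obtain ⟨W₁, hW₁, hW₁V, m, e, he, h⟩ := hfr g.1 g.2
    let e' : Fin m → y.fil i (Y.basicOpen g.1) (hle g) := fun j =>
      ⟨res y.E hW₁ (e j), y.fil_res i _ _ _ _ _ (he j)⟩
    let L : (Fin m → Γ(Y, Y.basicOpen g.1)) →ₗ[Γ(Y, Y.basicOpen g.1)] Mₚ g :=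
      Submodule.mkQ _ ∘ₗ Fintype.linearCombination Γ(Y, Y.basicOpen g.1) e'
    have hL : ∀ (a : Fin m → Γ(Y, Y.basicOpen g.1)) (s : y.fil i (Y.basicOpen g.1) (hle g)),
        Submodule.Quotient.mk s = L a ↔
        s.1 - ∑ j, a j • res y.E hW₁ (e j) ∈ y.fil (i - 1) _ (hle g) := by
      intro a s
      change Submodule.Quotient.mk s = Submodule.Quotient.mk _ ↔ _
      rw [Submodule.Quotient.eq]
      change (s - Fintype.linearCombination Γ(Y, Y.basicOpen g.1) e' a).1 ∈
        y.fil (i - 1) _ (hle g) ↔ _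
      rw [Fintype.linearCombination_apply]
      simp [e']
    refine ⟨m, ⟨LinearEquiv.ofBijective L ⟨?_, ?_⟩⟩⟩
    · intro a b hab
      obtain ⟨s, hs⟩ := Submodule.Quotient.mk_surjective _ (L a)
      obtain ⟨c, -, hc⟩ := h _ hW₁ s.1 s.2
      rw [hc a ((hL a s).mp hs), hc b ((hL b s).mp (hs.trans hab))]
    · intro z
      obtain ⟨s, rfl⟩ := Submodule.Quotient.mk_surjective _ z
      obtain ⟨c, hc, -⟩ := h _ hW₁ s.1 s.2
      exact ⟨c, ((hL c s).mpr hc).symm⟩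
  refine projective_of_free_localization _ hspan (Rₚ := fun g => Γ(Y, Y.basicOpen g.1)) ϕ
    (fun g => ?_) (fun g => ?_)
  · obtain ⟨m, ⟨e⟩⟩ := hequiv g
    exact Module.Free.of_equiv e
  · obtain ⟨m, ⟨e⟩⟩ := hequiv g
    exact Module.Finite.equiv e


/-! ### Extension of linear maps from an affine open -/

/-- `t` corresponds to `s` under the extension of `L` to the open set `W`, up to a unit. -/
def ExtRel {E N : Y.Modules} {U : Y.Opens} (L : Γ(E, U) →ₗ[Γ(Y, U)] Γ(N, U)) {W : Y.Opens}
    (hW : W ≤ U) (s : Γ(E, W)) (t : Γ(N, W)) : Prop :=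
  ∃ a : Γ(Y, U), IsUnit (resO Y hW a) ∧ ∃ s' : Γ(E, U),
    res E hW s' = resO Y hW a • s ∧ res N hW (L s') = resO Y hW a • t

section Ext

variable {E N : Y.Modules} {U : Y.Opens} {L : Γ(E, U) →ₗ[Γ(Y, U)] Γ(N, U)}

lemma ExtRel.restrict {W W' : Y.Opens} {hW : W ≤ U} {s : Γ(E, W)} {t : Γ(N, W)}
    (h : ExtRel L hW s t) (h' : W' ≤ W) :
    ExtRel L (h'.trans hW) (res E h' s) (res N h' t) := by
  obtain ⟨a, ha, s', h1, h2⟩ := h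
  refine ⟨a, by rw [← resO_resO hW h']; exact ha.map _, s', ?_, ?_⟩
  · rw [← res_res E hW h', h1, res_smul, resO_resO]
  · rw [← res_res N hW h', h2, res_smul, resO_resO]

lemma ExtRel.add {W : Y.Opens} {hW : W ≤ U} {s₁ s₂ : Γ(E, W)} {t₁ t₂ : Γ(N, W)}
    (h₁ : ExtRel L hW s₁ t₁) (h₂ : ExtRel L hW s₂ t₂) : ExtRel L hW (s₁ + s₂) (t₁ + t₂) := by
  obtain ⟨a, ha, s, h1, h2⟩ := h₁
  obtain ⟨a', ha', s', h1', h2'⟩ := h₂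
  refine ⟨a * a', by rw [map_mul]; exact ha.mul ha', a' • s + a • s', ?_, ?_⟩
  · rw [map_add, res_smul, res_smul, h1, h1', map_mul, smul_add, smul_smul, smul_smul, mul_comm]
  · rw [map_add, map_smul, map_smul, map_add, res_smul, res_smul, h2, h2', map_mul, smul_add,
      smul_smul, smul_smul, mul_comm]

/-- A function `c` on `W` need not come from `U`; it enters as a fraction `b / a` of functions on
`U`. -/
lemma ExtRel.smul {W : Y.Opens} {hW : W ≤ U} {s : Γ(E, W)} {t : Γ(N, W)}
    (h : ExtRel L hW s t) {a b : Γ(Y, U)} {c : Γ(Y, W)} (ha : IsUnit (resO Y hW a))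
    (hb : resO Y hW b = resO Y hW a * c) : ExtRel L hW (c • s) (c • t) := by
  obtain ⟨a', ha', s', h1, h2⟩ := h
  refine ⟨a * a', by rw [map_mul]; exact ha.mul ha', b • s', ?_, ?_⟩
  · rw [res_smul, h1, hb, map_mul, smul_smul, smul_smul]; ring_nf
  · rw [map_smul, res_smul, h2, hb, map_mul, smul_smul, smul_smul]; ring_nf

/-- After cross-multiplication the two numerators agree on `W`, so near each point their difference
is killed by a power of a function that is invertible there. Linearity of `L` carries this relation
over to the values. -/
lemma ExtRel.eq (hE : LocFree E U (fun _ _ => ⊤)) (hU : IsAffineOpen U) {W : Y.Opens}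
    {hW : W ≤ U} {s : Γ(E, W)} {t₁ t₂ : Γ(N, W)}
    (h₁ : ExtRel L hW s t₁) (h₂ : ExtRel L hW s t₂) : t₁ = t₂ := by
  obtain ⟨a, ha, s, h1, h2⟩ := h₁
  obtain ⟨a', ha', s', h1', h2'⟩ := h₂
  refine eq_of_locally fun x hx => ?_
  obtain ⟨f, hf, hxf⟩ := hU.exists_basicOpen_le ⟨x, hx⟩ (hW hx)
  refine ⟨_, hf, hxf, ?_⟩
  have h0 : res E hW (a' • s - a • s') = 0 := by
    rw [map_sub, res_smul, res_smul, h1, h1', smul_smul, smul_smul, mul_comm, sub_self]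
  obtain ⟨m, hm⟩ := hE.exists_pow_smul_eq_zero hU le_rfl f rfl (hf.trans hW)
    (s := a' • s - a • s') trivial (by rw [← res_res E hW hf, h0, map_zero])
  have h3 : f ^ m • (a' • L s - a • L s') = 0 := by
    rw [← map_smul, ← map_smul, ← map_sub, ← map_smul, hm, map_zero]
  have h4 := congrArg (res N (hf.trans hW)) h3
  rw [map_zero, res_smul, map_pow] at h4
  rw [((isUnit_resO_basicOpen f le_rfl (hf.trans hW)).pow m).smul_eq_zero, ← res_res N hW hf,
    map_sub, res_smul, res_smul, h2, h2', smul_smul, smul_smul, mul_comm, ← smul_sub, res_smul,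
    ((ha.mul ha').map _).smul_eq_zero, map_sub, sub_eq_zero] at h4
  exact h4

/-- A linear map between the sections over an affine open extends to a morphism of sheaves if the
source is locally free. -/
theorem exists_extension (hE : LocFree E U (fun _ _ => ⊤)) (hU : IsAffineOpen U)
    (L : Γ(E, U) →ₗ[Γ(Y, U)] Γ(N, U)) : ∃ φ : Fam E N U, IsNat φ ∧ φ U le_rfl = L := by
  -- Locally a section has the form s'/a with s' defined over `U`, and its value must be L(s')/a;
  -- the local values agree by `ExtRel.eq` and are then glued.
  have hloc : ∀ (W : Y.Opens) (hW : W ≤ U) (s : Γ(E, W)), ∀ x ∈ W, ∃ (W' : Y.Opens) (h' : W' ≤ W)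
      (t : Γ(N, W')), x ∈ W' ∧ ExtRel L (h'.trans hW) (res E h' s) t := by
    intro W hW s x hx
    obtain ⟨W', h', a, hx', -, ha, s', -, hs'⟩ := hE.exists_smul_eq hU le_rfl hW (s := s) trivial hx
    refine ⟨W', h', (↑(ha.unit⁻¹) : Γ(Y, W')) • res N (h'.trans hW) (L s'), hx', a, ha, s', hs', ?_⟩
    rw [smul_smul, IsUnit.mul_val_inv, one_smul]
  have hex : ∀ (W : Y.Opens) (hW : W ≤ U) (s : Γ(E, W)), ∃ t : Γ(N, W), ∀ x ∈ W,
      ∃ (W' : Y.Opens) (h' : W' ≤ W), x ∈ W' ∧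
        ExtRel L (h'.trans hW) (res E h' s) (res N h' t) := by
    intro W hW s
    choose W' h' t hx h using hloc W hW s
    obtain ⟨t₀, ht₀⟩ := exists_glue N (fun x : W => W' x.1 x.2) W (fun x => h' x.1 x.2)
      (fun x hxW => Opens.mem_iSup.mpr ⟨⟨x, hxW⟩, hx x hxW⟩) (fun x => t x.1 x.2) (fun x x' => by
        have h1 := (h x.1 x.2).restrict (inf_le_left : W' x.1 x.2 ⊓ W' x'.1 x'.2 ≤ _)
        have h2 := (h x'.1 x'.2).restrict (inf_le_right : W' x.1 x.2 ⊓ W' x'.1 x'.2 ≤ _)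
        rw [res_res] at h1 h2
        exact ExtRel.eq hE hU h1 h2)
    exact ⟨t₀, fun x hxW => ⟨W' x hxW, h' x hxW, hx x hxW, by
      rw [ht₀ ⟨x, hxW⟩]; exact h x hxW⟩⟩
  have huniq : ∀ (W : Y.Opens) (hW : W ≤ U) (s : Γ(E, W)) (t t' : Γ(N, W)),
      (∀ x ∈ W, ∃ (W' : Y.Opens) (h' : W' ≤ W), x ∈ W' ∧
        ExtRel L (h'.trans hW) (res E h' s) (res N h' t)) →
      (∀ x ∈ W, ∃ (W' : Y.Opens) (h' : W' ≤ W), x ∈ W' ∧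
        ExtRel L (h'.trans hW) (res E h' s) (res N h' t')) → t = t' := by
    intro W hW s t t' h1 h2
    refine eq_of_locally fun x hx => ?_
    obtain ⟨W₁, hW₁, hx₁, e₁⟩ := h1 x hx
    obtain ⟨W₂, hW₂, hx₂, e₂⟩ := h2 x hx
    refine ⟨W₁ ⊓ W₂, inf_le_left.trans hW₁, ⟨hx₁, hx₂⟩, ?_⟩
    have e₁' := e₁.restrict (inf_le_left : W₁ ⊓ W₂ ≤ W₁)
    have e₂' := e₂.restrict (inf_le_right : W₁ ⊓ W₂ ≤ W₂)
    rw [res_res, res_res] at e₁' e₂'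
    exact ExtRel.eq hE hU e₁' e₂'
  choose φ hφ using hex
  let ψ : Fam E N U := fun W hW =>
    { toFun := φ W hW
      map_add' := fun s₁ s₂ => by
        refine huniq W hW _ _ _ (hφ W hW _) fun x hx => ?_
        obtain ⟨W₁, hW₁, hx₁, e₁⟩ := hφ W hW s₁ x hx
        obtain ⟨W₂, hW₂, hx₂, e₂⟩ := hφ W hW s₂ x hx
        refine ⟨W₁ ⊓ W₂, inf_le_left.trans hW₁, ⟨hx₁, hx₂⟩, ?_⟩
        have e₁' := e₁.restrict (inf_le_left : W₁ ⊓ W₂ ≤ W₁)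
        have e₂' := e₂.restrict (inf_le_right : W₁ ⊓ W₂ ≤ W₂)
        rw [res_res, res_res] at e₁' e₂'
        rw [map_add, map_add]
        exact e₁'.add e₂'
      map_smul' := fun c s => by
        refine huniq W hW _ _ _ (hφ W hW _) fun x hx => ?_
        obtain ⟨W₁, hW₁, hx₁, e₁⟩ := hφ W hW s x hx
        obtain ⟨f, hf, hxf⟩ := hU.exists_basicOpen_le ⟨x, hx₁⟩ (hW hx)
        refine ⟨_, hf.trans hW₁, hxf, ?_⟩
        -- On a basic open of `U` the coefficient becomes a fraction with denominator a power of
        -- `f`.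
        obtain ⟨n, b, hb⟩ := exists_pow_mul_eq_resO hU f rfl (hf.trans (hW₁.trans hW))
          (resO Y (hf.trans hW₁) c)
        have e₁' := e₁.restrict hf
        rw [res_res, res_res] at e₁'
        rw [RingHom.id_apply, res_smul, res_smul]
        exact e₁'.smul (a := f ^ n) (b := b) (by
          rw [map_pow]; exact (isUnit_resO_basicOpen f le_rfl _).pow n) (by rw [map_pow]; exact hb) }
  refine ⟨ψ, fun W W' h h' s => ?_, LinearMap.ext fun s => ?_⟩
  · refine huniq W' (h'.trans h) (res E h' s) _ _ (fun x hx => ?_) (hφ W' _ _)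
    obtain ⟨W₁, hW₁, hx₁, e₁⟩ := hφ W h s x (h' hx)
    refine ⟨W₁ ⊓ W', inf_le_right, ⟨hx₁, hx⟩, ?_⟩
    have e₁' := e₁.restrict (inf_le_left : W₁ ⊓ W' ≤ W₁)
    rw [res_res, res_res] at e₁'
    rw [res_res, res_res]
    exact e₁'
  · refine huniq U le_rfl s _ _ (hφ U le_rfl s) fun x hx => ?_
    exact ⟨U, le_rfl, hx, 1, by simp, s, by simp, by simp⟩

/-- Morphisms from a locally free sheaf on an affine open are determined by their values on global
sections. -/
lemma IsNat.ext_of_affine (hE : LocFree E U (fun _ _ => ⊤)) (hU : IsAffineOpen U)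
    {φ ψ : Fam E N U} (hφ : IsNat φ) (hψ : IsNat ψ) (h : ∀ s, φ U le_rfl s = ψ U le_rfl s) :
    φ = ψ := by
  funext W hW
  refine LinearMap.ext fun s => eq_of_locally fun x hx => ?_
  obtain ⟨W', h', a, hx', -, ha, s', -, hs'⟩ := hE.exists_smul_eq hU le_rfl hW (s := s) trivial hx
  refine ⟨W', h', hx', ?_⟩
  rw [← ha.smul_left_cancel, hφ, hψ, ← LinearMap.map_smul, ← LinearMap.map_smul, ← hs', ← hφ U W' le_rfl, h, hψ]

end Ext

/-- The structure sheaf as a sheaf of modules. -/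
def structureModule (Y : Scheme.{u}) : Y.Modules :=
  SecData.toModules
    { obj := fun W => Γ(Y, W)
      res := fun h => (resO Y h).toAddMonoidHom
      res_self := fun h s => resO_self h s
      res_res := fun h h' s => resO_resO h h' s
      res_smul := fun h a s => map_mul (resO Y h) a s
      sep := fun W s t h => eq_of_locallyO fun x hx => by
        obtain ⟨j, hj⟩ := Opens.mem_iSup.mp hx
        exact ⟨W j, le_iSup W j, hj, h j⟩
      glue := fun W s hs => exists_glueO W _ (le_iSup W) le_rfl s hs }

variable {U : Y.Opens} (hU : IsAffineOpen U) (hUV : U ≤ V)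

lemma LocFree.restrict {E : Y.Modules} {N : ∀ W : Y.Opens, W ≤ V → Submodule Γ(Y, W) Γ(E, W)}
    (hN : LocFree E V N) (hUV : U ≤ V) : LocFree E U (fun W h => N W (h.trans hUV)) where
  res_mem h h' _ hs := hN.res_mem _ h' hs
  local_mem h s hs := hN.local_mem _ s hs
  frame x hx := by
    obtain ⟨W, hW, hxW, m, e, he, hf⟩ := hN.frame x (hUV hx)
    refine ⟨W ⊓ U, inf_le_right, ⟨hxW, hx⟩, m, fun j => res E inf_le_left (e j),
      fun j => hN.res_mem _ _ (he j), fun W' h s hs => ?_⟩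
    obtain ⟨a, ha, hu⟩ := hf W' (h.trans inf_le_left) s hs
    exact ⟨a, by simpa only [res_res] using ha, fun b hb => hu b (by simpa only [res_res] using hb)⟩

include hU in
-- Nondegeneracy tests against sections over all smaller open sets. Over an affine open each of them
-- is locally a section over `U` divided by a unit, so testing against sections over `U` is enough.
lemma FilSymp.eq_zero_of_form_eq_zero (s : Γ(y.E, U))
    (h : ∀ t, y.form U hUV s t = 0) : s = 0 := by
  obtain ⟨s₀, -, hu⟩ := y.form_nondeg U hUV (fun _ _ => 0) (fun _ _ _ _ _ => by simp)
  rw [hu s, ← hu 0]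
  · intro W' h' t; simp
  · intro W' h' t
    refine (eq_of_locallyO fun x hx => ?_)
    obtain ⟨W₁, h₁, a, hx', -, ha, t', -, ht'⟩ :=
      y.locFree.exists_smul_eq hU hUV h' (s := t) trivial hx
    refine ⟨W₁, h₁, hx', ?_⟩
    rw [← ha.mul_right_inj, y.form_res, LinearMap.zero_apply, map_zero, mul_zero, ← smul_eq_mul,
      ← LinearMap.map_smul, ← ht', res_res, ← y.form_res U W₁ hUV, h, map_zero]

include hU in
-- `form_nondeg` represents functionals on the sheaf, and a functional on the sections over an
-- affine open extends to such a functional by `exists_extension`.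
lemma FilSymp.exists_form_eq (l : Γ(y.E, U) →ₗ[Γ(Y, U)] Γ(Y, U)) :
    ∃ s, ∀ t, y.form U hUV s t = l t := by
  obtain ⟨φ, hφ, hφU⟩ := exists_extension (N := structureModule Y)
    (y.locFree.restrict hUV) hU l
  obtain ⟨s, hs, -⟩ := y.form_nondeg U hUV (fun W h => φ W h) (fun W₁ W₂ h₁ h₂ t => hφ W₁ W₂ h₁ h₂ t)
  refine ⟨s, fun t => ?_⟩
  have := hs U le_rfl t
  rw [res_self] at this
  rw [← this, hφU]

include hU in
lemma FilSymp.mem_fil_of_form_eq_zero (i : ℤ) (s : Γ(y.E, U))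
    (h : ∀ t ∈ y.fil i U hUV, y.form U hUV s t = 0) : s ∈ y.fil (-1 - i) U hUV := by
  rw [y.fil_perp]
  intro W' h' t ht
  refine (eq_of_locallyO fun x hx => ?_)
  obtain ⟨W₁, h₁, a, hx', -, ha, t', htN, ht'⟩ :=
    (y.locFree_fil i).exists_smul_eq hU hUV h' (s := t) ht hx
  refine ⟨W₁, h₁, hx', ?_⟩
  rw [← ha.mul_right_inj, y.form_res, map_zero, mul_zero, ← smul_eq_mul,
    ← LinearMap.map_smul, ← ht', res_res, ← y.form_res U W₁ hUV, h _ htN, map_zero]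

end Frames

/-! ## Thickenings of the curve -/

section Thickening

/-- A local artinian `k`-algebra with residue field `k` is finite-dimensional. -/
theorem finite_of_augmentation {k S : Type*} [Field k] [CommRing S] [IsLocalRing S]
    [IsArtinianRing S] [Algebra k S] (ε : S →ₐ[k] k) : Module.Finite k S := by
  have key : ∀ (M : Type _) [AddCommGroup M] [Module S M], IsFiniteLength S M →
      ∃ (n : ℕ) (m : Fin n → M), ∀ x, ∃ c : Fin n → k, x = ∑ j, algebraMap k S (c j) • m j := by
    intro M _ _ h
    induction h with
    | of_subsingleton => exact ⟨0, Fin.elim0, fun x => ⟨Fin.elim0, Subsingleton.elim _ _⟩⟩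
    | @of_simple_quotient M _ _ N hs hN ih =>
      obtain ⟨n, m, hm⟩ := ih
      have := IsSimpleModule.nontrivial S (M ⧸ N)
      obtain ⟨v, hv⟩ := exists_ne (0 : M ⧸ N)
      obtain ⟨e, rfl⟩ := Submodule.Quotient.mk_surjective N v
      -- The annihilator of a simple module is the maximal ideal of S. So S acts on the quotient
      -- through `ε`, and one nonzero vector spans it over `k`.
      have hann : ∀ a ∈ IsLocalRing.maximalIdeal S, ∀ z : M ⧸ N, a • z = 0 := by
        intro a ha z
        have hmax := IsSimpleModule.annihilator_isMaximal (R := S) (M := M ⧸ N)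
        rw [← IsLocalRing.eq_maximalIdeal hmax] at ha
        exact Module.mem_annihilator.mp ha z
      refine ⟨n + 1, Fin.cons e fun j => (m j).1, fun x => ?_⟩
      obtain ⟨a, ha⟩ := (isSimpleModule_iff_toSpanSingleton_surjective.mp hs).2 _ hv
        (Submodule.Quotient.mk x)
      have hmem : a - algebraMap k S (ε a) ∈ IsLocalRing.maximalIdeal S := by
        rw [IsLocalRing.mem_maximalIdeal]
        intro hu
        have := hu.map ε
        simp at this
      have h0 := hann _ hmem (Submodule.Quotient.mk e)
      rw [LinearMap.toSpanSingleton_apply] at ha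
      rw [sub_smul, ha, sub_eq_zero, ← Submodule.Quotient.mk_smul, Submodule.Quotient.eq] at h0
      obtain ⟨c, hc⟩ := hm ⟨_, h0⟩
      refine ⟨Fin.cons (ε a) c, ?_⟩
      rw [Fin.sum_univ_succ]
      simp only [Fin.cons_zero, Fin.cons_succ]
      have := congrArg Subtype.val hc
      simp only [Submodule.coe_sum, Submodule.coe_smul] at this
      rw [← this]; abel
  obtain ⟨n, m, hm⟩ := key S (isFiniteLength_iff_isNoetherian_isArtinian.mpr
    ⟨inferInstance, inferInstance⟩)
  refine Module.Finite.of_surjective (Fintype.linearCombination k m) fun x => ?_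
  obtain ⟨c, hc⟩ := hm x
  refine ⟨c, ?_⟩
  rw [hc, Fintype.linearCombination_apply]
  simp [Algebra.smul_def]

variable {k : Type u} [Field k] {X : Scheme.{u}} (f : X ⟶ Spec (CommRingCat.of k))
  (S : Type u) [CommRing S] [Algebra k S]

lemma specialFibre_toX (ε : S →ₐ[k] k) : specialFibre f ε ≫ toX f S = 𝟙 X :=
  pullback.lift_fst _ _ _

lemma specialFibre_toSpec (ε : S →ₐ[k] k) :
    specialFibre f ε ≫ toSpec f S = f ≫ Spec.map (CommRingCat.ofHom ε.toRingHom) :=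
  pullback.lift_snd _ _ _

/-- Pasting of squares: the square next to this one defines X_S, and the horizontal sides of the
composite square are identities. -/
lemma isPullback_specialFibre (ε : S →ₐ[k] k) :
    IsPullback (specialFibre f ε) f (toSpec f S) (Spec.map (CommRingCat.ofHom ε.toRingHom)) := by
  refine IsPullback.of_right (h₁₂ := toX f S) (v₁₃ := f)
    (h₂₂ := Spec.map (CommRingCat.ofHom (algebraMap k S))) ?_ (specialFibre_toSpec f S ε)
    (IsPullback.of_hasPullback _ _)
  have h1 : Spec.map (CommRingCat.ofHom ε.toRingHom) ≫
      Spec.map (CommRingCat.ofHom (algebraMap k S)) = 𝟙 _ := by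
    rw [← Spec.map_comp, ← CommRingCat.ofHom_comp]
    have : ε.toRingHom.comp (algebraMap k S) = RingHom.id k := ε.comp_algebraMap
    rw [this]
    exact Spec.map_id _
  rw [specialFibre_toX, h1]
  exact IsPullback.of_id_fst

/-- The data of the inclusion of the special fibre in `X_S`. -/
structure Thick where
  /-- the inclusion -/
  i : X ⟶ XBase f S
  /-- the augmentation -/
  ε : S →ₐ[k] k
  -- An equation is used so that for `B` the inclusion can be taken to be the composite X ⟶ X_A ⟶
  -- X_B; inverse images along it are then iterated inverse images by definition.
  i_eq : i = specialFibre f ε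

variable {f S} (T : Thick f S)

namespace Thick

lemma i_toX : T.i ≫ toX f S = 𝟙 X := by rw [T.i_eq, specialFibre_toX]

instance : IsClosedImmersion T.i := by
  have : IsClosedImmersion (Spec.map (CommRingCat.ofHom T.ε.toRingHom)) :=
    IsClosedImmersion.spec_of_surjective _ fun c =>
      ⟨algebraMap k S c, T.ε.commutes c⟩
  rw [T.i_eq]
  exact MorphismProperty.of_isPullback (P := @IsClosedImmersion)
    (isPullback_specialFibre f S T.ε).flip this

instance isAffineHom_toX : IsAffineHom (toX f S) :=
  MorphismProperty.of_isPullback (P := @IsAffineHom)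
    (IsPullback.of_hasPullback f (Spec.map (CommRingCat.ofHom (algebraMap k S)))).flip inferInstance

lemma preimage_toX (U : X.Opens) : T.i ⁻¹ᵁ (toX f S ⁻¹ᵁ U) = U := by
  rw [← Scheme.Hom.comp_preimage, T.i_toX]
  rfl

variable [IsLocalRing S] [IsArtinianRing S]

/-- The spectrum of a local artinian ring is a point, and surjectivity is stable under base change.
-/
lemma surjective : Function.Surjective T.i := by
  have : Surjective (Spec.map (CommRingCat.ofHom T.ε.toRingHom)) := by
    refine ⟨fun x => ⟨(⊥ : PrimeSpectrum k), ?_⟩⟩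
    have : Subsingleton (PrimeSpectrum S) := inferInstance
    exact Subsingleton.elim (α := PrimeSpectrum S) _ _
  have h : Surjective T.i := by
    rw [T.i_eq]
    exact MorphismProperty.of_isPullback (P := @Surjective)
      (isPullback_specialFibre f S T.ε).flip this
  exact h.surj

lemma i_toX_apply (z : XBase f S) : T.i (toX f S z) = z := by
  obtain ⟨x, rfl⟩ := T.surjective z
  have : toX f S (T.i x) = x := by
    rw [← Scheme.Hom.comp_apply, T.i_toX]
    rfl
  rw [this]

/-- The two maps on points are mutually inverse, so the open subsets of X and of X_S correspond to
each other. -/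
lemma toX_preimage (W : (XBase f S).Opens) : toX f S ⁻¹ᵁ (T.i ⁻¹ᵁ W) = W := by
  ext z
  change T.i (toX f S z) ∈ W ↔ z ∈ W
  rw [T.i_toX_apply]

lemma le_of_preimage_le {W W' : (XBase f S).Opens} (h : T.i ⁻¹ᵁ W ≤ T.i ⁻¹ᵁ W') : W ≤ W' := by
  rw [← T.toX_preimage W, ← T.toX_preimage W']
  exact (toX f S).preimage_mono h

/-- Functions on `X`, pulled back to `X_S`. -/
def pr (W : (XBase f S).Opens) : Γ(X, T.i ⁻¹ᵁ W) →+* Γ(XBase f S, W) :=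
  ((toX f S).appLE (T.i ⁻¹ᵁ W) W (T.toX_preimage W).ge).hom

lemma resO_pr {W W' : (XBase f S).Opens} (h : W' ≤ W) (a : Γ(X, T.i ⁻¹ᵁ W)) :
    resO _ h (T.pr W a) = T.pr W' (resO X (T.i.preimage_mono h) a) := by
  simp only [resO, pr, ← CommRingCat.comp_apply, Scheme.Hom.appLE_map, Scheme.Hom.map_appLE]

lemma app_pr (W : (XBase f S).Opens) (a : Γ(X, T.i ⁻¹ᵁ W)) : (T.i.app W).hom (T.pr W a) = a := by
  have h : (toX f S).appLE (T.i ⁻¹ᵁ W) W (T.toX_preimage W).ge ≫ T.i.app W = 𝟙 _ := by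
    rw [Scheme.Hom.app_eq_appLE, Scheme.Hom.appLE_comp_appLE]
    have : ∀ (g : X ⟶ X) (hg : g = 𝟙 X) (e), g.appLE (T.i ⁻¹ᵁ W) (T.i ⁻¹ᵁ W) e = 𝟙 _ := by
      rintro _ rfl e
      simp only [Scheme.Hom.appLE, Scheme.Hom.id_app]
      exact X.presheaf.map_id _
    exact this _ T.i_toX _
  exact congr($h a)

end Thick

lemma resO_scalar' {Y : Scheme.{u}} {R : Type u} [CommRing R] (g : Y ⟶ Spec (CommRingCat.of R))
    {W W' : Y.Opens} (h : W' ≤ W) (c : R) : resO Y h (scalar g W c) = scalar g W' c := by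
  simp only [scalar, resO, RingHom.comp_apply, ← CommRingCat.comp_apply, ← Functor.map_comp]
  rfl

lemma scalar_eq {Y : Scheme.{u}} {R : Type u} [CommRing R] (g : Y ⟶ Spec (CommRingCat.of R))
    (W : Y.Opens) (c : R) :
    scalar g W c = (((Scheme.ΓSpecIso (CommRingCat.of R)).inv ≫ g.appLE ⊤ W (show W ≤ g ⁻¹ᵁ ⊤ from le_top)).hom c) := by
  simp only [scalar, resO, RingHom.comp_apply, Scheme.Hom.appTop, Scheme.Hom.appLE]
  rfl

/-- Scalars are compatible with morphisms. -/
lemma appLE_scalar {Y Y' : Scheme.{u}} {R R' : Type u} [CommRing R] [CommRing R']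
    (g : Y ⟶ Spec (CommRingCat.of R)) (g' : Y' ⟶ Spec (CommRingCat.of R')) (h : Y' ⟶ Y)
    (φ : R →+* R') (e : h ≫ g = g' ≫ Spec.map (CommRingCat.ofHom φ))
    {W : Y.Opens} {W' : Y'.Opens} (hW : W' ≤ h ⁻¹ᵁ W) (c : R) :
    (h.appLE W W' hW).hom (scalar g W c) = scalar g' W' (φ c) := by
  rw [scalar_eq, scalar_eq]
  have h1 : (Scheme.ΓSpecIso (CommRingCat.of R)).inv ≫ g.appLE ⊤ W (show W ≤ g ⁻¹ᵁ ⊤ from le_top) ≫ h.appLE W W' hW =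
      CommRingCat.ofHom φ ≫ (Scheme.ΓSpecIso (CommRingCat.of R')).inv ≫ g'.appLE ⊤ W' (show W' ≤ g' ⁻¹ᵁ ⊤ from le_top) := by
    rw [Scheme.Hom.appLE_comp_appLE, Scheme.ΓSpecIso_inv_naturality_assoc]
    simp only [e]
    rw [Scheme.Hom.comp_appLE]
    rfl
  exact congr($h1 c)

namespace Thick

lemma app_scalar (W : (XBase f S).Opens) (c : S) :
    (T.i.app W).hom (scalar (toSpec f S) W c) = scalar f (T.i ⁻¹ᵁ W) (T.ε c) := by
  rw [Scheme.Hom.app_eq_appLE]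
  exact appLE_scalar _ _ _ T.ε.toRingHom (by rw [T.i_eq, specialFibre_toSpec]) _ c

variable [IsLocalRing S] [IsArtinianRing S]

lemma scalar_algebraMap (W : (XBase f S).Opens) (c : k) :
    scalar (toSpec f S) W (algebraMap k S c) = T.pr W (scalar f (T.i ⁻¹ᵁ W) c) :=
  (appLE_scalar f (toSpec f S) (toX f S) (algebraMap k S) pullback.condition
    (T.toX_preimage W).ge c).symm

lemma isAffineOpen_preimage {W : (XBase f S).Opens} (hW : IsAffineOpen W) :
    IsAffineOpen (T.i ⁻¹ᵁ W) :=
  hW.preimage T.i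

/-- Functions on a fibre product of affine schemes form the tensor product, here of the functions on
an affine open of X with `S`. -/
lemma isPushout_affine {W : (XBase f S).Opens} (hW : IsAffineOpen W) :
    IsPushout (CommRingCat.ofHom (scalar f (T.i ⁻¹ᵁ W))) (CommRingCat.ofHom (algebraMap k S))
      (CommRingCat.ofHom (T.pr W)) (CommRingCat.ofHom (scalar (toSpec f S) W)) := by
  have H : IsPullback (toX f S) (toSpec f S) f (Spec.map (CommRingCat.ofHom (algebraMap k S))) :=
    IsPullback.of_hasPullback _ _
  have hUST : (⊤ : (Spec (CommRingCat.of S)).Opens) ≤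
    Spec.map (CommRingCat.ofHom (algebraMap k S)) ⁻¹ᵁ ⊤ := le_top
  have hUSX : T.i ⁻¹ᵁ W ≤ f ⁻¹ᵁ ⊤ := le_top
  have hUY : W = toX f S ⁻¹ᵁ (T.i ⁻¹ᵁ W) ⊓ toSpec f S ⁻¹ᵁ ⊤ := by
    rw [T.toX_preimage]; exact (inf_top_eq W).symm
  have h1 := (isIso_pushoutSection_iff H hUST hUSX hUY).mp
    (isIso_pushoutSection_of_isAffineOpen H hUST hUSX hUY (isAffineOpen_top _) (isAffineOpen_top _)
      (T.isAffineOpen_preimage hW))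
  refine IsPushout.of_iso h1 (Scheme.ΓSpecIso (CommRingCat.of k)) (Iso.refl _)
    (Scheme.ΓSpecIso (CommRingCat.of S)) (Iso.refl _) ?_ ?_ ?_ ?_
  · rw [← Iso.inv_comp_eq]
    ext c
    exact (scalar_eq f _ c).symm
  · have : (Spec.map (CommRingCat.ofHom (algebraMap k S))).appLE ⊤ ⊤ hUST =
        (Spec.map (CommRingCat.ofHom (algebraMap k S))).appTop := by
      rw [Scheme.Hom.appTop, Scheme.Hom.app_eq_appLE]; rfl
    rw [this, Scheme.ΓSpecIso_naturality]
  · rfl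
  · rw [← Iso.inv_comp_eq]
    ext c
    exact (scalar_eq (toSpec f S) _ c).symm

section Free

variable {κ : Type*} [Fintype κ] (β : Module.Basis κ k S)

/-- A `k`-basis of `S` stays a basis after base change from `k` to the functions on X. -/
lemma exists_basis_affine {W : (XBase f S).Opens} (hW : IsAffineOpen W) :
    (∀ c : κ → Γ(X, T.i ⁻¹ᵁ W), ∑ l, scalar (toSpec f S) W (β l) * T.pr W (c l) = 0 → c = 0) ∧
    ∀ a : Γ(XBase f S, W), ∃ c : κ → Γ(X, T.i ⁻¹ᵁ W),
      a = ∑ l, scalar (toSpec f S) W (β l) * T.pr W (c l) := by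
  let _ : Algebra k Γ(X, T.i ⁻¹ᵁ W) := (scalar f (T.i ⁻¹ᵁ W)).toAlgebra
  let _ : Algebra Γ(X, T.i ⁻¹ᵁ W) Γ(XBase f S, W) := (T.pr W).toAlgebra
  let _ : Algebra S Γ(XBase f S, W) := (scalar (toSpec f S) W).toAlgebra
  let _ : Algebra k Γ(XBase f S, W) := ((scalar (toSpec f S) W).comp (algebraMap k S)).toAlgebra
  have : IsScalarTower k S Γ(XBase f S, W) := IsScalarTower.of_algebraMap_eq fun _ => rfl
  have : IsScalarTower k Γ(X, T.i ⁻¹ᵁ W) Γ(XBase f S, W) :=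
    IsScalarTower.of_algebraMap_eq fun c => T.scalar_algebraMap W c
  have hp : Algebra.IsPushout k Γ(X, T.i ⁻¹ᵁ W) S Γ(XBase f S, W) :=
    CommRingCat.isPushout_iff_isPushout.mp (T.isPushout_affine hW)
  let b := hp.out.basis β
  have hb : ∀ (c : κ → Γ(X, T.i ⁻¹ᵁ W)),
      ∑ l, scalar (toSpec f S) W (β l) * T.pr W (c l) = ∑ l, c l • b l := fun c => by
    refine Finset.sum_congr rfl fun l _ => ?_
    rw [Algebra.smul_def, mul_comm, IsBaseChange.basis_apply]
    rfl
  refine ⟨fun c hc => ?_, fun a => ⟨fun l => b.repr a l, ?_⟩⟩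
  · rw [hb] at hc
    funext l
    exact Fintype.linearIndependent_iff.mp b.linearIndependent c hc l
  · rw [hb, b.sum_repr]

lemma exists_affine_le {W : (XBase f S).Opens} {x : X} (hx : x ∈ T.i ⁻¹ᵁ W) :
    ∃ W' : (XBase f S).Opens, IsAffineOpen W' ∧ W' ≤ W ∧ x ∈ T.i ⁻¹ᵁ W' := by
  obtain ⟨_, ⟨W', hW', rfl⟩, hx', hle⟩ :=
    (XBase f S).isBasis_affineOpens.exists_subset_of_mem_open (show T.i x ∈ (W : Set _) from hx) W.2
  exact ⟨W', hW', hle, hx'⟩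

lemma eq_zero_of_sum_eq_zero {W : (XBase f S).Opens} {c : κ → Γ(X, T.i ⁻¹ᵁ W)}
    (hc : ∑ l, scalar (toSpec f S) W (β l) * T.pr W (c l) = 0) : c = 0 := by
  funext l
  refine eq_of_locallyO fun x hx => ?_
  obtain ⟨W', hW', hle, hx'⟩ := T.exists_affine_le hx
  refine ⟨T.i ⁻¹ᵁ W', T.i.preimage_mono hle, hx', ?_⟩
  have h1 := congrArg (resO _ hle) hc
  simp only [map_sum, map_mul, resO_scalar', T.resO_pr, map_zero] at h1
  have h2 := congrFun ((T.exists_basis_affine β hW').1 _ h1) l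
  simpa using h2

lemma sum_injective {W : (XBase f S).Opens} {c c' : κ → Γ(X, T.i ⁻¹ᵁ W)}
    (hc : ∑ l, scalar (toSpec f S) W (β l) * T.pr W (c l) =
      ∑ l, scalar (toSpec f S) W (β l) * T.pr W (c' l)) : c = c' := by
  rw [← sub_eq_zero]
  refine T.eq_zero_of_sum_eq_zero β ?_
  simp only [Pi.sub_apply, map_sub, mul_sub, Finset.sum_sub_distrib, hc, sub_self]

/-- Functions on `X_S` are linear combinations of functions on `X`. -/
lemma exists_eq_sum (W : (XBase f S).Opens) (a : Γ(XBase f S, W)) :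
    ∃ c : κ → Γ(X, T.i ⁻¹ᵁ W), a = ∑ l, scalar (toSpec f S) W (β l) * T.pr W (c l) := by
  have h1 := fun (x : X) (hx : x ∈ T.i ⁻¹ᵁ W) => T.exists_affine_le hx
  choose W' hW' hle hx' using h1
  choose c hc using fun (x : X) (hx : x ∈ T.i ⁻¹ᵁ W) =>
    (T.exists_basis_affine β (hW' x hx)).2 (resO _ (hle x hx) a)
  -- The coordinates found on affine pieces agree on intersections, because coordinates are unique
  -- on every open set.
  have h2 := fun l => exists_glueO (fun x : T.i ⁻¹ᵁ W => T.i ⁻¹ᵁ (W' x.1 x.2)) (T.i ⁻¹ᵁ W)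
    (fun x => T.i.preimage_mono (hle x.1 x.2))
    (fun x hx => Opens.mem_iSup.mpr ⟨⟨x, hx⟩, hx' x hx⟩) (fun x => c x.1 x.2 l) (fun x x' => by
      have h3 := congrArg (resO _ (inf_le_left : W' x.1 x.2 ⊓ W' x'.1 x'.2 ≤ _)) (hc x.1 x.2)
      have h4 := congrArg (resO _ (inf_le_right : W' x.1 x.2 ⊓ W' x'.1 x'.2 ≤ _)) (hc x'.1 x'.2)
      rw [resO_resO] at h3 h4
      simp only [map_sum, map_mul, resO_scalar', T.resO_pr] at h3 h4
      exact congrFun (T.sum_injective β (h3.symm.trans h4)) l)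
  choose d hd using h2
  refine ⟨d, eq_of_locallyO fun z hz => ?_⟩
  have hz' : toX f S z ∈ T.i ⁻¹ᵁ W := by
    change T.i (toX f S z) ∈ W
    rwa [T.i_toX_apply]
  refine ⟨W' _ hz', hle _ hz', ?_, ?_⟩
  · have := hx' _ hz'
    change T.i (toX f S z) ∈ W' _ hz' at this
    rwa [T.i_toX_apply] at this
  · rw [hc]
    simp only [map_sum, map_mul, resO_scalar', T.resO_pr]
    refine Finset.sum_congr rfl fun l _ => ?_
    rw [hd l ⟨_, hz'⟩]

end Free

end Thick

end Thickening

/-! ## Trivializations of filtered symplectic bundles on thickenings -/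

/-- The kernel lies in the maximal ideal, which is the Jacobson radical and hence nilpotent. -/
lemma isNilpotent_ker_augmentation {k S : Type*} [Field k] [CommRing S] [IsLocalRing S]
    [IsArtinianRing S] [Algebra k S] (ε : S →ₐ[k] k) : IsNilpotent (RingHom.ker ε) := by
  obtain ⟨m, hm⟩ := IsArtinianRing.isNilpotent_jacobson_bot (R := S)
  refine ⟨m, ?_⟩
  rw [Ideal.zero_eq_bot, eq_bot_iff] at *
  refine (Ideal.pow_right_mono ?_ m).trans hm
  rw [IsLocalRing.jacobson_eq_maximalIdeal _ bot_ne_top]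
  exact IsLocalRing.le_maximalIdeal (RingHom.ker_ne_top _)

/-- A nilpotent version of Nakayama's lemma. -/
lemma eq_top_of_sub_mem_smul {R M : Type*} [CommRing R] [AddCommGroup M] [Module R M]
    (J : Ideal R) (hJ : IsNilpotent J) (N : Submodule R M)
    (h : ∀ s : M, ∃ t ∈ N, s - t ∈ J • (⊤ : Submodule R M)) : N = ⊤ := by
  have key : ∀ m : ℕ, N ⊔ J ^ m • (⊤ : Submodule R M) = ⊤ := by
    intro m
    induction m with
    | zero => simp
    | succ m ih =>
      refine top_le_iff.mp (ih.ge.trans (sup_le le_sup_left ?_))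
      rw [pow_succ, mul_smul]
      refine Submodule.smul_le.mpr fun a ha s _ => ?_
      obtain ⟨t, ht, hst⟩ := h s
      rw [show a • s = a • t + a • (s - t) by rw [← smul_add]; congr 1; abel]
      exact Submodule.add_mem_sup (N.smul_mem a ht) (Submodule.smul_mem_smul ha hst)
  obtain ⟨m, hm⟩ := hJ
  have := key m
  rwa [hm, Submodule.zero_eq_bot, Submodule.bot_smul, sup_bot_eq] at this

section Triv

variable {k : Type u} [Field k] {X : Scheme.{u}} {f : X ⟶ Spec (CommRingCat.of k)}
  {S : Type u} [CommRing S] [Algebra k S] (T : Thick f S) [IsLocalRing S] [IsArtinianRing S]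

namespace Thick

section Coord

variable {κ : Type*} [Fintype κ] (β : Module.Basis κ k S) (W : (XBase f S).Opens)

/-- The coordinates of a function on `X_S`. -/
def coord : Γ(XBase f S, W) →+ (κ → Γ(X, T.i ⁻¹ᵁ W)) :=
  AddMonoidHom.mk' (fun a => (T.exists_eq_sum β W a).choose) fun a b => by
    refine T.sum_injective β ?_
    rw [← (T.exists_eq_sum β W (a + b)).choose_spec]
    simp only [Pi.add_apply, map_add, mul_add, Finset.sum_add_distrib]
    rw [← (T.exists_eq_sum β W a).choose_spec, ← (T.exists_eq_sum β W b).choose_spec]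

lemma sum_coord (a : Γ(XBase f S, W)) :
    ∑ l, scalar (toSpec f S) W (β l) * T.pr W (T.coord β W a l) = a :=
  (T.exists_eq_sum β W a).choose_spec.symm

lemma coord_eq {a : Γ(XBase f S, W)} {c : κ → Γ(X, T.i ⁻¹ᵁ W)}
    (h : a = ∑ l, scalar (toSpec f S) W (β l) * T.pr W (c l)) : T.coord β W a = c :=
  T.sum_injective β (by rw [sum_coord, h])

lemma coord_pr_mul (c : Γ(X, T.i ⁻¹ᵁ W)) (a : Γ(XBase f S, W)) (l : κ) :
    T.coord β W (T.pr W c * a) l = c * T.coord β W a l := by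
  have : T.coord β W (T.pr W c * a) = fun l => c * T.coord β W a l := by
    refine T.coord_eq β W ?_
    nth_rw 1 [← T.sum_coord β W a]
    rw [Finset.mul_sum]
    refine Finset.sum_congr rfl fun l _ => ?_
    rw [map_mul]; ring
  rw [this]

lemma coord_scalar_mul_pr (b : S) (c : Γ(X, T.i ⁻¹ᵁ W)) (l : κ) :
    T.coord β W (scalar (toSpec f S) W b * T.pr W c) l = scalar f _ (β.repr b l) * c := by
  have : T.coord β W (scalar (toSpec f S) W b * T.pr W c) =
      fun l => scalar f _ (β.repr b l) * c := by
    refine T.coord_eq β W ?_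
    nth_rw 1 [← β.sum_repr b]
    rw [map_sum, Finset.sum_mul]
    refine Finset.sum_congr rfl fun l _ => ?_
    rw [Algebra.smul_def, map_mul, T.scalar_algebraMap, map_mul]; ring
  rw [this]

/-- Elements of `K · O` are combinations of fixed elements of `K`, with their coordinates as
coefficients. -/
lemma exists_coeff (K : Ideal S) : ∃ b : κ → S, (∀ l, b l ∈ K) ∧ ∀ (W : (XBase f S).Opens),
    ∀ a ∈ K.map (scalar (toSpec f S) W),
      ∑ l, scalar (toSpec f S) W (b l) * T.pr W (T.coord β W a l) = a := by
  -- `P` is a `k`-linear projection of `S` onto `K`, and the fixed elements of `K` are its values on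
  -- the basis.
  obtain ⟨P, hP⟩ := LinearMap.exists_leftInverse_of_injective (K.restrictScalars k).subtype
    (Submodule.ker_subtype _)
  have hP' : ∀ x ∈ K, (P x : S) = x := fun x hx => congrArg Subtype.val (LinearMap.congr_fun hP ⟨x, hx⟩)
  refine ⟨fun l => (P (β l)).1, fun l => (P (β l)).2, fun W a ha => ?_⟩
  let L : Γ(XBase f S, W) →+ Γ(XBase f S, W) :=
    { toFun := fun a => ∑ l, scalar (toSpec f S) W (P (β l)).1 * T.pr W (T.coord β W a l)
      map_zero' := by simp
      map_add' := fun a b => by simp [mul_add, Finset.sum_add_distrib] }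
  have hL : ∀ (x : S) (c), x ∈ K → L (scalar (toSpec f S) W x * T.pr W c) =
      scalar (toSpec f S) W x * T.pr W c := by
    intro x c hx
    change ∑ l, scalar (toSpec f S) W (P (β l)).1 * T.pr W (T.coord β W _ l) = _
    simp only [coord_scalar_mul_pr, map_mul, ← T.scalar_algebraMap, ← mul_assoc]
    simp only [← map_mul, ← Finset.sum_mul, ← map_sum]
    congr 2
    conv_rhs => rw [← hP' x hx, ← β.sum_repr x, map_sum]
    rw [Submodule.coe_sum]
    refine Finset.sum_congr rfl fun j _ => ?_
    rw [map_smul, Submodule.coe_smul, Algebra.smul_def, mul_comm]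
  -- The factor `c` is carried along so that the induction passes through multiplication by
  -- arbitrary functions on X_S.
  have key : ∀ c, L (c * a) = c * a := by
    refine Submodule.span_induction (p := fun a _ => ∀ c, L (c * a) = c * a) ?_ ?_ ?_ ?_ ha
    · rintro _ ⟨x, hx, rfl⟩ c
      rw [← T.sum_coord β W c, Finset.sum_mul, map_sum]
      refine Finset.sum_congr rfl fun l _ => ?_
      have := hL (β l * x) (T.coord β W c l) (K.mul_mem_left _ hx)
      rw [map_mul (scalar (toSpec f S) W), mul_right_comm] at this
      exact this
    · simp
    · intro a b _ _ h1 h2 c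
      rw [mul_add, map_add, h1, h2]
    · intro r a _ h c
      rw [smul_eq_mul, ← mul_assoc, h]
  have := key 1
  rwa [one_mul] at this

end Coord

/-- The ideal of the special fibre is generated by the augmentation ideal. -/
lemma ker_app_le (W : (XBase f S).Opens) :
    RingHom.ker (T.i.app W).hom ≤ (RingHom.ker T.ε).map (scalar (toSpec f S) W) := by
  intro a ha
  have := finite_of_augmentation T.ε
  let β := Module.finBasis k S
  rw [← T.sum_coord β W a]
  -- Restricted to the special fibre the expansion of `a` reads Σ ε(β_l) c_l = 0. Subtracting this
  -- from the expansion replaces β_l by β_l - ε(β_l), which lies in the augmentation ideal.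
  have h0 : ∑ l, T.pr W (scalar f _ (T.ε (β l)) * T.coord β W a l) = 0 := by
    rw [← map_sum]
    have := congrArg (T.i.app W).hom (T.sum_coord β W a)
    rw [RingHom.mem_ker.mp ha] at this
    simp only [map_sum, map_mul, app_scalar, app_pr] at this
    rw [this, map_zero]
  rw [← sub_zero (∑ l, _), ← h0, ← Finset.sum_sub_distrib]
  refine Ideal.sum_mem _ fun l _ => ?_
  rw [map_mul, ← T.scalar_algebraMap, ← sub_mul, ← map_sub]
  refine Ideal.mul_mem_right _ _ (Ideal.mem_map_of_mem _ ?_)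
  rw [RingHom.mem_ker, map_sub]
  simp

variable {r n : ℕ} {V : (XBase f S).Opens} {y : FilSymp (XBase f S) V r n} {x₀ : FilSymp X ⊤ r n}
  {W₀ : (XBase f S).Opens}

/-- A filtered map from the special fibre that is isometric modulo `K^m` can be corrected to one
that is isometric modulo `K^{m+1}`. -/
lemma exists_isometric_step [CharZero k] (hW₀ : IsAffineOpen W₀) (hV : W₀ ≤ V) (K : Ideal S)
    (m : ℕ) (hm : 1 ≤ m) (σ : Γ(x₀.E, T.i ⁻¹ᵁ W₀) →ₛₗ[T.pr W₀] Γ(y.E, W₀))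
    (hfil : ∀ i, ∀ s ∈ x₀.fil i _ le_top, σ s ∈ y.fil i W₀ hV)
    (hσ : ∀ s t, y.form W₀ hV (σ s) (σ t) - T.pr W₀ (x₀.form _ le_top s t) ∈
      (K ^ m).map (scalar (toSpec f S) W₀)) :
    ∃ σ' : Γ(x₀.E, T.i ⁻¹ᵁ W₀) →ₛₗ[T.pr W₀] Γ(y.E, W₀),
      (∀ i, ∀ s ∈ x₀.fil i _ le_top, σ' s ∈ y.fil i W₀ hV) ∧
      (∀ s t, y.form W₀ hV (σ' s) (σ' t) - T.pr W₀ (x₀.form _ le_top s t) ∈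
        (K ^ (m + 1)).map (scalar (toSpec f S) W₀)) ∧
      ∀ s, σ' s - σ s ∈ K.map (scalar (toSpec f S) W₀) • (⊤ : Submodule Γ(XBase f S, W₀) Γ(y.E, W₀)) := by
  have := finite_of_augmentation T.ε
  let β := Module.finBasis k S
  obtain ⟨b, hb, hbK⟩ := T.exists_coeff β (K ^ m)
  have hU := T.isAffineOpen_preimage hW₀
  -- The defect of `σ` from being an isometry; it is skew, and bilinear over functions on X.
  let D := fun s t => y.form W₀ hV (σ s) (σ t) - T.pr W₀ (x₀.form _ le_top s t)
  let half : Γ(X, T.i ⁻¹ᵁ W₀) := scalar f _ (2⁻¹ : k)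
  have hhalf : half + half = 1 := by
    rw [← map_add, ← two_mul, mul_inv_cancel₀ two_ne_zero, map_one]
  have hDsymm : ∀ s t, D t s = - D s t := by
    intro s t
    have h1 : ∀ a b, y.form W₀ hV a b = - y.form W₀ hV b a := fun a b =>
      (LinearMap.IsAlt.neg (B := y.form W₀ hV) (y.form_alt W₀ hV) b a).symm
    have h2 : ∀ a b, x₀.form _ le_top a b = - x₀.form _ le_top b a := fun a b =>
      (LinearMap.IsAlt.neg (B := x₀.form (T.i ⁻¹ᵁ W₀) le_top) (x₀.form_alt _ le_top) b a).symm
    simp only [D]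
    rw [h1, h2, map_neg]; ring
  have hDadd : ∀ s t t', D s (t + t') = D s t + D s t' := by
    intro s t t'
    simp only [D]
    rw [map_add σ, map_add (y.form W₀ hV (σ s)), map_add (x₀.form _ le_top s), map_add (T.pr W₀)]
    ring
  have hDsmul : ∀ c s t, D s (c • t) = T.pr W₀ c * D s t := by
    intro c s t
    simp only [D]
    rw [map_smulₛₗ σ, map_smul (y.form W₀ hV (σ s)), map_smul (x₀.form _ le_top s), smul_eq_mul,
      smul_eq_mul, map_mul (T.pr W₀), mul_sub]
  have hDadd' : ∀ s s' t, D (s + s') t = D s t + D s' t := by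
    intro s s' t
    rw [hDsymm t, hDadd, hDsymm t s, hDsymm t s']; ring
  have hDsmul' : ∀ c s t, D (c • s) t = T.pr W₀ c * D s t := by
    intro c s t
    rw [hDsymm t, hDsmul, hDsymm t s]; ring
  let l : Fin _ → Γ(x₀.E, T.i ⁻¹ᵁ W₀) → (Γ(x₀.E, T.i ⁻¹ᵁ W₀) →ₗ[Γ(X, T.i ⁻¹ᵁ W₀)] Γ(X, T.i ⁻¹ᵁ W₀)) :=
    fun j s =>
      { toFun := fun t => half * T.coord β W₀ (D s t) j
        map_add' := fun t t' => by
          rw [hDadd, map_add, Pi.add_apply, mul_add]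
        map_smul' := fun c t => by
          rw [hDsmul, coord_pr_mul, RingHom.id_apply, smul_eq_mul]; ring }
  -- The form on E₀ turns half of the j-th coordinate of the defect into an endomorphism; the
  -- corrected map is σ - Σ b_j σΨ_j.
  choose ψ hψ using fun j s => x₀.exists_form_eq hU le_top (l j s)
  have hext : ∀ s s' : Γ(x₀.E, T.i ⁻¹ᵁ W₀), (∀ t, x₀.form _ le_top s t = x₀.form _ le_top s' t) →
      s = s' := by
    intro s s' h
    rw [← sub_eq_zero]
    refine x₀.eq_zero_of_form_eq_zero hU le_top _ fun t => ?_
    rw [map_sub, LinearMap.sub_apply, h, sub_self]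
  let Ψ : Fin _ → (Γ(x₀.E, T.i ⁻¹ᵁ W₀) →ₗ[Γ(X, T.i ⁻¹ᵁ W₀)] Γ(x₀.E, T.i ⁻¹ᵁ W₀)) := fun j =>
    { toFun := ψ j
      map_add' := fun s s' => hext _ _ fun t => by
        rw [map_add, LinearMap.add_apply, hψ, hψ, hψ]
        change half * _ = half * _ + half * _
        rw [hDadd', map_add, Pi.add_apply, mul_add]
      map_smul' := fun c s => hext _ _ fun t => by
        rw [map_smul, LinearMap.smul_apply, hψ, hψ]
        change half * _ = c • (half * _)
        rw [hDsmul', coord_pr_mul, smul_eq_mul]; ring }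
  have hΨ : ∀ j s t, x₀.form _ le_top (Ψ j s) t = half * T.coord β W₀ (D s t) j := fun j s t => hψ j s t
  have hΨ' : ∀ j s t, x₀.form _ le_top s (Ψ j t) = half * T.coord β W₀ (D s t) j := by
    intro j s t
    rw [← LinearMap.IsAlt.neg (B := x₀.form (T.i ⁻¹ᵁ W₀) le_top) (x₀.form_alt _ le_top), hΨ,
      hDsymm s t, map_neg, Pi.neg_apply]
    ring
  -- Both forms vanish on F^i × F^{-1-i}, so the defect does as well. Since F^i is the orthogonal of
  -- F^{-1-i}, it is preserved by `Ψ j`.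
  have hΨfil : ∀ j i, ∀ s ∈ x₀.fil i _ le_top, Ψ j s ∈ x₀.fil i _ le_top := by
    intro j i s hs
    have h1 : Ψ j s ∈ x₀.fil (-1 - (-1 - i)) _ le_top := by
      refine x₀.mem_fil_of_form_eq_zero hU le_top _ _ fun t ht => ?_
      have h2 : D s t = 0 := by
        have e1 : -1 - (-1 - i) = i := by ring
        have h3 := (x₀.fil_perp (-1 - i) _ le_top s).mp (by rw [e1]; exact hs) _ le_rfl t ht
        have h4 := (y.fil_perp (-1 - i) _ hV (σ s)).mp (by rw [e1]; exact hfil i s hs) _ le_rfl _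
          (hfil _ t ht)
        rw [res_self] at h3 h4
        simp only [D]
        rw [h3, h4, map_zero, sub_zero]
      rw [hΨ, h2, map_zero, Pi.zero_apply, mul_zero]
    rwa [show -1 - (-1 - i) = i by ring] at h1
  let sc := scalar (toSpec f S) W₀
  let δ : Γ(x₀.E, T.i ⁻¹ᵁ W₀) →ₛₗ[T.pr W₀] Γ(y.E, W₀) := ∑ j, sc (b j) • σ.comp (Ψ j)
  have hδ : ∀ s, δ s = ∑ j, sc (b j) • σ (Ψ j s) := fun s => by
    simp [δ, LinearMap.sum_apply]
  have hmem : ∀ j, sc (b j) ∈ (K ^ m).map sc := fun j => Ideal.mem_map_of_mem _ (hb j)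
  have hle : (K ^ m).map sc ≤ K.map sc := Ideal.map_mono (Ideal.pow_le_self (by omega))
  -- By `1 ≤ m` one has 2m ≥ m + 1, so products of two quantities of order m may be neglected.
  have hmul : ∀ j a, a ∈ (K ^ m).map sc → sc (b j) * a ∈ (K ^ (m + 1)).map sc := by
    intro j a ha
    have h1 : (K ^ m).map sc * (K ^ m).map sc ≤ (K ^ (m + 1)).map sc := by
      rw [← Ideal.map_mul, ← pow_add]
      exact Ideal.map_mono (Ideal.pow_le_pow_right (by omega))
    exact h1 (Ideal.mul_mem_mul (hmem j) ha)
  refine ⟨σ - δ, fun i s hs => ?_, fun s t => ?_, fun s => ?_⟩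
  · rw [LinearMap.sub_apply, hδ]
    exact sub_mem (hfil i s hs) (Submodule.sum_mem _ fun j _ =>
      Submodule.smul_mem _ _ (hfil i _ (hΨfil j i s hs)))
  · have e1 : ∀ s t, y.form W₀ hV (σ s) (σ t) = D s t + T.pr W₀ (x₀.form _ le_top s t) :=
      fun s t => by simp only [D]; ring
    have hDK : ∀ s t, D s t = ∑ j, sc (b j) * T.pr W₀ (T.coord β W₀ (D s t) j) := fun s t =>
      (hbK W₀ _ (hσ s t)).symm
    have e2 : y.form W₀ hV (δ s) (σ t) = ∑ j, sc (b j) * D (Ψ j s) t +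
        ∑ j, sc (b j) * T.pr W₀ (half * T.coord β W₀ (D s t) j) := by
      rw [hδ, map_sum, LinearMap.sum_apply, ← Finset.sum_add_distrib]
      refine Finset.sum_congr rfl fun j _ => ?_
      rw [map_smul, LinearMap.smul_apply, smul_eq_mul, e1, hΨ, mul_add]
    have e3 : y.form W₀ hV (σ s) (δ t) = ∑ j, sc (b j) * D s (Ψ j t) +
        ∑ j, sc (b j) * T.pr W₀ (half * T.coord β W₀ (D s t) j) := by
      rw [hδ, map_sum, ← Finset.sum_add_distrib]
      refine Finset.sum_congr rfl fun j _ => ?_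
      rw [map_smul, smul_eq_mul, e1, hΨ', mul_add]
    have e4 : y.form W₀ hV (δ s) (δ t) = ∑ j, sc (b j) * y.form W₀ hV (σ (Ψ j s)) (δ t) := by
      rw [hδ s, map_sum, LinearMap.sum_apply]
      exact Finset.sum_congr rfl fun j _ => by rw [map_smul, LinearMap.smul_apply, smul_eq_mul]
    -- To first order the correction enters once in each argument, and the two halves make up the
    -- whole defect.
    have e5 : D s t = ∑ j, sc (b j) * T.pr W₀ (half * T.coord β W₀ (D s t) j) +
        ∑ j, sc (b j) * T.pr W₀ (half * T.coord β W₀ (D s t) j) := by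
      conv_lhs => rw [hDK]
      rw [← Finset.sum_add_distrib]
      refine Finset.sum_congr rfl fun j _ => ?_
      rw [← mul_add, ← map_add, ← add_mul, hhalf, one_mul]
    have e6 : y.form W₀ hV ((σ - δ) s) ((σ - δ) t) - T.pr W₀ (x₀.form _ le_top s t) =
        y.form W₀ hV (δ s) (δ t) - ∑ j, sc (b j) * D (Ψ j s) t - ∑ j, sc (b j) * D s (Ψ j t) := by
      simp only [LinearMap.sub_apply, map_sub]
      rw [e2, e3, e1]
      linear_combination e5
    rw [e6]
    refine Ideal.sub_mem _ (Ideal.sub_mem _ ?_ (Ideal.sum_mem _ fun j _ => hmul j _ (hσ _ _)))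
      (Ideal.sum_mem _ fun j _ => hmul j _ (hσ _ _))
    rw [e4]
    refine Ideal.sum_mem _ fun j _ => hmul j _ ?_
    rw [hδ, map_sum]
    refine Ideal.sum_mem _ fun j' _ => ?_
    rw [map_smul, smul_eq_mul]
    exact Ideal.mul_mem_right _ _ (hmem j')
  · rw [LinearMap.sub_apply, sub_sub_cancel_left, hδ]
    exact Submodule.neg_mem _ (Submodule.sum_mem _ fun j _ =>
      Submodule.smul_mem_smul (hle (hmem j)) trivial)

/-- The improvement step is iterated, starting from K^1, until a power of the nilpotent ideal
vanishes. -/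
lemma exists_isometric [CharZero k] (hW₀ : IsAffineOpen W₀) (hV : W₀ ≤ V) (K : Ideal S)
    (hK : IsNilpotent K) (σ : Γ(x₀.E, T.i ⁻¹ᵁ W₀) →ₛₗ[T.pr W₀] Γ(y.E, W₀))
    (hfil : ∀ i, ∀ s ∈ x₀.fil i _ le_top, σ s ∈ y.fil i W₀ hV)
    (hσ : ∀ s t, y.form W₀ hV (σ s) (σ t) - T.pr W₀ (x₀.form _ le_top s t) ∈
      K.map (scalar (toSpec f S) W₀)) :
    ∃ σ' : Γ(x₀.E, T.i ⁻¹ᵁ W₀) →ₛₗ[T.pr W₀] Γ(y.E, W₀),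
      (∀ i, ∀ s ∈ x₀.fil i _ le_top, σ' s ∈ y.fil i W₀ hV) ∧
      (∀ s t, y.form W₀ hV (σ' s) (σ' t) = T.pr W₀ (x₀.form _ le_top s t)) ∧
      ∀ s, σ' s - σ s ∈ K.map (scalar (toSpec f S) W₀) • (⊤ : Submodule Γ(XBase f S, W₀) Γ(y.E, W₀)) := by
  have key : ∀ m : ℕ, ∃ σ' : Γ(x₀.E, T.i ⁻¹ᵁ W₀) →ₛₗ[T.pr W₀] Γ(y.E, W₀),
      (∀ i, ∀ s ∈ x₀.fil i _ le_top, σ' s ∈ y.fil i W₀ hV) ∧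
      (∀ s t, y.form W₀ hV (σ' s) (σ' t) - T.pr W₀ (x₀.form _ le_top s t) ∈
        (K ^ (m + 1)).map (scalar (toSpec f S) W₀)) ∧
      ∀ s, σ' s - σ s ∈ K.map (scalar (toSpec f S) W₀) • (⊤ : Submodule Γ(XBase f S, W₀) Γ(y.E, W₀)) := by
    intro m
    induction m with
    | zero => exact ⟨σ, hfil, by simpa using hσ, fun s => by simp⟩
    | succ m ih =>
      obtain ⟨σ₁, h1, h2, h3⟩ := ih
      obtain ⟨σ₂, g1, g2, g3⟩ := T.exists_isometric_step hW₀ hV K (m + 1) (by omega) σ₁ h1 h2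
      refine ⟨σ₂, g1, g2, fun s => ?_⟩
      rw [← sub_add_sub_cancel]
      exact add_mem (g3 s) (h3 s)
  obtain ⟨m, hm⟩ := hK
  obtain ⟨σ', h1, h2, h3⟩ := key m
  refine ⟨σ', h1, fun s t => ?_, h3⟩
  have := h2 s t
  rw [pow_succ, hm, zero_mul, Ideal.zero_eq_bot, Ideal.map_bot, Ideal.mem_bot, sub_eq_zero] at this
  exact this

end Thick

end Triv

/-! ### Reductions of filtered symplectic bundles -/

section FilRed

/-- The part of a reduction that does not involve `θ`. -/
structure FilRed {Y Y' : Scheme.{u}} {r n : ℕ} (i : Y ⟶ Y') {V : Y'.Opens}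
    (y : FilSymp Y' V r n) (x : FilSymp Y ⊤ r n) where
  /-- the map on sections -/
  red : ∀ W : Y'.Opens, W ≤ V → (Γ(y.E, W) →+ Γ(x.E, i ⁻¹ᵁ W))
  red_smul : ∀ (W : Y'.Opens) (h : W ≤ V) (a : Γ(Y', W)) (s : Γ(y.E, W)),
    red W h (a • s) = (i.app W).hom a • red W h s
  red_res : ∀ (W W' : Y'.Opens) (h : W ≤ V) (h' : W' ≤ W) (s : Γ(y.E, W)),
    red W' (h'.trans h) (res y.E h' s) = res x.E (i.preimage_mono h') (red W h s)
  red_surj : ∀ (W : Y'.Opens) (h : W ≤ V), IsAffineOpen W → Function.Surjective (red W h)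
  red_ker : ∀ (W : Y'.Opens) (h : W ≤ V), IsAffineOpen W → ∀ s : Γ(y.E, W),
    red W h s = 0 ↔ s ∈ RingHom.ker (i.app W).hom • (⊤ : Submodule Γ(Y', W) Γ(y.E, W))
  red_form : ∀ (W : Y'.Opens) (h : W ≤ V) (s t : Γ(y.E, W)),
    (i.app W).hom (y.form W h s t) = x.form (i ⁻¹ᵁ W) le_top (red W h s) (red W h t)
  red_fil : ∀ (j : ℤ) (W : Y'.Opens) (h : W ≤ V), ∀ s ∈ y.fil j W h,
    red W h s ∈ x.fil j (i ⁻¹ᵁ W) le_top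
  red_fil_surj : ∀ (j : ℤ) (W : Y'.Opens) (h : W ≤ V), IsAffineOpen W →
    ∀ t ∈ x.fil j (i ⁻¹ᵁ W) le_top, ∃ s ∈ y.fil j W h, red W h s = t

/-- Forget the compatibility with `θ`. -/
def Reduction.toFilRed {Y Y' : Scheme.{u}} {r n : ℕ} {i : Y ⟶ Y'} {V : Y'.Opens}
    {y : NilBundle Y' V r n} {x : NilBundle Y ⊤ r n} (ρ : Reduction i y x) :
    FilRed i y.toFilSymp x.toFilSymp where
  red := ρ.red
  red_smul := ρ.red_smul
  red_res := ρ.red_res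
  red_surj := ρ.red_surj
  red_ker := ρ.red_ker
  red_form := ρ.red_form
  red_fil := ρ.red_fil
  red_fil_surj := ρ.red_fil_surj

/-- Add the compatibility with `θ`. -/
def FilRed.toReduction {Y Y' : Scheme.{u}} {r n : ℕ} {i : Y ⟶ Y'} {V : Y'.Opens}
    {y : NilBundle Y' V r n} {x : NilBundle Y ⊤ r n} (ρ : FilRed i y.toFilSymp x.toFilSymp)
    (h : ∀ (W : Y'.Opens) (h : W ≤ V) (s : Γ(y.E, W)),
      ρ.red W h (y.θ W h s) = x.θ (i ⁻¹ᵁ W) le_top (ρ.red W h s)) : Reduction i y x where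
  red := ρ.red
  red_smul := ρ.red_smul
  red_res := ρ.red_res
  red_surj := ρ.red_surj
  red_ker := ρ.red_ker
  red_form := ρ.red_form
  red_θ := h
  red_fil := ρ.red_fil
  red_fil_surj := ρ.red_fil_surj

end FilRed

/-! ### Trivializations as semilinear maps on sections of E₀ -/

section Triv

variable {k : Type u} [Field k] {X : Scheme.{u}} {f : X ⟶ Spec (CommRingCat.of k)}
  {S : Type u} [CommRing S] [Algebra k S] (T : Thick f S) [IsLocalRing S] [IsArtinianRing S]
  {r n : ℕ} {V V₀ : (XBase f S).Opens}

/-- An isomorphism of `E₀ ⊗ S` with `y`, over `V₀`, as a map on sections of `E₀`. -/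
structure Triv (x₀ : FilSymp X ⊤ r n) (y : FilSymp (XBase f S) V r n) (hV : V₀ ≤ V) where
  /-- the map on sections -/
  σ : ∀ W : (XBase f S).Opens, W ≤ V₀ → (Γ(x₀.E, T.i ⁻¹ᵁ W) →ₛₗ[T.pr W] Γ(y.E, W))
  nat : ∀ (W W' : (XBase f S).Opens) (h : W ≤ V₀) (h' : W' ≤ W) (s : Γ(x₀.E, T.i ⁻¹ᵁ W)),
    res y.E h' (σ W h s) = σ W' (h'.trans h) (res x₀.E (T.i.preimage_mono h') s)
  form_eq : ∀ (W : (XBase f S).Opens) (h : W ≤ V₀) (s t : Γ(x₀.E, T.i ⁻¹ᵁ W)),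
    y.form W (h.trans hV) (σ W h s) (σ W h t) = T.pr W (x₀.form _ le_top s t)
  fil_mem : ∀ (j : ℤ) (W : (XBase f S).Opens) (h : W ≤ V₀), ∀ s ∈ x₀.fil j _ le_top,
    σ W h s ∈ y.fil j W (h.trans hV)
  span : ∀ (W : (XBase f S).Opens) (h : W ≤ V₀),
    Submodule.span Γ(XBase f S, W) (Set.range (σ W h)) = ⊤

namespace Thick

lemma exists_preimage_eq (U : X.Opens) : ∃ W : (XBase f S).Opens, T.i ⁻¹ᵁ W = U :=
  ⟨_, T.preimage_toX U⟩

lemma preimage_injective {W W' : (XBase f S).Opens} (h : T.i ⁻¹ᵁ W = T.i ⁻¹ᵁ W') : W = W' := by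
  rw [← T.toX_preimage W, h, T.toX_preimage]

variable {x₀ : FilSymp X ⊤ r n} {y : FilSymp (XBase f S) V r n}

lemma eq_zero_of_form {W : (XBase f S).Opens} (s : Γ(x₀.E, T.i ⁻¹ᵁ W))
    (h : ∀ (W' : (XBase f S).Opens) (h' : W' ≤ W) (t : Γ(x₀.E, T.i ⁻¹ᵁ W')),
      x₀.form _ le_top (res x₀.E (T.i.preimage_mono h') s) t = 0) : s = 0 := by
  obtain ⟨s₀, -, hu⟩ := x₀.form_nondeg (T.i ⁻¹ᵁ W) le_top (fun _ _ => 0) (fun _ _ _ _ _ => by simp)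
  rw [hu s, ← hu 0]
  · intro W' h' t; simp
  · intro W' h' t
    obtain ⟨W', rfl⟩ := T.exists_preimage_eq W'
    exact (h W' (T.le_of_preimage_le h') t).symm

lemma mem_fil_of_form {W : (XBase f S).Opens} (i : ℤ) (s : Γ(x₀.E, T.i ⁻¹ᵁ W))
    (h : ∀ (W' : (XBase f S).Opens) (h' : W' ≤ W), ∀ t ∈ x₀.fil (-1 - i) (T.i ⁻¹ᵁ W') le_top,
      x₀.form _ le_top (res x₀.E (T.i.preimage_mono h') s) t = 0) : s ∈ x₀.fil i _ le_top := by
  have h1 : s ∈ x₀.fil (-1 - (-1 - i)) _ le_top := by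
    rw [x₀.fil_perp]
    intro W' h' t ht
    obtain ⟨W', rfl⟩ := T.exists_preimage_eq W'
    exact h W' (T.le_of_preimage_le h') t ht
  rwa [show -1 - (-1 - i) = i by ring] at h1

lemma form_eq_zero_of_mem_fil {Y : Scheme.{u}} {V W : Y.Opens} {y : FilSymp Y V r n}
    (h : W ≤ V) (i : ℤ) {s t : Γ(y.E, W)} (hs : s ∈ y.fil i W h) (ht : t ∈ y.fil (-1 - i) W h) :
    y.form W h s t = 0 := by
  have := (y.fil_perp (-1 - i) W h s).mp (by rwa [show -1 - (-1 - i) = i by ring]) W le_rfl t ht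
  rwa [res_self] at this

lemma exists_smul_eq {N : ∀ W : X.Opens, W ≤ ⊤ → Submodule Γ(X, W) Γ(x₀.E, W)}
    (hN : LocFree x₀.E ⊤ N) {W₀ W : (XBase f S).Opens} (hW₀ : IsAffineOpen W₀) (hW : W ≤ W₀)
    {s : Γ(x₀.E, T.i ⁻¹ᵁ W)} (hs : s ∈ N _ le_top) {z : XBase f S} (hz : z ∈ W) :
    ∃ (W' : (XBase f S).Opens) (h' : W' ≤ W) (a : Γ(X, T.i ⁻¹ᵁ W₀)), z ∈ W' ∧
      IsUnit (resO X (T.i.preimage_mono (h'.trans hW)) a) ∧ ∃ t ∈ N (T.i ⁻¹ᵁ W₀) le_top,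
        res x₀.E (T.i.preimage_mono (h'.trans hW)) t =
          resO X (T.i.preimage_mono (h'.trans hW)) a • res x₀.E (T.i.preimage_mono h') s := by
  have hx : toX f S z ∈ T.i ⁻¹ᵁ W := by
    change T.i (toX f S z) ∈ W
    rwa [T.i_toX_apply]
  obtain ⟨W', h', a, hx', -, ha, t, ht, e⟩ := hN.exists_smul_eq (T.isAffineOpen_preimage hW₀) le_top
    (T.i.preimage_mono hW) hs hx
  obtain ⟨W', rfl⟩ := T.exists_preimage_eq W'
  refine ⟨W', T.le_of_preimage_le h', a, ?_, ha, t, ht, e⟩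
  change T.i (toX f S z) ∈ W' at hx'
  rwa [T.i_toX_apply] at hx'

/-- Natural maps from sections of `E₀` are determined by their values on an affine open. -/
lemma ext_of_affine {Y' : Scheme.{u}} (g : Y' ⟶ XBase f S) (N : Y'.Modules)
    {W₀ : (XBase f S).Opens} (hW₀ : IsAffineOpen W₀)
    (p p' : ∀ W : (XBase f S).Opens, W ≤ W₀ → (Γ(x₀.E, T.i ⁻¹ᵁ W) → Γ(N, g ⁻¹ᵁ W)))
    (hp : ∀ W h a s, p W h (a • s) = (g.app W).hom (T.pr W a) • p W h s)
    (hp' : ∀ W h a s, p' W h (a • s) = (g.app W).hom (T.pr W a) • p' W h s)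
    (np : ∀ W W' h (h' : W' ≤ W) s, res N (g.preimage_mono h') (p W h s) =
      p W' (h'.trans h) (res x₀.E (T.i.preimage_mono h') s))
    (np' : ∀ W W' h (h' : W' ≤ W) s, res N (g.preimage_mono h') (p' W h s) =
      p' W' (h'.trans h) (res x₀.E (T.i.preimage_mono h') s))
    (h₀ : ∀ s, p W₀ le_rfl s = p' W₀ le_rfl s) (W h s) : p W h s = p' W h s := by
  refine eq_of_locally fun z hz => ?_
  obtain ⟨W', h', a, hz', ha, t, -, e⟩ := T.exists_smul_eq x₀.locFree hW₀ h (s := s) trivial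
    (z := g z) hz
  refine ⟨g ⁻¹ᵁ W', g.preimage_mono h', hz', ?_⟩
  have hu := (ha.map (T.pr W')).map (g.app W').hom
  rw [np _ _ _ h', np' _ _ _ h', ← hu.smul_left_cancel, ← hp, ← hp', ← e,
    ← np W₀ W' le_rfl (h'.trans h), ← np' W₀ W' le_rfl (h'.trans h), h₀]

/-- Extension of a map on sections over an affine open to the smaller open sets. -/
lemma exists_family {N : (XBase f S).Modules} {W₀ : (XBase f S).Opens} (hW₀ : IsAffineOpen W₀)
    (σ₀ : Γ(x₀.E, T.i ⁻¹ᵁ W₀) →ₛₗ[T.pr W₀] Γ(N, W₀)) :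
    ∃ σ : ∀ W : (XBase f S).Opens, W ≤ W₀ → (Γ(x₀.E, T.i ⁻¹ᵁ W) →ₛₗ[T.pr W] Γ(N, W)),
      (∀ (W W' : (XBase f S).Opens) (h : W ≤ W₀) (h' : W' ≤ W) (s : Γ(x₀.E, T.i ⁻¹ᵁ W)),
        res N h' (σ W h s) = σ W' (h'.trans h) (res x₀.E (T.i.preimage_mono h') s)) ∧
      ∀ s, σ W₀ le_rfl s = σ₀ s := by
  -- Pushed forward to X the semilinear map becomes linear, and `exists_extension` applies.
  let P : X.Modules := (Scheme.Modules.pushforward (toX f S)).obj N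
  have hpr' : ∀ (W : (XBase f S).Opens) (a : Γ(X, T.i ⁻¹ᵁ W)),
      T.pr W a = resO _ (T.toX_preimage W).ge (((toX f S).app _).hom a) := fun W a => rfl
  have hpr : ∀ (W W' : (XBase f S).Opens) (h : W' = toX f S ⁻¹ᵁ (T.i ⁻¹ᵁ W)) (h' : W' ≤ W)
      (a : Γ(X, T.i ⁻¹ᵁ W)), resO _ h' (T.pr W a) = resO _ h.le (((toX f S).app _).hom a) := by
    intro W W' h h' a
    rw [hpr', resO_resO]
  let L : Γ(x₀.E, T.i ⁻¹ᵁ W₀) →ₗ[Γ(X, T.i ⁻¹ᵁ W₀)] Γ(P, T.i ⁻¹ᵁ W₀) :=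
    { toFun := fun s => res N (T.toX_preimage W₀).le (σ₀ s)
      map_add' := fun s t => by rw [map_add, map_add]; rfl
      map_smul' := fun a s => by
        rw [map_smulₛₗ, res_smul, hpr W₀ _ rfl, resO_self]; rfl }
  obtain ⟨φ, hφ, hφL⟩ := exists_extension (x₀.locFree.restrict le_top)
    (T.isAffineOpen_preimage hW₀) L
  refine ⟨fun W h =>
    { toFun := fun s => res N (T.toX_preimage W).ge (φ _ (T.i.preimage_mono h) s)
      map_add' := fun s t => by rw [map_add]; exact map_add (res N _) _ _
      map_smul' := fun a s => by
        rw [map_smul, hpr']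
        exact res_smul N _ (((toX f S).app _).hom a) _ }, ?_, ?_⟩
  · intro W W' h h' s
    have e := hφ _ _ (T.i.preimage_mono h) (T.i.preimage_mono h') s
    exact ((res_res N _ h' _).trans (res_res N ((toX f S).preimage_mono (T.i.preimage_mono h'))
      (T.toX_preimage W').ge _).symm).trans (congrArg (res N (T.toX_preimage W').ge) e)
  · intro s
    have e := LinearMap.congr_fun hφL s
    refine (congrArg (res N (T.toX_preimage W₀).ge) e).trans ?_
    exact (res_res N (T.toX_preimage W₀).le (T.toX_preimage W₀).ge _).trans (res_self N _ _)

end Thick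

namespace Triv

variable {T} {x₀ : FilSymp X ⊤ r n} {y : FilSymp (XBase f S) V r n} {hV : V₀ ≤ V}

section Coord

variable {κ : Type*} [Fintype κ] (β : Module.Basis κ k S)

/-- Pairing with σ t gives Σ β_l Q(c_l, t) = 0, so every c_l is orthogonal to all sections. A bare
family is assumed instead of a `Triv` because the spanning property of the latter is itself proved
with this uniqueness. -/
lemma eq_zero_of_sum_aux
    (σ : ∀ W : (XBase f S).Opens, W ≤ V₀ → (Γ(x₀.E, T.i ⁻¹ᵁ W) →ₛₗ[T.pr W] Γ(y.E, W)))
    (nat : ∀ (W W' : (XBase f S).Opens) (h : W ≤ V₀) (h' : W' ≤ W) (s : Γ(x₀.E, T.i ⁻¹ᵁ W)),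
      res y.E h' (σ W h s) = σ W' (h'.trans h) (res x₀.E (T.i.preimage_mono h') s))
    (form_eq : ∀ (W : (XBase f S).Opens) (h : W ≤ V₀) (s t : Γ(x₀.E, T.i ⁻¹ᵁ W)),
      y.form W (h.trans hV) (σ W h s) (σ W h t) = T.pr W (x₀.form _ le_top s t))
    {W : (XBase f S).Opens} (h : W ≤ V₀) {c : κ → Γ(x₀.E, T.i ⁻¹ᵁ W)}
    (hc : ∑ l, scalar (toSpec f S) W (β l) • σ W h (c l) = 0) : c = 0 := by
  funext l
  refine T.eq_zero_of_form _ fun W' h' t => ?_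
  have h1 := congrArg (fun s => y.form W' ((h'.trans h).trans hV) (res y.E h' s)
    (σ W' (h'.trans h) t)) hc
  simp only [map_sum, res_smul, resO_scalar', nat, map_smul, LinearMap.sum_apply,
    LinearMap.smul_apply, form_eq, map_zero, LinearMap.zero_apply, smul_eq_mul] at h1
  exact congrFun (T.eq_zero_of_sum_eq_zero β h1) l

end Coord

end Triv

end Triv

/-! ### Coordinates in a trivialization, and existence of trivializations -/

section Triv

variable {k : Type u} [Field k] {X : Scheme.{u}} {f : X ⟶ Spec (CommRingCat.of k)}
  {S : Type u} [CommRing S] [Algebra k S] {T : Thick f S} [IsLocalRing S] [IsArtinianRing S]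
  {r n : ℕ} {V V₀ : (XBase f S).Opens}
  {x₀ : FilSymp X ⊤ r n} {y : FilSymp (XBase f S) V r n} {hV : V₀ ≤ V}

namespace Triv

section Coord

variable {κ : Type*} [Fintype κ] (β : Module.Basis κ k S)

/-- A multiplier from the functions on X_S is carried through the induction and expanded in the
basis, which turns arbitrary coefficients of a span into basis elements. -/
lemma exists_eq_sum_of_mem_span {W : (XBase f S).Opens}
    (σ : Γ(x₀.E, T.i ⁻¹ᵁ W) →ₛₗ[T.pr W] Γ(y.E, W)) {s : Γ(y.E, W)}
    (hs : s ∈ Submodule.span Γ(XBase f S, W) (Set.range σ)) :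
    ∃ c : κ → Γ(x₀.E, T.i ⁻¹ᵁ W), s = ∑ l, scalar (toSpec f S) W (β l) • σ (c l) := by
  refine Submodule.span_induction (p := fun s _ => ∀ a : Γ(XBase f S, W),
    ∃ c : κ → Γ(x₀.E, T.i ⁻¹ᵁ W), a • s = ∑ l, scalar (toSpec f S) W (β l) • σ (c l))
    ?_ ?_ ?_ ?_ hs 1 |>.imp fun c hc => by rwa [one_smul] at hc
  · rintro _ ⟨t, rfl⟩ a
    refine ⟨fun l => T.coord β W a l • t, ?_⟩
    conv_lhs => rw [← T.sum_coord β W a, Finset.sum_smul]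
    exact Finset.sum_congr rfl fun l _ => by rw [mul_smul, map_smulₛₗ]
  · intro a
    exact ⟨0, by simp⟩
  · intro s t _ _ h1 h2 a
    obtain ⟨c, hc⟩ := h1 a
    obtain ⟨d, hd⟩ := h2 a
    exact ⟨c + d, by simp [smul_add, hc, hd, Finset.sum_add_distrib]⟩
  · intro b s _ h1 a
    rw [smul_smul]
    exact h1 _

variable (τ : Triv T x₀ y hV) {W : (XBase f S).Opens} (h : W ≤ V₀)

lemma sum_injective {c c' : κ → Γ(x₀.E, T.i ⁻¹ᵁ W)}
    (hc : ∑ l, scalar (toSpec f S) W (β l) • τ.σ W h (c l) =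
      ∑ l, scalar (toSpec f S) W (β l) • τ.σ W h (c' l)) : c = c' := by
  rw [← sub_eq_zero]
  refine eq_zero_of_sum_aux (hV := hV) β τ.σ τ.nat τ.form_eq h ?_
  simp only [Pi.sub_apply, map_sub, smul_sub, Finset.sum_sub_distrib, hc, sub_self]

lemma exists_eq_sum (s : Γ(y.E, W)) : ∃ c : κ → Γ(x₀.E, T.i ⁻¹ᵁ W),
    s = ∑ l, scalar (toSpec f S) W (β l) • τ.σ W h (c l) :=
  exists_eq_sum_of_mem_span β _ (by rw [τ.span]; trivial)

/-- The coordinates of a section. -/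
def coord : Γ(y.E, W) →+ (κ → Γ(x₀.E, T.i ⁻¹ᵁ W)) :=
  AddMonoidHom.mk' (fun s => (τ.exists_eq_sum β h s).choose) fun s t => by
    refine τ.sum_injective β h ?_
    rw [← (τ.exists_eq_sum β h (s + t)).choose_spec]
    simp only [Pi.add_apply, map_add, smul_add, Finset.sum_add_distrib]
    rw [← (τ.exists_eq_sum β h s).choose_spec, ← (τ.exists_eq_sum β h t).choose_spec]

lemma sum_coord (s : Γ(y.E, W)) :
    ∑ l, scalar (toSpec f S) W (β l) • τ.σ W h (τ.coord β h s l) = s :=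
  (τ.exists_eq_sum β h s).choose_spec.symm

lemma coord_eq {s : Γ(y.E, W)} {c : κ → Γ(x₀.E, T.i ⁻¹ᵁ W)}
    (hs : s = ∑ l, scalar (toSpec f S) W (β l) • τ.σ W h (c l)) : τ.coord β h s = c :=
  τ.sum_injective β h (by rw [sum_coord, hs])

@[simp] lemma coord_sum (c : κ → Γ(x₀.E, T.i ⁻¹ᵁ W)) :
    τ.coord β h (∑ l, scalar (toSpec f S) W (β l) • τ.σ W h (c l)) = c :=
  τ.coord_eq β h rfl

lemma coord_pr_smul (a : Γ(X, T.i ⁻¹ᵁ W)) (s : Γ(y.E, W)) :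
    τ.coord β h (T.pr W a • s) = a • τ.coord β h s := by
  refine τ.coord_eq β h ?_
  nth_rw 1 [← τ.sum_coord β h s]
  rw [Finset.smul_sum]
  exact Finset.sum_congr rfl fun l _ => by rw [Pi.smul_apply, map_smulₛₗ, smul_comm]

lemma coord_res {W' : (XBase f S).Opens} (h' : W' ≤ W) (s : Γ(y.E, W)) (l : κ) :
    τ.coord β (h'.trans h) (res y.E h' s) l =
      res x₀.E (T.i.preimage_mono h') (τ.coord β h s l) := by
  have : τ.coord β (h'.trans h) (res y.E h' s) =
      fun l => res x₀.E (T.i.preimage_mono h') (τ.coord β h s l) := by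
    refine τ.coord_eq β _ ?_
    nth_rw 1 [← τ.sum_coord β h s]
    simp only [map_sum, res_smul, resO_scalar', τ.nat]
  rw [this]

/-- A section of F^i is orthogonal to the image of F^{-1-i}(E₀). Comparing coefficients, each
coordinate is orthogonal to F^{-1-i}(E₀) and so lies in F^i(E₀). -/
lemma mem_fil_iff (i : ℤ) (s : Γ(y.E, W)) :
    s ∈ y.fil i W (h.trans hV) ↔ ∀ l, τ.coord β h s l ∈ x₀.fil i _ le_top := by
  constructor
  · intro hs l
    refine T.mem_fil_of_form i _ fun W' h' t ht => ?_
    have h1 := Thick.form_eq_zero_of_mem_fil _ i (y.fil_res i W W' _ h' s hs)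
      (τ.fil_mem _ W' (h'.trans h) t ht)
    rw [← τ.sum_coord β (h'.trans h) (res y.E h' s)] at h1
    simp only [map_sum, map_smul, LinearMap.sum_apply, LinearMap.smul_apply, τ.form_eq,
      smul_eq_mul, coord_res _ _ h] at h1
    exact congrFun (T.eq_zero_of_sum_eq_zero β h1) l
  · intro hs
    rw [← τ.sum_coord β h s]
    exact Submodule.sum_mem _ fun l _ => Submodule.smul_mem _ _ (τ.fil_mem _ _ _ _ (hs l))

end Coord

end Triv

/-- Trivializations exist on affine opens, and lift those of the reduction. -/
theorem exists_triv [CharZero k] (T : Thick f S) (hV₀ : IsAffineOpen V₀) (hV : V₀ ≤ V)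
    {Y' : Scheme.{u}} (g : Y' ⟶ XBase f S) (x : FilSymp Y' ⊤ r n) (ρ : FilRed g y x)
    (K : Ideal S) (hK : IsNilpotent K)
    (hker : ∀ W, RingHom.ker (g.app W).hom = K.map (scalar (toSpec f S) W))
    (p : ∀ W : (XBase f S).Opens, W ≤ V₀ → (Γ(x₀.E, T.i ⁻¹ᵁ W) →+ Γ(x.E, g ⁻¹ᵁ W)))
    (p_smul : ∀ W h a s, p W h (a • s) = (g.app W).hom (T.pr W a) • p W h s)
    (p_nat : ∀ W W' h (h' : W' ≤ W) s, res x.E (g.preimage_mono h') (p W h s) =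
      p W' (h'.trans h) (res x₀.E (T.i.preimage_mono h') s))
    (p_form : ∀ W h s t, x.form _ le_top (p W h s) (p W h t) =
      (g.app W).hom (T.pr W (x₀.form _ le_top s t)))
    (p_fil : ∀ j W h, ∀ s ∈ x₀.fil j _ le_top, p W h s ∈ x.fil j _ le_top)
    (p_span : ∀ W h s, s ∈ Submodule.span Γ(Y', g ⁻¹ᵁ W) (Set.range (p W h)))
    (g_surj : ∀ W, IsAffineOpen W → Function.Surjective (g.app W).hom) :
    ∃ τ : Triv T x₀ y hV, ∀ W h s, ρ.red W (h.trans hV) (τ.σ W h s) = p W h s := by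
  have hU := T.isAffineOpen_preimage hV₀
  -- A filtered lift of `p`. All modules are regarded as modules over the functions on X, over which
  -- the sections of Gr of E₀ are projective.
  obtain ⟨σ₁, hσ₁, hσ₁fil⟩ : ∃ σ : Γ(x₀.E, T.i ⁻¹ᵁ V₀) →ₛₗ[T.pr V₀] Γ(y.E, V₀),
      (∀ s, ρ.red V₀ hV (σ s) = p V₀ le_rfl s) ∧
      ∀ i, ∀ s ∈ x₀.fil i _ le_top, σ s ∈ y.fil i V₀ hV := by
    let _ : Algebra Γ(X, T.i ⁻¹ᵁ V₀) Γ(XBase f S, V₀) := (T.pr V₀).toAlgebra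
    let _ : Algebra Γ(X, T.i ⁻¹ᵁ V₀) Γ(Y', g ⁻¹ᵁ V₀) := ((g.app V₀).hom.comp (T.pr V₀)).toAlgebra
    let _ : Module Γ(X, T.i ⁻¹ᵁ V₀) Γ(y.E, V₀) := Module.compHom _ (T.pr V₀)
    let _ : Module Γ(X, T.i ⁻¹ᵁ V₀) Γ(x.E, g ⁻¹ᵁ V₀) :=
      Module.compHom _ ((g.app V₀).hom.comp (T.pr V₀))
    have _ : IsScalarTower Γ(X, T.i ⁻¹ᵁ V₀) Γ(XBase f S, V₀) Γ(y.E, V₀) :=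
      ⟨fun a b s => mul_smul (T.pr V₀ a) b s⟩
    have _ : IsScalarTower Γ(X, T.i ⁻¹ᵁ V₀) Γ(Y', g ⁻¹ᵁ V₀) Γ(x.E, g ⁻¹ᵁ V₀) :=
      ⟨fun a b s => mul_smul ((g.app V₀).hom (T.pr V₀ a)) b s⟩
    obtain ⟨σ, h1, h2⟩ := exists_filtered_lift (R := Γ(X, T.i ⁻¹ᵁ V₀)) n
      (fun i => x₀.fil i (T.i ⁻¹ᵁ V₀) le_top)
      (fun i => (y.fil i V₀ hV).restrictScalars Γ(X, T.i ⁻¹ᵁ V₀))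
      (fun i => (x.fil i (g ⁻¹ᵁ V₀) le_top).restrictScalars Γ(X, T.i ⁻¹ᵁ V₀))
      (fun i => x₀.fil_mono i _ _) (fun i => y.fil_mono i _ _)
      (fun i hi => x₀.fil_bot i hi _ _) (fun i hi => x₀.fil_top i hi _ _)
      (fun i => x₀.gr_projective i hU le_top)
      { toFun := ρ.red V₀ hV
        map_add' := map_add _
        map_smul' := fun a s => ρ.red_smul V₀ hV (T.pr V₀ a) s }
      (fun i t ht => ρ.red_fil_surj i V₀ hV hV₀ t ht)
      { toFun := p V₀ le_rfl
        map_add' := map_add _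
        map_smul' := fun a s => p_smul V₀ le_rfl a s } (fun i s hs => p_fil i V₀ le_rfl s hs)
    exact ⟨{ toFun := σ, map_add' := map_add σ, map_smul' := fun a s => σ.map_smul a s }, h1, h2⟩
  -- Modulo `K` the lift is already an isometry, since its reduction `p` is one.
  obtain ⟨σ₀, hfil, hform, hdiff⟩ := T.exists_isometric hV₀ hV K hK σ₁ hσ₁fil (by
    intro s t
    rw [← hker, RingHom.mem_ker, map_sub, ρ.red_form, hσ₁, hσ₁, p_form, sub_self])
  -- The isometric correction changes values only by multiples of `K`, which the reduction kills.
  have hred₀ : ∀ s, ρ.red V₀ hV (σ₀ s) = p V₀ le_rfl s := by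
    intro s
    rw [← hσ₁, ← sub_eq_zero, ← map_sub, ρ.red_ker V₀ hV hV₀, hker]
    exact hdiff s
  obtain ⟨σ, σ_nat, σ_eq⟩ := T.exists_family hV₀ σ₀
  have hred : ∀ W h s, ρ.red W (h.trans hV) (σ W h s) = p W h s := by
    refine T.ext_of_affine g x.E hV₀ (fun W h s => ρ.red W (h.trans hV) (σ W h s))
      (fun W h s => p W h s) ?_ p_smul ?_ p_nat ?_
    · intro W h a s
      rw [map_smulₛₗ, ρ.red_smul]
    · intro W W' h h' s
      change res x.E _ (ρ.red W _ (σ W h s)) = ρ.red W' _ (σ W' _ _)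
      rw [← ρ.red_res W W' (h.trans hV) h', σ_nat]
    · intro s
      rw [σ_eq, hred₀]
  have σ_form : ∀ (W : (XBase f S).Opens) (h : W ≤ V₀) (s t : Γ(x₀.E, T.i ⁻¹ᵁ W)),
      y.form W (h.trans hV) (σ W h s) (σ W h t) = T.pr W (x₀.form _ le_top s t) := by
    intro W h s t
    -- Locally both sections are, up to units, restrictions of sections over `V₀`, where the
    -- identity is known.
    refine eq_of_locallyO fun z hz => ?_
    obtain ⟨W₁, h₁, a, hz₁, ha, s', -, es⟩ := T.exists_smul_eq x₀.locFree hV₀ h (s := s) trivial hz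
    obtain ⟨W₂, h₂, b, hz₂, hb, t', -, et⟩ := T.exists_smul_eq x₀.locFree hV₀ (h₁.trans h)
      (s := res x₀.E (T.i.preimage_mono h₁) t) trivial hz₁
    refine ⟨W₂, h₂.trans h₁, hz₂, ?_⟩
    have ha' : IsUnit (T.pr W₂ (resO X (T.i.preimage_mono (h₂.trans (h₁.trans h))) a)) := by
      rw [← resO_resO (T.i.preimage_mono (h₁.trans h)) (T.i.preimage_mono h₂)]
      exact (ha.map _).map _
    have es' := congrArg (res x₀.E (T.i.preimage_mono h₂)) es
    rw [res_res, res_smul, resO_resO, res_res] at es'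
    rw [res_res] at et
    rw [y.form_res, T.resO_pr, x₀.form_res _ _ le_top, σ_nat, σ_nat, ← ha'.mul_right_inj,
      ← (hb.map (T.pr W₂)).mul_right_inj]
    calc _ = y.form W₂ _ (σ W₂ _ (resO X (T.i.preimage_mono (h₂.trans (h₁.trans h))) a •
            res x₀.E (T.i.preimage_mono (h₂.trans h₁)) s))
          (σ W₂ _ (resO X (T.i.preimage_mono (h₂.trans (h₁.trans h))) b •
            res x₀.E (T.i.preimage_mono (h₂.trans h₁)) t)) := by
          rw [map_smulₛₗ (σ W₂ _), map_smulₛₗ (σ W₂ _), map_smul, map_smul, LinearMap.smul_apply,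
            smul_eq_mul, smul_eq_mul]
      _ = y.form W₂ _ (σ W₂ _ (res x₀.E (T.i.preimage_mono (h₂.trans (h₁.trans h))) s'))
          (σ W₂ _ (res x₀.E (T.i.preimage_mono (h₂.trans (h₁.trans h))) t')) := by
          rw [← es', ← et]
      _ = T.pr W₂ (x₀.form _ le_top (res x₀.E (T.i.preimage_mono (h₂.trans (h₁.trans h))) s')
          (res x₀.E (T.i.preimage_mono (h₂.trans (h₁.trans h))) t')) := by
          rw [← σ_nat V₀ W₂ le_rfl (h₂.trans (h₁.trans h)),
            ← σ_nat V₀ W₂ le_rfl (h₂.trans (h₁.trans h)), ← y.form_res V₀ W₂ hV, σ_eq, σ_eq, hform,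
            T.resO_pr, x₀.form_res _ _ le_top]
      _ = _ := by
          rw [es', et, map_smul (x₀.form _ _ _), map_smul (x₀.form _ _), LinearMap.smul_apply,
            smul_eq_mul, smul_eq_mul, map_mul, map_mul]
  have hspan : ∀ (W : (XBase f S).Opens) (h : W ≤ V₀), IsAffineOpen W →
      Submodule.span Γ(XBase f S, W) (Set.range (σ W h)) = ⊤ := by
    intro W h hW
    -- Nakayama's lemma: modulo `K` the image of `σ` spans, because the image of `p` spans and
    -- functions lift.
    refine eq_top_of_sub_mem_smul (K.map (scalar (toSpec f S) W)) ?_ _ fun s => ?_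
    · obtain ⟨m, hm⟩ := hK
      exact ⟨m, by rw [← Ideal.map_pow, hm, Ideal.zero_eq_bot, Ideal.map_bot]; rfl⟩
    · have key : ∀ u ∈ Submodule.span Γ(Y', g ⁻¹ᵁ W) (Set.range (p W h)),
          ∃ t ∈ Submodule.span Γ(XBase f S, W) (Set.range (σ W h)),
            ρ.red W (h.trans hV) t = u := by
        intro u hu
        induction hu using Submodule.span_induction with
        | mem u hu =>
          obtain ⟨v, rfl⟩ := hu
          exact ⟨_, Submodule.subset_span ⟨v, rfl⟩, hred W h v⟩
        | zero => exact ⟨0, zero_mem _, map_zero _⟩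
        | add u v _ _ h1 h2 =>
          obtain ⟨t, ht, rfl⟩ := h1
          obtain ⟨t', ht', rfl⟩ := h2
          exact ⟨t + t', add_mem ht ht', map_add _ _ _⟩
        | smul a u _ h1 =>
          obtain ⟨t, ht, rfl⟩ := h1
          obtain ⟨b, rfl⟩ := g_surj W hW a
          exact ⟨b • t, Submodule.smul_mem _ _ ht, ρ.red_smul _ _ _ _⟩
      obtain ⟨t, ht, e⟩ := key _ (p_span W h (ρ.red W (h.trans hV) s))
      refine ⟨t, ht, ?_⟩
      rw [← hker, ← ρ.red_ker W (h.trans hV) hW, map_sub, e, sub_self]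
  refine ⟨⟨σ, σ_nat, σ_form, ?_, ?_⟩, hred⟩
  · intro j W h s hs
    refine y.fil_local j W _ _ fun z hz => ?_
    obtain ⟨W₁, h₁, a, hz₁, ha, s', hs', es⟩ := T.exists_smul_eq (x₀.locFree_fil j) hV₀ h hs hz
    refine ⟨W₁, h₁, hz₁, ?_⟩
    have ha' := ha.map (T.pr W₁)
    rw [← Submodule.smul_mem_iff_of_isUnit _ ha', σ_nat, ← map_smulₛₗ, ← es,
      ← σ_nat V₀ W₁ le_rfl (h₁.trans h), σ_eq]
    exact y.fil_res j _ _ hV _ _ (hfil j s' hs')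
  · intro W h
    rw [eq_top_iff]
    intro s _
    have := finite_of_augmentation T.ε
    let β := Module.finBasis k S
    have h1 := fun (x : X) (hx : x ∈ T.i ⁻¹ᵁ W) => T.exists_affine_le hx
    choose W' hW' hle hx' using h1
    -- On a general open set, coordinates are taken on affine pieces; being unique they glue.
    choose c hc using fun (x : X) (hx : x ∈ T.i ⁻¹ᵁ W) =>
      Triv.exists_eq_sum_of_mem_span β (σ (W' x hx) ((hle x hx).trans h))
        (s := res y.E (hle x hx) s) (by rw [hspan _ _ (hW' x hx)]; trivial)
    have hinj : ∀ {W : (XBase f S).Opens} (h : W ≤ V₀) {c c' : Fin _ → Γ(x₀.E, T.i ⁻¹ᵁ W)}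
        (hc : ∑ l, scalar (toSpec f S) W (β l) • σ W h (c l) =
          ∑ l, scalar (toSpec f S) W (β l) • σ W h (c' l)), c = c' := by
      intro W h c c' hc
      rw [← sub_eq_zero]
      refine Triv.eq_zero_of_sum_aux (hV := hV) β σ σ_nat σ_form h ?_
      simp only [Pi.sub_apply, map_sub, smul_sub, Finset.sum_sub_distrib, hc, sub_self]
    have h2 := fun l => exists_glue x₀.E (fun x : T.i ⁻¹ᵁ W => T.i ⁻¹ᵁ (W' x.1 x.2)) (T.i ⁻¹ᵁ W)
      (fun x => T.i.preimage_mono (hle x.1 x.2))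
      (fun x hx => Opens.mem_iSup.mpr ⟨⟨x, hx⟩, hx' x hx⟩) (fun x => c x.1 x.2 l) (fun x x' => by
        have h3 := congrArg (res y.E (inf_le_left : W' x.1 x.2 ⊓ W' x'.1 x'.2 ≤ _)) (hc x.1 x.2)
        have h4 := congrArg (res y.E (inf_le_right : W' x.1 x.2 ⊓ W' x'.1 x'.2 ≤ _)) (hc x'.1 x'.2)
        rw [res_res] at h3 h4
        simp only [map_sum, res_smul, resO_scalar', σ_nat] at h3 h4
        exact congrFun (hinj _ (h3.symm.trans h4)) l)
    choose d hd using h2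
    have : s = ∑ l, scalar (toSpec f S) W (β l) • σ W h (d l) := by
      refine eq_of_locally fun z hz => ?_
      have hz' : toX f S z ∈ T.i ⁻¹ᵁ W := by
        change T.i (toX f S z) ∈ W
        rwa [T.i_toX_apply]
      refine ⟨W' _ hz', hle _ hz', ?_, ?_⟩
      · have := hx' _ hz'
        change T.i (toX f S z) ∈ W' _ hz' at this
        rwa [T.i_toX_apply] at this
      · rw [hc]
        simp only [map_sum, res_smul, resO_scalar', σ_nat]
        refine Finset.sum_congr rfl fun l _ => ?_
        rw [hd l ⟨_, hz'⟩]
    rw [this]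
    exact Submodule.sum_mem _ fun l _ => Submodule.smul_mem _ _ (Submodule.subset_span ⟨_, rfl⟩)

end Triv

/-! ## Small extensions -/

/-- A small extension `B → A` of local artinian `k`-algebras, with bases adapted to it. -/
structure SmallExt (k A B : Type u) [Field k] [CommRing A] [Algebra k A] [CommRing B]
    [IsLocalRing B] [Algebra k B] where
  ε : A →ₐ[k] k
  q : B →ₐ[k] A
  small : IsLocalRing.maximalIdeal B * RingHom.ker q = ⊥
  a : ℕ
  b : ℕ
  β : Module.Basis (Fin a ⊕ Fin b) k B
  α : Module.Basis (Fin b) k A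
  βI : Module.Basis (Fin a) k (RingHom.ker q)
  β_inl : ∀ l, β (Sum.inl l) = βI l
  β_inr : ∀ l, q (β (Sum.inr l)) = α l

namespace SmallExt

section Algebra

variable {k A B : Type u} [Field k] [CommRing A] [Algebra k A] [CommRing B]
    [IsLocalRing B] [Algebra k B]

/-- Over the field `k` the map `q` has a linear section, so `B` is the sum of I and a copy of `A`;
bases of the two summands are put together. -/
theorem exists_eq [IsLocalRing A] [IsArtinianRing A] [IsArtinianRing B] (ε : A →ₐ[k] k)
    (q : B →ₐ[k] A) (hq : Function.Surjective q)
    (hsmall : IsLocalRing.maximalIdeal B * RingHom.ker q = ⊥) :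
    ∃ D : SmallExt k A B, D.ε = ε ∧ D.q = q := by
  have := finite_of_augmentation ε
  have := finite_of_augmentation (ε.comp q)
  obtain ⟨s, hs⟩ := LinearMap.exists_rightInverse_of_surjective q.toLinearMap
    (LinearMap.range_eq_top.mpr hq)
  have hs' : ∀ a, q (s a) = a := fun a => LinearMap.congr_fun hs a
  have hfin : Module.Finite k (RingHom.ker q) :=
    inferInstanceAs (Module.Finite k ((RingHom.ker q).restrictScalars k))
  have hfree : Module.Free k (RingHom.ker q) := Module.Free.of_divisionRing _ _
  let α := Module.finBasis k A
  let βI := Module.finBasis k (RingHom.ker q)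
  let e : (RingHom.ker q × A) ≃ₗ[k] B :=
    { toFun := fun p => p.1.1 + s p.2
      map_add' := fun p p' => by simp only [Prod.fst_add, Prod.snd_add, map_add, Submodule.coe_add]; abel
      map_smul' := fun c p => by
        simp only [Prod.smul_fst, Prod.smul_snd, map_smul, RingHom.id_apply, smul_add]; rfl
      invFun := fun b => (⟨b - s (q b), by rw [RingHom.mem_ker, map_sub, hs', sub_self]⟩, q b)
      left_inv := fun p => by
        have h1 : q p.1.1 = 0 := p.1.2
        refine Prod.ext (Subtype.ext ?_) ?_
        · simp [h1, hs']
        · simp [h1, hs']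
      right_inv := fun b => by simp }
  have he : ∀ p, e p = p.1.1 + s p.2 := fun _ => rfl
  refine ⟨⟨ε, q, hsmall, _, _, (βI.prod α).map e, α, βI, fun l => ?_, fun l => ?_⟩, rfl, rfl⟩
  · simp [he]
  · simp [he, hs']

variable (D : SmallExt k A B)

lemma β_inl_mem (l : Fin D.a) : D.β (Sum.inl l) ∈ RingHom.ker D.q := by
  rw [D.β_inl]; exact (D.βI l).2

lemma q_β_inl (l : Fin D.a) : D.q (D.β (Sum.inl l)) = 0 := D.β_inl_mem l

lemma ker_comp_le : RingHom.ker (D.ε.comp D.q) ≤ IsLocalRing.maximalIdeal B :=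
  IsLocalRing.le_maximalIdeal (RingHom.ker_ne_top _)

lemma ker_le : RingHom.ker D.q ≤ RingHom.ker (D.ε.comp D.q) := fun c hc => by
  rw [RingHom.mem_ker, AlgHom.comp_apply, RingHom.mem_ker.mp hc, map_zero]

lemma mul_eq_zero {c b : B} (hc : D.ε (D.q c) = 0) (hb : b ∈ RingHom.ker D.q) : c * b = 0 := by
  have := Ideal.mul_mem_mul (D.ker_comp_le (RingHom.mem_ker.mpr hc)) hb
  rwa [D.small, Ideal.mem_bot] at this

/-- As m_B I = 0, the ring `B` acts on I through its residue field. -/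
lemma mul_eq {b : B} (hb : b ∈ RingHom.ker D.q) (c : B) :
    c * b = algebraMap k B (D.ε (D.q c)) * b := by
  rw [← sub_eq_zero, ← sub_mul]
  exact D.mul_eq_zero (by simp) hb

/-- I² ⊆ m_B I = 0. -/
lemma isNilpotent_ker : IsNilpotent (RingHom.ker D.q) :=
  ⟨2, by
    rw [pow_two, Ideal.zero_eq_bot, eq_bot_iff, ← D.small]
    exact Ideal.mul_mono (D.ker_le.trans D.ker_comp_le) le_rfl⟩

end Algebra

variable {k : Type u} [Field k] {X : Scheme.{u}} (f : X ⟶ Spec (CommRingCat.of k))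
  {A B : Type u} [CommRing A] [Algebra k A] [CommRing B] [IsLocalRing B]
  [Algebra k B] (D : SmallExt k A B)

lemma baseMap_toX (q : B →ₐ[k] A) : baseMap f q ≫ toX f B = toX f A := pullback.lift_fst _ _ _

lemma baseMap_toSpec (q : B →ₐ[k] A) : baseMap f q ≫ toSpec f B =
    toSpec f A ≫ Spec.map (CommRingCat.ofHom q.toRingHom) := pullback.lift_snd _ _ _

/-- The special fibre of `X_A`. -/
def TA : Thick f A := ⟨specialFibre f D.ε, D.ε, rfl⟩

/-- The special fibre of `X_B`. -/
def TB : Thick f B := ⟨specialFibre f D.ε ≫ baseMap f D.q, D.ε.comp D.q, by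
  refine pullback.hom_ext ?_ ?_
  · rw [Category.assoc]
    refine (congrArg (specialFibre f D.ε ≫ ·) (baseMap_toX f D.q)).trans ?_
    exact (specialFibre_toX f A D.ε).trans (specialFibre_toX f B _).symm
  · rw [Category.assoc]
    refine (congrArg (specialFibre f D.ε ≫ ·) (baseMap_toSpec f D.q)).trans ?_
    rw [← Category.assoc]
    refine (congrArg (· ≫ _) (specialFibre_toSpec f A D.ε)).trans ?_
    refine Eq.trans ?_ (specialFibre_toSpec f B _).symm
    rw [Category.assoc, ← Spec.map_comp]
    rfl⟩

lemma app_scalar (W : (XBase f B).Opens) (c : B) :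
    ((baseMap f D.q).app W).hom (scalar (toSpec f B) W c) =
      scalar (toSpec f A) (baseMap f D.q ⁻¹ᵁ W) (D.q c) := by
  rw [Scheme.Hom.app_eq_appLE]
  exact appLE_scalar _ _ _ D.q.toRingHom (baseMap_toSpec f D.q) _ c

variable [IsLocalRing A] [IsArtinianRing A] [IsArtinianRing B]

lemma app_pr (W : (XBase f B).Opens) (c : Γ(X, (D.TB f).i ⁻¹ᵁ W)) :
    ((baseMap f D.q).app W).hom ((D.TB f).pr W c) = (D.TA f).pr (baseMap f D.q ⁻¹ᵁ W) c := by
  have h : (toX f B).appLE ((D.TB f).i ⁻¹ᵁ W) W ((D.TB f).toX_preimage W).ge ≫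
      (baseMap f D.q).app W = (toX f A).appLE ((D.TA f).i ⁻¹ᵁ (baseMap f D.q ⁻¹ᵁ W))
        (baseMap f D.q ⁻¹ᵁ W) ((D.TA f).toX_preimage _).ge := by
    rw [Scheme.Hom.app_eq_appLE, Scheme.Hom.appLE_comp_appLE]
    have : ∀ (g : XBase f A ⟶ X) (hg : g = toX f A) (U W e e'), g.appLE U W e =
        (toX f A).appLE U W e' := by
      rintro _ rfl U W e e'
      rfl
    exact this _ (baseMap_toX f D.q) _ _ _ _
  exact congr($h c)

lemma isAffineOpen_preimage {W : (XBase f B).Opens} (hW : IsAffineOpen W) :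
    IsAffineOpen (baseMap f D.q ⁻¹ᵁ W) := by
  rw [← (D.TA f).toX_preimage (baseMap f D.q ⁻¹ᵁ W)]
  exact ((D.TB f).isAffineOpen_preimage hW).preimage (toX f A)

/-- Coordinates exist on every open set, so functions on X_A lift by lifting the basis of `A`;
affineness is not needed. -/
lemma app_surjective (W : (XBase f B).Opens) :
    Function.Surjective ((baseMap f D.q).app W).hom := by
  intro a
  refine ⟨∑ l, scalar (toSpec f B) W (D.β (Sum.inr l)) *
    (D.TB f).pr W ((D.TA f).coord D.α _ a l), ?_⟩
  refine Eq.trans ?_ ((D.TA f).sum_coord D.α _ a)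
  rw [map_sum]
  refine Finset.sum_congr rfl fun l _ => ?_
  rw [map_mul, app_scalar, D.β_inr]
  exact congrArg _ (D.app_pr f W _)

/-- In adapted coordinates reduction forgets the coordinates along I and keeps the others, so a
function in the kernel has only coordinates along I. -/
lemma ker_app (W : (XBase f B).Opens) : RingHom.ker ((baseMap f D.q).app W).hom =
    (RingHom.ker D.q).map (scalar (toSpec f B) W) := by
  apply le_antisymm
  · intro a ha
    rw [RingHom.mem_ker] at ha
    have h1 := (D.TB f).sum_coord D.β W a
    rw [Fintype.sum_sum_type] at h1
    have h2 := congrArg ((baseMap f D.q).app W).hom h1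
    rw [ha] at h2
    simp only [map_add, map_sum, map_mul, app_scalar, D.q_β_inl, map_zero, zero_mul,
      Finset.sum_const_zero, zero_add, app_pr, D.β_inr] at h2
    have h3 := (D.TA f).eq_zero_of_sum_eq_zero D.α h2
    rw [← h1]
    refine Ideal.add_mem _ (Ideal.sum_mem _ fun l _ => Ideal.mul_mem_right _ _
      (Ideal.mem_map_of_mem _ (D.β_inl_mem l))) (Ideal.sum_mem _ fun l _ => ?_)
    rw [show (D.TB f).coord D.β W a (Sum.inr l) = 0 from congrFun h3 l, map_zero, mul_zero]
    exact zero_mem _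
  · rw [Ideal.map_le_iff_le_comap]
    intro c hc
    rw [Ideal.mem_comap, RingHom.mem_ker, app_scalar, RingHom.mem_ker.mp hc, map_zero]

variable {f} {r n : ℕ} {x₀ : NilBundle X ⊤ r n} {x : NilBundle (XBase f A) ⊤ r n}
  (ρ₀ : Reduction (specialFibre f D.ε) x x₀) [CharZero k]

include ρ₀ in
-- The case in which the reduction is E₀ itself, with `p` the identity and `K` the augmentation
-- ideal.
theorem exists_trivA {V₀ : (XBase f A).Opens} (hV₀ : IsAffineOpen V₀) :
    ∃ τ : Triv (D.TA f) x₀.toFilSymp x.toFilSymp (le_top : V₀ ≤ ⊤), ∀ W h s,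
      ρ₀.red W le_top (τ.σ W h s) = s := by
  refine exists_triv (D.TA f) hV₀ le_top (D.TA f).i x₀.toFilSymp ρ₀.toFilRed (RingHom.ker D.ε)
    (isNilpotent_ker_augmentation D.ε) ?_ (fun W h => AddMonoidHom.id _) ?_ ?_ ?_ ?_ ?_ ?_
  · intro W
    refine le_antisymm ((D.TA f).ker_app_le W) ?_
    rw [Ideal.map_le_iff_le_comap]
    intro c hc
    rw [Ideal.mem_comap, RingHom.mem_ker, Thick.app_scalar]
    change scalar f _ (D.ε c) = 0
    rw [RingHom.mem_ker.mp hc, map_zero]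
  · intro W h a s
    rw [Thick.app_pr]; rfl
  · intro W W' h h' s
    rfl
  · intro W h s t
    rw [Thick.app_pr]; rfl
  · intro j W h s hs
    exact hs
  · intro W h s
    exact Submodule.subset_span ⟨s, rfl⟩
  · intro W _ a
    exact ⟨_, (D.TA f).app_pr W a⟩

/-- Here the reduction is `x` and `p` is a trivialization of it. Being able to prescribe `τA` is
what makes trivializations of different lifts comparable. -/
theorem exists_trivB {V V₀ : (XBase f B).Opens} (hV₀ : IsAffineOpen V₀) (hV : V₀ ≤ V)
    {y : FilSymp (XBase f B) V r n} (ρ : FilRed (baseMap f D.q) y x.toFilSymp)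
    (τA : Triv (D.TA f) x₀.toFilSymp x.toFilSymp (le_top : baseMap f D.q ⁻¹ᵁ V₀ ≤ ⊤)) :
    ∃ τ : Triv (D.TB f) x₀.toFilSymp y hV, ∀ W h s, ρ.red W (h.trans hV) (τ.σ W h s) =
      τA.σ _ ((baseMap f D.q).preimage_mono h) s := by
  refine exists_triv (D.TB f) hV₀ hV (baseMap f D.q) x.toFilSymp ρ (RingHom.ker D.q)
    D.isNilpotent_ker (D.ker_app f)
    (fun W h => (τA.σ _ ((baseMap f D.q).preimage_mono h)).toAddMonoidHom) ?_ ?_ ?_ ?_ ?_ ?_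
  · intro W h a s
    rw [app_pr]
    exact (τA.σ _ ((baseMap f D.q).preimage_mono h)).map_smulₛₗ a s
  · intro W W' h h' s
    exact τA.nat _ _ _ ((baseMap f D.q).preimage_mono h') s
  · intro W h s t
    rw [app_pr]
    exact τA.form_eq (baseMap f D.q ⁻¹ᵁ W) _ s t
  · intro j W h s hs
    exact τA.fil_mem j (baseMap f D.q ⁻¹ᵁ W) _ s hs
  · intro W h s
    exact (τA.span _ ((baseMap f D.q).preimage_mono h)).ge trivial
  · intro W _
    exact D.app_surjective f W

end SmallExt

/-! ## The action of `P ⊗ I` on lifts -/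

section Transport

variable {k : Type u} [Field k] {X : Scheme.{u}} {f : X ⟶ Spec (CommRingCat.of k)}
  {S : Type u} [CommRing S] [Algebra k S] (T : Thick f S)

/-- A family indexed by the open subsets of `X_S`, as a family indexed by those of `X`. -/
def Thick.fam {E : X.Modules} {U : X.Opens}
    (φ : ∀ W : (XBase f S).Opens, W ≤ toX f S ⁻¹ᵁ U →
      (Γ(E, T.i ⁻¹ᵁ W) →ₗ[Γ(X, T.i ⁻¹ᵁ W)] Γ(E, T.i ⁻¹ᵁ W))) : EndFam f E U :=
  fun W => T.preimage_toX W.1 ▸ φ (toX f S ⁻¹ᵁ W.1) ((toX f S).preimage_mono W.2)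

lemma Thick.fam_app [IsLocalRing S] [IsArtinianRing S] {E : X.Modules} {U : X.Opens}
    (φ : ∀ W : (XBase f S).Opens, W ≤ toX f S ⁻¹ᵁ U →
      (Γ(E, T.i ⁻¹ᵁ W) →ₗ[Γ(X, T.i ⁻¹ᵁ W)] Γ(E, T.i ⁻¹ᵁ W))) (W : (XBase f S).Opens)
    (h : W ≤ toX f S ⁻¹ᵁ U) (h' : T.i ⁻¹ᵁ W ≤ U) : (T.fam φ).app (T.i ⁻¹ᵁ W) h' = φ W h := by
  have key : ∀ (W₂ : (XBase f S).Opens) (e : T.i ⁻¹ᵁ W₂ = T.i ⁻¹ᵁ W) (h₂ : W₂ ≤ toX f S ⁻¹ᵁ U),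
      (e ▸ φ W₂ h₂ : Γ(E, T.i ⁻¹ᵁ W) →ₗ[Γ(X, T.i ⁻¹ᵁ W)] Γ(E, T.i ⁻¹ᵁ W)) = φ W h := by
    intro W₂ e h₂
    obtain rfl := T.preimage_injective e
    rfl
  exact key _ _ _

lemma Thick.preimage_le {U : X.Opens} {W : (XBase f S).Opens} (h : W ≤ toX f S ⁻¹ᵁ U) :
    T.i ⁻¹ᵁ W ≤ U := (T.i.preimage_mono h).trans (T.preimage_toX U).le

lemma Thick.le_preimage [IsLocalRing S] [IsArtinianRing S] {U : X.Opens} {W : (XBase f S).Opens}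
    (h : T.i ⁻¹ᵁ W ≤ U) : W ≤ toX f S ⁻¹ᵁ U :=
  T.le_of_preimage_le (h.trans (T.preimage_toX U).ge)

end Transport

namespace SmallExt

variable {k : Type u} [Field k] {X : Scheme.{u}} {f : X ⟶ Spec (CommRingCat.of k)}
  {A B : Type u} [CommRing A] [Algebra k A] [CommRing B] [IsLocalRing B]
  [Algebra k B] (D : SmallExt k A B) {r n : ℕ} {x₀ : NilBundle X ⊤ r n}
  {x : NilBundle (XBase f A) ⊤ r n}
  (ρ₀ : Reduction (specialFibre f D.ε) x x₀) {V V₀ : (XBase f B).Opens}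
  {y : FilSymp (XBase f B) V r n} (ρ : FilRed (baseMap f D.q) y x.toFilSymp)

/-- The reduction to the special fibre. -/
def red0 (W : (XBase f B).Opens) (h : W ≤ V) : Γ(y.E, W) →+ Γ(x₀.E, (D.TB f).i ⁻¹ᵁ W) :=
  (ρ₀.red (baseMap f D.q ⁻¹ᵁ W) le_top).comp (ρ.red W h)

lemma red0_eq (W : (XBase f B).Opens) (h : W ≤ V) (s : Γ(y.E, W)) :
    D.red0 ρ₀ ρ W h s = ρ₀.red (baseMap f D.q ⁻¹ᵁ W) le_top (ρ.red W h s) := rfl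

lemma red0_eq_zero (W : (XBase f B).Opens) (h : W ≤ V) {s : Γ(y.E, W)} (hs : ρ.red W h s = 0) :
    D.red0 ρ₀ ρ W h s = 0 := by
  rw [red0_eq, hs, map_zero]; rfl

lemma red0_smul (W : (XBase f B).Opens) (h : W ≤ V) (a : Γ(XBase f B, W)) (s : Γ(y.E, W)) :
    D.red0 ρ₀ ρ W h (a • s) = ((D.TB f).i.app W).hom a • D.red0 ρ₀ ρ W h s := by
  rw [red0_eq, ρ.red_smul, ρ₀.red_smul]
  rfl

lemma red0_scalar_smul (W : (XBase f B).Opens) (h : W ≤ V) (b : B) (s : Γ(y.E, W)) :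
    D.red0 ρ₀ ρ W h (scalar (toSpec f B) W b • s) =
      scalar f ((D.TB f).i ⁻¹ᵁ W) (D.ε (D.q b)) • D.red0 ρ₀ ρ W h s := by
  rw [red0_smul, Thick.app_scalar]
  rfl

lemma red0_res (W W' : (XBase f B).Opens) (h : W ≤ V) (h' : W' ≤ W) (s : Γ(y.E, W)) :
    D.red0 ρ₀ ρ W' (h'.trans h) (res y.E h' s) =
      res x₀.E ((D.TB f).i.preimage_mono h') (D.red0 ρ₀ ρ W h s) := by
  rw [red0_eq, ρ.red_res W W' h h', ρ₀.red_res _ _ le_top ((baseMap f D.q).preimage_mono h')]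
  rfl

lemma red0_fil (j : ℤ) (W : (XBase f B).Opens) (h : W ≤ V) (s : Γ(y.E, W)) (hs : s ∈ y.fil j W h) :
    D.red0 ρ₀ ρ W h s ∈ x₀.fil j _ le_top :=
  ρ₀.red_fil j _ le_top _ (ρ.red_fil j W h s hs)

variable [IsLocalRing A] [IsArtinianRing A] [IsArtinianRing B]

/-- Trivializations of a lift, lifting a trivialization of its reduction. -/
structure LTriv (hV : V₀ ≤ V) extends Triv (D.TB f) x₀.toFilSymp y hV where
  τA : Triv (D.TA f) x₀.toFilSymp x.toFilSymp (le_top : baseMap f D.q ⁻¹ᵁ V₀ ≤ ⊤)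
  red_τA : ∀ W h s, ρ₀.red W le_top (τA.σ W h s) = s
  red_σ : ∀ W h s, ρ.red W (h.trans hV) (σ W h s) =
    τA.σ _ ((baseMap f D.q).preimage_mono h) s

theorem nonempty_LTriv [CharZero k] (hV₀ : IsAffineOpen V₀) (hV : V₀ ≤ V) :
    Nonempty (D.LTriv ρ₀ ρ hV) := by
  obtain ⟨τA, hτA⟩ := D.exists_trivA ρ₀ (D.isAffineOpen_preimage f hV₀)
  obtain ⟨τ, hτ⟩ := D.exists_trivB hV₀ hV ρ τA
  exact ⟨⟨τ, τA, hτA, hτ⟩⟩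

namespace LTriv

variable {D ρ₀ ρ}

section

variable {hV : V₀ ≤ V} (τ : D.LTriv ρ₀ ρ hV) {W : (XBase f B).Opens} (h : W ≤ V₀)

lemma red0_σ (s : Γ(x₀.E, (D.TB f).i ⁻¹ᵁ W)) :
    D.red0 ρ₀ ρ W (h.trans hV) (τ.σ W h s) = s := by
  rw [red0_eq, τ.red_σ]
  exact τ.red_τA (baseMap f D.q ⁻¹ᵁ W) _ s

/-- Multiplication by an element of I factors through the special fibre because `B` acts on I
through `k`. This underlies the identification of I E with E₀ ⊗ I. -/
lemma smul_eq {b : B} (hb : b ∈ RingHom.ker D.q) (s : Γ(y.E, W)) :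
    scalar (toSpec f B) W b • s =
      scalar (toSpec f B) W b • τ.σ W h (D.red0 ρ₀ ρ W (h.trans hV) s) := by
  conv_lhs => rw [← τ.sum_coord D.β h s]
  conv_rhs => rw [← τ.sum_coord D.β h s]
  simp only [map_sum, red0_scalar_smul, τ.red0_σ, Finset.smul_sum, map_smulₛₗ]
  refine Finset.sum_congr rfl fun l _ => ?_
  rw [smul_smul, smul_smul, ← map_mul, mul_comm b, D.mul_eq hb, ← (D.TB f).scalar_algebraMap,
    ← map_mul, mul_comm]

include τ in
lemma mul_form_eq {b : B} (hb : b ∈ RingHom.ker D.q) (s t : Γ(y.E, W)) :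
    scalar (toSpec f B) W b * y.form W (h.trans hV) s t = scalar (toSpec f B) W b *
      (D.TB f).pr W (x₀.form _ le_top (D.red0 ρ₀ ρ W (h.trans hV) s)
        (D.red0 ρ₀ ρ W (h.trans hV) t)) := by
  have h1 : scalar (toSpec f B) W b * y.form W (h.trans hV) s t =
      y.form W (h.trans hV) (scalar (toSpec f B) W b • s) t := by
    rw [map_smul, LinearMap.smul_apply, smul_eq_mul]
  rw [h1, τ.smul_eq h hb s, map_smul, LinearMap.smul_apply, ← map_smul, τ.smul_eq h hb t,
    map_smul, smul_eq_mul, τ.form_eq]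

lemma red_eq_sum (s : Γ(y.E, W)) : ρ.red W (h.trans hV) s =
    ∑ l, scalar (toSpec f A) (baseMap f D.q ⁻¹ᵁ W) (D.α l) •
      τ.τA.σ _ ((baseMap f D.q).preimage_mono h) (τ.coord D.β h s (Sum.inr l)) := by
  conv_lhs => rw [← τ.sum_coord D.β h s]
  rw [Fintype.sum_sum_type, map_add]
  simp only [map_sum, ρ.red_smul, app_scalar, D.q_β_inl, D.β_inr, map_zero, zero_smul,
    Finset.sum_const_zero, zero_add, τ.red_σ]

lemma coord_inr_eq_zero {s : Γ(y.E, W)} (hs : ρ.red W (h.trans hV) s = 0) (l : Fin D.b) :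
    τ.coord D.β h s (Sum.inr l) = 0 := by
  have h1 := τ.red_eq_sum h s
  rw [hs] at h1
  exact congrFun (Triv.eq_zero_of_sum_aux (hV := le_top) D.α τ.τA.σ τ.τA.nat τ.τA.form_eq
    ((baseMap f D.q).preimage_mono h) h1.symm) l

/-- The coordinates outside I are those of the reduction, so they vanish; what is left lies in I E.
-/
lemma eq_sum_of_red_eq_zero {s : Γ(y.E, W)} (hs : ρ.red W (h.trans hV) s = 0) :
    s = ∑ l, scalar (toSpec f B) W (D.βI l) • τ.σ W h (τ.coord D.β h s (Sum.inl l)) := by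
  conv_lhs => rw [← τ.sum_coord D.β h s, Fintype.sum_sum_type]
  simp only [τ.coord_inr_eq_zero h hs, map_zero, smul_zero, Finset.sum_const_zero, add_zero,
    D.β_inl]

include τ in
-- With a factor from I taken out of the first argument, only the value of the second on the special
-- fibre matters, and this is zero.
lemma form_eq_zero {s t : Γ(y.E, W)} (hs : ρ.red W (h.trans hV) s = 0)
    (ht : ρ.red W (h.trans hV) t = 0) : y.form W (h.trans hV) s t = 0 := by
  rw [τ.eq_sum_of_red_eq_zero h hs, map_sum, LinearMap.sum_apply]
  refine Finset.sum_eq_zero fun l _ => ?_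
  rw [map_smul, LinearMap.smul_apply, smul_eq_mul, τ.mul_form_eq h (D.βI l).2,
    D.red0_eq_zero ρ₀ ρ W _ ht, map_zero, map_zero, mul_zero]

end

section Act

variable {U : X.Opens} {hV : toX f B ⁻¹ᵁ U ≤ V} (τ : D.LTriv ρ₀ ρ hV) {j : ℤ}
  {W : (XBase f B).Opens}

/-- The action on sections, through a trivialization. -/
def actHom (W : (XBase f B).Opens) (h : W ≤ toX f B ⁻¹ᵁ U) :
    PTensor f x₀ (RingHom.ker D.q) j U →+ (Γ(y.E, W) →ₗ[Γ(XBase f B, W)] Γ(y.E, W)) :=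
  TensorProduct.liftAddHom
    { toFun := fun g =>
        { toFun := fun b =>
            { toFun := fun s => scalar (toSpec f B) W (b : B) •
                τ.σ W h (g.1.app _ ((D.TB f).preimage_le h) (D.red0 ρ₀ ρ W (h.trans hV) s))
              map_add' := fun s t => by simp only [map_add, smul_add]
              -- `τ.σ` is only semilinear over functions on X. After multiplication by `b` in I a
              -- function on X_B acts through its restriction to X, and this makes the map linear.
              map_smul' := fun a s => by
                rw [red0_smul, map_smul, map_smulₛₗ, RingHom.id_apply, smul_comm a,
                  τ.smul_eq h b.2 (a • _), τ.smul_eq h b.2 ((D.TB f).pr W _ • _), red0_smul,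
                  red0_smul, Thick.app_pr] }
          map_zero' := LinearMap.ext fun s => by
            change scalar (toSpec f B) W (0 : B) • τ.σ W h _ = (0 : Γ(y.E, W))
            rw [map_zero, zero_smul]
          map_add' := fun b b' => LinearMap.ext fun s => by
            change scalar (toSpec f B) W (b + b' : B) • τ.σ W h _ =
              scalar (toSpec f B) W (b : B) • τ.σ W h _ + scalar (toSpec f B) W (b' : B) • τ.σ W h _
            rw [map_add, add_smul] }
      map_zero' := by
        ext b s
        change scalar (toSpec f B) W (b : B) • τ.σ W h 0 = 0
        rw [map_zero, smul_zero]
      map_add' := fun g g' => by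
        ext b s
        change scalar (toSpec f B) W (b : B) • τ.σ W h (_ + _) =
          scalar (toSpec f B) W (b : B) • τ.σ W h _ + scalar (toSpec f B) W (b : B) • τ.σ W h _
        rw [map_add, smul_add]; rfl }
    (fun c g b => by
      ext s
      change scalar (toSpec f B) W (b : B) • τ.σ W h (scalar f ((D.TB f).i ⁻¹ᵁ W) c •
          g.1.app _ ((D.TB f).preimage_le h) (D.red0 ρ₀ ρ W (h.trans hV) s)) =
        scalar (toSpec f B) W ((c • b : RingHom.ker D.q) : B) •
          τ.σ W h (g.1.app _ ((D.TB f).preimage_le h) (D.red0 ρ₀ ρ W (h.trans hV) s))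
      rw [map_smulₛₗ, ← Thick.scalar_algebraMap, smul_smul, ← map_mul, mul_comm,
        show ((c • b : RingHom.ker D.q) : B) = algebraMap k B c * b from
          Algebra.smul_def c (b : B)])

lemma actHom_tmul (g : PSec f x₀ j U) (b : RingHom.ker D.q) (s : Γ(y.E, W))
    (h : W ≤ toX f B ⁻¹ᵁ U) :
    τ.actHom W h (PTensor.tmul f x₀ _ g b) s = scalar (toSpec f B) W (b : B) •
      τ.σ W h (g.1.app _ ((D.TB f).preimage_le h) (D.red0 ρ₀ ρ W (h.trans hV) s)) := rfl

end Act

end LTriv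

end SmallExt

/-! ### Elements of P ⊗ I -/

section PTensor

variable {k : Type u} [Field k] {X : Scheme.{u}} {f : X ⟶ Spec (CommRingCat.of k)} {r n : ℕ}
  {x : NilBundle X ⊤ r n} {I : Type u} [AddCommGroup I] [Module k I] {j : ℤ} {U : X.Opens}

lemma PTensor.induction {p : PTensor f x I j U → Prop} (z : PTensor f x I j U) (h0 : p 0)
    (ht : ∀ g b, p (PTensor.tmul f x I g b)) (ha : ∀ z w, p z → p w → p (z + w)) : p z :=
  TensorProduct.induction_on z h0 ht ha

lemma PTensor.map_tmul {j' : ℤ} {U' : X.Opens} (L : PSec f x j U →ₗ[k] PSec f x j' U')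
    (g : PSec f x j U) (b : I) :
    PTensor.map f x I L (PTensor.tmul f x I g b) = PTensor.tmul f x I (L g) b := rfl

lemma PTensor.exists_eq_sum {a : ℕ} (β : Module.Basis (Fin a) k I) (z : PTensor f x I j U) :
    ∃ g : Fin a → PSec f x j U, z = ∑ l, PTensor.tmul f x I (g l) (β l) := by
  induction z using PTensor.induction with
  | h0 =>
    refine ⟨0, (Finset.sum_eq_zero fun l _ => ?_).symm⟩
    exact TensorProduct.zero_tmul _ _
  | ht g b =>
    refine ⟨fun l => β.repr b l • g, ?_⟩
    have : (g ⊗ₜ[k] b : PSec f x j U ⊗[k] I) = ∑ l, (β.repr b l • g) ⊗ₜ[k] β l := by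
      conv_lhs => rw [← β.sum_repr b, TensorProduct.tmul_sum]
      exact Finset.sum_congr rfl fun l _ => by rw [TensorProduct.tmul_smul, TensorProduct.smul_tmul']
    exact this
  | ha z w h1 h2 =>
    obtain ⟨g, rfl⟩ := h1
    obtain ⟨g', rfl⟩ := h2
    refine ⟨g + g', ?_⟩
    rw [← Finset.sum_add_distrib]
    exact Finset.sum_congr rfl fun l _ => (TensorProduct.add_tmul _ _ _).symm

end PTensor

namespace SmallExt

variable {k : Type u} [Field k] {X : Scheme.{u}} {f : X ⟶ Spec (CommRingCat.of k)}
  {A B : Type u} [CommRing A] [Algebra k A] [CommRing B] [IsLocalRing B]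
  [Algebra k B] (D : SmallExt k A B) {r n : ℕ} {x₀ : NilBundle X ⊤ r n}
  {x : NilBundle (XBase f A) ⊤ r n}
  (ρ₀ : Reduction (specialFibre f D.ε) x x₀) {V : (XBase f B).Opens}
  {y : FilSymp (XBase f B) V r n} (ρ : FilRed (baseMap f D.q) y x.toFilSymp)
  [IsLocalRing A] [IsArtinianRing A] [IsArtinianRing B] [CharZero k]
  {U : X.Opens} (hU : IsAffineOpen U) (hV : toX f B ⁻¹ᵁ U ≤ V) {j : ℤ}

lemma isAffineOpen_toX {U : X.Opens} (hU : IsAffineOpen U) : IsAffineOpen (toX f B ⁻¹ᵁ U) :=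
  hU.preimage (toX f B)

/-- A section of `F_h^j Hom_s(E₀, E₀) ⊗ I` acts on sections of a lift. -/
def act (z : PTensor f x₀ (RingHom.ker D.q) j U) : Fam y.E y.E (toX f B ⁻¹ᵁ U) := fun W h =>
  (Classical.choice (D.nonempty_LTriv ρ₀ ρ (isAffineOpen_toX hU) hV)).actHom W h z

variable {D ρ₀ ρ hU hV}

@[simp] lemma act_zero (W : (XBase f B).Opens) (h : W ≤ toX f B ⁻¹ᵁ U) (s : Γ(y.E, W)) :
    D.act ρ₀ ρ hU hV (0 : PTensor f x₀ (RingHom.ker D.q) j U) W h s = 0 := by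
  rw [act, map_zero, LinearMap.zero_apply]

lemma act_add (z w : PTensor f x₀ (RingHom.ker D.q) j U) (W : (XBase f B).Opens)
    (h : W ≤ toX f B ⁻¹ᵁ U) (s : Γ(y.E, W)) : D.act ρ₀ ρ hU hV (z + w) W h s =
      D.act ρ₀ ρ hU hV z W h s + D.act ρ₀ ρ hU hV w W h s := by
  rw [act, map_add, LinearMap.add_apply]; rfl

lemma act_neg (z : PTensor f x₀ (RingHom.ker D.q) j U) (W : (XBase f B).Opens)
    (h : W ≤ toX f B ⁻¹ᵁ U) (s : Γ(y.E, W)) : D.act ρ₀ ρ hU hV (-z) W h s =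
      - D.act ρ₀ ρ hU hV z W h s := by
  rw [act, map_neg, LinearMap.neg_apply]; rfl

lemma act_sub (z w : PTensor f x₀ (RingHom.ker D.q) j U) (W : (XBase f B).Opens)
    (h : W ≤ toX f B ⁻¹ᵁ U) (s : Γ(y.E, W)) : D.act ρ₀ ρ hU hV (z - w) W h s =
      D.act ρ₀ ρ hU hV z W h s - D.act ρ₀ ρ hU hV w W h s := by
  rw [act, map_sub, LinearMap.sub_apply]; rfl

lemma act_sum {ι : Type*} (t : Finset ι) (z : ι → PTensor f x₀ (RingHom.ker D.q) j U)
    (W : (XBase f B).Opens) (h : W ≤ toX f B ⁻¹ᵁ U) (s : Γ(y.E, W)) :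
    D.act ρ₀ ρ hU hV (∑ l ∈ t, z l) W h s = ∑ l ∈ t, D.act ρ₀ ρ hU hV (z l) W h s := by
  rw [act, map_sum, LinearMap.sum_apply]; rfl

variable (hU) in
include hU in
-- This is why the action does not depend on the trivialization chosen in `act`.
lemma smul_eq_of_red0_eq {b : B} (hb : b ∈ RingHom.ker D.q) {W : (XBase f B).Opens}
    (h : W ≤ toX f B ⁻¹ᵁ U) {s t : Γ(y.E, W)}
    (hst : D.red0 ρ₀ ρ W (h.trans hV) s = D.red0 ρ₀ ρ W (h.trans hV) t) :
    scalar (toSpec f B) W b • s = scalar (toSpec f B) W b • t := by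
  let τ := Classical.choice (D.nonempty_LTriv ρ₀ ρ (isAffineOpen_toX hU) hV)
  rw [τ.smul_eq h hb s, hst, ← τ.smul_eq h hb t]

/-- The characterization of the action. -/
lemma act_tmul (g : PSec f x₀ j U) (b : RingHom.ker D.q) (W : (XBase f B).Opens)
    (h : W ≤ toX f B ⁻¹ᵁ U) (s t : Γ(y.E, W)) (hst : D.red0 ρ₀ ρ W (h.trans hV) t =
      g.1.app _ ((D.TB f).preimage_le h) (D.red0 ρ₀ ρ W (h.trans hV) s)) :
    D.act ρ₀ ρ hU hV (PTensor.tmul f x₀ _ g b) W h s = scalar (toSpec f B) W (b : B) • t := by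
  rw [act, LTriv.actHom_tmul]
  refine smul_eq_of_red0_eq (ρ₀ := ρ₀) (ρ := ρ) (hV := hV) hU b.2 h ?_
  rw [LTriv.red0_σ, hst]

variable (ρ₀ ρ hU hV) in
include hU in
lemma exists_red0_eq (W : (XBase f B).Opens) (h : W ≤ toX f B ⁻¹ᵁ U)
    (s : Γ(x₀.E, (D.TB f).i ⁻¹ᵁ W)) : ∃ t : Γ(y.E, W), D.red0 ρ₀ ρ W (h.trans hV) t = s := by
  let τ := Classical.choice (D.nonempty_LTriv ρ₀ ρ (isAffineOpen_toX hU) hV)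
  exact ⟨τ.σ W h s, τ.red0_σ h s⟩

lemma act_congr (z : PTensor f x₀ (RingHom.ker D.q) j U) (W : (XBase f B).Opens)
    (h : W ≤ toX f B ⁻¹ᵁ U) {s t : Γ(y.E, W)}
    (hst : D.red0 ρ₀ ρ W (h.trans hV) s = D.red0 ρ₀ ρ W (h.trans hV) t) :
    D.act ρ₀ ρ hU hV z W h s = D.act ρ₀ ρ hU hV z W h t := by
  induction z using PTensor.induction with
  | h0 => rw [act_zero, act_zero]
  | ht g b => rw [act, LTriv.actHom_tmul, LTriv.actHom_tmul, hst]
  | ha z w h1 h2 => rw [act_add, act_add, h1, h2]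

lemma act_nat (z : PTensor f x₀ (RingHom.ker D.q) j U) : IsNat (D.act ρ₀ ρ hU hV z) := by
  intro W W' h h' s
  induction z using PTensor.induction with
  | h0 => rw [act_zero, act_zero, map_zero]
  | ht g b =>
    obtain ⟨t, ht⟩ := exists_red0_eq ρ₀ ρ hU hV W h
      (g.1.app _ ((D.TB f).preimage_le h) (D.red0 ρ₀ ρ W (h.trans hV) s))
    rw [act_tmul g b W h s t ht, act_tmul g b W' (h'.trans h) _ (res y.E h' t), res_smul,
      resO_scalar']
    rw [red0_res _ _ _ _ _ (h.trans hV), ht, red0_res _ _ _ _ _ (h.trans hV)]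
    exact g.2.1 _ _ _ _ _
  | ha z w h1 h2 => rw [act_add, act_add, map_add, h1, h2]

lemma act_fil (z : PTensor f x₀ (RingHom.ker D.q) j U) (i : ℤ) (W : (XBase f B).Opens)
    (h : W ≤ toX f B ⁻¹ᵁ U) (s : Γ(y.E, W)) (hs : s ∈ y.fil i W (h.trans hV)) :
    D.act ρ₀ ρ hU hV z W h s ∈ y.fil (i + j) W (h.trans hV) := by
  induction z using PTensor.induction with
  | h0 => rw [act_zero]; exact zero_mem _
  | ht g b =>
    rw [act, LTriv.actHom_tmul]
    exact Submodule.smul_mem _ _ (Triv.fil_mem _ _ _ _ _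
      (g.2.2.2 i _ _ _ (D.red0_fil ρ₀ ρ i W _ s hs)))
  | ha z w h1 h2 => rw [act_add]; exact add_mem h1 h2

lemma act_form (z : PTensor f x₀ (RingHom.ker D.q) j U) (W : (XBase f B).Opens)
    (h : W ≤ toX f B ⁻¹ᵁ U) (s t : Γ(y.E, W)) :
    y.form W (h.trans hV) s (D.act ρ₀ ρ hU hV z W h t) =
      - y.form W (h.trans hV) (D.act ρ₀ ρ hU hV z W h s) t := by
  induction z using PTensor.induction with
  | h0 => rw [act_zero, act_zero, map_zero, map_zero, LinearMap.zero_apply, neg_zero]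
  | ht g b =>
    rw [act, LTriv.actHom_tmul, LTriv.actHom_tmul, map_smul, map_smul, LinearMap.smul_apply,
      smul_eq_mul, smul_eq_mul]
    generalize Classical.choice (D.nonempty_LTriv ρ₀ ρ (isAffineOpen_toX hU) hV) = τ
    rw [τ.mul_form_eq h b.2, τ.mul_form_eq h b.2, τ.red0_σ, τ.red0_σ, g.2.2.1, map_neg, mul_neg]
  | ha z w h1 h2 =>
    rw [act_add, act_add, map_add, map_add, LinearMap.add_apply, h1, h2, neg_add]

lemma red_act (z : PTensor f x₀ (RingHom.ker D.q) j U) (W : (XBase f B).Opens)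
    (h : W ≤ toX f B ⁻¹ᵁ U) (s : Γ(y.E, W)) :
    ρ.red W (h.trans hV) (D.act ρ₀ ρ hU hV z W h s) = 0 := by
  induction z using PTensor.induction with
  | h0 => rw [act_zero, map_zero]
  | ht g b =>
    rw [act, LTriv.actHom_tmul, ρ.red_smul, app_scalar, RingHom.mem_ker.mp b.2, map_zero, zero_smul]
  | ha z w h1 h2 => rw [act_add, map_add, h1, h2, add_zero]

lemma act_of_red_eq_zero (z : PTensor f x₀ (RingHom.ker D.q) j U) (W : (XBase f B).Opens)
    (h : W ≤ toX f B ⁻¹ᵁ U) {s : Γ(y.E, W)} (hs : ρ.red W (h.trans hV) s = 0) :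
    D.act ρ₀ ρ hU hV z W h s = 0 := by
  rw [act_congr z W h (t := 0), map_zero]
  rw [map_zero, red0_eq_zero _ _ _ _ _ hs]

/-- The values of the action vanish on the reduction, and the action depends only on the reduction
of its argument. Therefore 1 + z is multiplicative in z up to nothing: (1 + z)(1 + w) = 1 + z + w.
-/
lemma act_act {j' : ℤ} (z : PTensor f x₀ (RingHom.ker D.q) j U)
    (w : PTensor f x₀ (RingHom.ker D.q) j' U) (W : (XBase f B).Opens)
    (h : W ≤ toX f B ⁻¹ᵁ U) (s : Γ(y.E, W)) :
    D.act ρ₀ ρ hU hV z W h (D.act ρ₀ ρ hU hV w W h s) = 0 :=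
  act_of_red_eq_zero z W h (red_act w W h s)

lemma act_restrict {U' : X.Opens} (hU' : IsAffineOpen U') (hUU' : U' ≤ U)
    (z : PTensor f x₀ (RingHom.ker D.q) j U) (W : (XBase f B).Opens)
    (h : W ≤ toX f B ⁻¹ᵁ U') (s : Γ(y.E, W)) :
    D.act ρ₀ ρ hU' (((toX f B).preimage_mono hUU').trans hV)
      (PTensor.map f x₀ _ (PSec.restrict f x₀ j hUU') z) W h s =
      D.act ρ₀ ρ hU hV z W (h.trans ((toX f B).preimage_mono hUU')) s := by
  induction z using PTensor.induction with
  | h0 => rw [map_zero, act_zero, act_zero]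
  | ht g b =>
    have h1 := h.trans ((toX f B).preimage_mono hUU')
    obtain ⟨t, ht⟩ := exists_red0_eq ρ₀ ρ hU hV W h1
      (g.1.app _ ((D.TB f).preimage_le h1) (D.red0 ρ₀ ρ W (h1.trans hV) s))
    rw [PTensor.map_tmul, act_tmul g b W h1 s t ht, act_tmul _ b W h s t ht]
  | ha z w h1 h2 => rw [map_add, act_add, act_add, h1, h2]

/-- The action commutes with maps compatible with the reductions. -/
lemma map_act {V' : (XBase f B).Opens} {y' : FilSymp (XBase f B) V' r n}
    {ρ' : FilRed (baseMap f D.q) y' x.toFilSymp} {hV' : toX f B ⁻¹ᵁ U ≤ V'}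
    (W : (XBase f B).Opens) (h : W ≤ toX f B ⁻¹ᵁ U)
    (φ : Γ(y.E, W) →ₗ[Γ(XBase f B, W)] Γ(y'.E, W))
    (hφ : ∀ s, ρ'.red W (h.trans hV') (φ s) = ρ.red W (h.trans hV) s)
    (z : PTensor f x₀ (RingHom.ker D.q) j U) (s : Γ(y.E, W)) :
    φ (D.act ρ₀ ρ hU hV z W h s) = D.act ρ₀ ρ' hU hV' z W h (φ s) := by
  induction z using PTensor.induction with
  | h0 => rw [act_zero, act_zero, map_zero]
  | ht g b =>
    obtain ⟨t, ht⟩ := exists_red0_eq ρ₀ ρ hU hV W h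
      (g.1.app _ ((D.TB f).preimage_le h) (D.red0 ρ₀ ρ W (h.trans hV) s))
    have h1 : ∀ s, D.red0 ρ₀ ρ' W (h.trans hV') (φ s) = D.red0 ρ₀ ρ W (h.trans hV) s := fun s => by
      rw [red0_eq, hφ, red0_eq]
    rw [act_tmul g b W h s t ht, act_tmul g b W h _ (φ t) (by rw [h1, h1, ht]), map_smul]
  | ha z w h1 h2 => rw [act_add, act_add, map_add, h1, h2]

/-- The commutator of the action with a lift of `θ`. -/
lemma comm_act (W : (XBase f B).Opens) (h : W ≤ toX f B ⁻¹ᵁ U)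
    (θ : Γ(y.E, W) →ₗ[Γ(XBase f B, W)] Γ(y.E, W))
    (hθ : ∀ s, ρ.red W (h.trans hV) (θ s) = x.θ _ le_top (ρ.red W (h.trans hV) s))
    (z : PTensor f x₀ (RingHom.ker D.q) 0 U) (s : Γ(y.E, W)) :
    θ (D.act ρ₀ ρ hU hV z W h s) - D.act ρ₀ ρ hU hV z W h (θ s) =
      D.act ρ₀ ρ hU hV (PTensor.map f x₀ _ (bracket f x₀ U) z) W h s := by
  have h1 : ∀ s, D.red0 ρ₀ ρ W (h.trans hV) (θ s) =
      x₀.θ _ le_top (D.red0 ρ₀ ρ W (h.trans hV) s) := fun s => by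
    rw [red0_eq, hθ, ρ₀.red_θ]; rfl
  induction z using PTensor.induction with
  | h0 => simp
  | ht g b =>
    obtain ⟨t, ht⟩ := exists_red0_eq ρ₀ ρ hU hV W h
      (g.1.app _ ((D.TB f).preimage_le h) (D.red0 ρ₀ ρ W (h.trans hV) s))
    obtain ⟨t', ht'⟩ := exists_red0_eq ρ₀ ρ hU hV W h
      (g.1.app _ ((D.TB f).preimage_le h) (D.red0 ρ₀ ρ W (h.trans hV) (θ s)))
    rw [PTensor.map_tmul, act_tmul g b W h s t ht, act_tmul g b W h _ t' ht',
      act_tmul _ b W h s (θ t - t'), map_smul, smul_sub]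
    rw [map_sub, h1, ht, ht', h1]
    rfl
  | ha z w h1 h2 => rw [map_add, act_add, act_add, act_add, map_add, ← h1, ← h2]; abel

end SmallExt

/-! ### Faithfulness and image of the action -/

namespace SmallExt

variable {k : Type u} [Field k] {X : Scheme.{u}} {f : X ⟶ Spec (CommRingCat.of k)}
  {A B : Type u} [CommRing A] [Algebra k A] [CommRing B] [IsLocalRing B]
  [Algebra k B] {D : SmallExt k A B} {r n : ℕ} {x₀ : NilBundle X ⊤ r n}
  {x : NilBundle (XBase f A) ⊤ r n}
  {ρ₀ : Reduction (specialFibre f D.ε) x x₀} {V : (XBase f B).Opens}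
  {y : FilSymp (XBase f B) V r n} {ρ : FilRed (baseMap f D.q) y x.toFilSymp}
  [IsLocalRing A] [IsArtinianRing A] [IsArtinianRing B] [CharZero k]
  {U : X.Opens} {hU : IsAffineOpen U} {hV : toX f B ⁻¹ᵁ U ≤ V} {j : ℤ}

lemma act_sum_tmul (τ : D.LTriv ρ₀ ρ hV) (g : Fin D.a → PSec f x₀ j U) (W : (XBase f B).Opens)
    (h : W ≤ toX f B ⁻¹ᵁ U) (s : Γ(y.E, W)) :
    D.act ρ₀ ρ hU hV (∑ l, PTensor.tmul f x₀ _ (g l) (D.βI l)) W h s =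
      ∑ l, scalar (toSpec f B) W (D.βI l) • τ.σ W h ((g l).1.app _ ((D.TB f).preimage_le h)
        (D.red0 ρ₀ ρ W (h.trans hV) s)) := by
  rw [act_sum]
  exact Finset.sum_congr rfl fun l _ => act_tmul _ _ _ _ _ _ (τ.red0_σ h _)

/-- The action is faithful. -/
lemma act_injective {z w : PTensor f x₀ (RingHom.ker D.q) j U}
    (hzw : ∀ s, D.act ρ₀ ρ hU hV z _ le_rfl s = D.act ρ₀ ρ hU hV w _ le_rfl s) : z = w := by
  rw [← sub_eq_zero]
  obtain ⟨g, hg⟩ := PTensor.exists_eq_sum D.βI (z - w)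
  let τ := Classical.choice (D.nonempty_LTriv ρ₀ ρ (isAffineOpen_toX hU) hV)
  -- Equality over the affine open passes to all smaller open sets; this is needed because the
  -- components of `z - w` are families over all of them.
  have h1 : D.act ρ₀ ρ hU hV z = D.act ρ₀ ρ hU hV w :=
    IsNat.ext_of_affine (y.locFree.restrict hV) (isAffineOpen_toX hU) (act_nat z) (act_nat w) hzw
  rw [hg]
  refine Finset.sum_eq_zero fun l _ => ?_
  have hgl : g l = 0 := by
    refine Subtype.ext (funext fun ⟨W', hW'⟩ => LinearMap.ext fun s => ?_)
    obtain ⟨W, rfl⟩ := (D.TB f).exists_preimage_eq W'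
    have h := (D.TB f).le_preimage hW'
    have h2 : D.act ρ₀ ρ hU hV (z - w) W h (τ.σ W h s) = 0 := by
      rw [act_sub, h1, sub_self]
    rw [hg, act_sum_tmul τ, τ.red0_σ] at h2
    have h3 : ∑ l, scalar (toSpec f B) W (D.β l) • τ.σ W h
        (Sum.elim (fun l => (g l).1.app _ hW' s) 0 l) = 0 := by
      rw [Fintype.sum_sum_type]
      simpa [D.β_inl] using h2
    exact congrFun (Triv.eq_zero_of_sum_aux (hV := hV) D.β τ.σ τ.nat τ.form_eq h h3) (Sum.inl l)
  rw [hgl]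
  exact TensorProduct.zero_tmul _ _

/-- Every filtered skew endomorphism of a lift that vanishes on the reduction comes from a section
of `F_h^j Hom_s(E₀, E₀) ⊗ I`. -/
theorem exists_act_eq (hU : IsAffineOpen U) (hV : toX f B ⁻¹ᵁ U ≤ V)
    (δ : Fam y.E y.E (toX f B ⁻¹ᵁ U)) (hδ : IsNat δ)
    (hred : ∀ W h s, ρ.red W (h.trans hV) (δ W h s) = 0)
    (hform : ∀ W h s t, y.form W (h.trans hV) s (δ W h t) = - y.form W (h.trans hV) (δ W h s) t)
    (hfil : ∀ i W h, ∀ s ∈ y.fil i W (h.trans hV), δ W h s ∈ y.fil (i + j) W (h.trans hV)) :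
    ∃ z : PTensor f x₀ (RingHom.ker D.q) j U, ∀ W h s, D.act ρ₀ ρ hU hV z W h s = δ W h s := by
  let τ := Classical.choice (D.nonempty_LTriv ρ₀ ρ (isAffineOpen_toX hU) hV)
  -- The coordinates of `δ` on sections of E₀. Those along the basis of I are the components of the
  -- tensor to be found, and the others vanish because `δ` is zero on the reduction.
  let c : ∀ (l : Fin D.a ⊕ Fin D.b) (W : (XBase f B).Opens) (_ : W ≤ toX f B ⁻¹ᵁ U),
      (Γ(x₀.E, (D.TB f).i ⁻¹ᵁ W) →ₗ[Γ(X, (D.TB f).i ⁻¹ᵁ W)] Γ(x₀.E, (D.TB f).i ⁻¹ᵁ W)) :=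
    fun l W h =>
      { toFun := fun s => τ.coord D.β h (δ W h (τ.σ W h s)) l
        map_add' := fun s t => by rw [map_add, map_add, map_add, Pi.add_apply]
        map_smul' := fun a s => by
          rw [map_smulₛₗ, map_smul, Triv.coord_pr_smul, Pi.smul_apply, RingHom.id_apply] }
  have hc : ∀ l W h s, c l W h s = τ.coord D.β h (δ W h (τ.σ W h s)) l := fun _ _ _ _ => rfl
  have happ : ∀ l (W : (XBase f B).Opens) (h : W ≤ toX f B ⁻¹ᵁ U) h',
      ((D.TB f).fam (c l)).app ((D.TB f).i ⁻¹ᵁ W) h' = c l W h := fun l W h h' =>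
    (D.TB f).fam_app (c l) W h h'
  let g : Fin D.a → PSec f x₀ j U := fun l => ⟨(D.TB f).fam (c (Sum.inl l)), by
    refine ⟨?_, ?_, ?_⟩
    · intro W W' h h' s
      obtain ⟨W, rfl⟩ := (D.TB f).exists_preimage_eq W
      obtain ⟨W', rfl⟩ := (D.TB f).exists_preimage_eq W'
      have h1 := (D.TB f).le_preimage h
      have h2 := (D.TB f).le_of_preimage_le h'
      rw [happ _ W h1, happ _ W' (h2.trans h1), hc, hc, ← τ.nat W W' h1 h2, ← hδ _ _ h1 h2,
        Triv.coord_res]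
    · intro W h s t
      obtain ⟨W, rfl⟩ := (D.TB f).exists_preimage_eq W
      have h1 := (D.TB f).le_preimage h
      rw [happ _ W h1]
      -- Self-adjointness of the components is read off by comparing coefficients of the basis.
      have h2 := hform W h1 (τ.σ W h1 s) (τ.σ W h1 t)
      rw [← τ.sum_coord D.β h1 (δ W h1 (τ.σ W h1 t)), ← τ.sum_coord D.β h1 (δ W h1 (τ.σ W h1 s))]
        at h2
      simp only [map_sum, map_smul, LinearMap.sum_apply, LinearMap.smul_apply, τ.form_eq,
        smul_eq_mul, ← Finset.sum_neg_distrib, ← mul_neg, ← map_neg] at h2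
      exact (congrFun ((D.TB f).sum_injective D.β h2) (Sum.inl l)).trans (map_neg _ _)
    · intro i W h s hs
      obtain ⟨W, rfl⟩ := (D.TB f).exists_preimage_eq W
      have h1 := (D.TB f).le_preimage h
      rw [happ _ W h1]
      exact (τ.mem_fil_iff D.β h1 _ _).mp (hfil i W h1 _ (τ.fil_mem i W h1 s hs)) _⟩
  refine ⟨∑ l, PTensor.tmul f x₀ _ (g l) (D.βI l), fun W h s => ?_⟩
  have key : D.act ρ₀ ρ hU hV (∑ l, PTensor.tmul f x₀ _ (g l) (D.βI l)) W h = δ W h := by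
    -- Both sides are linear over functions on X_B, so they are compared on the spanning sections σ
    -- s.
    refine LinearMap.ext_on (τ.span W h) ?_
    rintro _ ⟨s, rfl⟩
    rw [act_sum_tmul τ, τ.red0_σ, τ.eq_sum_of_red_eq_zero h (hred W h (τ.σ W h s))]
    refine Finset.sum_congr rfl fun l _ => ?_
    change _ • τ.σ W h (((D.TB f).fam (c (Sum.inl l))).app _ _ s) = _
    rw [happ _ W h, hc]
  rw [key]

/-- The decomposition of `z` and the lifted sections in `Acts` are arbitrary; by `act_tmul` they do
not affect the result. -/
theorem acts_iff (hU : IsAffineOpen U) {V : (XBase f B).Opens} (y : LiftOn (baseMap f D.q) x V)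
    (hV : toX f B ⁻¹ᵁ U ≤ V) (z : PTensor f x₀ (RingHom.ker D.q) j U)
    (δ : Γ(y.obj.E, toX f B ⁻¹ᵁ U) → Γ(y.obj.E, toX f B ⁻¹ᵁ U)) :
    Acts f D.q ρ₀ y U hV z δ ↔ ∀ s, δ s = D.act ρ₀ y.ρ.toFilRed hU hV z _ le_rfl s := by
  constructor
  · rintro ⟨m, g, b, rfl, h⟩ s
    obtain ⟨t, ht, e⟩ := h s
    rw [e, act_sum]
    refine Finset.sum_congr rfl fun l _ => ?_
    have ht' : D.red0 ρ₀ y.ρ.toFilRed _ (le_rfl.trans hV) (t l) =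
      (g l).1.app _ ((D.TB f).preimage_le le_rfl) (D.red0 ρ₀ y.ρ.toFilRed _ (le_rfl.trans hV) s) :=
      ht l
    exact (act_tmul (g l) (b l) _ le_rfl s (t l) ht').symm
  · intro h
    obtain ⟨g, hg⟩ := PTensor.exists_eq_sum D.βI z
    refine ⟨D.a, g, D.βI, hg, fun s => ?_⟩
    let τ := Classical.choice (D.nonempty_LTriv ρ₀ y.ρ.toFilRed (isAffineOpen_toX hU) hV)
    refine ⟨fun l => τ.σ _ le_rfl ((g l).1.app _ ((D.TB f).preimage_le le_rfl)
      (D.red0 ρ₀ y.ρ.toFilRed _ (le_rfl.trans hV) s)), fun l => ?_, ?_⟩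
    · exact τ.red0_σ le_rfl _
    · rw [h, hg, act_sum_tmul τ]

/-- Sections that vanish on the reduction are orthogonal. -/
lemma form_eq_zero_of_red_eq_zero (ρ₀ : Reduction (specialFibre f D.ε) x x₀)
    (W : (XBase f B).Opens) (h : W ≤ V) {s t : Γ(y.E, W)}
    (hs : ρ.red W h s = 0) (ht : ρ.red W h t = 0) : y.form W h s t = 0 := by
  refine eq_of_locallyO fun z hz => ?_
  obtain ⟨_, ⟨W', hW', rfl⟩, hz', hle⟩ :=
    (XBase f B).isBasis_affineOpens.exists_subset_of_mem_open (show z ∈ (W : Set _) from hz) W.2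
  have hle' : W' ≤ W := hle
  refine ⟨W', hle', hz', ?_⟩
  let τ := Classical.choice (D.nonempty_LTriv ρ₀ ρ hW' (hle'.trans h))
  rw [map_zero, y.form_res]
  refine τ.form_eq_zero le_rfl ?_ ?_
  · rw [ρ.red_res W W' h hle', hs, map_zero]
  · rw [ρ.red_res W W' h hle', ht, map_zero]

end SmallExt

/-! ## Isomorphisms of lifts and changes of `θ` -/

section FilIso

variable {Y Y' : Scheme.{u}} {r n : ℕ} {i : Y ⟶ Y'} {x : NilBundle Y ⊤ r n}
  {V₁ V₂ V₃ V₀ V₀' : Y'.Opens} {y₁ : LiftOn i x V₁} {y₂ : LiftOn i x V₂} {y₃ : LiftOn i x V₃}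
  {h₁ : V₀ ≤ V₁} {h₂ : V₀ ≤ V₂} {h₃ : V₀ ≤ V₃}

/-- The inverse of an isomorphism. -/
def FilIso.symm (φ : FilIso y₁ y₂ V₀ h₁ h₂) : FilIso y₂ y₁ V₀ h₂ h₁ where
  app W h := (φ.app W h).symm
  nat W W' h h' s := by
    obtain ⟨t, rfl⟩ := (φ.app W h).surjective s
    have := φ.nat W W' h h' t
    simp only [LinearEquiv.coe_coe] at this ⊢
    simp [this]
  form_eq W h s t := by rw [← φ.form_eq W h]; simp
  fil_iff j W h s := by rw [← φ.fil_iff j W h]; simp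
  red_eq W h s := by rw [← φ.red_eq W h]; simp

/-- The composition of isomorphisms. -/
def FilIso.trans (φ : FilIso y₁ y₂ V₀ h₁ h₂) (ψ : FilIso y₂ y₃ V₀ h₂ h₃) :
    FilIso y₁ y₃ V₀ h₁ h₃ where
  app W h := (φ.app W h).trans (ψ.app W h)
  nat W W' h h' s := by
    have h1 := φ.nat W W' h h' s
    have h2 := ψ.nat W W' h h' (φ.app W h s)
    simp only [LinearEquiv.coe_coe, LinearEquiv.trans_apply] at h1 h2 ⊢
    rw [h2, h1]
  form_eq W h s t := by rw [← φ.form_eq W h, ← ψ.form_eq W h]; rfl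
  fil_iff j W h s := by rw [← φ.fil_iff j W h, ← ψ.fil_iff j W h]; rfl
  red_eq W h s := by rw [← φ.red_eq W h, ← ψ.red_eq W h]; rfl

/-- The restriction of an isomorphism. -/
def FilIso.restrict (φ : FilIso y₁ y₂ V₀ h₁ h₂) (h : V₀' ≤ V₀) :
    FilIso y₁ y₂ V₀' (h.trans h₁) (h.trans h₂) where
  app W hW := φ.app W (hW.trans h)
  nat W W' hW h' s := φ.nat W W' (hW.trans h) h' s
  form_eq W hW s t := φ.form_eq W (hW.trans h) s t
  fil_iff j W hW s := φ.fil_iff j W (hW.trans h) s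
  red_eq W hW s := φ.red_eq W (hW.trans h) s

/-- The identity. -/
def FilIso.refl (y : LiftOn i x V₁) (h₁ : V₀ ≤ V₁) : FilIso y y V₀ h₁ h₁ where
  app _ _ := LinearEquiv.refl _ _
  nat _ _ _ _ _ := rfl
  form_eq _ _ _ _ := rfl
  fil_iff _ _ _ _ := Iff.rfl
  red_eq _ _ _ := rfl

@[simp] lemma FilIso.symm_app (φ : FilIso y₁ y₂ V₀ h₁ h₂) (W : Y'.Opens) (h : W ≤ V₀) :
    φ.symm.app W h = (φ.app W h).symm := rfl

@[simp] lemma FilIso.trans_app (φ : FilIso y₁ y₂ V₀ h₁ h₂) (ψ : FilIso y₂ y₃ V₀ h₂ h₃)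
    (W : Y'.Opens) (h : W ≤ V₀) (s : Γ(y₁.obj.E, W)) :
    (φ.trans ψ).app W h s = ψ.app W h (φ.app W h s) := rfl

lemma FilIso.nat' (φ : FilIso y₁ y₂ V₀ h₁ h₂) {W W' : Y'.Opens} (h : W ≤ V₀) (h' : W' ≤ W)
    (s : Γ(y₁.obj.E, W)) : res y₂.obj.E h' (φ.app W h s) =
      φ.app W' (h'.trans h) (res y₁.obj.E h' s) :=
  φ.nat W W' h h' s

end FilIso

lemma IsNat.pow {Y : Scheme.{u}} {E : Y.Modules} {V : Y.Opens} {φ : Fam E E V} (hφ : IsNat φ)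
    (m : ℕ) : IsNat (fun W h => (φ W h ^ m : Module.End Γ(Y, W) Γ(E, W))) := by
  intro W W' h h' s
  induction m generalizing s with
  | zero => rfl
  | succ m ih =>
    simp only [pow_succ, Module.End.mul_apply] at ih ⊢
    rw [ih, hφ _ _ h h']

lemma pow_mem_fil {Y : Scheme.{u}} {V W : Y.Opens} {r n : ℕ} {y : FilSymp Y V r n} (h : W ≤ V)
    {θ : Γ(y.E, W) →ₗ[Γ(Y, W)] Γ(y.E, W)}
    (hθ : ∀ i, ∀ s ∈ y.fil i W h, θ s ∈ y.fil (i - 2) W h) (m : ℕ) (i : ℤ) (s : Γ(y.E, W))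
    (hs : s ∈ y.fil i W h) : (θ ^ m) s ∈ y.fil (i - 2 * m) W h := by
  induction m generalizing i s with
  | zero => simpa using hs
  | succ m ih =>
    rw [pow_succ, Module.End.mul_apply]
    have := ih _ _ (hθ i s hs)
    convert this using 2
    push_cast; ring

/-! ### Local uniqueness of lifts, and lifts built from a lift of θ -/

namespace SmallExt

variable {k : Type u} [Field k] {X : Scheme.{u}} {f : X ⟶ Spec (CommRingCat.of k)}
  {A B : Type u} [CommRing A] [Algebra k A] [CommRing B] [IsLocalRing B]
  [Algebra k B] {D : SmallExt k A B} {r n : ℕ} {x₀ : NilBundle X ⊤ r n}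
  {x : NilBundle (XBase f A) ⊤ r n}
  (ρ₀ : Reduction (specialFibre f D.ε) x x₀) {V : (XBase f B).Opens}
  {y : FilSymp (XBase f B) V r n} {ρ : FilRed (baseMap f D.q) y x.toFilSymp}
  [IsLocalRing A] [IsArtinianRing A] [IsArtinianRing B] [CharZero k]

include ρ₀ in
/-- The filtered symplectic bundles underlying two lifts are isomorphic on affine opens. -/
theorem nonempty_filIso {V₀ V₁ V₂ : (XBase f B).Opens} (hV₀ : IsAffineOpen V₀)
    (y₁ : LiftOn (baseMap f D.q) x V₁) (y₂ : LiftOn (baseMap f D.q) x V₂) (h₁ : V₀ ≤ V₁)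
    (h₂ : V₀ ≤ V₂) : Nonempty (FilIso y₁ y₂ V₀ h₁ h₂) := by
  -- Both lifts are trivialized over the same trivialization of `x`, so the map matching their
  -- coordinates is compatible with the reductions.
  obtain ⟨τA, -⟩ := D.exists_trivA ρ₀ (D.isAffineOpen_preimage f hV₀)
  have key : ∀ {V₁ V₂ : (XBase f B).Opens} (y₁ : LiftOn (baseMap f D.q) x V₁)
      (y₂ : LiftOn (baseMap f D.q) x V₂) (h₁ : V₀ ≤ V₁) (h₂ : V₀ ≤ V₂)
      (τ₁ : Triv (D.TB f) x₀.toFilSymp y₁.obj.toFilSymp h₁)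
      (τ₂ : Triv (D.TB f) x₀.toFilSymp y₂.obj.toFilSymp h₂) (W : (XBase f B).Opens) (h : W ≤ V₀),
      ∃ ψ : Γ(y₁.obj.E, W) →ₗ[Γ(XBase f B, W)] Γ(y₂.obj.E, W), ∀ s, ψ s =
        ∑ l, scalar (toSpec f B) W (D.β l) • τ₂.σ W h (τ₁.coord D.β h s l) := by
    intro V₁ V₂ y₁ y₂ h₁ h₂ τ₁ τ₂ W h
    let ψ : Γ(y₁.obj.E, W) →+ Γ(y₂.obj.E, W) :=
      { toFun := fun s => ∑ l, scalar (toSpec f B) W (D.β l) • τ₂.σ W h (τ₁.coord D.β h s l)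
        map_zero' := by simp
        map_add' := fun s t => by simp [Finset.sum_add_distrib] }
    have hψ : ∀ (a : Γ(XBase f B, W)) c, ψ (a • τ₁.σ W h c) = a • τ₂.σ W h c := by
      intro a c
      have e : a • τ₁.σ W h c =
          ∑ l, scalar (toSpec f B) W (D.β l) • τ₁.σ W h ((D.TB f).coord D.β W a l • c) := by
        conv_lhs => rw [← (D.TB f).sum_coord D.β W a, Finset.sum_smul]
        exact Finset.sum_congr rfl fun l _ => by rw [map_smulₛₗ, mul_smul]
      change ∑ l, scalar (toSpec f B) W (D.β l) • τ₂.σ W h (τ₁.coord D.β h _ l) = _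
      rw [e, τ₁.coord_sum]
      conv_rhs => rw [← (D.TB f).sum_coord D.β W a, Finset.sum_smul]
      exact Finset.sum_congr rfl fun l _ => by rw [map_smulₛₗ, mul_smul]
    refine ⟨{ toFun := ψ, map_add' := map_add ψ, map_smul' := fun a s => ?_ }, fun s => rfl⟩
    conv_lhs => rw [← τ₁.sum_coord D.β h s, Finset.smul_sum, map_sum]
    conv_rhs => rw [← τ₁.sum_coord D.β h s, map_sum, Finset.smul_sum]
    exact Finset.sum_congr rfl fun l _ => by rw [smul_smul, hψ, hψ, mul_smul]; rfl
  obtain ⟨τ₁, hτ₁⟩ := D.exists_trivB hV₀ h₁ y₁.ρ.toFilRed τA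
  obtain ⟨τ₂, hτ₂⟩ := D.exists_trivB hV₀ h₂ y₂.ρ.toFilRed τA
  choose ψ hψ using key y₁ y₂ h₁ h₂ τ₁ τ₂
  choose ψ' hψ' using key y₂ y₁ h₂ h₁ τ₂ τ₁
  refine ⟨{ app := fun W h => LinearEquiv.ofLinearMap (ψ W h) (ψ' W h) ?_ ?_
            nat := ?_, form_eq := ?_, fil_iff := ?_, red_eq := ?_ }⟩
  · ext s
    rw [LinearMap.comp_apply, hψ, hψ', τ₁.coord_sum, τ₂.sum_coord, LinearMap.id_apply]
  · ext s
    rw [LinearMap.comp_apply, hψ', hψ, τ₂.coord_sum, τ₁.sum_coord, LinearMap.id_apply]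
  · intro W W' h h' s
    change res _ h' (ψ W h s) = ψ W' _ (res _ h' s)
    rw [hψ, hψ, map_sum]
    refine Finset.sum_congr rfl fun l _ => ?_
    rw [res_smul, resO_scalar', τ₂.nat, τ₁.coord_res D.β h h']
  · intro W h s t
    change y₂.obj.form W _ (ψ W h s) (ψ W h t) = _
    rw [hψ, hψ]
    conv_rhs => rw [← τ₁.sum_coord D.β h s, ← τ₁.sum_coord D.β h t]
    simp only [map_sum, map_smul, LinearMap.sum_apply, LinearMap.smul_apply, τ₁.form_eq, τ₂.form_eq]
  · intro j W h s
    change ψ W h s ∈ _ ↔ _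
    rw [τ₂.mem_fil_iff D.β h, τ₁.mem_fil_iff D.β h, hψ, τ₂.coord_sum]
  · intro W h s
    change y₂.ρ.red W _ (ψ W h s) = _
    rw [hψ]
    conv_rhs => rw [← τ₁.sum_coord D.β h s]
    rw [map_sum, map_sum]
    refine Finset.sum_congr rfl fun l _ => ?_
    rw [y₁.ρ.red_smul, y₂.ρ.red_smul]
    exact congrArg _ ((hτ₂ W h _).trans (hτ₁ W h _).symm)

/-- A lift of a filtered symplectic bundle with a lift of `θ`. -/
def mkLift (ρ : FilRed (baseMap f D.q) y x.toFilSymp) (θ : Fam y.E y.E V) (θ_nat : IsNat θ)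
    (θ_adj : ∀ (W : (XBase f B).Opens) (h : W ≤ V) (s t : Γ(y.E, W)),
      y.form W h s (θ W h t) = -y.form W h (θ W h s) t)
    (θ_fil : ∀ (i : ℤ) (W : (XBase f B).Opens) (h : W ≤ V), ∀ s ∈ y.fil i W h,
      θ W h s ∈ y.fil (i - 2) W h)
    (θ_red : ∀ (W : (XBase f B).Opens) (h : W ≤ V) (s : Γ(y.E, W)),
      ρ.red W h (θ W h s) = x.θ _ le_top (ρ.red W h s)) : LiftOn (baseMap f D.q) x V where
  obj :=
    { y with
      θ := θ
      θ_nat := θ_nat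
      θ_adj := θ_adj
      θ_pow := fun W h => by
        refine LinearMap.ext fun s => ?_
        -- θ^n takes E = F^{n-1} to F^{-n-1} = 0.
        have h1 := pow_mem_fil h (fun i => θ_fil i W h) n (n - 1) s
          (by rw [y.fil_top _ le_rfl]; trivial)
        rw [y.fil_bot _ (by omega), Submodule.mem_bot] at h1
        exact h1
      θ_fil := θ_fil
      θ_inj := fun i W h s hs hθs => by
        refine y.fil_local _ W h s fun z hz => ?_
        obtain ⟨_, ⟨W', hW', rfl⟩, hz', hle⟩ :=
          (XBase f B).isBasis_affineOpens.exists_subset_of_mem_open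
            (show z ∈ (W : Set _) from hz) W.2
        have hle' : W' ≤ W := hle
        refine ⟨W', hle', hz', ?_⟩
        have h' := hle'.trans h
        have hs' := y.fil_res _ W W' h hle' s hs
        have hθs' := y.fil_res _ W W' h hle' _ hθs
        rw [θ_nat.pow i W W' h hle' s] at hθs'
        generalize res y.E hle' s = s at hs' hθs'
        let τ := Classical.choice (D.nonempty_LTriv ρ₀ ρ hW' h')
        have hredpow : ∀ s, ρ.red W' h' ((θ W' h' ^ i) s) =
            (x.θ _ le_top ^ i) (ρ.red W' h' s) := by
          intro s
          have : ∀ m : ℕ, ρ.red W' h' ((θ W' h' ^ m) s) = (x.θ _ le_top ^ m) (ρ.red W' h' s) := by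
            intro m
            induction m with
            | zero => rfl
            | succ m ih =>
              rw [pow_succ', pow_succ', Module.End.mul_apply, Module.End.mul_apply, θ_red, ih]
          exact this i
        have hred0pow : ∀ s, D.red0 ρ₀ ρ W' h' ((θ W' h' ^ i) s) =
            (x₀.θ _ le_top ^ i) (D.red0 ρ₀ ρ W' h' s) := by
          intro s
          rw [red0_eq, hredpow]
          have : ∀ (m : ℕ) (t : Γ(x.E, baseMap f D.q ⁻¹ᵁ W')), ρ₀.red _ le_top ((x.θ _ le_top ^ m) t) =
              (x₀.θ _ le_top ^ m) (ρ₀.red _ le_top t) := by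
            intro m t
            induction m with
            | zero => rfl
            | succ m ih =>
              rw [pow_succ', pow_succ', Module.End.mul_apply, Module.End.mul_apply, ρ₀.red_θ, ih]
          exact this i _
        have hc := (τ.mem_fil_iff D.β le_rfl _ s).mp hs'
        have h1 : ρ.red W' h' s ∈ x.fil ((i : ℤ) - 1) _ le_top := by
          refine x.θ_inj i _ _ _ (ρ.red_fil _ _ _ _ hs') ?_
          rw [← hredpow]
          exact ρ.red_fil _ _ _ _ hθs'
        -- Injectivity for `x` takes care of the coordinates outside I.
        have h2 : ∀ l, τ.coord D.β le_rfl s (Sum.inr l) ∈ x₀.fil ((i : ℤ) - 1) _ le_top := by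
          intro l
          have h3 := (τ.τA.mem_fil_iff D.α ((baseMap f D.q).preimage_mono le_rfl) _ _).mp h1 l
          rw [τ.τA.coord_eq D.α _ (τ.red_eq_sum le_rfl s)] at h3
          exact h3
        have hsum := τ.sum_coord D.β le_rfl s
        rw [Fintype.sum_sum_type] at hsum
        set s₁ := ∑ l, scalar (toSpec f B) W' (D.β (Sum.inl l)) •
          τ.σ W' le_rfl (τ.coord D.β le_rfl s (Sum.inl l)) with hs₁
        set s₂ := ∑ l, scalar (toSpec f B) W' (D.β (Sum.inr l)) •
          τ.σ W' le_rfl (τ.coord D.β le_rfl s (Sum.inr l)) with hs₂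
        have h4 : s₂ ∈ y.fil ((i : ℤ) - 1) W' h' := Submodule.sum_mem _ fun l _ =>
          Submodule.smul_mem _ _ (τ.fil_mem _ _ _ _ (h2 l))
        -- The part `s₂` is already in F^{i-1}, so θ^i takes it to F^{-i-1} and it can be split off.
        have h5 : (θ W' h' ^ i) s₁ ∈ y.fil (-(i : ℤ) - 1) W' h' := by
          have h6 := pow_mem_fil h' (fun i => θ_fil i W' h') i _ s₂ h4
          rw [show (i : ℤ) - 1 - 2 * i = -(i : ℤ) - 1 by ring] at h6
          rw [← hsum, map_add] at hθs'
          exact (Submodule.add_mem_iff_left _ h6).mp hθs'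
        -- On the part with coefficients in I, θ^i acts on coordinates through θ₀^i, so injectivity
        -- for `x₀` takes care of the rest.
        have h7 : (θ W' h' ^ i) s₁ = ∑ l, scalar (toSpec f B) W' (D.β l) • τ.σ W' le_rfl
            (Sum.elim (fun l => (x₀.θ _ le_top ^ i) (τ.coord D.β le_rfl s (Sum.inl l))) 0 l) := by
          rw [Fintype.sum_sum_type, hs₁, map_sum]
          simp only [Sum.elim_inl, Sum.elim_inr, Pi.zero_apply, map_zero, smul_zero,
            Finset.sum_const_zero, add_zero]
          refine Finset.sum_congr rfl fun l _ => ?_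
          rw [map_smul, τ.smul_eq le_rfl (D.β_inl_mem l)]
          congr 2
          exact (hred0pow _).trans (congrArg _ (τ.red0_σ le_rfl _))
        rw [τ.mem_fil_iff D.β le_rfl, h7, τ.coord_sum] at h5
        rw [← hsum]
        refine add_mem (Submodule.sum_mem _ fun l _ => Submodule.smul_mem _ _
          (τ.fil_mem _ _ _ _ ?_)) h4
        exact x₀.θ_inj i _ _ _ (hc _) (h5 (Sum.inl l)) }
  ρ := FilRed.toReduction (y := { y with θ := θ, .. }) ρ θ_red

end SmallExt

/-! ## The bundle `E₀ ⊗ S` -/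

section Model

variable {k : Type u} [Field k] {X : Scheme.{u}} {f : X ⟶ Spec (CommRingCat.of k)}
  {S : Type u} [CommRing S] [Algebra k S] (T : Thick f S) [IsLocalRing S] [IsArtinianRing S]
  {r n : ℕ} (x₀ : FilSymp X ⊤ r n)

namespace Thick

/-- Functions on `X_S` as an algebra over functions on `X`. -/
@[reducible] def algebra (W : (XBase f S).Opens) : Algebra Γ(X, T.i ⁻¹ᵁ W) Γ(XBase f S, W) :=
  (T.pr W).toAlgebra

attribute [local instance] Thick.algebra

lemma smul_def (W : (XBase f S).Opens) (a : Γ(X, T.i ⁻¹ᵁ W)) (b : Γ(XBase f S, W)) :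
    a • b = T.pr W a * b := rfl

/-- Transport of a family indexed by the open subsets of `X_S` to those of `X`. -/
def transport {P : X.Opens → Type*} (φ : ∀ W : (XBase f S).Opens, P (T.i ⁻¹ᵁ W)) (U : X.Opens) :
    P U :=
  T.preimage_toX U ▸ φ (toX f S ⁻¹ᵁ U)

lemma transport_preimage {P : X.Opens → Type*} (φ : ∀ W : (XBase f S).Opens, P (T.i ⁻¹ᵁ W))
    (W : (XBase f S).Opens) : T.transport φ (T.i ⁻¹ᵁ W) = φ W := by
  have key : ∀ (W₂ : (XBase f S).Opens) (e : T.i ⁻¹ᵁ W₂ = T.i ⁻¹ᵁ W),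
      (e ▸ φ W₂ : P (T.i ⁻¹ᵁ W)) = φ W := by
    intro W₂ e
    obtain rfl := T.preimage_injective e
    rfl
  exact key _ _

/-- The basis of functions on `X_S` over functions on `X`. -/
def basisO {κ : Type} [Fintype κ] (β : Module.Basis κ k S) (W : (XBase f S).Opens) :
    Module.Basis κ Γ(X, T.i ⁻¹ᵁ W) Γ(XBase f S, W) :=
  .ofEquivFun
    { toFun := T.coord β W
      map_add' := map_add _
      map_smul' := fun a b => funext fun l => T.coord_pr_mul β W a b l
      invFun := fun c => ∑ l, scalar (toSpec f S) W (β l) * T.pr W (c l)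
      left_inv := fun a => T.sum_coord β W a
      right_inv := fun c => T.coord_eq β W rfl }

lemma basisO_apply {κ : Type} [Fintype κ] (β : Module.Basis κ k S) (W : (XBase f S).Opens) (l : κ) :
    T.basisO β W l = scalar (toSpec f S) W (β l) := by
  classical
  rw [basisO, Module.Basis.coe_ofEquivFun]
  change ∑ l', scalar (toSpec f S) W (β l') * T.pr W ((Pi.single l 1 : κ → _) l') = _
  rw [Finset.sum_eq_single l]
  · simp
  · intro b _ hb; simp [hb]
  · simp

/-- The sections of `E₀ ⊗ S`. -/
abbrev mObj (W : (XBase f S).Opens) : Type u := Γ(XBase f S, W) ⊗[Γ(X, T.i ⁻¹ᵁ W)] Γ(x₀.E, T.i ⁻¹ᵁ W)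

/-- Sections of `E₀` as sections of `E₀ ⊗ S`. -/
def mσ (W : (XBase f S).Opens) : Γ(x₀.E, T.i ⁻¹ᵁ W) →ₛₗ[T.pr W] T.mObj x₀ W where
  toFun s := 1 ⊗ₜ s
  map_add' s t := TensorProduct.tmul_add _ _ _
  map_smul' a s := by
    rw [← TensorProduct.smul_tmul, TensorProduct.smul_tmul', smul_eq_mul, mul_one, smul_def, mul_one]

lemma smul_mσ (W : (XBase f S).Opens) (a : Γ(XBase f S, W)) (s : Γ(x₀.E, T.i ⁻¹ᵁ W)) :
    a • T.mσ x₀ W s = a ⊗ₜ s := by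
  change a • (1 ⊗ₜ s) = _
  rw [TensorProduct.smul_tmul', smul_eq_mul, mul_one]

/-- Restriction of sections of `E₀ ⊗ S`. -/
def mRes {W W' : (XBase f S).Opens} (h : W' ≤ W) : T.mObj x₀ W →+ T.mObj x₀ W' :=
  TensorProduct.liftAddHom
    { toFun := fun a =>
        { toFun := fun s => resO _ h a ⊗ₜ res x₀.E (T.i.preimage_mono h) s
          map_zero' := by rw [map_zero, TensorProduct.tmul_zero]
          map_add' := fun s t => by rw [map_add, TensorProduct.tmul_add] }
      map_zero' := by ext s; simp
      map_add' := fun a b => by ext s; simp [TensorProduct.add_tmul] }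
    (fun a b s => by
      change resO _ h (T.pr W a * b) ⊗ₜ _ = resO _ h b ⊗ₜ res x₀.E _ (a • s)
      rw [res_smul, ← TensorProduct.smul_tmul, map_mul, resO_pr, smul_def])

lemma mRes_tmul {W W' : (XBase f S).Opens} (h : W' ≤ W) (a : Γ(XBase f S, W))
    (s : Γ(x₀.E, T.i ⁻¹ᵁ W)) : T.mRes x₀ h (a ⊗ₜ s) =
      resO _ h a ⊗ₜ res x₀.E (T.i.preimage_mono h) s := rfl

lemma mRes_smul {W W' : (XBase f S).Opens} (h : W' ≤ W) (a : Γ(XBase f S, W))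
    (s : T.mObj x₀ W) : T.mRes x₀ h (a • s) = resO _ h a • T.mRes x₀ h s := by
  induction s using TensorProduct.induction_on with
  | zero => simp
  | tmul b s =>
    rw [TensorProduct.smul_tmul', mRes_tmul, mRes_tmul, TensorProduct.smul_tmul', smul_eq_mul,
      map_mul, smul_eq_mul]
  | add s t hs ht => rw [smul_add, map_add, map_add, hs, ht, smul_add]

lemma mRes_mσ {W W' : (XBase f S).Opens} (h : W' ≤ W) (s : Γ(x₀.E, T.i ⁻¹ᵁ W)) :
    T.mRes x₀ h (T.mσ x₀ W s) = T.mσ x₀ W' (res x₀.E (T.i.preimage_mono h) s) := by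
  change T.mRes x₀ h (1 ⊗ₜ s) = 1 ⊗ₜ _
  rw [mRes_tmul, map_one]

section Coord

variable {κ : Type} [Fintype κ] [DecidableEq κ] (β : Module.Basis κ k S) {W : (XBase f S).Opens}

/-- The coordinates of a section of `E₀ ⊗ S`. -/
def mcoord (W : (XBase f S).Opens) : T.mObj x₀ W →+ (κ → Γ(x₀.E, T.i ⁻¹ᵁ W)) where
  toFun t := TensorProduct.equivFinsuppOfBasisLeft (T.basisO β W) t
  map_zero' := by simp
  map_add' s t := by simp

lemma sum_mcoord (t : T.mObj x₀ W) :
    ∑ l, scalar (toSpec f S) W (β l) • T.mσ x₀ W (T.mcoord x₀ β W t l) = t := by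
  have h := (TensorProduct.equivFinsuppOfBasisLeft (N := Γ(x₀.E, T.i ⁻¹ᵁ W)) (T.basisO β W)).symm_apply_apply t
  rw [TensorProduct.equivFinsuppOfBasisLeft_symm_apply, Finsupp.sum_fintype] at h
  · rw [← h]
    refine Finset.sum_congr rfl fun l _ => ?_
    rw [smul_mσ, basisO_apply, h]
    rfl
  · simp

lemma mcoord_smul (a : Γ(XBase f S, W)) (s : Γ(x₀.E, T.i ⁻¹ᵁ W)) (l : κ) :
    T.mcoord x₀ β W (a • T.mσ x₀ W s) l = T.coord β W a l • s := by
  rw [smul_mσ]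
  change TensorProduct.equivFinsuppOfBasisLeft (T.basisO β W) (a ⊗ₜ s) l = _
  rw [TensorProduct.equivFinsuppOfBasisLeft_apply_tmul_apply]
  rfl

@[simp] lemma mcoord_sum (c : κ → Γ(x₀.E, T.i ⁻¹ᵁ W)) :
    T.mcoord x₀ β W (∑ l, scalar (toSpec f S) W (β l) • T.mσ x₀ W (c l)) = c := by
  classical
  funext l
  rw [map_sum, Finset.sum_apply]
  simp only [mcoord_smul]
  have : ∀ l', T.coord β W (scalar (toSpec f S) W (β l')) l = if l = l' then 1 else 0 := by
    intro l'
    have := T.coord_scalar_mul_pr β W (β l') 1 l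
    rw [map_one, mul_one, mul_one] at this
    rw [this, Module.Basis.repr_self, Finsupp.single_apply]
    split_ifs with h1 h2 h2
    · rw [map_one]
    · exact absurd h1.symm h2
    · exact absurd h2.symm h1
    · rw [map_zero]
  simp [this]

lemma mcoord_eq {s : T.mObj x₀ W} {c : κ → Γ(x₀.E, T.i ⁻¹ᵁ W)}
    (h : s = ∑ l, scalar (toSpec f S) W (β l) • T.mσ x₀ W (c l)) : T.mcoord x₀ β W s = c := by
  rw [h, mcoord_sum]

lemma mcoord_injective : Function.Injective (T.mcoord x₀ β W) := fun s t h => by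
  rw [← T.sum_mcoord x₀ β s, h, sum_mcoord]

lemma mcoord_mRes {W' : (XBase f S).Opens} (h : W' ≤ W) (s : T.mObj x₀ W) (l : κ) :
    T.mcoord x₀ β W' (T.mRes x₀ h s) l = res x₀.E (T.i.preimage_mono h) (T.mcoord x₀ β W s l) := by
  have : T.mcoord x₀ β W' (T.mRes x₀ h s) =
      fun l => res x₀.E (T.i.preimage_mono h) (T.mcoord x₀ β W s l) := by
    refine T.mcoord_eq x₀ β ?_
    nth_rw 1 [← T.sum_mcoord x₀ β s]
    simp only [map_sum, mRes_smul, resO_scalar', mRes_mσ]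
  rw [this]

/-- Multiplication by a function on X_S acts on coordinates by a matrix of functions on X. Hence
requiring all coordinates to lie in F^i(E₀) defines a submodule. -/
lemma mcoord_smul_eq (a : Γ(XBase f S, W)) (s : T.mObj x₀ W) (l : κ) :
    T.mcoord x₀ β W (a • s) l =
      ∑ l', T.coord β W (a * scalar (toSpec f S) W (β l')) l • T.mcoord x₀ β W s l' := by
  conv_lhs => rw [← T.sum_mcoord x₀ β s]
  rw [Finset.smul_sum, map_sum, Finset.sum_apply]
  simp only [smul_smul, mcoord_smul]

end Coord

/-- The sheaf `E₀ ⊗ S`. -/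
def mSec : SecData (XBase f S) where
  obj W := T.mObj x₀ W
  res h := T.mRes x₀ h
  res_self h s := by
    have := finite_of_augmentation T.ε
    refine T.mcoord_injective x₀ (Module.finBasis k S) (funext fun l => ?_)
    rw [mcoord_mRes, res_self]
  res_res h h' s := by
    have := finite_of_augmentation T.ε
    refine T.mcoord_injective x₀ (Module.finBasis k S) (funext fun l => ?_)
    rw [mcoord_mRes, mcoord_mRes, mcoord_mRes, res_res]
  res_smul h a s := T.mRes_smul x₀ h a s
  sep W s t h := by
    have := finite_of_augmentation T.ε
    refine T.mcoord_injective x₀ (Module.finBasis k S) (funext fun l => eq_of_locally fun z hz => ?_)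
    obtain ⟨j, hj⟩ := Opens.mem_iSup.mp (show T.i z ∈ ⨆ j, W j from hz)
    refine ⟨T.i ⁻¹ᵁ W j, T.i.preimage_mono (le_iSup W j), hj, ?_⟩
    rw [← mcoord_mRes T x₀ _ (le_iSup W j), h j, mcoord_mRes]
  glue W s hs := by
    have := finite_of_augmentation T.ε
    let β := Module.finBasis k S
    have h1 := fun l => exists_glue x₀.E (fun j => T.i ⁻¹ᵁ W j) (T.i ⁻¹ᵁ (⨆ j, W j))
      (fun j => T.i.preimage_mono (le_iSup W j)) (fun z hz => by
        obtain ⟨j, hj⟩ := Opens.mem_iSup.mp (show T.i z ∈ ⨆ j, W j from hz)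
        exact Opens.mem_iSup.mpr ⟨j, hj⟩)
      (fun j => T.mcoord x₀ β (W j) (s j) l) (fun j j' => by
        have h2 := congrFun (congrArg (T.mcoord x₀ β _) (hs j j')) l
        rw [mcoord_mRes, mcoord_mRes] at h2
        exact h2)
    choose c hc using h1
    refine ⟨∑ l, scalar (toSpec f S) (⨆ j, W j) (β l) • T.mσ x₀ (⨆ j, W j) (c l), fun j => ?_⟩
    refine T.mcoord_injective x₀ β (funext fun l => ?_)
    rw [mcoord_mRes, mcoord_sum, hc]

/-- The form on `E₀ ⊗ S`. -/
def mForm (W : (XBase f S).Opens) :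
    T.mObj x₀ W →ₗ[Γ(XBase f S, W)] T.mObj x₀ W →ₗ[Γ(XBase f S, W)] Γ(XBase f S, W) :=
  LinearMap.BilinForm.baseChange Γ(XBase f S, W) (x₀.form (T.i ⁻¹ᵁ W) le_top)

lemma mForm_mσ (W : (XBase f S).Opens) (s t : Γ(x₀.E, T.i ⁻¹ᵁ W)) :
    T.mForm x₀ W (T.mσ x₀ W s) (T.mσ x₀ W t) = T.pr W (x₀.form _ le_top s t) := by
  refine (LinearMap.BilinForm.baseChange_tmul _ _ _ _ _).trans ?_
  rw [mul_one, smul_def, mul_one]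

section Coord

variable {κ : Type} [Fintype κ] [DecidableEq κ] (β : Module.Basis κ k S) {W : (XBase f S).Opens}

lemma mForm_eq_sum (s t : T.mObj x₀ W) : T.mForm x₀ W s t =
    ∑ l, ∑ m, scalar (toSpec f S) W (β l) * (scalar (toSpec f S) W (β m) *
      T.pr W (x₀.form _ le_top (T.mcoord x₀ β W s l) (T.mcoord x₀ β W t m))) := by
  conv_lhs => rw [← T.sum_mcoord x₀ β s, ← T.sum_mcoord x₀ β t]
  simp only [map_sum, map_smul, LinearMap.sum_apply, LinearMap.smul_apply, mForm_mσ, smul_eq_mul]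
  rw [Finset.sum_comm]
  refine Finset.sum_congr rfl fun l _ => ?_
  rw [Finset.mul_sum]
  exact Finset.sum_congr rfl fun m _ => mul_left_comm _ _ _

lemma mForm_mσ_right (s : T.mObj x₀ W) (t : Γ(x₀.E, T.i ⁻¹ᵁ W)) : T.mForm x₀ W s (T.mσ x₀ W t) =
    ∑ l, scalar (toSpec f S) W (β l) *
      T.pr W (x₀.form _ le_top (T.mcoord x₀ β W s l) t) := by
  conv_lhs => rw [← T.sum_mcoord x₀ β s]
  simp only [map_sum, map_smul, LinearMap.sum_apply, LinearMap.smul_apply, mForm_mσ, smul_eq_mul]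

/-- The filtration on `E₀ ⊗ S`. -/
def mFil (i : ℤ) (W : (XBase f S).Opens) : Submodule Γ(XBase f S, W) (T.mObj x₀ W) where
  carrier := { s | ∀ l, T.mcoord x₀ β W s l ∈ x₀.fil i _ le_top }
  zero_mem' l := by rw [map_zero]; exact zero_mem _
  add_mem' hs ht l := by rw [map_add]; exact add_mem (hs l) (ht l)
  smul_mem' a s hs l := by
    rw [mcoord_smul_eq]
    exact Submodule.sum_mem _ fun l' _ => Submodule.smul_mem _ _ (hs l')

lemma mem_mFil (i : ℤ) (s : T.mObj x₀ W) :
    s ∈ T.mFil x₀ β i W ↔ ∀ l, T.mcoord x₀ β W s l ∈ x₀.fil i _ le_top := Iff.rfl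

lemma mσ_mem_mFil (i : ℤ) {s : Γ(x₀.E, T.i ⁻¹ᵁ W)} (hs : s ∈ x₀.fil i _ le_top) :
    T.mσ x₀ W s ∈ T.mFil x₀ β i W := fun l => by
  have := T.mcoord_smul x₀ β (W := W) 1 s l
  rw [one_smul] at this
  rw [this]
  exact Submodule.smul_mem _ _ hs

include β in
-- Evaluated on sections of E₀, each coordinate of the functional is a functional on E₀. The
-- sections representing these functionals are the coordinates of the section sought.
lemma mForm_nondeg (l : ∀ W' : (XBase f S).Opens, W' ≤ W →
      (T.mObj x₀ W' →ₗ[Γ(XBase f S, W')] Γ(XBase f S, W')))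
    (hl : ∀ (W₁ W₂ : (XBase f S).Opens) (h₁ : W₁ ≤ W) (h₂ : W₂ ≤ W₁) (t : T.mObj x₀ W₁),
      resO _ h₂ (l W₁ h₁ t) = l W₂ (h₂.trans h₁) (T.mRes x₀ h₂ t)) :
    ∃! s : T.mObj x₀ W, ∀ (W' : (XBase f S).Opens) (h' : W' ≤ W) (t : T.mObj x₀ W'),
      l W' h' t = T.mForm x₀ W' (T.mRes x₀ h' s) t := by
  have hcoordres : ∀ {W W' : (XBase f S).Opens} (h : W' ≤ W) (a : Γ(XBase f S, W)) (m : κ),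
      T.coord β W' (resO _ h a) m = resO X (T.i.preimage_mono h) (T.coord β W a m) := by
    intro W W' h a m
    have : T.coord β W' (resO _ h a) = fun m => resO X (T.i.preimage_mono h) (T.coord β W a m) := by
      refine T.coord_eq β _ ?_
      nth_rw 1 [← T.sum_coord β W a]
      simp only [map_sum, map_mul, resO_scalar', resO_pr]
    rw [this]
  let P : X.Opens → Type u := fun U => U ≤ T.i ⁻¹ᵁ W → (Γ(x₀.E, U) →ₗ[Γ(X, U)] Γ(X, U))
  -- The coordinate functionals are built over open subsets of X_S and then transported, because
  -- `x₀.form_nondeg` asks for a family over all open subsets of X.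
  let c : κ → ∀ W' : (XBase f S).Opens, P (T.i ⁻¹ᵁ W') := fun m W' h' =>
    { toFun := fun t => T.coord β W' (l W' (T.le_of_preimage_le h') (T.mσ x₀ W' t)) m
      map_add' := fun s t => by rw [map_add, map_add, map_add, Pi.add_apply]
      map_smul' := fun a s => by
        rw [map_smulₛₗ, map_smul, smul_eq_mul, coord_pr_mul, RingHom.id_apply, smul_eq_mul] }
  have hc : ∀ m W' h' t, T.transport (c m) (T.i ⁻¹ᵁ W') h' t =
      T.coord β W' (l W' (T.le_of_preimage_le h') (T.mσ x₀ W' t)) m := by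
    intro m W' h' t
    rw [transport_preimage]
    rfl
  have hex : ∀ m, ∃ s : Γ(x₀.E, T.i ⁻¹ᵁ W), ∀ (W' : (XBase f S).Opens) (h' : W' ≤ W)
      (t : Γ(x₀.E, T.i ⁻¹ᵁ W')), T.coord β W' (l W' h' (T.mσ x₀ W' t)) m =
        x₀.form _ le_top (res x₀.E (T.i.preimage_mono h') s) t := by
    intro m
    obtain ⟨s, hs, -⟩ := x₀.form_nondeg (T.i ⁻¹ᵁ W) le_top (fun U hU => T.transport (c m) U hU) (by
      intro W₁ W₂ h₁ h₂ t
      obtain ⟨W₁, rfl⟩ := T.exists_preimage_eq W₁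
      obtain ⟨W₂, rfl⟩ := T.exists_preimage_eq W₂
      rw [hc, hc, ← mRes_mσ T x₀ (T.le_of_preimage_le h₂),
        ← hl W₁ W₂ (T.le_of_preimage_le h₁) (T.le_of_preimage_le h₂), hcoordres])
    refine ⟨s, fun W' h' t => ?_⟩
    rw [← hs, hc]
  choose s hs using hex
  refine ⟨∑ m, scalar (toSpec f S) W (β m) • T.mσ x₀ W (s m), fun W' h' t => ?_, fun s' hs' => ?_⟩
  · induction t using TensorProduct.induction_on with
    | zero => simp
    | tmul a t =>
      rw [← smul_mσ, map_smul, map_smul]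
      congr 1
      rw [mForm_mσ_right T x₀ β, ← T.sum_coord β W' (l W' h' (T.mσ x₀ W' t))]
      refine Finset.sum_congr rfl fun m _ => ?_
      rw [hs, mcoord_mRes, mcoord_sum]
    | add t t' ht ht' => rw [map_add, map_add, ht, ht']
  · refine T.mcoord_injective x₀ β (funext fun m => ?_)
    rw [mcoord_sum, ← sub_eq_zero]
    refine T.eq_zero_of_form _ fun W' h' t => ?_
    have h1 := hs' W' h' (T.mσ x₀ W' t)
    rw [mForm_mσ_right T x₀ β] at h1
    rw [map_sub, map_sub, LinearMap.sub_apply, sub_eq_zero, ← hs m W' h', h1, T.coord_eq β W' rfl,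
      mcoord_mRes]

end Coord

end Thick

end Model

/-! ### E₀ ⊗ S as a filtered symplectic bundle -/

section ModelBundle

variable {k : Type u} [Field k] {X : Scheme.{u}} {f : X ⟶ Spec (CommRingCat.of k)}
  {S : Type u} [CommRing S] [Algebra k S] (T : Thick f S) [IsLocalRing S] [IsArtinianRing S]
  {r n : ℕ} (x₀ : FilSymp X ⊤ r n)
  {κ : Type} [Fintype κ] [DecidableEq κ] (β : Module.Basis κ k S)

namespace Thick

attribute [local instance] Thick.algebra

lemma mcoord_sum_smul {m : ℕ} {W : (XBase f S).Opens} (a : Fin m → Γ(XBase f S, W))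
    (e : Fin m → Γ(x₀.E, T.i ⁻¹ᵁ W)) (l : κ) :
    T.mcoord x₀ β W (∑ j, a j • T.mσ x₀ W (e j)) l = ∑ j, T.coord β W (a j) l • e j := by
  rw [map_sum, Finset.sum_apply]
  simp only [mcoord_smul]

lemma mForm_mRes {W W' : (XBase f S).Opens} (h : W' ≤ W) (s t : T.mObj x₀ W) :
    resO _ h (T.mForm x₀ W s t) = T.mForm x₀ W' (T.mRes x₀ h s) (T.mRes x₀ h t) := by
  have := finite_of_augmentation T.ε
  rw [T.mForm_eq_sum x₀ (Module.finBasis k S), T.mForm_eq_sum x₀ (Module.finBasis k S)]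
  simp only [map_sum, map_mul, resO_scalar', resO_pr, mcoord_mRes, x₀.form_res _ _ le_top
    (T.i.preimage_mono h)]

/-- In the expansion the terms for (l, m) and (m, l) cancel and the diagonal terms vanish. -/
lemma mForm_self {W : (XBase f S).Opens} (s : T.mObj x₀ W) : T.mForm x₀ W s s = 0 := by
  have := finite_of_augmentation T.ε
  rw [T.mForm_eq_sum x₀ (Module.finBasis k S), ← Finset.sum_product']
  refine Finset.sum_involution (fun p _ => p.swap) ?_ ?_ (fun _ _ => Finset.mem_univ _)
    (fun _ _ => Prod.swap_swap _)
  · rintro ⟨l, m⟩ -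
    have h := LinearMap.IsAlt.neg (x₀.form_alt (T.i ⁻¹ᵁ W) le_top)
      (T.mcoord x₀ (Module.finBasis k S) W s l) (T.mcoord x₀ (Module.finBasis k S) W s m)
    simp only [Prod.swap]
    rw [← h, map_neg]
    ring
  · rintro ⟨l, m⟩ - h1 h2
    simp only [Prod.swap, Prod.mk.injEq] at h2
    apply h1
    obtain ⟨rfl, -⟩ := h2
    rw [x₀.form_alt, map_zero, mul_zero, mul_zero]

/-- Points and open sets of X_S are those of X, so a neighbourhood with the desired property may be
looked for on X. -/
lemma exists_frame_preimage {P : (XBase f S).Opens → Prop} {V : (XBase f S).Opens}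
    (h : ∀ z ∈ T.i ⁻¹ᵁ V, ∃ U : X.Opens, z ∈ U ∧ U ≤ T.i ⁻¹ᵁ V ∧ ∀ W, U = T.i ⁻¹ᵁ W → P W) :
    ∀ z ∈ V, ∃ W : (XBase f S).Opens, z ∈ W ∧ W ≤ V ∧ P W := by
  intro z hz
  obtain ⟨U, hzU, hU, hP⟩ := h (toX f S z) (by
    change T.i (toX f S z) ∈ V
    rwa [T.i_toX_apply])
  obtain ⟨W, rfl⟩ := T.exists_preimage_eq U
  refine ⟨W, ?_, T.le_of_preimage_le hU, hP W rfl⟩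
  change T.i (toX f S z) ∈ W at hzU
  rwa [T.i_toX_apply] at hzU

lemma mFil_mRes (i : ℤ) {W W' : (XBase f S).Opens} (h' : W' ≤ W) {s : T.mObj x₀ W}
    (hs : s ∈ T.mFil x₀ β i W) : T.mRes x₀ h' s ∈ T.mFil x₀ β i W' := fun l => by
  rw [mcoord_mRes]
  exact x₀.fil_res _ _ _ _ _ _ (hs l)

lemma mFil_local (i : ℤ) {W : (XBase f S).Opens} {s : T.mObj x₀ W}
    (hs : ∀ z ∈ W, ∃ (W' : (XBase f S).Opens) (h' : W' ≤ W), z ∈ W' ∧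
      T.mRes x₀ h' s ∈ T.mFil x₀ β i W') : s ∈ T.mFil x₀ β i W := fun l => by
  refine x₀.fil_local _ _ _ _ fun z hz => ?_
  obtain ⟨W', h', hz', h1⟩ := hs (T.i z) hz
  refine ⟨T.i ⁻¹ᵁ W', T.i.preimage_mono h', hz', ?_⟩
  have h2 := h1 l
  rwa [mcoord_mRes] at h2

lemma mFil_bot (i : ℤ) (hi : i ≤ -(n : ℤ)) (W : (XBase f S).Opens) : T.mFil x₀ β i W = ⊥ := by
  rw [eq_bot_iff]
  intro s hs
  refine T.mcoord_injective x₀ β (funext fun l => ?_)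
  have h1 := hs l
  rw [x₀.fil_bot i hi] at h1
  rw [map_zero]
  exact h1

lemma mFil_top (i : ℤ) (hi : (n : ℤ) - 1 ≤ i) (W : (XBase f S).Opens) : T.mFil x₀ β i W = ⊤ := by
  rw [eq_top_iff]
  intro s _ l
  rw [x₀.fil_top i hi]
  trivial

/-- In one direction all pairings of coordinates vanish; in the other, testing against sections of
E₀ isolates the coordinates one by one. -/
lemma mFil_perp (i : ℤ) {W : (XBase f S).Opens} (s : T.mObj x₀ W) :
    s ∈ T.mFil x₀ β (-1 - i) W ↔ ∀ (W' : (XBase f S).Opens) (h' : W' ≤ W),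
      ∀ t ∈ T.mFil x₀ β i W', T.mForm x₀ W' (T.mRes x₀ h' s) t = 0 := by
  constructor
  · intro hs W' h' t ht
    rw [T.mForm_eq_sum x₀ β]
    refine Finset.sum_eq_zero fun l _ => Finset.sum_eq_zero fun m _ => ?_
    rw [mcoord_mRes, (x₀.fil_perp i _ le_top _).mp (hs l) _ (T.i.preimage_mono h') _ (ht m),
      map_zero, mul_zero, mul_zero]
  · intro hs l
    refine T.mem_fil_of_form _ _ fun W' h' t ht => ?_
    rw [show -1 - (-1 - i) = i by ring] at ht
    have h1 := hs W' h' _ (T.mσ_mem_mFil x₀ β i ht)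
    rw [T.mForm_mσ_right x₀ β] at h1
    have h2 := congrFun (T.eq_zero_of_sum_eq_zero β h1) l
    rwa [mcoord_mRes] at h2

/-- The filtered symplectic bundle `E₀ ⊗ S`, over an open subset `V`. -/
def model (V : (XBase f S).Opens) : FilSymp (XBase f S) V r n where
  E := (T.mSec x₀).toModules
  locallyFree := by
    refine T.exists_frame_preimage (P := fun W => ∃ e : Fin (2 * r) → T.mObj x₀ W,
      ∀ (W' : (XBase f S).Opens) (h : W' ≤ W), Function.Bijective
        (fun a : Fin (2 * r) → Γ(XBase f S, W') => ∑ j, a j • T.mRes x₀ h (e j))) fun z hz => ?_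
    obtain ⟨U, hzU, -, e, he⟩ := x₀.locallyFree z trivial
    refine ⟨U ⊓ T.i ⁻¹ᵁ V, ⟨hzU, hz⟩, inf_le_right, fun W hW => ?_⟩
    have hWU : T.i ⁻¹ᵁ W ≤ U := hW ▸ inf_le_left
    refine ⟨fun j => T.mσ x₀ W (res x₀.E hWU (e j)), fun W' h => ?_⟩
    simp only [mRes_mσ, res_res]
    have he' := he (T.i ⁻¹ᵁ W') ((T.i.preimage_mono h).trans hWU)
    constructor
    · intro a b hab
      funext j
      rw [← T.sum_coord β W' (a j), ← T.sum_coord β W' (b j)]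
      refine Finset.sum_congr rfl fun l _ => ?_
      have h1 := congrFun (congrArg (T.mcoord x₀ β W') hab) l
      simp only [mcoord_sum_smul] at h1
      rw [congrFun (he'.1 h1) j]
    · intro s
      choose c hc using fun l => he'.2 (T.mcoord x₀ β W' s l)
      refine ⟨fun j => ∑ l, scalar (toSpec f S) W' (β l) * T.pr W' (c l j), ?_⟩
      refine T.mcoord_injective x₀ β (funext fun l => ?_)
      rw [mcoord_sum_smul, ← hc]
      refine Finset.sum_congr rfl fun j _ => ?_
      rw [T.coord_eq β W' rfl]
  form W _ := T.mForm x₀ W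
  form_res W W' _ h' s t := T.mForm_mRes x₀ h' s t
  form_alt W _ s := T.mForm_self x₀ s
  form_nondeg W _ l hl := T.mForm_nondeg x₀ β l hl
  fil i W _ := T.mFil x₀ β i W
  fil_res i W W' _ h' s hs := T.mFil_mRes x₀ β i h' hs
  fil_local i W _ s hs := T.mFil_local x₀ β i hs
  fil_mono i W _ s hs l := x₀.fil_mono _ _ _ (hs l)
  fil_bot i hi W _ := T.mFil_bot x₀ β i hi W
  fil_top i hi W _ := T.mFil_top x₀ β i hi W
  gr_free i := by
    suffices H : ∀ z ∈ V, ∃ W : (XBase f S).Opens, z ∈ W ∧ W ≤ V ∧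
        ∃ (m : ℕ) (e : Fin m → T.mObj x₀ W), (∀ j, e j ∈ T.mFil x₀ β i W) ∧
          ∀ (W' : (XBase f S).Opens) (h : W' ≤ W), ∀ s ∈ T.mFil x₀ β i W',
            ∃! a : Fin m → Γ(XBase f S, W'), s - ∑ j, a j • T.mRes x₀ h (e j) ∈
              T.mFil x₀ β (i - 1) W' by
      intro z hz
      obtain ⟨W, hz, hW, m, e, he⟩ := H z hz
      exact ⟨W, hW, hz, m, e, he⟩
    refine T.exists_frame_preimage fun z hz => ?_
    obtain ⟨U, hU, hzU, m, e, he, he'⟩ := x₀.gr_free i z trivial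
    refine ⟨U ⊓ T.i ⁻¹ᵁ V, ⟨hzU, hz⟩, inf_le_right, fun W hW => ?_⟩
    have hWU : T.i ⁻¹ᵁ W ≤ U := hW ▸ inf_le_left
    refine ⟨m, fun j => T.mσ x₀ W (res x₀.E hWU (e j)), fun j => T.mσ_mem_mFil x₀ β i
      (x₀.fil_res _ _ _ _ _ _ (he j)), fun W' h s hs => ?_⟩
    simp only [mRes_mσ, res_res]
    have he'' := he' (T.i ⁻¹ᵁ W') ((T.i.preimage_mono h).trans hWU)
    choose c hc huniq using fun l => he'' _ (hs l)
    -- The condition splits into one for each basis element, where the frame of Gr^i(E₀) determines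
    -- the coefficients.
    have key : ∀ a : Fin m → Γ(XBase f S, W'), s - ∑ j, a j • T.mσ x₀ W'
        (res x₀.E ((T.i.preimage_mono h).trans hWU) (e j)) ∈ T.mFil x₀ β (i - 1) W' ↔
        ∀ l, (fun j => T.coord β W' (a j) l) = c l := by
      intro a
      rw [mem_mFil]
      refine forall_congr' fun l => ?_
      rw [map_sub, Pi.sub_apply, mcoord_sum_smul]
      refine ⟨fun h1 => huniq l _ h1, fun h1 => ?_⟩
      have h2 := hc l
      rw [← h1] at h2
      exact h2
    refine ⟨fun j => ∑ l, scalar (toSpec f S) W' (β l) * T.pr W' (c l j), ?_, fun a ha => ?_⟩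
    · refine (key _).mpr fun l => funext fun j => ?_
      rw [T.coord_eq β W' rfl]
    · have h1 := (key a).mp ha
      funext j
      rw [← T.sum_coord β W' (a j)]
      refine Finset.sum_congr rfl fun l _ => ?_
      rw [← h1 l]
  fil_perp i W _ s := T.mFil_perp x₀ β i s

/-- The canonical trivialization of `E₀ ⊗ S`. -/
def modelTriv (V : (XBase f S).Opens) : Triv T x₀ (T.model x₀ β V) (le_rfl : V ≤ V) where
  σ W _ := T.mσ x₀ W
  nat W W' _ h' s := T.mRes_mσ x₀ h' s
  form_eq W _ s t := T.mForm_mσ x₀ W s t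
  fil_mem j W _ s hs := T.mσ_mem_mFil x₀ β j hs
  span W _ := by
    rw [eq_top_iff]
    intro s _
    rw [← T.sum_mcoord x₀ β s]
    exact Submodule.sum_mem _ fun l _ => Submodule.smul_mem _ _ (Submodule.subset_span ⟨_, rfl⟩)

end Thick

end ModelBundle

/-! ## Local existence of lifts -/

section TrivLift

variable {k : Type u} [Field k] {X : Scheme.{u}} {f : X ⟶ Spec (CommRingCat.of k)}
  {S : Type u} [CommRing S] [Algebra k S] {T : Thick f S} [IsLocalRing S] [IsArtinianRing S]
  {r n : ℕ} {V V₀ : (XBase f S).Opens}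
  {x₀ : FilSymp X ⊤ r n} {y : FilSymp (XBase f S) V r n} {hV : V₀ ≤ V}

namespace Triv

variable {κ : Type*} [Fintype κ] (β : Module.Basis κ k S) (τ : Triv T x₀ y hV)
  {W : (XBase f S).Opens} (h : W ≤ V₀)

lemma coord_smul (a : Γ(XBase f S, W)) (c : Γ(x₀.E, T.i ⁻¹ᵁ W)) :
    τ.coord β h (a • τ.σ W h c) = fun l => T.coord β W a l • c := by
  refine τ.coord_eq β h ?_
  nth_rw 1 [← T.sum_coord β W a]
  rw [Finset.sum_smul]
  exact Finset.sum_congr rfl fun l _ => by rw [mul_smul, map_smulₛₗ]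

variable {R M : Type*} [CommRing R] [AddCommGroup M] [Module R M] (ψ : Γ(XBase f S, W) →+* R)

/-- The semilinear extension of a map on sections of `E₀`. -/
def lift (p : Γ(x₀.E, T.i ⁻¹ᵁ W) →+ M) (hp : ∀ a s, p (a • s) = ψ (T.pr W a) • p s) :
    Γ(y.E, W) →ₛₗ[ψ] M :=
  have key : ∀ (a : Γ(XBase f S, W)) (c : Γ(x₀.E, T.i ⁻¹ᵁ W)),
      ∑ l, ψ (scalar (toSpec f S) W (β l)) • p (τ.coord β h (a • τ.σ W h c) l) = ψ a • p c := by
    intro a c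
    rw [τ.coord_smul β h]
    nth_rw 2 [← T.sum_coord β W a]
    rw [map_sum, Finset.sum_smul]
    exact Finset.sum_congr rfl fun l _ => by rw [hp, map_mul, mul_smul]
  { toFun := fun s => ∑ l, ψ (scalar (toSpec f S) W (β l)) • p (τ.coord β h s l)
    map_add' := fun s t => by
      simp only [map_add, Pi.add_apply, smul_add, Finset.sum_add_distrib]
    map_smul' := fun a s => by
      nth_rw 1 [← τ.sum_coord β h s]
      rw [Finset.smul_sum, map_sum]
      simp only [Finset.sum_apply, map_sum, smul_smul, Finset.smul_sum]
      rw [Finset.sum_comm]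
      refine Finset.sum_congr rfl fun l _ => ?_
      rw [key, map_mul] }

lemma lift_apply (p : Γ(x₀.E, T.i ⁻¹ᵁ W) →+ M) (hp : ∀ a s, p (a • s) = ψ (T.pr W a) • p s)
    (s : Γ(y.E, W)) : τ.lift β h ψ p hp s =
      ∑ l, ψ (scalar (toSpec f S) W (β l)) • p (τ.coord β h s l) := rfl

lemma lift_σ (p : Γ(x₀.E, T.i ⁻¹ᵁ W) →+ M) (hp : ∀ a s, p (a • s) = ψ (T.pr W a) • p s)
    (s : Γ(x₀.E, T.i ⁻¹ᵁ W)) : τ.lift β h ψ p hp (τ.σ W h s) = p s := by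
  have h1 : τ.coord β h (τ.σ W h s) = fun l => T.coord β W 1 l • s := by
    rw [← τ.coord_smul β h, one_smul]
  rw [lift_apply, h1]
  simp only [hp, smul_smul, ← map_mul, ← Finset.sum_smul, ← map_sum, T.sum_coord, map_one, one_smul]

end Triv

end TrivLift

/-! ### The lift attached to a trivialization -/

namespace SmallExt

variable {k : Type u} [Field k] {X : Scheme.{u}} {f : X ⟶ Spec (CommRingCat.of k)}
  {A B : Type u} [CommRing A] [Algebra k A] [CommRing B] [IsLocalRing B]
  [Algebra k B] (D : SmallExt k A B) {r n : ℕ} {x₀ : NilBundle X ⊤ r n}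
  {x : NilBundle (XBase f A) ⊤ r n} {V : (XBase f B).Opens}
  [IsLocalRing A] [IsArtinianRing A] [IsArtinianRing B]

section

variable {y : FilSymp (XBase f B) V r n} (τ : Triv (D.TB f) x₀.toFilSymp y (le_rfl : V ≤ V))
  (τA : Triv (D.TA f) x₀.toFilSymp x.toFilSymp (le_top : baseMap f D.q ⁻¹ᵁ V ≤ ⊤))

/-- The reduction map of a trivialized bundle. -/
def trivRed (W : (XBase f B).Opens) (h : W ≤ V) :
    Γ(y.E, W) →ₛₗ[((baseMap f D.q).app W).hom] Γ(x.E, baseMap f D.q ⁻¹ᵁ W) :=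
  τ.lift D.β h ((baseMap f D.q).app W).hom
    (τA.σ _ ((baseMap f D.q).preimage_mono h)).toAddMonoidHom (fun a s => by
      rw [app_pr]
      exact (τA.σ _ ((baseMap f D.q).preimage_mono h)).map_smulₛₗ a s)

lemma trivRed_σ (W : (XBase f B).Opens) (h : W ≤ V) (s : Γ(x₀.E, (D.TB f).i ⁻¹ᵁ W)) :
    D.trivRed τ τA W h (τ.σ W h s) = τA.σ _ ((baseMap f D.q).preimage_mono h) s :=
  τ.lift_σ _ _ _ _ _ _

lemma trivRed_eq (W : (XBase f B).Opens) (h : W ≤ V) (s : Γ(y.E, W)) : D.trivRed τ τA W h s =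
    ∑ l, scalar (toSpec f A) (baseMap f D.q ⁻¹ᵁ W) (D.α l) •
      τA.σ _ ((baseMap f D.q).preimage_mono h) (τ.coord D.β h s (Sum.inr l)) := by
  conv_lhs => rw [← τ.sum_coord D.β h s]
  rw [Fintype.sum_sum_type, map_add]
  simp only [map_sum, map_smulₛₗ, app_scalar, D.q_β_inl, D.β_inr, map_zero, zero_smul,
    Finset.sum_const_zero, zero_add, trivRed_σ]

/-- Replacing the basis of `A` by its lifts in `B` gives an explicit section of the reduction on
every open set. -/
lemma trivRed_lift (W : (XBase f B).Opens) (h : W ≤ V) (t : Γ(x.E, baseMap f D.q ⁻¹ᵁ W)) :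
    D.trivRed τ τA W h (∑ l, scalar (toSpec f B) W (D.β (Sum.inr l)) •
      τ.σ W h (τA.coord D.α ((baseMap f D.q).preimage_mono h) t l)) = t := by
  rw [map_sum]
  simp only [map_smulₛₗ, app_scalar, D.β_inr]
  refine Eq.trans ?_ (τA.sum_coord D.α ((baseMap f D.q).preimage_mono h) t)
  exact Finset.sum_congr rfl fun l _ => congrArg _ (D.trivRed_σ τ τA W h _)

/-- The reduction of a trivialized bundle. -/
def trivFilRed : FilRed (baseMap f D.q) y x.toFilSymp where
  red W h := (D.trivRed τ τA W h).toAddMonoidHom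
  red_smul W h a s := (D.trivRed τ τA W h).map_smulₛₗ a s
  red_res W W' h h' s := by
    change D.trivRed τ τA W' _ (res y.E h' s) = res x.E _ (D.trivRed τ τA W h s)
    rw [trivRed_eq, trivRed_eq, map_sum]
    refine Finset.sum_congr rfl fun l _ => ?_
    rw [res_smul, resO_scalar', τ.coord_res D.β h h']
    exact congrArg _ (τA.nat _ _ ((baseMap f D.q).preimage_mono h)
      ((baseMap f D.q).preimage_mono h') _).symm
  red_surj W h _ t := ⟨_, D.trivRed_lift τ τA W h t⟩
  red_ker W h _ s := by
    change D.trivRed τ τA W h s = 0 ↔ _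
    constructor
    · intro hs
      rw [trivRed_eq] at hs
      have h1 := Triv.eq_zero_of_sum_aux (hV := le_top) D.α τA.σ τA.nat τA.form_eq
        ((baseMap f D.q).preimage_mono h) hs
      rw [← τ.sum_coord D.β h s, Fintype.sum_sum_type]
      refine add_mem (Submodule.sum_mem _ fun l _ => Submodule.smul_mem_smul ?_ trivial)
        (Submodule.sum_mem _ fun l _ => ?_)
      · rw [D.ker_app]
        exact Ideal.mem_map_of_mem _ (D.β_inl_mem l)
      · have h2 : τ.coord D.β h s (Sum.inr l) = 0 := congrFun h1 l
        rw [h2, map_zero, smul_zero]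
        exact zero_mem _
    · intro hs
      refine Submodule.smul_induction_on hs (fun a ha t _ => ?_) fun s t hs ht => ?_
      · rw [map_smulₛₗ, RingHom.mem_ker.mp ha, zero_smul]
      · rw [map_add, hs, ht, add_zero]
  red_form W h s t := by
    change _ = x.form _ le_top (D.trivRed τ τA W h s) (D.trivRed τ τA W h t)
    rw [← τ.sum_coord D.β h s, ← τ.sum_coord D.β h t]
    simp only [map_sum, map_smul, map_smulₛₗ, LinearMap.sum_apply, LinearMap.smul_apply, τ.form_eq,
      smul_eq_mul, map_mul, trivRed_σ]
    refine Finset.sum_congr rfl fun l _ => congrArg _ (Finset.sum_congr rfl fun m _ =>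
      congrArg _ ?_)
    rw [app_pr]
    exact (τA.form_eq (baseMap f D.q ⁻¹ᵁ W) _ _ _).symm
  red_fil j W h s hs := by
    change D.trivRed τ τA W h s ∈ _
    rw [trivRed_eq]
    exact Submodule.sum_mem _ fun l _ => Submodule.smul_mem _ _ (τA.fil_mem j _ _ _
      ((τ.mem_fil_iff D.β h j s).mp hs _))
  red_fil_surj j W h _ t ht := by
    refine ⟨_, Submodule.sum_mem _ fun l _ => Submodule.smul_mem _ _ (τ.fil_mem j W h _ ?_),
      D.trivRed_lift τ τA W h t⟩
    exact (τA.mem_fil_iff D.α ((baseMap f D.q).preimage_mono h) j t).mp ht l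

/-- The coordinates of `θ` on sections of `E₀`. -/
def θcoord (W : (XBase f B).Opens) (h : W ≤ V) (s : Γ(x₀.E, (D.TB f).i ⁻¹ᵁ W)) (l : Fin D.b) :
    Γ(x₀.E, (D.TB f).i ⁻¹ᵁ W) :=
  τA.coord D.α ((baseMap f D.q).preimage_mono h)
    (x.θ _ le_top (τA.σ _ ((baseMap f D.q).preimage_mono h) s)) l

lemma θcoord_add (W : (XBase f B).Opens) (h : W ≤ V) (s t : Γ(x₀.E, (D.TB f).i ⁻¹ᵁ W))
    (l : Fin D.b) : D.θcoord τA W h (s + t) l = D.θcoord τA W h s l + D.θcoord τA W h t l := by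
  refine (congrFun (congrArg (τA.coord D.α ((baseMap f D.q).preimage_mono h)) ((congrArg
    (x.θ _ le_top) (map_add (τA.σ _ ((baseMap f D.q).preimage_mono h)) s t)).trans
      (map_add (x.θ _ le_top) _ _))) l).trans ?_
  exact congrFun (map_add (τA.coord D.α ((baseMap f D.q).preimage_mono h)) _ _) l

lemma θcoord_smul (W : (XBase f B).Opens) (h : W ≤ V) (a : Γ(X, (D.TB f).i ⁻¹ᵁ W))
    (s : Γ(x₀.E, (D.TB f).i ⁻¹ᵁ W)) (l : Fin D.b) :
    D.θcoord τA W h (a • s) l = a • D.θcoord τA W h s l := by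
  refine (congrFun (congrArg (τA.coord D.α ((baseMap f D.q).preimage_mono h)) ((congrArg
    (x.θ _ le_top) ((τA.σ _ ((baseMap f D.q).preimage_mono h)).map_smulₛₗ a s)).trans
      ((x.θ _ le_top).map_smul _ _))) l).trans ?_
  exact congrFun (τA.coord_pr_smul D.α ((baseMap f D.q).preimage_mono h) a _) l

lemma θcoord_res (W W' : (XBase f B).Opens) (h : W ≤ V) (h' : W' ≤ W)
    (s : Γ(x₀.E, (D.TB f).i ⁻¹ᵁ W)) (l : Fin D.b) :
    res x₀.E ((D.TB f).i.preimage_mono h') (D.θcoord τA W h s l) =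
      D.θcoord τA W' (h'.trans h) (res x₀.E ((D.TB f).i.preimage_mono h') s) l := by
  refine (τA.coord_res D.α ((baseMap f D.q).preimage_mono h) ((baseMap f D.q).preimage_mono h')
    _ l).symm.trans ?_
  refine congrFun (congrArg (τA.coord D.α _) ?_) l
  refine (x.θ_nat _ _ le_top ((baseMap f D.q).preimage_mono h') _).trans ?_
  exact congrArg _ (τA.nat _ _ _ ((baseMap f D.q).preimage_mono h') s)

lemma sum_θcoord (W : (XBase f B).Opens) (h : W ≤ V) (s : Γ(x₀.E, (D.TB f).i ⁻¹ᵁ W)) :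
    ∑ l, scalar (toSpec f A) (baseMap f D.q ⁻¹ᵁ W) (D.α l) •
      τA.σ _ ((baseMap f D.q).preimage_mono h) (D.θcoord τA W h s l) =
      x.θ _ le_top (τA.σ _ ((baseMap f D.q).preimage_mono h) s) :=
  τA.sum_coord D.α ((baseMap f D.q).preimage_mono h) _

/-- Comparison of the coefficients of the basis of `A` in the skewness of θ. -/
lemma form_θcoord (W : (XBase f B).Opens) (h : W ≤ V) (s t : Γ(x₀.E, (D.TB f).i ⁻¹ᵁ W))
    (l : Fin D.b) : x₀.form _ le_top s (D.θcoord τA W h t l) =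
      -x₀.form _ le_top (D.θcoord τA W h s l) t := by
  have h1 := x.θ_adj _ le_top (τA.σ _ ((baseMap f D.q).preimage_mono h) s)
    (τA.σ _ ((baseMap f D.q).preimage_mono h) t)
  have e : ∀ s t : Γ(x₀.E, (D.TB f).i ⁻¹ᵁ W), x.form _ le_top
      (τA.σ _ ((baseMap f D.q).preimage_mono h) s) (τA.σ _ ((baseMap f D.q).preimage_mono h) t) =
      (D.TA f).pr (baseMap f D.q ⁻¹ᵁ W) (x₀.form _ le_top s t) :=
    τA.form_eq (baseMap f D.q ⁻¹ᵁ W) _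
  rw [← D.sum_θcoord τA W h, ← D.sum_θcoord τA W h, eq_neg_iff_add_eq_zero] at h1
  simp only [map_sum, map_smul, LinearMap.sum_apply, LinearMap.smul_apply, smul_eq_mul] at h1
  rw [← Finset.sum_add_distrib] at h1
  rw [eq_neg_iff_add_eq_zero]
  refine congrFun ((D.TA f).eq_zero_of_sum_eq_zero D.α (W := baseMap f D.q ⁻¹ᵁ W)
    (c := fun l => x₀.form _ le_top s (D.θcoord τA W h t l) +
      x₀.form _ le_top (D.θcoord τA W h s l) t) ?_) l
  refine Eq.trans (Finset.sum_congr rfl fun l _ => ?_) h1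
  rw [e, e, ← mul_add]
  exact congrArg _ (map_add ((D.TA f).pr (baseMap f D.q ⁻¹ᵁ W)) _ _)

/-- The lift of `θ` to a trivialized bundle. -/
def trivθ : Fam y.E y.E V := fun W h =>
  -- The coefficients of θ in `A` are lifted to `B` by lifting the basis of `A`. Skewness and the
  -- filtration condition hold coefficient by coefficient, so they survive.
  τ.lift D.β h (RingHom.id _)
    (AddMonoidHom.mk' (fun s => ∑ l, scalar (toSpec f B) W (D.β (Sum.inr l)) •
      τ.σ W h (D.θcoord τA W h s l)) fun s t => by
        simp only [θcoord_add, map_add, smul_add, Finset.sum_add_distrib])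
    (fun a s => by
      simp only [AddMonoidHom.mk'_apply, θcoord_smul, map_smulₛₗ, RingHom.id_apply,
        Finset.smul_sum]
      exact Finset.sum_congr rfl fun l _ => smul_comm _ _ _)

lemma trivθ_σ (W : (XBase f B).Opens) (h : W ≤ V) (s : Γ(x₀.E, (D.TB f).i ⁻¹ᵁ W)) :
    D.trivθ τ τA W h (τ.σ W h s) = ∑ l, scalar (toSpec f B) W (D.β (Sum.inr l)) •
      τ.σ W h (D.θcoord τA W h s l) :=
  τ.lift_σ _ _ _ _ _ _

lemma trivθ_eq (W : (XBase f B).Opens) (h : W ≤ V) (s : Γ(y.E, W)) :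
    D.trivθ τ τA W h s = ∑ m, scalar (toSpec f B) W (D.β m) •
      ∑ l, scalar (toSpec f B) W (D.β (Sum.inr l)) •
        τ.σ W h (D.θcoord τA W h (τ.coord D.β h s m) l) :=
  τ.lift_apply _ _ _ _ _ _

/-- The lift given by a trivialized bundle. -/
def trivLift [CharZero k] (ρ₀ : Reduction (specialFibre f D.ε) x x₀) : LiftOn (baseMap f D.q) x V :=
  D.mkLift ρ₀ (D.trivFilRed τ τA) (D.trivθ τ τA)
    (by
      intro W W' h h' s
      rw [trivθ_eq, trivθ_eq]
      simp only [map_sum, res_smul, resO_scalar', τ.nat, τ.coord_res D.β h h']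
      exact Finset.sum_congr rfl fun m _ => congrArg _ (Finset.sum_congr rfl fun l _ =>
        congrArg _ (congrArg _ (D.θcoord_res τA W W' h h' _ l))))
    (by
      intro W h s t
      rw [← τ.sum_coord D.β h s, ← τ.sum_coord D.β h t]
      simp only [map_sum, map_smul, LinearMap.sum_apply, LinearMap.smul_apply, trivθ_σ, τ.form_eq,
        form_θcoord, map_neg, smul_neg, Finset.sum_neg_distrib]
      refine congrArg _ (Finset.sum_congr rfl fun m _ => congrArg _ ?_)
      simp only [Finset.smul_sum]
      rw [Finset.sum_comm]
      exact Finset.sum_congr rfl fun l _ => Finset.sum_congr rfl fun l' _ => smul_comm _ _ _)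
    (by
      intro i W h s hs
      rw [trivθ_eq]
      refine Submodule.sum_mem _ fun m _ => Submodule.smul_mem _ _ (Submodule.sum_mem _ fun l _ =>
        Submodule.smul_mem _ _ (τ.fil_mem _ _ _ _ ?_))
      have h1 := (τ.mem_fil_iff D.β h i s).mp hs m
      refine (τA.mem_fil_iff D.α ((baseMap f D.q).preimage_mono h) (i - 2) _).mp ?_ l
      exact x.θ_fil _ _ _ _ (τA.fil_mem i (baseMap f D.q ⁻¹ᵁ W) _ _ h1))
    (by
      intro W h s
      change D.trivRed τ τA W h (D.trivθ τ τA W h s) = x.θ _ le_top (D.trivRed τ τA W h s)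
      rw [← τ.sum_coord D.β h s]
      simp only [map_sum, map_smul, map_smulₛₗ, trivθ_σ, trivRed_σ, app_scalar, D.β_inr]
      exact Finset.sum_congr rfl fun m _ => congrArg _ (D.sum_θcoord τA W h _))

end

/-- Lifts exist on affine opens. -/
theorem nonempty_liftOn [CharZero k] (ρ₀ : Reduction (specialFibre f D.ε) x x₀)
    (hV : IsAffineOpen V) : Nonempty (LiftOn (baseMap f D.q) x V) := by
  obtain ⟨τA, -⟩ := D.exists_trivA ρ₀ (D.isAffineOpen_preimage f hV)
  exact ⟨D.trivLift ((D.TB f).modelTriv x₀.toFilSymp D.β V) τA ρ₀⟩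

end SmallExt

/-! ## The action on lifts and their isomorphisms -/

namespace SmallExt

variable {k : Type u} [Field k] {X : Scheme.{u}} {f : X ⟶ Spec (CommRingCat.of k)}
  {A B : Type u} [CommRing A] [Algebra k A] [CommRing B] [IsLocalRing B]
  [Algebra k B] (D : SmallExt k A B) {r n : ℕ} {x₀ : NilBundle X ⊤ r n}
  {x : NilBundle (XBase f A) ⊤ r n}
  (ρ₀ : Reduction (specialFibre f D.ε) x x₀) {V V₁ V₂ V₀ : (XBase f B).Opens}
  (y : LiftOn (baseMap f D.q) x V)
  [IsLocalRing A] [IsArtinianRing A] [IsArtinianRing B] [CharZero k]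
  {U : X.Opens} (hU : IsAffineOpen U) (hV : toX f B ⁻¹ᵁ U ≤ V) {j : ℤ}

/-- The action on the sections of a lift. -/
def lact (z : PTensor f x₀ (RingHom.ker D.q) j U) : Fam y.obj.E y.obj.E (toX f B ⁻¹ᵁ U) :=
  D.act ρ₀ y.ρ.toFilRed hU hV z

variable {D ρ₀ y hU hV} {W : (XBase f B).Opens} {h : W ≤ toX f B ⁻¹ᵁ U}
  (z w : PTensor f x₀ (RingHom.ker D.q) j U)

@[simp] lemma lact_zero (s : Γ(y.obj.E, W)) :
    D.lact ρ₀ y hU hV (0 : PTensor f x₀ (RingHom.ker D.q) j U) W h s = 0 := act_zero W h s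

lemma lact_add (s : Γ(y.obj.E, W)) : D.lact ρ₀ y hU hV (z + w) W h s =
    D.lact ρ₀ y hU hV z W h s + D.lact ρ₀ y hU hV w W h s := act_add z w W h s

lemma lact_neg (s : Γ(y.obj.E, W)) : D.lact ρ₀ y hU hV (-z) W h s =
    - D.lact ρ₀ y hU hV z W h s := act_neg z W h s

lemma lact_sub (s : Γ(y.obj.E, W)) : D.lact ρ₀ y hU hV (z - w) W h s =
    D.lact ρ₀ y hU hV z W h s - D.lact ρ₀ y hU hV w W h s := act_sub z w W h s

lemma lact_nat : IsNat (D.lact ρ₀ y hU hV z) := act_nat z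

@[simp] lemma red_lact (s : Γ(y.obj.E, W)) :
    y.ρ.red W (h.trans hV) (D.lact ρ₀ y hU hV z W h s) = 0 :=
  red_act (ρ := y.ρ.toFilRed) z W h s

@[simp] lemma lact_lact {j' : ℤ} (w : PTensor f x₀ (RingHom.ker D.q) j' U) (s : Γ(y.obj.E, W)) :
    D.lact ρ₀ y hU hV z W h (D.lact ρ₀ y hU hV w W h s) = 0 := act_act z w W h s

lemma lact_form (s t : Γ(y.obj.E, W)) :
    y.obj.form W (h.trans hV) s (D.lact ρ₀ y hU hV z W h t) =
      - y.obj.form W (h.trans hV) (D.lact ρ₀ y hU hV z W h s) t := act_form z W h s t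

lemma lact_fil (i : ℤ) {s : Γ(y.obj.E, W)} (hs : s ∈ y.obj.fil i W (h.trans hV)) :
    D.lact ρ₀ y hU hV z W h s ∈ y.obj.fil (i + j) W (h.trans hV) := act_fil z i W h s hs

lemma lact_restrict {U' : X.Opens} {hU' : IsAffineOpen U'} (hUU' : U' ≤ U)
    {hV' : toX f B ⁻¹ᵁ U' ≤ V} {h : W ≤ toX f B ⁻¹ᵁ U'} (s : Γ(y.obj.E, W)) :
    D.lact ρ₀ y hU' hV' (PTensor.map f x₀ _ (PSec.restrict f x₀ j hUU') z) W h s =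
      D.lact ρ₀ y hU hV z W (h.trans ((toX f B).preimage_mono hUU')) s :=
  act_restrict hU' hUU' z W h s

lemma filIso_lact {y₁ : LiftOn (baseMap f D.q) x V₁} {y₂ : LiftOn (baseMap f D.q) x V₂}
    {h₁ : V₀ ≤ V₁} {h₂ : V₀ ≤ V₂} (φ : FilIso y₁ y₂ V₀ h₁ h₂) {hV₁ : toX f B ⁻¹ᵁ U ≤ V₁}
    {hV₂ : toX f B ⁻¹ᵁ U ≤ V₂} {hW : W ≤ V₀} (s : Γ(y₁.obj.E, W)) :
    φ.app W hW (D.lact ρ₀ y₁ hU hV₁ z W h s) = D.lact ρ₀ y₂ hU hV₂ z W h (φ.app W hW s) :=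
  map_act W h (φ.app W hW).toLinearMap (fun s => φ.red_eq W hW s) z s

lemma θ_lact (z : PTensor f x₀ (RingHom.ker D.q) 0 U) (s : Γ(y.obj.E, W)) :
    y.obj.θ W (h.trans hV) (D.lact ρ₀ y hU hV z W h s) =
      D.lact ρ₀ y hU hV z W h (y.obj.θ W (h.trans hV) s) +
      D.lact ρ₀ y hU hV (PTensor.map f x₀ _ (bracket f x₀ U) z) W h s := by
  rw [← sub_eq_iff_eq_add']
  exact comm_act W h (y.obj.θ W (h.trans hV)) (fun s => y.ρ.red_θ W _ s) z s

variable {z w} in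
lemma lact_injective (H : ∀ s, D.lact ρ₀ y hU hV z _ le_rfl s = D.lact ρ₀ y hU hV w _ le_rfl s) :
    z = w := act_injective H

lemma acts_iff_lact {δ : Fam y.obj.E y.obj.E (toX f B ⁻¹ᵁ U)} (hδ : IsNat δ) :
    Acts f D.q ρ₀ y U hV z (δ _ le_rfl) ↔ ∀ W h s, δ W h s = D.lact ρ₀ y hU hV z W h s := by
  rw [acts_iff hU]
  refine ⟨fun H => ?_, fun H s => H _ _ s⟩
  have h1 : δ = D.lact ρ₀ y hU hV z := IsNat.ext_of_affine (y.obj.locFree.restrict hV)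
    (isAffineOpen_toX hU) hδ (lact_nat z) H
  intro W h s
  rw [h1]

variable (D ρ₀ y hU hV)

/-- The isomorphism `1 + z`. -/
def oneAdd (z : PTensor f x₀ (RingHom.ker D.q) 0 U) : FilIso y y (toX f B ⁻¹ᵁ U) hV hV where
  app W h :=
    { toFun := fun s => s + D.lact ρ₀ y hU hV z W h s
      map_add' := fun s t => by rw [map_add]; abel
      map_smul' := fun a s => by rw [map_smul, RingHom.id_apply, smul_add]
      -- The inverse of 1 + z is 1 - z, since z acts with square zero.
      invFun := fun s => s - D.lact ρ₀ y hU hV z W h s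
      left_inv := fun s => by beta_reduce; rw [map_add, lact_lact]; abel
      right_inv := fun s => by beta_reduce; rw [map_sub, lact_lact]; abel }
  nat W W' h h' s := by
    change res _ h' (s + D.lact ρ₀ y hU hV z W h s) =
      res _ h' s + D.lact ρ₀ y hU hV z W' _ (res _ h' s)
    rw [map_add, lact_nat z W W' h h' s]
  form_eq W h s t := by
    -- The linear terms cancel by skewness, and the quadratic term is -Q(z z s, t) = 0.
    change y.obj.form W _ (s + D.lact ρ₀ y hU hV z W h s) (t + D.lact ρ₀ y hU hV z W h t) = _
    rw [map_add, map_add, LinearMap.add_apply, LinearMap.add_apply, lact_form, lact_form,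
      lact_lact, map_zero, LinearMap.zero_apply]
    abel
  fil_iff j W h s := by
    have key : ∀ s ∈ y.obj.fil j W (h.trans hV), D.lact ρ₀ y hU hV z W h s ∈
        y.obj.fil j W (h.trans hV) := fun s hs => by
      have := lact_fil (ρ₀ := ρ₀) (hU := hU) (hV := hV) (h := h) z j hs
      rwa [add_zero] at this
    change s + D.lact ρ₀ y hU hV z W h s ∈ _ ↔ _
    refine ⟨fun hs => ?_, fun hs => add_mem hs (key s hs)⟩
    have h1 := sub_mem hs (key _ hs)
    rwa [map_add, lact_lact, add_zero, add_sub_cancel_right] at h1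
  red_eq W h s := by
    change y.ρ.red W _ (s + D.lact ρ₀ y hU hV z W h s) = _
    rw [map_add, red_lact, add_zero]

variable {D y hV}

/-- φ - 1 vanishes on the reduction. Expanding the isometry property of φ shows that it is skew up
to Q((φ-1)s, (φ-1)t), which is zero because both entries reduce to zero; `exists_act_eq` then
applies. -/
theorem exists_oneAdd_eq (φ : FilIso y y (toX f B ⁻¹ᵁ U) hV hV) :
    ∃ z : PTensor f x₀ (RingHom.ker D.q) 0 U, ∀ W h s,
      φ.app W h s = s + D.lact ρ₀ y hU hV z W h s := by
  have hred : ∀ W h s, y.ρ.red W (h.trans hV) (φ.app W h s - s) = 0 := fun W h s => by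
    rw [map_sub, φ.red_eq, sub_self]
  obtain ⟨z, hz⟩ := exists_act_eq (j := 0) (ρ₀ := ρ₀) (ρ := y.ρ.toFilRed) hU hV
    (fun W h => (φ.app W h).toLinearMap - LinearMap.id)
    (by
      intro W W' h h' s
      change res _ h' (φ.app W h s - s) = φ.app W' _ (res _ h' s) - res _ h' s
      rw [map_sub, φ.nat'])
    hred
    (by
      intro W h s t
      change y.obj.form W _ s (φ.app W h t - t) = -y.obj.form W _ (φ.app W h s - s) t
      have h1 := form_eq_zero_of_red_eq_zero (ρ := y.ρ.toFilRed) ρ₀ W (h.trans hV)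
        (hred W h s) (hred W h t)
      have h2 := φ.form_eq W h s t
      simp only [map_sub, LinearMap.sub_apply] at h1 ⊢
      rw [h2] at h1
      linear_combination -h1)
    (by
      intro i W h s hs
      rw [add_zero]
      exact sub_mem ((φ.fil_iff i W h s).mpr hs) hs)
  refine ⟨z, fun W h s => ?_⟩
  rw [lact, hz]
  change _ = s + (φ.app W h s - s)
  abel

/-- Two isomorphisms of lifts of filtered symplectic bundles differ by a section of `P⁰ ⊗ I`. -/
theorem exists_filIso_eq {y₁ : LiftOn (baseMap f D.q) x V₁} {y₂ : LiftOn (baseMap f D.q) x V₂}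
    {h₁ : toX f B ⁻¹ᵁ U ≤ V₁} {h₂ : toX f B ⁻¹ᵁ U ≤ V₂} (φ ψ : FilIso y₁ y₂ (toX f B ⁻¹ᵁ U) h₁ h₂) :
    ∃ z : PTensor f x₀ (RingHom.ker D.q) 0 U, ∀ W h s,
      φ.app W h s = ψ.app W h s + D.lact ρ₀ y₂ hU h₂ z W h (ψ.app W h s) := by
  obtain ⟨z, hz⟩ := exists_oneAdd_eq ρ₀ hU (ψ.symm.trans φ)
  refine ⟨z, fun W h s => ?_⟩
  rw [← hz]
  simp

/-- Two lifts of `θ` differ by a section of `P¹ ⊗ I`. -/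
theorem exists_θ_eq (θ₁ θ₂ : Fam y.obj.E y.obj.E (toX f B ⁻¹ᵁ U)) (n₁ : IsNat θ₁) (n₂ : IsNat θ₂)
    (a₁ : ∀ W h s t, y.obj.form W (h.trans hV) s (θ₁ W h t) =
      - y.obj.form W (h.trans hV) (θ₁ W h s) t)
    (a₂ : ∀ W h s t, y.obj.form W (h.trans hV) s (θ₂ W h t) =
      - y.obj.form W (h.trans hV) (θ₂ W h s) t)
    (f₁ : ∀ i W h, ∀ s ∈ y.obj.fil i W (h.trans hV), θ₁ W h s ∈ y.obj.fil (i - 2) W (h.trans hV))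
    (f₂ : ∀ i W h, ∀ s ∈ y.obj.fil i W (h.trans hV), θ₂ W h s ∈ y.obj.fil (i - 2) W (h.trans hV))
    (hred : ∀ W h s, y.ρ.red W (h.trans hV) (θ₁ W h s) = y.ρ.red W (h.trans hV) (θ₂ W h s)) :
    ∃ z : PTensor f x₀ (RingHom.ker D.q) (-2) U, ∀ W h s,
      θ₁ W h s = θ₂ W h s + D.lact ρ₀ y hU hV z W h s := by
  obtain ⟨z, hz⟩ := exists_act_eq (j := -2) (ρ₀ := ρ₀) (ρ := y.ρ.toFilRed) hU hV
    (fun W h => θ₁ W h - θ₂ W h)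
    (by
      intro W W' h h' s
      simp only [LinearMap.sub_apply, map_sub, n₁ W W' h h' s, n₂ W W' h h' s])
    (by
      intro W h s
      change y.ρ.red W _ (θ₁ W h s - θ₂ W h s) = 0
      rw [map_sub, hred, sub_self])
    (by
      intro W h s t
      simp only [LinearMap.sub_apply, map_sub, a₁, a₂]
      ring)
    (by
      intro i W h s hs
      exact sub_mem (f₁ i W h s hs) (f₂ i W h s hs))
  refine ⟨z, fun W h s => ?_⟩
  rw [lact, hz, LinearMap.sub_apply]
  abel

/-- Transport of `θ` along an isomorphism changes it by a section of `P¹ ⊗ I`. -/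
theorem exists_conj_θ_eq {y₁ : LiftOn (baseMap f D.q) x V₁} {y₂ : LiftOn (baseMap f D.q) x V₂}
    {h₁ : toX f B ⁻¹ᵁ U ≤ V₁} {h₂ : toX f B ⁻¹ᵁ U ≤ V₂} (φ : FilIso y₁ y₂ (toX f B ⁻¹ᵁ U) h₁ h₂) :
    ∃ z : PTensor f x₀ (RingHom.ker D.q) (-2) U, ∀ W h s,
      φ.app W h (y₁.obj.θ W (h.trans h₁) s) = y₂.obj.θ W (h.trans h₂) (φ.app W h s) +
        D.lact ρ₀ y₂ hU h₂ z W h (φ.app W h s) := by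
  obtain ⟨z, hz⟩ := exists_θ_eq ρ₀ hU (y := y₂) (hV := h₂)
    (fun W h => (φ.app W h).toLinearMap ∘ₗ y₁.obj.θ W (h.trans h₁) ∘ₗ (φ.app W h).symm.toLinearMap)
    (fun W h => y₂.obj.θ W (h.trans h₂))
    (by
      intro W W' h h' s
      simp only [LinearMap.comp_apply, LinearEquiv.coe_coe]
      rw [φ.nat', y₁.obj.θ_nat _ _ _ h']
      have := φ.symm.nat' h h' s
      simp only [FilIso.symm_app] at this
      rw [this])
    (fun W W' h h' s => y₂.obj.θ_nat W W' _ h' s)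
    (by
      intro W h s t
      have e1 := φ.form_eq W h ((φ.app W h).symm s) (y₁.obj.θ W (h.trans h₁) ((φ.app W h).symm t))
      have e2 := φ.form_eq W h (y₁.obj.θ W (h.trans h₁) ((φ.app W h).symm s)) ((φ.app W h).symm t)
      simp only [LinearEquiv.apply_symm_apply] at e1 e2
      simp only [LinearMap.comp_apply, LinearEquiv.coe_coe]
      rw [e1, e2, y₁.obj.θ_adj])
    (fun W h s t => y₂.obj.θ_adj W _ s t)
    (by
      intro i W h s hs
      simp only [LinearMap.comp_apply, LinearEquiv.coe_coe]
      rw [φ.fil_iff]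
      refine y₁.obj.θ_fil _ _ _ _ ?_
      rw [← φ.fil_iff i W h]
      simpa using hs)
    (fun i W h s hs => y₂.obj.θ_fil i W _ s hs)
    (by
      intro W h s
      simp only [LinearMap.comp_apply, LinearEquiv.coe_coe]
      rw [φ.red_eq, y₁.ρ.red_θ, y₂.ρ.red_θ, ← φ.red_eq W h]
      simp)
  refine ⟨z, fun W h s => ?_⟩
  have := hz W h (φ.app W h s)
  simpa using this

end SmallExt

/-! ## Gluing sheaves of modules -/

section GlueSheaf

variable {Y : Scheme.{u}} {ι : Type u} {V : ι → Y.Opens} {E : ι → Y.Modules}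

/-- Gluing data for sheaves of modules on the members of an open cover. -/
structure GlueData (V : ι → Y.Opens) (E : ι → Y.Modules) where
  /-- the transition maps -/
  g : ∀ (α β : ι) (W : Y.Opens), W ≤ V α → W ≤ V β → (Γ(E β, W) ≃ₗ[Γ(Y, W)] Γ(E α, W))
  nat : ∀ (α β : ι) (W W' : Y.Opens) (h : W ≤ V α) (h' : W ≤ V β) (hW : W' ≤ W) (s : Γ(E β, W)),
    res (E α) hW (g α β W h h' s) = g α β W' (hW.trans h) (hW.trans h') (res (E β) hW s)
  cocycle : ∀ (α β γ : ι) (W : Y.Opens) (hα : W ≤ V α) (hβ : W ≤ V β) (hγ : W ≤ V γ)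
    (s : Γ(E γ, W)), g α β W hα hβ (g β γ W hβ hγ s) = g α γ W hα hγ s

namespace GlueData

variable (G : GlueData V E)

/-- No normalization of the transition maps is assumed; it follows from the cocycle condition for a
single index, by injectivity. -/
lemma g_self (α : ι) (W : Y.Opens) (h h' : W ≤ V α) (s : Γ(E α, W)) : G.g α α W h h' s = s :=
  (G.g α α W h h').injective (G.cocycle α α α W h h h s)

/-- The sections of the glued sheaf. -/
def obj (W : Y.Opens) : AddSubgroup (∀ α, Γ(E α, W ⊓ V α)) where
  carrier := { s | ∀ (α β : ι) (W' : Y.Opens) (h : W' ≤ W ⊓ V α) (h' : W' ≤ W ⊓ V β),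
    G.g α β W' (h.trans inf_le_right) (h'.trans inf_le_right) (res (E β) h' (s β)) =
      res (E α) h (s α) }
  zero_mem' α β W' h h' := by simp only [Pi.zero_apply, map_zero]
  add_mem' hs ht α β W' h h' := by
    simp only [Pi.add_apply, map_add]
    rw [hs, ht]
  neg_mem' hs α β W' h h' := by
    simp only [Pi.neg_apply, map_neg]
    rw [hs]

instance (W : Y.Opens) : Module Γ(Y, W) (G.obj W) where
  smul a s := ⟨fun α => resO Y (inf_le_left : W ⊓ V α ≤ W) a • s.1 α, fun α β W' h h' => by
    rw [res_smul, res_smul, resO_resO, resO_resO, map_smul, s.2]⟩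
  one_smul s := Subtype.ext (funext fun α => by
    change resO Y (inf_le_left : W ⊓ V α ≤ W) 1 • s.1 α = s.1 α
    rw [map_one, one_smul])
  mul_smul a b s := Subtype.ext (funext fun α => by
    change resO Y (inf_le_left : W ⊓ V α ≤ W) (a * b) • s.1 α = resO Y (inf_le_left : W ⊓ V α ≤ W) a • resO Y (inf_le_left : W ⊓ V α ≤ W) b • s.1 α
    rw [map_mul, mul_smul])
  smul_zero a := Subtype.ext (funext fun α => smul_zero (resO Y (inf_le_left : W ⊓ V α ≤ W) a))
  smul_add a s t := Subtype.ext (funext fun α => smul_add (resO Y (inf_le_left : W ⊓ V α ≤ W) a) (s.1 α) (t.1 α))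
  add_smul a b s := Subtype.ext (funext fun α => by
    change resO Y (inf_le_left : W ⊓ V α ≤ W) (a + b) • s.1 α =
      resO Y (inf_le_left : W ⊓ V α ≤ W) a • s.1 α + resO Y (inf_le_left : W ⊓ V α ≤ W) b • s.1 α
    rw [map_add, add_smul])
  zero_smul s := Subtype.ext (funext fun α => by
    change resO Y (inf_le_left : W ⊓ V α ≤ W) 0 • s.1 α = 0
    rw [map_zero, zero_smul])

lemma smul_val {W : Y.Opens} (a : Γ(Y, W)) (s : G.obj W) (α : ι) :
    (a • s).1 α = resO Y (inf_le_left : W ⊓ V α ≤ W) a • s.1 α := rfl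

/-- Restriction of sections of the glued sheaf. -/
def objRes {W W' : Y.Opens} (h : W' ≤ W) : G.obj W →+ G.obj W' :=
  AddMonoidHom.mk' (fun s => ⟨fun α => res (E α) (inf_le_inf_right _ h) (s.1 α),
    fun α β W'' h' h'' => by rw [res_res, res_res, s.2]⟩) fun s t =>
      Subtype.ext (funext fun α => map_add (res (E α) _) _ _)

lemma objRes_val {W W' : Y.Opens} (h : W' ≤ W) (s : G.obj W) (α : ι) :
    (G.objRes h s).1 α = res (E α) (inf_le_inf_right _ h) (s.1 α) := rfl

/-- The sections of the glued sheaf, as sheaf data. -/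
def sec : SecData Y where
  obj W := G.obj W
  res h := G.objRes h
  res_self h s := Subtype.ext (funext fun α => res_self _ _ _)
  res_res h h' s := Subtype.ext (funext fun α => res_res _ _ _ _)
  res_smul h a s := Subtype.ext (funext fun α => by
    rw [objRes_val, smul_val, smul_val, objRes_val, res_smul, resO_resO, resO_resO])
  sep W s t H := Subtype.ext (funext fun α => eq_of_locally fun z hz => by
    obtain ⟨j, hj⟩ := Opens.mem_iSup.mp hz.1
    exact ⟨W j ⊓ V α, inf_le_inf_right _ (le_iSup W j), ⟨hj, hz.2⟩,
      congrFun (congrArg Subtype.val (H j)) α⟩)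
  glue W s hs := by
    have hcov : ∀ α, (⨆ j, W j) ⊓ V α ≤ ⨆ j, W j ⊓ V α := fun α z hz => by
      obtain ⟨j, hj⟩ := Opens.mem_iSup.mp hz.1
      exact Opens.mem_iSup.mpr ⟨j, hj, hz.2⟩
    have h1 := fun α => exists_glue (E α) (fun j => W j ⊓ V α) ((⨆ j, W j) ⊓ V α)
      (fun j => inf_le_inf_right _ (le_iSup W j)) (hcov α) (fun j => (s j).1 α) (fun j l => by
        have h2 := congrArg (res (E α) (show (W j ⊓ V α) ⊓ (W l ⊓ V α) ≤ (W j ⊓ W l) ⊓ V α from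
          le_inf (inf_le_inf inf_le_left inf_le_left) (inf_le_left.trans inf_le_right)))
          (congrFun (congrArg Subtype.val (hs j l)) α)
        rw [objRes_val, objRes_val, res_res, res_res] at h2
        exact h2)
    choose t ht using h1
    refine ⟨⟨t, fun α β W' h h' => ?_⟩, fun j => Subtype.ext (funext fun α => ht α j)⟩
    refine eq_of_locally fun z hz => ?_
    obtain ⟨j, hj⟩ := Opens.mem_iSup.mp (h hz).1
    have h₁ : W' ⊓ W j ≤ W j ⊓ V α := le_inf inf_le_right (inf_le_left.trans (h.trans inf_le_right))
    have h₂ : W' ⊓ W j ≤ W j ⊓ V β := le_inf inf_le_right (inf_le_left.trans (h'.trans inf_le_right))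
    refine ⟨W' ⊓ W j, inf_le_left, ⟨hz, hj⟩, ?_⟩
    rw [G.nat, res_res, res_res, ← res_res (E β) (inf_le_inf_right (V β) (le_iSup W j)) h₂,
      ← res_res (E α) (inf_le_inf_right (V α) (le_iSup W j)) h₁, ht, ht]
    exact (s j).2 α β _ h₁ h₂

/-- The glued sheaf is isomorphic to the given one on each member of the cover. -/
def iso (α : ι) (W : Y.Opens) (h : W ≤ V α) : G.obj W ≃ₗ[Γ(Y, W)] Γ(E α, W) where
  toFun s := res (E α) (le_inf le_rfl h) (s.1 α)
  map_add' s t := map_add (res (E α) _) _ _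
  map_smul' a s := by rw [smul_val, res_smul, resO_resO, resO_self, RingHom.id_apply]
  invFun t := ⟨fun β => G.g β α _ inf_le_right (inf_le_left.trans h) (res (E α) inf_le_left t),
    fun β γ W' h' h'' => by rw [G.nat, G.nat, G.cocycle, res_res, res_res]⟩
  left_inv s := Subtype.ext (funext fun β => by
    change G.g β α _ _ _ (res (E α) _ (res (E α) _ (s.1 α))) = s.1 β
    rw [res_res, s.2 β α _ le_rfl (le_inf inf_le_left (inf_le_left.trans h)), res_self])
  right_inv t := by
    change res (E α) _ (G.g α α _ _ _ (res (E α) _ t)) = t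
    rw [g_self, res_res, res_self]

lemma iso_nat (α : ι) (W W' : Y.Opens) (h : W ≤ V α) (h' : W' ≤ W) (s : G.obj W) :
    res (E α) h' (G.iso α W h s) = G.iso α W' (h'.trans h) (G.objRes h' s) := by
  change res (E α) h' (res (E α) _ (s.1 α)) = res (E α) _ (res (E α) _ (s.1 α))
  rw [res_res, res_res]

lemma g_iso (α β : ι) (W : Y.Opens) (h : W ≤ V α) (h' : W ≤ V β) (s : G.obj W) :
    G.g α β W h h' (G.iso β W h' s) = G.iso α W h s :=
  s.2 α β W (le_inf le_rfl h) (le_inf le_rfl h')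

theorem exists_sheaf : ∃ (N : Y.Modules)
    (ψ : ∀ (α : ι) (W : Y.Opens), W ≤ V α → (Γ(N, W) ≃ₗ[Γ(Y, W)] Γ(E α, W))),
    (∀ (α : ι) (W W' : Y.Opens) (h : W ≤ V α) (h' : W' ≤ W) (s : Γ(N, W)),
      res (E α) h' (ψ α W h s) = ψ α W' (h'.trans h) (res N h' s)) ∧
    ∀ (α β : ι) (W : Y.Opens) (h : W ≤ V α) (h' : W ≤ V β) (s : Γ(N, W)),
      G.g α β W h h' (ψ β W h' s) = ψ α W h s :=
  ⟨G.sec.toModules, G.iso, G.iso_nat, G.g_iso⟩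

end GlueData

end GlueSheaf

/-! ## Gluing filtered symplectic bundles -/

section GlueBundle

variable {Y Y' : Scheme.{u}} {r n : ℕ} {i : Y ⟶ Y'} {x : NilBundle Y ⊤ r n} {ι : Type u}

/-- The map `m` is the identity for objects on `Y'`, and the inverse image along `i` for reductions.
Local data are given on all small open sets, so that compatibility is needed only on a common open
set. -/
lemma exists_glue_of_cover {V : ι → Y'.Opens} {Z : Scheme.{u}} (F : Z.Modules)
    (m : Y'.Opens → Z.Opens) (hm : ∀ {W W' : Y'.Opens}, W' ≤ W → m W' ≤ m W)
    (hcov : ∀ W, m W ≤ ⨆ α, m (W ⊓ V α)) (hinf : ∀ W W', m W ⊓ m W' ≤ m (W ⊓ W'))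
    (W : Y'.Opens) (c : ∀ (α : ι) (W' : Y'.Opens), W' ≤ W → W' ≤ V α → Γ(F, m W'))
    (nat : ∀ α W' W'' (h : W' ≤ W) (hα : W' ≤ V α) (h' : W'' ≤ W'),
      res F (hm h') (c α W' h hα) = c α W'' (h'.trans h) (h'.trans hα))
    (ind : ∀ α β W' (h : W' ≤ W) (hα : W' ≤ V α) (hβ : W' ≤ V β), c α W' h hα = c β W' h hβ) :
    ∃ t : Γ(F, m W), ∀ α W' (h : W' ≤ W) (hα : W' ≤ V α), res F (hm h) t = c α W' h hα := by
  obtain ⟨t, ht⟩ := exists_glue F (fun α => m (W ⊓ V α)) (m W) (fun α => hm inf_le_left) (hcov W)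
    (fun α => c α _ inf_le_left inf_le_right) (fun α β => by
      have e1 := nat α _ ((W ⊓ V α) ⊓ (W ⊓ V β)) inf_le_left inf_le_right inf_le_left
      have e2 := nat β _ ((W ⊓ V α) ⊓ (W ⊓ V β)) inf_le_left inf_le_right inf_le_right
      rw [← res_res F (hm inf_le_left) (hinf _ _), e1, ← res_res F (hm inf_le_right) (hinf _ _), e2,
        ind α β])
  refine ⟨t, fun α W' h hα => ?_⟩
  rw [← res_res F (hm inf_le_left) (hm (le_inf h hα)), ht α, nat _ _ _ _ _ (le_inf h hα)]

/-- A sheaf with isomorphisms to the lifts `y α` over the members of a cover, which identify the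
forms, the filtrations and the reductions. -/
structure Atlas {V : ι → Y'.Opens} (y : ∀ α, LiftOn i x (V α)) where
  /-- the sheaf -/
  E : Y'.Modules
  /-- the isomorphisms -/
  ψ : ∀ (α : ι) (W : Y'.Opens), W ≤ V α → (Γ(E, W) ≃ₗ[Γ(Y', W)] Γ((y α).obj.E, W))
  nat : ∀ (α : ι) (W W' : Y'.Opens) (h : W ≤ V α) (h' : W' ≤ W) (s : Γ(E, W)),
    res (y α).obj.E h' (ψ α W h s) = ψ α W' (h'.trans h) (res E h' s)
  form_eq : ∀ (α β : ι) (W : Y'.Opens) (h : W ≤ V α) (h' : W ≤ V β) (s t : Γ(E, W)),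
    (y α).obj.form W h (ψ α W h s) (ψ α W h t) = (y β).obj.form W h' (ψ β W h' s) (ψ β W h' t)
  fil_imp : ∀ (j : ℤ) (α β : ι) (W : Y'.Opens) (h : W ≤ V α) (h' : W ≤ V β) (s : Γ(E, W)),
    ψ α W h s ∈ (y α).obj.fil j W h → ψ β W h' s ∈ (y β).obj.fil j W h'
  red_eq : ∀ (α β : ι) (W : Y'.Opens) (h : W ≤ V α) (h' : W ≤ V β) (s : Γ(E, W)),
    (y α).ρ.red W h (ψ α W h s) = (y β).ρ.red W h' (ψ β W h' s)
  cov : ⨆ α, V α = ⊤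

namespace Atlas

variable {V : ι → Y'.Opens} {y : ∀ α, LiftOn i x (V α)} (G : Atlas y)

include G in
lemma exists_mem (z : Y') : ∃ α, z ∈ V α :=
  Opens.mem_iSup.mp (show z ∈ ⨆ α, V α from G.cov ▸ trivial)

include G in
lemma le_iSup_inf (W : Y'.Opens) : W ≤ ⨆ α, W ⊓ V α := fun z hz => by
  obtain ⟨α, hα⟩ := G.exists_mem z
  exact Opens.mem_iSup.mpr ⟨α, hz, hα⟩

include G in
lemma preimage_le_iSup_inf (W : Y'.Opens) : i ⁻¹ᵁ W ≤ ⨆ α, i ⁻¹ᵁ (W ⊓ V α) := fun z hz => by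
  obtain ⟨α, hα⟩ := G.exists_mem (i z)
  exact Opens.mem_iSup.mpr ⟨α, hz, hα⟩

lemma symm_nat (α : ι) {W W' : Y'.Opens} (h : W ≤ V α) (h' : W' ≤ W) (s : Γ((y α).obj.E, W)) :
    res G.E h' ((G.ψ α W h).symm s) = (G.ψ α W' (h'.trans h)).symm (res (y α).obj.E h' s) := by
  rw [LinearEquiv.eq_symm_apply, ← G.nat α W W' h h', LinearEquiv.apply_symm_apply]

include G in
lemma eqO_of_cover {W : Y'.Opens} {a b : Γ(Y', W)} (h : ∀ α (W' : Y'.Opens) (h' : W' ≤ W),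
    W' ≤ V α → resO Y' h' a = resO Y' h' b) : a = b :=
  eq_of_locallyO fun z hz => by
    obtain ⟨α, hα⟩ := G.exists_mem z
    exact ⟨W ⊓ V α, inf_le_left, ⟨hz, hα⟩, h α _ _ inf_le_right⟩

include G in
lemma eq_of_cover {N : Y'.Modules} {W : Y'.Opens} {a b : Γ(N, W)}
    (h : ∀ α (W' : Y'.Opens) (h' : W' ≤ W), W' ≤ V α → res N h' a = res N h' b) : a = b :=
  eq_of_locally fun z hz => by
    obtain ⟨α, hα⟩ := G.exists_mem z
    exact ⟨W ⊓ V α, inf_le_left, ⟨hz, hα⟩, h α _ _ inf_le_right⟩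

include G in
lemma eq_of_cover_preimage {N : Y.Modules} {W : Y'.Opens} {a b : Γ(N, i ⁻¹ᵁ W)}
    (h : ∀ α (W' : Y'.Opens) (h' : W' ≤ W), W' ≤ V α →
      res N (i.preimage_mono h') a = res N (i.preimage_mono h') b) : a = b :=
  eq_of_locally fun z hz => by
    obtain ⟨α, hα⟩ := G.exists_mem (i z)
    exact ⟨i ⁻¹ᵁ (W ⊓ V α), i.preimage_mono inf_le_left, ⟨hz, hα⟩, h α _ inf_le_left inf_le_right⟩

lemma exists_form (W : Y'.Opens) (s t : Γ(G.E, W)) : ∃ c : Γ(Y', W),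
    ∀ α (W' : Y'.Opens) (h : W' ≤ W) (hα : W' ≤ V α), resO Y' h c =
      (y α).obj.form W' hα (G.ψ α W' hα (res G.E h s)) (G.ψ α W' hα (res G.E h t)) :=
  exists_glue_of_cover (structureModule Y') id (fun h => h) G.le_iSup_inf (fun _ _ => le_rfl) W
    (fun α W' h hα => (y α).obj.form W' hα (G.ψ α W' hα (res G.E h s)) (G.ψ α W' hα (res G.E h t)))
    (fun α W' W'' h hα h' => by
      refine ((y α).obj.form_res W' W'' hα h' _ _).trans ?_
      rw [G.nat, G.nat, res_res, res_res])
    (fun α β W' h hα hβ => G.form_eq α β W' hα hβ _ _)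

/-- The form of the glued bundle. -/
def form (W : Y'.Opens) : Γ(G.E, W) →ₗ[Γ(Y', W)] Γ(G.E, W) →ₗ[Γ(Y', W)] Γ(Y', W) :=
  have spec := fun s t => (G.exists_form W s t).choose_spec
  LinearMap.mk₂ _ (fun s t => (G.exists_form W s t).choose)
    (fun s s' t => G.eqO_of_cover fun α W' h hα => by
      rw [map_add, spec _ _ α _ _ hα, spec _ _ α _ _ hα, spec _ _ α _ _ hα]
      simp only [map_add, LinearMap.add_apply])
    (fun a s t => G.eqO_of_cover fun α W' h hα => by
      rw [smul_eq_mul, map_mul, spec _ _ α _ _ hα, spec _ _ α _ _ hα, res_smul]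
      simp only [map_smul, LinearMap.smul_apply, smul_eq_mul])
    (fun s t t' => G.eqO_of_cover fun α W' h hα => by
      rw [map_add, spec _ _ α _ _ hα, spec _ _ α _ _ hα, spec _ _ α _ _ hα]
      simp only [map_add])
    (fun a s t => G.eqO_of_cover fun α W' h hα => by
      rw [smul_eq_mul, map_mul, spec _ _ α _ _ hα, spec _ _ α _ _ hα, res_smul]
      simp only [map_smul, smul_eq_mul])

lemma resO_form {W W' : Y'.Opens} (s t : Γ(G.E, W)) (α : ι) (h : W' ≤ W) (hα : W' ≤ V α) :
    resO Y' h (G.form W s t) =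
      (y α).obj.form W' hα (G.ψ α W' hα (res G.E h s)) (G.ψ α W' hα (res G.E h t)) :=
  (G.exists_form W s t).choose_spec α W' h hα

lemma form_of_le {W : Y'.Opens} (s t : Γ(G.E, W)) (α : ι) (hα : W ≤ V α) :
    G.form W s t = (y α).obj.form W hα (G.ψ α W hα s) (G.ψ α W hα t) := by
  have := G.resO_form s t α le_rfl hα
  rwa [resO_self, res_self, res_self] at this

lemma form_res {W W' : Y'.Opens} (h : W' ≤ W) (s t : Γ(G.E, W)) :
    resO Y' h (G.form W s t) = G.form W' (res G.E h s) (res G.E h t) :=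
  G.eqO_of_cover fun α W'' h' hα => by
    rw [resO_resO, G.resO_form _ _ α _ hα, G.resO_form _ _ α _ hα, res_res, res_res]

lemma eq_zero_of_form {W : Y'.Opens} (s : Γ(G.E, W))
    (H : ∀ (W' : Y'.Opens) (h : W' ≤ W) (t : Γ(G.E, W')), G.form W' (res G.E h s) t = 0) :
    s = 0 := by
  refine G.eq_of_cover fun α W' h hα => ?_
  obtain ⟨s₀, -, hu⟩ := (y α).obj.form_nondeg W' hα (fun _ _ => 0) (fun _ _ _ _ _ => by simp)
  apply (G.ψ α W' hα).injective
  rw [hu (G.ψ α W' hα _), ← hu (G.ψ α W' hα (res G.E h 0))]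
  · intro W'' h'' t
    simp
  · intro W'' h'' t
    have h1 := H W'' (h''.trans h) ((G.ψ α W'' (h''.trans hα)).symm t)
    rw [G.form_of_le _ _ α (h''.trans hα), LinearEquiv.apply_symm_apply, ← res_res G.E h h'',
      ← G.nat α W' W'' hα h''] at h1
    rw [h1, LinearMap.zero_apply]

/-- Nondegeneracy of the local lifts gives representing sections on the members of the cover. They
agree on overlaps by `eq_zero_of_form`, so they glue. -/
lemma exists_form_eq (W : Y'.Opens) (l : ∀ W' : Y'.Opens, W' ≤ W → (Γ(G.E, W') →ₗ[Γ(Y', W')] Γ(Y', W')))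
    (hl : ∀ (W₁ W₂ : Y'.Opens) (h₁ : W₁ ≤ W) (h₂ : W₂ ≤ W₁) (t : Γ(G.E, W₁)),
      resO Y' h₂ (l W₁ h₁ t) = l W₂ (h₂.trans h₁) (res G.E h₂ t)) :
    ∃ s : Γ(G.E, W), ∀ (W' : Y'.Opens) (h' : W' ≤ W) (t : Γ(G.E, W')),
      l W' h' t = G.form W' (res G.E h' s) t := by
  have h1 : ∀ α, ∃ s : Γ(G.E, W ⊓ V α), ∀ (W' : Y'.Opens) (h' : W' ≤ W ⊓ V α) (t : Γ(G.E, W')),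
      l W' (h'.trans inf_le_left) t = G.form W' (res G.E h' s) t := by
    intro α
    obtain ⟨s, hs, -⟩ := (y α).obj.form_nondeg (W ⊓ V α) inf_le_right
      (fun W' h' => l W' (h'.trans inf_le_left) ∘ₗ (G.ψ α W' (h'.trans inf_le_right)).symm.toLinearMap)
      (fun W₁ W₂ h₁ h₂ t => by
        simp only [LinearMap.comp_apply, LinearEquiv.coe_coe]
        rw [hl _ _ _ h₂, G.symm_nat])
    refine ⟨(G.ψ α _ inf_le_right).symm s, fun W' h' t => ?_⟩
    have h2 := hs W' h' (G.ψ α W' (h'.trans inf_le_right) t)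
    simp only [LinearMap.comp_apply, LinearEquiv.coe_coe, LinearEquiv.symm_apply_apply] at h2
    rw [h2, G.form_of_le _ _ α (h'.trans inf_le_right), G.symm_nat, LinearEquiv.apply_symm_apply]
  choose s hs using h1
  obtain ⟨t, ht⟩ := exists_glue G.E (fun α => W ⊓ V α) W (fun _ => inf_le_left) (G.le_iSup_inf W) s
    (fun α β => by
      rw [← sub_eq_zero]
      refine G.eq_zero_of_form _ fun W' h' t => ?_
      rw [map_sub, map_sub, LinearMap.sub_apply, res_res, res_res, ← hs, ← hs, sub_self])
  refine ⟨t, fun W' h' u => G.eqO_of_cover fun α W'' h'' hα => ?_⟩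
  rw [hl _ _ _ h'', G.form_res, res_res, ← res_res G.E (inf_le_left : W ⊓ V α ≤ W)
    (le_inf (h''.trans h') hα), ht, ← hs]

/-- The filtration of the glued bundle. -/
def fil (j : ℤ) (W : Y'.Opens) : Submodule Γ(Y', W) Γ(G.E, W) where
  carrier := { s | ∀ α (W' : Y'.Opens) (h : W' ≤ W) (hα : W' ≤ V α),
    G.ψ α W' hα (res G.E h s) ∈ (y α).obj.fil j W' hα }
  zero_mem' α W' h hα := by rw [map_zero, map_zero]; exact zero_mem _
  add_mem' hs ht α W' h hα := by rw [map_add, map_add]; exact add_mem (hs α W' h hα) (ht α W' h hα)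
  smul_mem' a s hs α W' h hα := by
    rw [res_smul, map_smul]; exact Submodule.smul_mem _ _ (hs α W' h hα)

lemma mem_fil_iff {j : ℤ} {W : Y'.Opens} {s : Γ(G.E, W)} (α : ι) (hα : W ≤ V α) :
    s ∈ G.fil j W ↔ G.ψ α W hα s ∈ (y α).obj.fil j W hα := by
  constructor
  · intro hs
    have := hs α W le_rfl hα
    rwa [res_self] at this
  · intro hs β W' h hβ
    refine G.fil_imp j α β W' (h.trans hα) hβ _ ?_
    rw [← G.nat α W W' hα h]
    exact (y α).obj.fil_res _ _ _ _ _ _ hs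

lemma fil_res {j : ℤ} {W W' : Y'.Opens} (h : W' ≤ W) {s : Γ(G.E, W)} (hs : s ∈ G.fil j W) :
    res G.E h s ∈ G.fil j W' := fun α W'' h' hα => by
  rw [res_res]
  exact hs α W'' _ hα

lemma fil_local {j : ℤ} {W : Y'.Opens} {s : Γ(G.E, W)}
    (H : ∀ z ∈ W, ∃ (W' : Y'.Opens) (h' : W' ≤ W), z ∈ W' ∧ res G.E h' s ∈ G.fil j W') :
    s ∈ G.fil j W := fun α W' h hα => by
  refine (y α).obj.fil_local _ _ _ _ fun z hz => ?_
  obtain ⟨W'', h'', hz', hs⟩ := H z (h hz)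
  refine ⟨W' ⊓ W'', inf_le_left, ⟨hz, hz'⟩, ?_⟩
  rw [G.nat, res_res]
  have := hs α (W' ⊓ W'') inf_le_right (inf_le_left.trans hα)
  rwa [res_res] at this

lemma fil_perp (j : ℤ) (W : Y'.Opens) (s : Γ(G.E, W)) : s ∈ G.fil (-1 - j) W ↔
    ∀ (W' : Y'.Opens) (h' : W' ≤ W), ∀ t ∈ G.fil j W', G.form W' (res G.E h' s) t = 0 := by
  constructor
  · intro hs W' h' t ht
    refine G.eqO_of_cover fun α W'' h'' hα => ?_
    rw [map_zero, G.resO_form _ _ α _ hα, res_res]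
    have := ((y α).obj.fil_perp j W'' hα _).mp (hs α W'' (h''.trans h') hα) W'' le_rfl _
      (ht α W'' h'' hα)
    rwa [res_self] at this
  · intro H α W' h hα
    rw [(y α).obj.fil_perp]
    intro W'' h'' t ht
    have h1 := H W'' (h''.trans h) ((G.ψ α W'' (h''.trans hα)).symm t)
      ((G.mem_fil_iff α (h''.trans hα)).mpr (by rwa [LinearEquiv.apply_symm_apply]))
    rwa [G.form_of_le _ _ α (h''.trans hα), LinearEquiv.apply_symm_apply, ← res_res G.E h h'',
      ← G.nat α W' W'' hα h''] at h1

/-- The glued bundle. -/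
def filSymp : FilSymp Y' ⊤ r n where
  E := G.E
  locallyFree z _ := by
    obtain ⟨α, hα⟩ := G.exists_mem z
    obtain ⟨W, hz, hW, e, he⟩ := (y α).obj.locallyFree z hα
    refine ⟨W, hz, le_top, fun j => (G.ψ α W hW).symm (e j), fun W' h => ?_⟩
    refine (Function.Bijective.of_comp_iff' (G.ψ α W' (h.trans hW)).bijective _).mp ?_
    convert he W' h using 1
    funext a
    simp only [Function.comp_apply, map_sum, map_smul, ← G.nat α W W' hW h,
      LinearEquiv.apply_symm_apply]
  form W _ := G.form W
  form_res W W' _ h' s t := G.form_res h' s t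
  form_alt W _ s := G.eqO_of_cover fun α W' h hα => by
    rw [G.resO_form _ _ α _ hα, (y α).obj.form_alt, map_zero]
  form_nondeg W _ l hl := by
    obtain ⟨s, hs⟩ := G.exists_form_eq W l hl
    refine ⟨s, hs, fun s' hs' => ?_⟩
    rw [← sub_eq_zero]
    refine G.eq_zero_of_form _ fun W' h t => ?_
    rw [map_sub, map_sub, LinearMap.sub_apply, ← hs, ← hs', sub_self]
  fil j W _ := G.fil j W
  fil_res j W W' _ h' s hs := G.fil_res h' hs
  fil_local j W _ s hs := G.fil_local hs
  fil_mono j W _ s hs α W' h hα := (y α).obj.fil_mono j W' hα (hs α W' h hα)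
  fil_bot j hj W _ := by
    rw [eq_bot_iff]
    intro s hs
    refine G.eq_of_cover fun α W' h hα => ?_
    have h1 := hs α W' h hα
    rw [(y α).obj.fil_bot j hj, Submodule.mem_bot, LinearEquiv.map_eq_zero_iff] at h1
    rw [h1, map_zero]
  fil_top j hj W _ := by
    rw [eq_top_iff]
    intro s _ α W' h hα
    rw [(y α).obj.fil_top j hj]
    trivial
  gr_free j z _ := by
    obtain ⟨α, hα⟩ := G.exists_mem z
    obtain ⟨W, hW, hz, m, e, he, he'⟩ := (y α).obj.gr_free j z hα
    refine ⟨W, le_top, hz, m, fun l => (G.ψ α W hW).symm (e l), fun l => ?_, fun W' h s hs => ?_⟩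
    · exact (G.mem_fil_iff α hW).mpr (by rw [LinearEquiv.apply_symm_apply]; exact he l)
    · have h1 := he' W' h _ ((G.mem_fil_iff α (h.trans hW)).mp hs)
      refine (existsUnique_congr fun a => ?_).mp h1
      rw [G.mem_fil_iff α (h.trans hW)]
      simp only [map_sub, map_sum, map_smul, ← G.nat α W W' hW h, LinearEquiv.apply_symm_apply]
  fil_perp j W _ s := G.fil_perp j W s

lemma exists_red (W : Y'.Opens) (s : Γ(G.E, W)) : ∃ c : Γ(x.E, i ⁻¹ᵁ W),
    ∀ α (W' : Y'.Opens) (h : W' ≤ W) (hα : W' ≤ V α), res x.E (i.preimage_mono h) c =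
      (y α).ρ.red W' hα (G.ψ α W' hα (res G.E h s)) :=
  exists_glue_of_cover x.E (fun W => i ⁻¹ᵁ W) (fun h => i.preimage_mono h)
    G.preimage_le_iSup_inf (fun _ _ => le_rfl) W
    (fun α W' h hα => (y α).ρ.red W' hα (G.ψ α W' hα (res G.E h s)))
    (fun α W' W'' h hα h' => by
      rw [← (y α).ρ.red_res W' W'' hα h', G.nat, res_res])
    (fun α β W' h hα hβ => G.red_eq α β W' hα hβ _)

/-- The reduction of the glued bundle. -/
def red (W : Y'.Opens) : Γ(G.E, W) →+ Γ(x.E, i ⁻¹ᵁ W) :=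
  AddMonoidHom.mk' (fun s => (G.exists_red W s).choose) fun s t =>
    G.eq_of_cover_preimage fun α W' h hα => by
      rw [map_add, (G.exists_red W _).choose_spec α W' h hα,
        (G.exists_red W _).choose_spec α W' h hα, (G.exists_red W _).choose_spec α W' h hα]
      simp only [map_add]

lemma res_red {W W' : Y'.Opens} (s : Γ(G.E, W)) (α : ι) (h : W' ≤ W) (hα : W' ≤ V α) :
    res x.E (i.preimage_mono h) (G.red W s) = (y α).ρ.red W' hα (G.ψ α W' hα (res G.E h s)) :=
  (G.exists_red W s).choose_spec α W' h hα

lemma red_of_le {W : Y'.Opens} (s : Γ(G.E, W)) (α : ι) (hα : W ≤ V α) :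
    G.red W s = (y α).ρ.red W hα (G.ψ α W hα s) := by
  have := G.res_red s α le_rfl hα
  rwa [res_self, res_self] at this

lemma red_smul (W : Y'.Opens) (a : Γ(Y', W)) (s : Γ(G.E, W)) :
    G.red W (a • s) = (i.app W).hom a • G.red W s :=
  G.eq_of_cover_preimage fun α W' h hα => by
    rw [G.res_red _ α h hα, res_smul, map_smul, (y α).ρ.red_smul, res_smul, G.res_red _ α h hα]
    congr 1
    exact congr($(i.naturality (homOfLE h).op) a)

lemma red_res {W W' : Y'.Opens} (h : W' ≤ W) (s : Γ(G.E, W)) :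
    G.red W' (res G.E h s) = res x.E (i.preimage_mono h) (G.red W s) :=
  G.eq_of_cover_preimage fun α W'' h' hα => by
    rw [G.res_red _ α h' hα, res_res, res_res, G.res_red _ α (h'.trans h) hα]

lemma red_form (W : Y'.Opens) (s t : Γ(G.E, W)) :
    (i.app W).hom (G.form W s t) = x.form (i ⁻¹ᵁ W) le_top (G.red W s) (G.red W t) :=
  eq_of_locallyO fun z hz => by
    obtain ⟨α, hα⟩ := G.exists_mem (i z)
    refine ⟨i ⁻¹ᵁ (W ⊓ V α), i.preimage_mono inf_le_left, ⟨hz, hα⟩, ?_⟩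
    rw [x.form_res _ _ _ (i.preimage_mono inf_le_left), G.res_red _ α inf_le_left inf_le_right,
      G.res_red _ α inf_le_left inf_le_right, ← (y α).ρ.red_form,
      ← G.resO_form _ _ α inf_le_left inf_le_right]
    exact congr($(i.naturality (homOfLE (inf_le_left : W ⊓ V α ≤ W)).op) (G.form W s t)).symm

lemma red_fil {j : ℤ} {W : Y'.Opens} {s : Γ(G.E, W)} (hs : s ∈ G.fil j W) :
    G.red W s ∈ x.fil j (i ⁻¹ᵁ W) le_top := by
  refine x.fil_local _ _ _ _ fun z hz => ?_
  obtain ⟨α, hα⟩ := G.exists_mem (i z)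
  refine ⟨i ⁻¹ᵁ (W ⊓ V α), i.preimage_mono inf_le_left, ⟨hz, hα⟩, ?_⟩
  rw [G.res_red _ α inf_le_left inf_le_right]
  exact (y α).ρ.red_fil _ _ _ _ (hs α _ _ _)

end Atlas

end GlueBundle

/-! ### The reduction of a glued bundle over affine opens -/

section GlueReduction

/-- A partition of unity: functions whose basic opens cover an affine open generate the unit ideal.
-/
lemma eq_top_of_forall_mem_basicOpen {Y : Scheme.{u}} {W : Y.Opens} (hW : IsAffineOpen W)
    (J : Ideal Γ(Y, W)) (H : ∀ z ∈ W, ∃ b ∈ J, z ∈ Y.basicOpen b) : J = ⊤ := by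
  have h1 : (⨆ b : (J : Set Γ(Y, W)), Y.basicOpen b.1) = W := by
    refine le_antisymm (iSup_le fun b => Y.basicOpen_le _) fun z hz => ?_
    obtain ⟨b, hb, hz⟩ := H z hz
    exact Opens.mem_iSup.mpr ⟨⟨b, hb⟩, hz⟩
  have h2 := hW.iSup_basicOpen_eq_self_iff.mp h1
  rwa [Ideal.span_eq] at h2

variable {Y Y' : Scheme.{u}} {r n : ℕ} {i : Y ⟶ Y'} {x : NilBundle Y ⊤ r n} {ι : Type u}
  {V : ι → Y'.Opens} {y : ∀ α, LiftOn i x (V α)}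

lemma resO_app {W W' : Y'.Opens} (h : W' ≤ W) (a : Γ(Y', W)) :
    resO Y (i.preimage_mono h) ((i.app W).hom a) = (i.app W').hom (resO Y' h a) :=
  congr($(i.naturality (homOfLE h).op) a).symm

/-- Gluing of homomorphisms of sheaves of modules. -/
lemma exists_glue_fam {V : ι → Y'.Opens} (hcov : ⨆ α, V α = ⊤) {E E' : Y'.Modules} (φ : ∀ α, Fam E E' (V α))
    (hφ : ∀ α, IsNat (φ α)) (hg : ∀ α β W (h : W ≤ V α) (h' : W ≤ V β) s, φ α W h s = φ β W h' s) :
    ∃ Φ : Fam E E' ⊤, IsNat Φ ∧ ∀ α W h s, Φ W le_top s = φ α W h s := by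
  have hmem : ∀ z, ∃ α, z ∈ V α := fun z =>
    Opens.mem_iSup.mp (show z ∈ ⨆ α, V α from hcov ▸ trivial)
  have heq : ∀ {W : Y'.Opens} {a b : Γ(E', W)}, (∀ α (W' : Y'.Opens) (h' : W' ≤ W),
      W' ≤ V α → res E' h' a = res E' h' b) → a = b := fun {W a b} h =>
    eq_of_locally fun z hz => by
      obtain ⟨α, hα⟩ := hmem z
      exact ⟨W ⊓ V α, inf_le_left, ⟨hz, hα⟩, h α _ _ inf_le_right⟩
  have hex : ∀ (W : Y'.Opens) (s : Γ(E, W)), ∃ c : Γ(E', W), ∀ α (W' : Y'.Opens) (h : W' ≤ W)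
      (hα : W' ≤ V α), res E' h c = φ α W' hα (res E h s) :=
    fun W s => exists_glue_of_cover E' id (fun h => h) (fun W z hz => by
        obtain ⟨α, hα⟩ := hmem z
        exact Opens.mem_iSup.mpr ⟨α, hz, hα⟩) (fun _ _ => le_rfl) W
      (fun α W' h hα => φ α W' hα (res E h s))
      (fun α W' W'' h hα h' => by
        refine (hφ α W' W'' hα h' _).trans ?_
        rw [res_res])
      (fun α β W' h hα hβ => hg α β W' hα hβ _)
  choose c hc using hex
  refine ⟨fun W _ =>
    { toFun := c W
      map_add' := fun s t => heq fun α W' h hα => by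
        rw [map_add, hc _ _ α _ _ hα, hc _ _ α _ _ hα, hc _ _ α _ _ hα]
        simp only [map_add]
      map_smul' := fun a s => heq fun α W' h hα => by
        rw [RingHom.id_apply, res_smul, hc _ _ α _ _ hα, hc _ _ α _ _ hα, res_smul]
        simp only [map_smul] }, ?_, ?_⟩
  · intro W W' _ h s
    refine heq fun α W'' h' hα => ?_
    change res E' h' (res E' h (c W s)) = res E' h' (c W' (res E h s))
    rw [res_res, hc _ _ α _ _ hα, hc _ _ α _ _ hα, res_res]
  · intro α W h s
    have := hc W s α W le_rfl h
    rwa [res_self, res_self] at this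

namespace Atlas

lemma locFree (G : Atlas y) : LocFree G.E ⊤ (fun _ _ => ⊤) := G.filSymp.locFree

lemma locFree_fil (G : Atlas y) (j : ℤ) : LocFree G.E ⊤ (fun W _ => G.fil j W) :=
  G.filSymp.locFree_fil j

variable (G : Atlas y) (hi : ∀ W : Y'.Opens, IsAffineOpen W → IsAffineOpen (i ⁻¹ᵁ W))

include hi in
-- The functions `a` for which `a • t` lifts form an ideal. Around each point `t` lifts over a basic
-- open contained in a member of the cover. A power of the function extends this lift to `W` and a
-- further power removes the error, so the ideal is the unit ideal.
lemma red_fil_surj (j : ℤ) {W : Y'.Opens} (hW : IsAffineOpen W) {t : Γ(x.E, i ⁻¹ᵁ W)}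
    (ht : t ∈ x.fil j (i ⁻¹ᵁ W) le_top) : ∃ s ∈ G.fil j W, G.red W s = t := by
  let J : Ideal Γ(Y', W) :=
    { carrier := { a | ∃ s ∈ G.fil j W, G.red W s = (i.app W).hom a • t }
      zero_mem' := ⟨0, zero_mem _, by rw [map_zero, map_zero, zero_smul]⟩
      add_mem' := by
        rintro a b ⟨s, hs, e⟩ ⟨s', hs', e'⟩
        exact ⟨s + s', add_mem hs hs', by rw [map_add, map_add, add_smul, e, e']⟩
      smul_mem' := by
        rintro a b ⟨s, hs, e⟩
        exact ⟨a • s, Submodule.smul_mem _ _ hs, by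
          rw [G.red_smul, e, smul_eq_mul, map_mul, mul_smul]⟩ }
  suffices hJ : J = ⊤ by
    obtain ⟨s, hs, e⟩ : (1 : Γ(Y', W)) ∈ J := hJ ▸ trivial
    exact ⟨s, hs, by rw [e, map_one, one_smul]⟩
  refine eq_top_of_forall_mem_basicOpen hW J fun z hz => ?_
  obtain ⟨α, hα⟩ := G.exists_mem z
  obtain ⟨a, haW, hza⟩ := hW.exists_basicOpen_le (V := W ⊓ V α) ⟨z, hz, hα⟩ hz
  have hle : Y'.basicOpen a ≤ W := haW.trans inf_le_left
  have hleα : Y'.basicOpen a ≤ V α := haW.trans inf_le_right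
  obtain ⟨s', hs', e'⟩ := (y α).ρ.red_fil_surj j (Y'.basicOpen a) hleα (hW.basicOpen a)
    (res x.E (i.preimage_mono hle) t) (x.fil_res _ _ _ _ _ _ ht)
  have hs'' : (G.ψ α _ hleα).symm s' ∈ G.fil j (Y'.basicOpen a) :=
    (G.mem_fil_iff α hleα).mpr (by rwa [LinearEquiv.apply_symm_apply])
  obtain ⟨m, S, hS, hSe⟩ := (G.locFree_fil j).exists_pow_smul_eq_res hW le_top a rfl hle hs''
  have hSe' : res G.E hle S = resO Y' hle a ^ m • (G.ψ α _ hleα).symm s' := hSe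
  have h0 : res x.E (i.preimage_mono hle) (G.red W S - (i.app W).hom a ^ m • t) = 0 := by
    rw [map_sub, ← G.red_res hle, hSe', G.red_smul, G.red_of_le _ α hleα, LinearEquiv.apply_symm_apply, e',
      res_smul, map_pow, map_pow, resO_app hle, sub_self]
  obtain ⟨m', hm'⟩ := x.locFree.exists_pow_smul_eq_zero (hi W hW) le_top ((i.app W).hom a)
    (W' := i ⁻¹ᵁ Y'.basicOpen a) (Scheme.preimage_basicOpen i a) (i.preimage_mono hle) trivial h0
  refine ⟨a ^ (m' + m + 1), ⟨a ^ (m' + 1) • S, Submodule.smul_mem _ _ hS, ?_⟩, ?_⟩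
  · rw [smul_sub, sub_eq_zero] at hm'
    rw [G.red_smul, map_pow, pow_succ', mul_smul, hm', smul_smul, smul_smul, map_pow]
    ring_nf
  · rw [Scheme.basicOpen_pow _ _ (by omega)]
    exact hza

lemma mem_of_mem_ker_smul {W : Y'.Opens} {s : Γ(G.E, W)}
    (hs : s ∈ RingHom.ker (i.app W).hom • (⊤ : Submodule Γ(Y', W) Γ(G.E, W))) : G.red W s = 0 := by
  refine Submodule.smul_induction_on hs (fun a ha t _ => ?_) fun s t hs ht => ?_
  · rw [G.red_smul, RingHom.mem_ker.mp ha, zero_smul]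
  · rw [map_add, hs, ht, add_zero]

include hi in
-- Both factors of a product extend after multiplication by powers of `a`, and one more power puts
-- the extended coefficient into the kernel.
lemma exists_pow_mem_ker_smul {W : Y'.Opens} (hW : IsAffineOpen W) (a : Γ(Y', W))
    {u : Γ(G.E, Y'.basicOpen a)} (hu : u ∈ RingHom.ker (i.app (Y'.basicOpen a)).hom •
      (⊤ : Submodule Γ(Y', Y'.basicOpen a) Γ(G.E, Y'.basicOpen a))) :
    ∃ (m : ℕ), ∃ S ∈ RingHom.ker (i.app W).hom • (⊤ : Submodule Γ(Y', W) Γ(G.E, W)),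
      res G.E (Y'.basicOpen_le a) S = resO Y' (Y'.basicOpen_le a) a ^ m • u := by
  have hle := Y'.basicOpen_le a
  refine Submodule.smul_induction_on hu (fun c hc v _ => ?_) ?_
  · obtain ⟨m₁, K, hK⟩ := exists_pow_mul_eq_resO hW a rfl hle c
    obtain ⟨m₂, hm₂⟩ := exists_pow_mul_eq_zero (hi W hW) ((i.app W).hom a)
      (W' := i ⁻¹ᵁ Y'.basicOpen a) (Scheme.preimage_basicOpen i a) (i.preimage_mono hle)
      ((i.app W).hom K) (by rw [resO_app hle, hK, map_mul, RingHom.mem_ker.mp hc, mul_zero])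
    obtain ⟨m₃, v', -, hv'⟩ := G.locFree.exists_pow_smul_eq_res hW le_top a rfl hle
      (s := v) trivial
    have hv'' : res G.E hle v' = resO Y' hle a ^ m₃ • v := hv'
    refine ⟨m₁ + m₂ + m₃, (a ^ m₂ * K) • v', Submodule.smul_mem_smul ?_ trivial, ?_⟩
    · rw [RingHom.mem_ker, map_mul, map_pow, hm₂]
    · rw [res_smul, hv'', map_mul, map_pow, hK, smul_smul, smul_smul]
      ring_nf
  · rintro u v ⟨m, S, hS, e⟩ ⟨m', S', hS', e'⟩
    refine ⟨m + m', a ^ m' • S + a ^ m • S', add_mem (Submodule.smul_mem _ _ hS)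
      (Submodule.smul_mem _ _ hS'), ?_⟩
    rw [map_add, res_smul, res_smul, e, e', smul_smul, smul_smul, smul_add, map_pow, map_pow,
      ← pow_add, ← pow_add, add_comm m' m]

include hi in
-- The ideal to consider consists of the functions that multiply `s` into the submodule; locally on
-- the cover the local lifts provide enough of them.
lemma red_ker {W : Y'.Opens} (hW : IsAffineOpen W) (s : Γ(G.E, W)) : G.red W s = 0 ↔
    s ∈ RingHom.ker (i.app W).hom • (⊤ : Submodule Γ(Y', W) Γ(G.E, W)) := by
  refine ⟨fun hs => ?_, G.mem_of_mem_ker_smul⟩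
  let J : Ideal Γ(Y', W) := (RingHom.ker (i.app W).hom • (⊤ : Submodule Γ(Y', W) Γ(G.E, W))).comap
    (LinearMap.toSpanSingleton Γ(Y', W) Γ(G.E, W) s)
  suffices hJ : J = ⊤ by
    have h1 : (1 : Γ(Y', W)) ∈ J := hJ ▸ trivial
    rwa [Submodule.mem_comap, LinearMap.toSpanSingleton_apply, one_smul] at h1
  refine eq_top_of_forall_mem_basicOpen hW J fun z hz => ?_
  obtain ⟨α, hα⟩ := G.exists_mem z
  obtain ⟨a, haW, hza⟩ := hW.exists_basicOpen_le (V := W ⊓ V α) ⟨z, hz, hα⟩ hz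
  have hle : Y'.basicOpen a ≤ W := haW.trans inf_le_left
  have hleα : Y'.basicOpen a ≤ V α := haW.trans inf_le_right
  have h1 : (y α).ρ.red _ hleα (G.ψ α _ hleα (res G.E hle s)) = 0 := by
    rw [← G.res_red _ α hle hleα, hs, map_zero]
  rw [(y α).ρ.red_ker _ _ (hW.basicOpen a)] at h1
  have h2 := Submodule.mem_map_of_mem (f := (G.ψ α _ hleα).symm.toLinearMap) h1
  rw [Submodule.map_smul'', Submodule.map_top, LinearEquiv.range, LinearEquiv.coe_coe,
    LinearEquiv.symm_apply_apply] at h2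
  obtain ⟨m, S, hS, hSe⟩ := G.exists_pow_mem_ker_smul hi hW a h2
  have h0 : res G.E hle (a ^ m • s - S) = 0 := by
    rw [map_sub, hSe, res_smul, map_pow, sub_self]
  obtain ⟨m', hm'⟩ := G.locFree.exists_pow_smul_eq_zero hW le_top a rfl hle trivial h0
  refine ⟨a ^ (m' + m + 1), ?_, ?_⟩
  · rw [Submodule.mem_comap, LinearMap.toSpanSingleton_apply]
    have h3 : a ^ (m' + m + 1) • s = a ^ (m' + 1) • S := by
      rw [smul_sub, sub_eq_zero, smul_smul, ← pow_add] at hm'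
      rw [pow_succ', mul_smul, hm', smul_smul, ← pow_succ']
    rw [h3]
    exact Submodule.smul_mem _ _ hS
  · rw [Scheme.basicOpen_pow _ _ (by omega)]
    exact hza

/-- The reduction of the glued bundle. -/
def filRed : FilRed i G.filSymp x.toFilSymp where
  red W _ := G.red W
  red_smul W _ a s := G.red_smul W a s
  red_res W W' _ h' s := G.red_res h' s
  red_surj W _ hW t := by
    -- Surjectivity is the case of the filtration step F^n, which is all of E.
    obtain ⟨s, -, e⟩ := G.red_fil_surj hi n hW (t := t) (by
      rw [x.fil_top _ (by omega)]; trivial)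
    exact ⟨s, e⟩
  red_ker W _ hW s := G.red_ker hi hW s
  red_form W _ s t := G.red_form W s t
  red_fil j W _ s hs := G.red_fil hs
  red_fil_surj j W _ hW t ht := G.red_fil_surj hi j hW ht

lemma exists_θ (θ : ∀ α, Fam (y α).obj.E (y α).obj.E (V α)) (hθ : ∀ α, IsNat (θ α))
    (hg : ∀ (α β : ι) (W : Y'.Opens) (h : W ≤ V α) (h' : W ≤ V β) (s : Γ(G.E, W)),
      (G.ψ α W h).symm (θ α W h (G.ψ α W h s)) = (G.ψ β W h').symm (θ β W h' (G.ψ β W h' s))) :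
    ∃ Θ : Fam G.E G.E ⊤, IsNat Θ ∧ ∀ α W h s, G.ψ α W h (Θ W le_top s) = θ α W h (G.ψ α W h s) := by
  obtain ⟨Θ, hΘ, e⟩ := exists_glue_fam G.cov
    (fun α W h => (G.ψ α W h).symm.toLinearMap ∘ₗ θ α W h ∘ₗ (G.ψ α W h).toLinearMap)
    (fun α W W' h h' s => by
      refine (G.symm_nat α h h' _).trans ?_
      refine congrArg (G.ψ α W' _).symm ((hθ α W W' h h' _).trans ?_)
      exact congrArg _ (G.nat α W W' h h' s)) hg
  refine ⟨Θ, hΘ, fun α W h s => ?_⟩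
  rw [e α W h]
  exact (G.ψ α W h).apply_symm_apply _

end Atlas

end GlueReduction

/-! ### Gluing of local lifts -/

namespace SmallExt

variable {k : Type u} [Field k] {X : Scheme.{u}} {f : X ⟶ Spec (CommRingCat.of k)}
  {A B : Type u} [CommRing A] [Algebra k A] [CommRing B] [IsLocalRing B]
  [Algebra k B] {D : SmallExt k A B} {r n : ℕ} {x₀ : NilBundle X ⊤ r n}
  {x : NilBundle (XBase f A) ⊤ r n}
  (ρ₀ : Reduction (specialFibre f D.ε) x x₀)
  [IsLocalRing A] [IsArtinianRing A] [IsArtinianRing B] [CharZero k]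
  {ι : Type u} {V : ι → (XBase f B).Opens} (hcov : ⨆ α, V α = ⊤)
  (y : ∀ α, LiftOn (baseMap f D.q) x (V α))
  (g : ∀ α β, FilIso (y β) (y α) (V α ⊓ V β) inf_le_right inf_le_left)

include ρ₀ hcov in
/-- Gluing of local lifts along isomorphisms satisfying the cocycle condition. -/
theorem exists_glue_lift
    (hg : ∀ α β γ W (hα : W ≤ V α) (hβ : W ≤ V β) (hγ : W ≤ V γ) s,
      (g α β).app W (le_inf hα hβ) ((g β γ).app W (le_inf hβ hγ) s) =
        (g α γ).app W (le_inf hα hγ) s)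
    (θ : ∀ α, Fam (y α).obj.E (y α).obj.E (V α)) (θ_nat : ∀ α, IsNat (θ α))
    (θ_adj : ∀ α W h s t, (y α).obj.form W h s (θ α W h t) = -(y α).obj.form W h (θ α W h s) t)
    (θ_fil : ∀ α i W h, ∀ s ∈ (y α).obj.fil i W h, θ α W h s ∈ (y α).obj.fil (i - 2) W h)
    (θ_red : ∀ α W h s, (y α).ρ.red W h (θ α W h s) = x.θ _ le_top ((y α).ρ.red W h s))
    (hθ : ∀ α β W (hα : W ≤ V α) (hβ : W ≤ V β) s, (g α β).app W (le_inf hα hβ) (θ β W hβ s) =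
      θ α W hα ((g α β).app W (le_inf hα hβ) s)) :
    ∃ (Z : LiftOn (baseMap f D.q) x ⊤) (φ : ∀ α, FilIso Z (y α) (V α) le_top le_rfl),
      (∀ α β W (hα : W ≤ V α) (hβ : W ≤ V β) s,
        (g α β).app W (le_inf hα hβ) ((φ β).app W hβ s) = (φ α).app W hα s) ∧
      ∀ α W h s, (φ α).app W h (Z.obj.θ W le_top s) = θ α W h ((φ α).app W h s) := by
  obtain ⟨N, ψ, hψ, hgψ⟩ := GlueData.exists_sheaf (V := V) (E := fun α => (y α).obj.E)
    { g := fun α β W h h' => (g α β).app W (le_inf h h')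
      nat := fun α β W W' h h' hW s => (g α β).nat' _ hW s
      cocycle := hg }
  have hgψ' : ∀ α β W (hα : W ≤ V α) (hβ : W ≤ V β) s,
      (g α β).app W (le_inf hα hβ) (ψ β W hβ s) = ψ α W hα s := hgψ
  let G : Atlas y :=
    { E := N
      ψ := ψ
      nat := hψ
      form_eq := fun α β W h h' s t => by rw [← hgψ' α β W h h' s, ← hgψ' α β W h h' t, (g α β).form_eq]
      fil_imp := fun j α β W h h' s hs => by
        rwa [← hgψ' α β W h h' s, (g α β).fil_iff] at hs
      red_eq := fun α β W h h' s => by rw [← hgψ' α β W h h' s, (g α β).red_eq]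
      cov := hcov }
  obtain ⟨Θ, hΘ, hΘθ⟩ := G.exists_θ θ θ_nat (fun α β W h h' s => by
    change (ψ α W h).symm (θ α W h (ψ α W h s)) = (ψ β W h').symm (θ β W h' (ψ β W h' s))
    rw [LinearEquiv.symm_apply_eq, ← hgψ' α β W h h' s, ← hθ, ← hgψ' α β W h h',
      LinearEquiv.apply_symm_apply])
  have hadj : ∀ W s t, G.form W s (Θ W le_top t) = -G.form W (Θ W le_top s) t := by
      intro W s t
      refine G.eqO_of_cover fun α W' h' hα => ?_
      rw [map_neg, G.resO_form _ _ α h' hα, G.resO_form _ _ α h' hα, hΘ _ _ _ h', hΘ _ _ _ h', hΘθ,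
        hΘθ, θ_adj]
  have hfil : ∀ i W, ∀ s ∈ G.fil i W, Θ W le_top s ∈ G.fil (i - 2) W := by
      intro i W s hs α W' h' hα
      rw [hΘ _ _ _ h', hΘθ]
      exact θ_fil _ _ _ _ _ (hs α W' h' hα)
  have hred : ∀ W s, G.red W (Θ W le_top s) = x.θ _ le_top (G.red W s) := by
      intro W s
      refine G.eq_of_cover_preimage fun α W' h' hα => ?_
      rw [G.res_red _ α h' hα, hΘ _ _ _ h', hΘθ, θ_red, x.θ_nat _ _ _ ((baseMap f D.q).preimage_mono h'),
        G.res_red _ α h' hα]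
  -- Only skewness, the filtration condition and the reduction of `Θ` have to be glued; nilpotency
  -- and injectivity on Gr come with `mkLift`.
  let Z : LiftOn (baseMap f D.q) x ⊤ := mkLift ρ₀
    (G.filRed fun W hW => D.isAffineOpen_preimage f hW) Θ hΘ (fun W _ => hadj W)
    (fun i W _ => hfil i W) (fun W _ => hred W)
  refine ⟨Z, fun α =>
    { app := ψ α
      nat := fun W W' h h' s => hψ α W W' h h' s
      form_eq := fun W h s t => (G.form_of_le s t α h).symm
      fil_iff := fun j W h s => (G.mem_fil_iff α h).symm
      red_eq := fun W h s => (G.red_of_le s α h).symm }, hgψ', fun α W h s => hΘθ α W h s⟩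

end SmallExt

/-! ## Gluing of isomorphisms, restriction of lifts -/

section GlueHom

variable {Y Y' : Scheme.{u}} {r n : ℕ} {i : Y ⟶ Y'} {x : NilBundle Y ⊤ r n} {ι : Type u}
  {V : ι → Y'.Opens}

/-- Gluing of isomorphisms. -/
theorem FilIso.exists_glue (hcov : ⨆ α, V α = ⊤) {y₁ y₂ : LiftOn i x ⊤}
    (φ : ∀ α, FilIso y₁ y₂ (V α) le_top le_top)
    (hg : ∀ α β W (h : W ≤ V α) (h' : W ≤ V β) s, (φ α).app W h s = (φ β).app W h' s) :
    ∃ Φ : FilIso y₁ y₂ ⊤ le_rfl le_rfl, ∀ α W h s, Φ.app W le_top s = (φ α).app W h s := by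
  have hmem : ∀ z, ∃ α, z ∈ V α := fun z =>
    Opens.mem_iSup.mp (show z ∈ ⨆ α, V α from hcov ▸ trivial)
  obtain ⟨Φ, hΦ, e⟩ := exists_glue_fam hcov (fun α W h => ((φ α).app W h).toLinearMap)
    (fun α => (φ α).nat) hg
  obtain ⟨Ψ, hΨ, e'⟩ := exists_glue_fam hcov (fun α W h => ((φ α).app W h).symm.toLinearMap)
    (fun α => (φ α).symm.nat) (fun α β W h h' s => by
      change ((φ α).app W h).symm s = ((φ β).app W h').symm s
      rw [LinearEquiv.symm_apply_eq, hg α β W h h', LinearEquiv.apply_symm_apply])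
  simp only [LinearEquiv.coe_coe] at e e'
  have hΨΦ : ∀ W s, Ψ W le_top (Φ W le_top s) = s := fun W s => eq_of_locally fun z hz => by
    obtain ⟨α, hα⟩ := hmem z
    refine ⟨W ⊓ V α, inf_le_left, ⟨hz, hα⟩, ?_⟩
    rw [hΨ _ _ _ inf_le_left, hΦ _ _ _ inf_le_left, e α _ inf_le_right, e' α _ inf_le_right,
      LinearEquiv.symm_apply_apply]
  have hΦΨ : ∀ W s, Φ W le_top (Ψ W le_top s) = s := fun W s => eq_of_locally fun z hz => by
    obtain ⟨α, hα⟩ := hmem z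
    refine ⟨W ⊓ V α, inf_le_left, ⟨hz, hα⟩, ?_⟩
    rw [hΦ _ _ _ inf_le_left, hΨ _ _ _ inf_le_left, e' α _ inf_le_right, e α _ inf_le_right,
      LinearEquiv.apply_symm_apply]
  refine ⟨{
    app := fun W _ => LinearEquiv.ofLinear (Φ W le_top) (Ψ W le_top)
      (LinearMap.ext fun s => hΦΨ W s) (LinearMap.ext fun s => hΨΦ W s)
    nat := fun W W' h h' s => hΦ W W' h h' s
    form_eq := fun W _ s t => eq_of_locallyO fun z hz => ?_
    fil_iff := fun j W _ s => ⟨fun hs => y₁.obj.fil_local _ _ _ _ fun z hz => ?_,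
      fun hs => y₂.obj.fil_local _ _ _ _ fun z hz => ?_⟩
    red_eq := fun W _ s => eq_of_locally fun z hz => ?_ }, e⟩
  · obtain ⟨α, hα⟩ := hmem z
    refine ⟨W ⊓ V α, inf_le_left, ⟨hz, hα⟩, ?_⟩
    change resO _ _ (y₂.obj.form W le_top (Φ W le_top s) (Φ W le_top t)) = _
    rw [y₂.obj.form_res _ _ _ inf_le_left, y₁.obj.form_res _ _ _ inf_le_left,
      hΦ _ _ _ inf_le_left, hΦ _ _ _ inf_le_left, e α _ inf_le_right, e α _ inf_le_right,
      (φ α).form_eq]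
  · obtain ⟨α, hα⟩ := hmem z
    refine ⟨W ⊓ V α, inf_le_left, ⟨hz, hα⟩, ?_⟩
    have h1 := y₂.obj.fil_res j _ _ le_top (inf_le_left : W ⊓ V α ≤ W) _ hs
    change res _ _ (Φ W le_top s) ∈ _ at h1
    rwa [hΦ _ _ _ inf_le_left, e α _ inf_le_right, (φ α).fil_iff] at h1
  · obtain ⟨α, hα⟩ := hmem z
    refine ⟨W ⊓ V α, inf_le_left, ⟨hz, hα⟩, ?_⟩
    change res _ _ (Φ W le_top s) ∈ _
    rw [hΦ _ _ _ inf_le_left, e α _ inf_le_right, (φ α).fil_iff]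
    exact y₁.obj.fil_res j _ _ le_top _ _ hs
  · obtain ⟨α, hα⟩ := hmem (i z)
    refine ⟨i ⁻¹ᵁ (W ⊓ V α), i.preimage_mono inf_le_left, ⟨hz, hα⟩, ?_⟩
    change res _ _ (y₂.ρ.red W le_top (Φ W le_top s)) = _
    rw [← y₂.ρ.red_res _ _ _ inf_le_left, ← y₁.ρ.red_res _ _ _ inf_le_left, hΦ _ _ _ inf_le_left,
      e α _ inf_le_right, (φ α).red_eq]

variable {V₁ V₂ : Y'.Opens}

/-- Restriction of a filtered symplectic bundle to an open subscheme. -/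
def FilSymp.restrict (y : FilSymp Y' V₁ r n) (h : V₂ ≤ V₁) : FilSymp Y' V₂ r n where
  E := y.E
  locallyFree z hz := by
    obtain ⟨W, hzW, hW, e, he⟩ := y.locallyFree z (h hz)
    refine ⟨W ⊓ V₂, ⟨hzW, hz⟩, inf_le_right, fun j => res y.E inf_le_left (e j), fun W' h' => ?_⟩
    simp only [res_res]
    exact he W' _
  form W hW := y.form W (hW.trans h)
  form_res W W' hW := y.form_res W W' (hW.trans h)
  form_alt W hW := y.form_alt W (hW.trans h)
  form_nondeg W hW := y.form_nondeg W (hW.trans h)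
  fil j W hW := y.fil j W (hW.trans h)
  fil_res j W W' hW := y.fil_res j W W' (hW.trans h)
  fil_local j W hW := y.fil_local j W (hW.trans h)
  fil_mono j W hW := y.fil_mono j W (hW.trans h)
  fil_bot j hj W hW := y.fil_bot j hj W (hW.trans h)
  fil_top j hj W hW := y.fil_top j hj W (hW.trans h)
  gr_free j z hz := by
    obtain ⟨W, hW, hzW, m, e, he, hs⟩ := y.gr_free j z (h hz)
    refine ⟨W ⊓ V₂, inf_le_right, ⟨hzW, hz⟩, m, fun j => res y.E inf_le_left (e j),
      fun l => y.fil_res _ _ _ _ _ _ (he l), fun W' h' s hs' => ?_⟩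
    simp only [res_res]
    exact hs W' _ s hs'
  fil_perp j W hW := y.fil_perp j W (hW.trans h)

/-- Restriction of a lift to an open subscheme. -/
def LiftOn.restrict (y : LiftOn i x V₁) (h : V₂ ≤ V₁) : LiftOn i x V₂ where
  obj :=
    { y.obj.toFilSymp.restrict h with
      θ := fun W hW => y.obj.θ W (hW.trans h)
      θ_nat := fun W W' hW => y.obj.θ_nat W W' (hW.trans h)
      θ_adj := fun W hW => y.obj.θ_adj W (hW.trans h)
      θ_pow := fun W hW => y.obj.θ_pow W (hW.trans h)
      θ_fil := fun j W hW => y.obj.θ_fil j W (hW.trans h)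
      θ_inj := fun j W hW => y.obj.θ_inj j W (hW.trans h) }
  ρ :=
    { red := fun W hW => y.ρ.red W (hW.trans h)
      red_smul := fun W hW => y.ρ.red_smul W (hW.trans h)
      red_res := fun W W' hW => y.ρ.red_res W W' (hW.trans h)
      red_surj := fun W hW => y.ρ.red_surj W (hW.trans h)
      red_ker := fun W hW => y.ρ.red_ker W (hW.trans h)
      red_form := fun W hW => y.ρ.red_form W (hW.trans h)
      red_θ := fun W hW => y.ρ.red_θ W (hW.trans h)
      red_fil := fun j W hW => y.ρ.red_fil j W (hW.trans h)
      red_fil_surj := fun j W hW => y.ρ.red_fil_surj j W (hW.trans h) }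

/-- A lift and its restriction are isomorphic over the smaller open set. -/
def LiftOn.restrictIso (y : LiftOn i x V₁) (h : V₂ ≤ V₁) :
    FilIso (y.restrict h) y V₂ le_rfl h where
  app _ _ := LinearEquiv.refl _ _
  nat _ _ _ _ _ := rfl
  form_eq _ _ _ _ := rfl
  fil_iff _ _ _ _ := Iff.rfl
  red_eq _ _ _ := rfl

end GlueHom

/-! ### The order of nilpotency of a lift -/

section HasOrder

variable {k : Type u} [Field k] {X : Scheme.{u}} {f : X ⟶ Spec (CommRingCat.of k)}
  {A B : Type u} [CommRing A] [Algebra k A] [CommRing B] [IsLocalRing B]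
  [Algebra k B] {D : SmallExt k A B} {r n : ℕ} {x : NilBundle (XBase f A) ⊤ r n}
  [IsLocalRing A] [IsArtinianRing A] [IsArtinianRing B] [CharZero k]

lemma Reduction.red_θ_pow {Y Y' : Scheme.{u}} {i : Y ⟶ Y'} {V : Y'.Opens}
    {y : NilBundle Y' V r n} {x : NilBundle Y ⊤ r n} (ρ : Reduction i y x) (W : Y'.Opens)
    (h : W ≤ V) (m : ℕ) (s : Γ(y.E, W)) :
    ρ.red W h ((y.θ W h ^ m) s) = (x.θ (i ⁻¹ᵁ W) le_top ^ m) (ρ.red W h s) := by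
  induction m generalizing s with
  | zero => rfl
  | succ m ih => rw [pow_succ, pow_succ, Module.End.mul_apply, Module.End.mul_apply, ih, ρ.red_θ]

/-- The lifts of a bundle of exact order of nilpotency `n` have this property, too. -/
lemma SmallExt.hasOrder (hx : x.HasOrder) (y : LiftOn (baseMap f D.q) x ⊤) : y.obj.HasOrder := by
  by_contra hy
  simp only [NilBundle.HasOrder, not_exists, not_not] at hy
  obtain ⟨W, h, hW⟩ := hx
  refine hW (LinearMap.ext fun s => ?_)
  rw [LinearMap.zero_apply]
  -- X_A and X_B have the same open sets, so `W` comes from X_B, and affine opens there have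
  -- surjective reduction maps.
  have hpre : baseMap f D.q ⁻¹ᵁ (toX f B ⁻¹ᵁ ((D.TA f).i ⁻¹ᵁ W)) = W := by
    rw [← Scheme.Hom.comp_preimage, baseMap, pullback.lift_fst]
    exact (D.TA f).toX_preimage W
  refine eq_of_locally fun z hz => ?_
  obtain ⟨W', hW', hzW', hle⟩ := (Opens.isBasis_iff_nbhd.mp (XBase f B).isBasis_affineOpens)
    (show baseMap f D.q z ∈ toX f B ⁻¹ᵁ ((D.TA f).i ⁻¹ᵁ W) from hpre.ge hz)
  have hle' : baseMap f D.q ⁻¹ᵁ W' ≤ W := ((baseMap f D.q).preimage_mono hle).trans hpre.le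
  refine ⟨_, hle', hzW', ?_⟩
  obtain ⟨t, ht⟩ := y.ρ.red_surj W' le_top hW' (res x.E hle' s)
  rw [map_zero, IsNat.pow x.θ_nat _ _ _ h hle', ← ht, ← y.ρ.red_θ_pow, hy, LinearMap.zero_apply,
    map_zero]

end HasOrder

/-! ## Differences of isomorphisms and of endomorphisms -/

namespace SmallExt

variable {k : Type u} [Field k] {X : Scheme.{u}} {f : X ⟶ Spec (CommRingCat.of k)}
  {A B : Type u} [CommRing A] [Algebra k A] [CommRing B] [IsLocalRing B]
  [Algebra k B] {D : SmallExt k A B} {r n : ℕ} {x₀ : NilBundle X ⊤ r n}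
  {x : NilBundle (XBase f A) ⊤ r n}
  (ρ₀ : Reduction (specialFibre f D.ε) x x₀) {V V₁ V₂ V₃ : (XBase f B).Opens}
  [IsLocalRing A] [IsArtinianRing A] [IsArtinianRing B] [CharZero k]
  {U U' : X.Opens} (hU : IsAffineOpen U) {j : ℤ}
  {y : LiftOn (baseMap f D.q) x V}
  {y₁ : LiftOn (baseMap f D.q) x V₁} {y₂ : LiftOn (baseMap f D.q) x V₂}
  {y₃ : LiftOn (baseMap f D.q) x V₃} {hV : toX f B ⁻¹ᵁ U ≤ V}
  {h₁ : toX f B ⁻¹ᵁ U ≤ V₁} {h₂ : toX f B ⁻¹ᵁ U ≤ V₂} {h₃ : toX f B ⁻¹ᵁ U ≤ V₃}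

/-- `g' = (1 + w) g`. -/
def Differ (g g' : FilIso y₁ y₂ (toX f B ⁻¹ᵁ U) h₁ h₂) (w : PTensor f x₀ (RingHom.ker D.q) 0 U) :
    Prop :=
  ∀ W h s, g'.app W h s = g.app W h s + D.lact ρ₀ y₂ hU h₂ w W h (g.app W h s)

/-- `g θ₁ g⁻¹ = θ₂ + τ`. -/
def Conj (g : FilIso y₁ y₂ (toX f B ⁻¹ᵁ U) h₁ h₂) (τ : PTensor f x₀ (RingHom.ker D.q) (-2) U) :
    Prop :=
  ∀ W h s, g.app W h (y₁.obj.θ W (h.trans h₁) s) = y₂.obj.θ W (h.trans h₂) (g.app W h s) +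
    D.lact ρ₀ y₂ hU h₂ τ W h (g.app W h s)

variable {ρ₀ hU} {g g' g'' : FilIso y₁ y₂ (toX f B ⁻¹ᵁ U) h₁ h₂}
  {w w' : PTensor f x₀ (RingHom.ker D.q) 0 U} {τ τ' : PTensor f x₀ (RingHom.ker D.q) (-2) U}

lemma Differ.refl (g : FilIso y₁ y₂ (toX f B ⁻¹ᵁ U) h₁ h₂) : Differ ρ₀ hU g g 0 := fun W h s => by
  rw [lact_zero, add_zero]

lemma Differ.of_eq (H : Differ ρ₀ hU g g' w) (e : w = w') : Differ ρ₀ hU g g' w' := e ▸ H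

/-- (1 + w')(1 + w) = 1 + w + w', because the product acts as zero; this is what makes the Čech
calculus additive. -/
lemma Differ.trans (H : Differ ρ₀ hU g g' w) (H' : Differ ρ₀ hU g' g'' w') :
    Differ ρ₀ hU g g'' (w + w') := fun W h s => by
  rw [H' W h, H W h, map_add, lact_lact, lact_add, add_zero, add_assoc]

lemma Differ.symm (H : Differ ρ₀ hU g g' w) : Differ ρ₀ hU g' g (-w) := fun W h s => by
  rw [H W h, map_add, lact_lact, lact_neg]
  abel

/-- Faithfulness of the action. It turns identities between isomorphisms into identities between
cochains. -/
lemma Differ.unique (H : Differ ρ₀ hU g g' w) (H' : Differ ρ₀ hU g g' w') : w = w' :=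
  lact_injective (ρ₀ := ρ₀) (y := y₂) (hU := hU) (hV := h₂) fun s => by
    have e := (H _ le_rfl ((g.app _ le_rfl).symm s)).symm.trans (H' _ le_rfl _)
    rwa [LinearEquiv.apply_symm_apply, add_right_inj] at e

/-- Isomorphisms compatible with the reductions commute with the action, so `w` is unchanged. -/
lemma Differ.comp_left (H : Differ ρ₀ hU g g' w) (φ : FilIso y₂ y₃ (toX f B ⁻¹ᵁ U) h₂ h₃) :
    Differ ρ₀ hU (g.trans φ) (g'.trans φ) w := fun W h s => by
  rw [FilIso.trans_app, FilIso.trans_app, H W h, map_add, filIso_lact]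

lemma Differ.comp_right {g g' : FilIso y₂ y₃ (toX f B ⁻¹ᵁ U) h₂ h₃} (H : Differ ρ₀ hU g g' w)
    (φ : FilIso y₁ y₂ (toX f B ⁻¹ᵁ U) h₁ h₂) : Differ ρ₀ hU (φ.trans g) (φ.trans g') w :=
  fun W h s => H W h _

lemma Differ.inv (H : Differ ρ₀ hU g g' w) : Differ ρ₀ hU g.symm g'.symm (-w) := fun W h s => by
  obtain ⟨t, rfl⟩ := (g.app W h).surjective s
  rw [FilIso.symm_app, FilIso.symm_app, LinearEquiv.symm_apply_apply, LinearEquiv.symm_apply_eq,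
    map_add, filIso_lact (hV₂ := h₂), H W h, map_add, lact_lact, lact_neg]
  abel

lemma Differ.restrict (H : Differ ρ₀ hU g g' w) (hUU' : U' ≤ U) (hU' : IsAffineOpen U') :
    Differ ρ₀ hU' (g.restrict ((toX f B).preimage_mono hUU'))
      (g'.restrict ((toX f B).preimage_mono hUU'))
      (PTensor.map f x₀ _ (PSec.restrict f x₀ 0 hUU') w) := fun W h s => by
  rw [lact_restrict (hU := hU) (hV := h₂)]
  exact H W _ s

variable (ρ₀ hU) in
lemma exists_differ (g g' : FilIso y₁ y₂ (toX f B ⁻¹ᵁ U) h₁ h₂) : ∃ w, Differ ρ₀ hU g g' w :=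
  exists_filIso_eq ρ₀ hU g' g

lemma Differ.eq (H : Differ ρ₀ hU g g' w) (H' : Differ ρ₀ hU g g'' w) (W h s) :
    g'.app W h s = g''.app W h s := by
  rw [H W h, H' W h]

lemma Conj.unique (H : Conj ρ₀ hU g τ) (H' : Conj ρ₀ hU g τ') : τ = τ' :=
  lact_injective (ρ₀ := ρ₀) (y := y₂) (hU := hU) (hV := h₂) fun s => by
    have e := (H _ le_rfl ((g.app _ le_rfl).symm s)).symm.trans (H' _ le_rfl _)
    rwa [LinearEquiv.apply_symm_apply, add_right_inj] at e

lemma Conj.of_eq (H : Conj ρ₀ hU g τ) (e : τ = τ') : Conj ρ₀ hU g τ' := e ▸ H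

lemma Conj.of_commutes (H : ∀ W h s, g.app W h (y₁.obj.θ W (h.trans h₁) s) =
    y₂.obj.θ W (h.trans h₂) (g.app W h s)) : Conj ρ₀ hU g 0 := fun W h s => by
  rw [H, lact_zero, add_zero]

lemma Conj.commutes (H : Conj ρ₀ hU g 0) (W h s) : g.app W h (y₁.obj.θ W (h.trans h₁) s) =
    y₂.obj.θ W (h.trans h₂) (g.app W h s) := by
  rw [H W h, lact_zero, add_zero]

lemma Conj.trans (H : Conj ρ₀ hU g τ) {φ : FilIso y₂ y₃ (toX f B ⁻¹ᵁ U) h₂ h₃}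
    (H' : Conj ρ₀ hU φ τ') : Conj ρ₀ hU (g.trans φ) (τ + τ') := fun W h s => by
  rw [FilIso.trans_app, FilIso.trans_app, H W h, map_add, H' W h, filIso_lact (hV₂ := h₃), lact_add]
  abel

lemma Conj.symm (H : Conj ρ₀ hU g τ) : Conj ρ₀ hU g.symm (-τ) := fun W h s => by
  obtain ⟨t, rfl⟩ := (g.app W h).surjective s
  rw [FilIso.symm_app, LinearEquiv.symm_apply_apply, LinearEquiv.symm_apply_eq, map_add, H W h,
    filIso_lact (hV₂ := h₂), lact_neg]
  abel

/-- (1 + w)(θ + τ)(1 - w) = θ + τ - [θ, w]; this is how the differential of P enters. -/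
lemma Conj.differ (H : Conj ρ₀ hU g τ) (H' : Differ ρ₀ hU g g' w) :
    Conj ρ₀ hU g' (τ - PTensor.map f x₀ _ (bracket f x₀ U) w) := fun W h s => by
  rw [H' W h, H' W h, H W h, map_add, map_add, map_add, lact_lact, lact_lact, θ_lact, lact_sub]
  abel

lemma Conj.restrict (H : Conj ρ₀ hU g τ) (hUU' : U' ≤ U) (hU' : IsAffineOpen U') :
    Conj ρ₀ hU' (g.restrict ((toX f B).preimage_mono hUU'))
      (PTensor.map f x₀ _ (PSec.restrict f x₀ (-2) hUU') τ) := fun W h s => by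
  rw [lact_restrict (hU := hU) (hV := h₂)]
  exact H W _ s

variable (ρ₀ hU) in
lemma exists_conj (g : FilIso y₁ y₂ (toX f B ⁻¹ᵁ U) h₁ h₂) : ∃ τ, Conj ρ₀ hU g τ :=
  exists_conj_θ_eq ρ₀ hU g

lemma acts_iff_differ : Acts f D.q ρ₀ y₂ U h₂ w
    (fun s => g'.app _ le_rfl ((g.app _ le_rfl).symm s) - s) ↔ Differ ρ₀ hU g g' w := by
  refine (acts_iff_lact (hU := hU) w (δ := fun W h =>
    (g'.app W h).toLinearMap ∘ₗ (g.app W h).symm.toLinearMap - LinearMap.id) ?_).trans ?_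
  · intro W W' h h' s
    change res _ h' (g'.app W h (g.symm.app W h s) - s) = g'.app W' _ (g.symm.app W' _ _) - _
    rw [map_sub, g'.nat', g.symm.nat']
    rfl
  · refine forall₂_congr fun W h => ((g.app W h).toEquiv.forall_congr fun s => ?_).symm
    change _ ↔ g'.app W h ((g.app W h).symm (g.app W h s)) - g.app W h s = _
    rw [LinearEquiv.symm_apply_apply, sub_eq_iff_eq_add']
    exact Iff.rfl

lemma acts_iff_differ_symm : Acts f D.q ρ₀ y₁ U h₁ w
    (fun s => (g.app _ le_rfl).symm (g'.app _ le_rfl s) - s) ↔ Differ ρ₀ hU g g' w := by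
  refine (acts_iff_lact (hU := hU) w (δ := fun W h =>
    (g.app W h).symm.toLinearMap ∘ₗ (g'.app W h).toLinearMap - LinearMap.id) ?_).trans ?_
  · intro W W' h h' s
    change res _ h' (g.symm.app W h (g'.app W h s) - s) = g.symm.app W' _ (g'.app W' _ _) - _
    rw [map_sub, g.symm.nat', g'.nat']
    rfl
  · refine forall₃_congr fun W h s => ?_
    change (g.app W h).symm (g'.app W h s) - s = _ ↔ _
    rw [sub_eq_iff_eq_add', LinearEquiv.symm_apply_eq, map_add, filIso_lact (hV₂ := h₂)]

lemma acts_iff_conj : Acts f D.q ρ₀ y₂ U h₂ τ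
    (fun s => g.app _ le_rfl (y₁.obj.θ _ h₁ ((g.app _ le_rfl).symm s)) - y₂.obj.θ _ h₂ s) ↔
      Conj ρ₀ hU g τ := by
  refine (acts_iff_lact (hU := hU) τ (δ := fun W h =>
    (g.app W h).toLinearMap ∘ₗ y₁.obj.θ W (h.trans h₁) ∘ₗ (g.app W h).symm.toLinearMap -
      y₂.obj.θ W (h.trans h₂)) ?_).trans ?_
  · intro W W' h h' s
    change res _ h' (g.app W h (y₁.obj.θ W _ (g.symm.app W h s)) - y₂.obj.θ W _ s) =
      g.app W' _ (y₁.obj.θ W' _ (g.symm.app W' _ _)) - y₂.obj.θ W' _ _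
    rw [map_sub, g.nat', y₁.obj.θ_nat, g.symm.nat', y₂.obj.θ_nat]
  · refine forall₂_congr fun W h => ((g.app W h).toEquiv.forall_congr fun s => ?_).symm
    change _ ↔ g.app W h (y₁.obj.θ W _ ((g.app W h).symm (g.app W h s))) -
      y₂.obj.θ W _ (g.app W h s) = _
    rw [LinearEquiv.symm_apply_apply, sub_eq_iff_eq_add']
    exact Iff.rfl

/-- g⁻¹ θ₂ g = θ₁ + τ is the same as g θ₁ g⁻¹ = θ₂ - τ, hence the sign. -/
lemma acts_iff_conj_symm : Acts f D.q ρ₀ y₁ U h₁ τ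
    (fun s => (g.app _ le_rfl).symm (y₂.obj.θ _ h₂ (g.app _ le_rfl s)) - y₁.obj.θ _ h₁ s) ↔
      Conj ρ₀ hU g (-τ) := by
  refine (acts_iff_lact (hU := hU) τ (δ := fun W h =>
    (g.app W h).symm.toLinearMap ∘ₗ y₂.obj.θ W (h.trans h₂) ∘ₗ (g.app W h).toLinearMap -
      y₁.obj.θ W (h.trans h₁)) ?_).trans ?_
  · intro W W' h h' s
    change res _ h' (g.symm.app W h (y₂.obj.θ W _ (g.app W h s)) - y₁.obj.θ W _ s) =
      g.symm.app W' _ (y₂.obj.θ W' _ (g.app W' _ _)) - y₁.obj.θ W' _ _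
    rw [map_sub, g.symm.nat', y₂.obj.θ_nat, g.nat', y₁.obj.θ_nat]
  · refine forall₃_congr fun W h s => ?_
    change (g.app W h).symm (y₂.obj.θ W _ (g.app W h s)) - y₁.obj.θ W _ s = _ ↔ _
    rw [sub_eq_iff_eq_add', LinearEquiv.symm_apply_eq, map_add, filIso_lact (hV₂ := h₂), lact_neg,
      ← sub_eq_add_neg, eq_sub_iff_add_eq, eq_comm]

end SmallExt

/-! ## The obstruction class -/

section Cech

variable {k : Type u} [Field k] {X : Scheme.{u}} (f : X ⟶ Spec (CommRingCat.of k)) {r n : ℕ}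
  {x : NilBundle X ⊤ r n} {I : Type u} [AddCommGroup I] [Module k I] {ι : Type u}
  (U : ι → X.Opens) {j : ℤ}

lemma face_le {p : ℕ} (a : Fin (p + 1) → ι) {p' : ℕ} (m : Fin (p' + 1) → Fin (p + 1)) :
    (⨅ l, U (a l)) ≤ ⨅ l, U ((a ∘ m) l) :=
  le_iInf fun l => iInf_le (fun l => U (a l)) (m l)

variable {U}

/-- Restriction of the member of a cochain at a face. -/
def faceRes {p p' : ℕ} (c : Cochain f x I U j p') (a : Fin (p + 1) → ι)
    (m : Fin (p' + 1) → Fin (p + 1)) : PTensor f x I j (⨅ l, U (a l)) :=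
  PTensor.map f x I (PSec.restrict f x j (face_le U a m)) (c (a ∘ m))

lemma cechD_apply {p : ℕ} (c : Cochain f x I U j p) (a : Fin (p + 2) → ι) :
    cechD f x I U j p c a = ∑ m : Fin (p + 2), ((-1 : k) ^ (m : ℕ)) • faceRes f c a m.succAbove := by
  rw [cechD, LinearMap.pi_apply, LinearMap.sum_apply]
  rfl

lemma cechD_zero_apply (c : Cochain f x I U j 0) (a : Fin 2 → ι) : cechD f x I U j 0 c a =
    faceRes f c a ![1] - faceRes f c a ![0] := by
  rw [cechD_apply, Fin.sum_univ_two, show Fin.succAbove (0 : Fin 2) = ![1] by decide,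
    show Fin.succAbove (1 : Fin 2) = ![0] by decide]
  simp [sub_eq_add_neg]

lemma cechD_one_apply (c : Cochain f x I U j 1) (a : Fin 3 → ι) : cechD f x I U j 1 c a =
    faceRes f c a ![1, 2] - faceRes f c a ![0, 2] +
      faceRes f c a ![0, 1] := by
  rw [cechD_apply, Fin.sum_univ_three, show Fin.succAbove (0 : Fin 3) = ![1, 2] by decide,
    show Fin.succAbove (1 : Fin 3) = ![0, 2] by decide,
    show Fin.succAbove (2 : Fin 3) = ![0, 1] by decide]
  simp [sub_eq_add_neg]

lemma cechD_two_apply (c : Cochain f x I U j 2) (a : Fin 4 → ι) : cechD f x I U j 2 c a =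
    faceRes f c a ![1, 2, 3] - faceRes f c a ![0, 2, 3] +
      faceRes f c a ![0, 1, 3] - faceRes f c a ![0, 1, 2] := by
  rw [cechD_apply, Fin.sum_univ_four, show Fin.succAbove (0 : Fin 4) = ![1, 2, 3] by decide,
    show Fin.succAbove (1 : Fin 4) = ![0, 2, 3] by decide,
    show Fin.succAbove (2 : Fin 4) = ![0, 1, 3] by decide,
    show Fin.succAbove (3 : Fin 4) = ![0, 1, 2] by decide]
  have : (-1 : k) ^ 3 = -1 := by ring
  simp [sub_eq_add_neg, this]

/-- The value of `[θ, -]` on a member of a cochain. -/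
abbrev br {p : ℕ} (c : Cochain f x I U 0 p) (a : Fin (p + 1) → ι) :
    PTensor f x I (-2) (⨅ l, U (a l)) :=
  PTensor.map f x I (bracket f x _) (c a)

lemma totD_one_fst (z : Tot f x I U 1) (a : Fin 4 → ι) : (totD f x I U 1 z).1 a =
    faceRes f z.1 a ![1, 2, 3] - faceRes f z.1 a ![0, 2, 3] +
      faceRes f z.1 a ![0, 1, 3] - faceRes f z.1 a ![0, 1, 2] :=
  cechD_two_apply f z.1 a

lemma totD_one_snd (z : Tot f x I U 1) (a : Fin 3 → ι) : (totD f x I U 1 z).2 a =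
    br f z.1 a + (faceRes f z.2 a ![1, 2] - faceRes f z.2 a ![0, 2] +
      faceRes f z.2 a ![0, 1]) := by
  rw [← cechD_one_apply]
  change ((-1 : k) ^ (1 + 1)) • br f z.1 a + _ = _
  rw [show (-1 : k) ^ (1 + 1) = 1 by ring, one_smul]
  rfl

lemma totD_zero_fst (z : Tot f x I U 0) (a : Fin 3 → ι) : (totD f x I U 0 z).1 a =
    faceRes f z.1 a ![1, 2] - faceRes f z.1 a ![0, 2] +
      faceRes f z.1 a ![0, 1] :=
  cechD_one_apply f z.1 a

lemma totD_zero_snd (z : Tot f x I U 0) (a : Fin 2 → ι) : (totD f x I U 0 z).2 a =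
    -br f z.1 a + (faceRes f z.2 a ![1] - faceRes f z.2 a ![0]) := by
  rw [← cechD_zero_apply]
  change ((-1 : k) ^ (0 + 1)) • br f z.1 a + _ = _
  rw [show (-1 : k) ^ (0 + 1) = -1 by ring, neg_one_smul]
  rfl

lemma totD₀_fst (c : Cochain f x I U 0 0) (a : Fin 2 → ι) : (totD₀ f x I U c).1 a =
    faceRes f c a ![1] - faceRes f c a ![0] :=
  cechD_zero_apply f c a

lemma totD₀_snd (c : Cochain f x I U 0 0) (a : Fin 1 → ι) : (totD₀ f x I U c).2 a = br f c a := rfl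

end Cech

namespace SmallExt

variable {k : Type u} [Field k] {X : Scheme.{u}} {f : X ⟶ Spec (CommRingCat.of k)}
  {A B : Type u} [CommRing A] [Algebra k A] [CommRing B] [IsLocalRing B]
  [Algebra k B] {D : SmallExt k A B} {r n : ℕ} {x₀ : NilBundle X ⊤ r n}
  {x : NilBundle (XBase f A) ⊤ r n}
  (ρ₀ : Reduction (specialFibre f D.ε) x x₀)
  [IsLocalRing A] [IsArtinianRing A] [IsArtinianRing B] [CharZero k]
  {ι : Type u} {U : ι → X.Opens} (hA : ∀ {p : ℕ} (a : Fin (p + 1) → ι), IsAffineOpen (⨅ l, U (a l)))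

/-- The isomorphisms of local lifts, restricted to an intersection. -/
def gr (L : LocalLifts f D.q U x) {p : ℕ} (a : Fin (p + 1) → ι) (l m : Fin (p + 1)) :
    FilIso (L.y (a m)) (L.y (a l)) (toX f B ⁻¹ᵁ (⨅ l, U (a l))) (inter_le f U a m)
      (inter_le f U a l) :=
  (L.g (a l) (a m)).restrict (le_inf (inter_le f U a l) (inter_le f U a m))

variable {ρ₀} in
lemma isObstructionCochain_iff {L : LocalLifts f D.q U x}
    {z : Tot f x₀ (RingHom.ker D.q) U 1} : L.IsObstructionCochain f D.q ρ₀ U z ↔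
      (∀ a : Fin 3 → ι, Differ ρ₀ (hA a) (gr L a 0 2) ((gr L a 1 2).trans (gr L a 0 1)) (z.1 a)) ∧
      ∀ a : Fin 2 → ι, Conj ρ₀ (hA a) (gr L a 0 1) (z.2 a) :=
  and_congr (forall_congr' fun a => acts_iff_differ (hU := hA a) (g := gr L a 0 2)
    (g' := (gr L a 1 2).trans (gr L a 0 1)))
    (forall_congr' fun a => acts_iff_conj (hU := hA a) (g := gr L a 0 1))

include hA in
lemma exists_isObstructionCochain (L : LocalLifts f D.q U x) :
    ∃ z, L.IsObstructionCochain f D.q ρ₀ U z := by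
  choose c hc using fun a : Fin 3 → ι =>
    exists_differ ρ₀ (hA a) (gr L a 0 2) ((gr L a 1 2).trans (gr L a 0 1))
  choose τ hτ using fun a : Fin 2 → ι => exists_conj ρ₀ (hA a) (gr L a 0 1)
  exact ⟨(c, τ), (isObstructionCochain_iff hA).mpr ⟨hc, hτ⟩⟩

variable {ρ₀}

include hA in
-- Each component is an equality of two ways to compute one difference, on fourfold and on triple
-- intersections.
lemma mem_ker_of_isObstructionCochain {L : LocalLifts f D.q U x}
    {z : Tot f x₀ (RingHom.ker D.q) U 1} (H : L.IsObstructionCochain f D.q ρ₀ U z) :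
    z ∈ LinearMap.ker (totD f x₀ (RingHom.ker D.q) U 1) := by
  obtain ⟨H1, H2⟩ := (isObstructionCochain_iff hA).mp H
  have FH1 : ∀ {p : ℕ} (a : Fin (p + 1) → ι) (m : Fin 3 → Fin (p + 1)), Differ ρ₀ (hA a)
      (gr L a (m 0) (m 2)) ((gr L a (m 1) (m 2)).trans (gr L a (m 0) (m 1))) (faceRes f z.1 a m) :=
    fun a m => (H1 (a ∘ m)).restrict (face_le U a m) (hA a)
  have FH2 : ∀ {p : ℕ} (a : Fin (p + 1) → ι) (m : Fin 2 → Fin (p + 1)), Conj ρ₀ (hA a)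
      (gr L a (m 0) (m 1)) (faceRes f z.2 a m) :=
    fun a m => (H2 (a ∘ m)).restrict (face_le U a m) (hA a)
  refine LinearMap.mem_ker.mpr (Prod.ext (funext fun a => ?_) (funext fun a => ?_))
  · rw [totD_one_fst]
    have e0 : Differ ρ₀ (hA a) (gr L a 1 3) ((gr L a 2 3).trans (gr L a 1 2))
      (faceRes f z.1 a ![1, 2, 3]) := FH1 a ![1, 2, 3]
    have e1 : Differ ρ₀ (hA a) (gr L a 0 3) ((gr L a 2 3).trans (gr L a 0 2))
      (faceRes f z.1 a ![0, 2, 3]) := FH1 a ![0, 2, 3]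
    have e2 : Differ ρ₀ (hA a) (gr L a 0 3) ((gr L a 1 3).trans (gr L a 0 1))
      (faceRes f z.1 a ![0, 1, 3]) := FH1 a ![0, 1, 3]
    have e3 : Differ ρ₀ (hA a) (gr L a 0 2) ((gr L a 1 2).trans (gr L a 0 1))
      (faceRes f z.1 a ![0, 1, 2]) := FH1 a ![0, 1, 2]
    -- Both sides lead from g₀₃ to g₀₁ g₁₂ g₂₃, one through g₀₁ g₁₃ and the other through g₀₂ g₂₃.
    have h := (e2.trans (e0.comp_left (gr L a 0 1))).unique (e1.trans (e3.comp_right (gr L a 2 3)))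
    change _ = (0 : PTensor f x₀ (RingHom.ker D.q) 0 (⨅ l, U (a l)))
    rw [sub_add_eq_add_sub, sub_sub, sub_eq_zero]
    exact (add_comm _ _).trans h
  · rw [totD_one_snd]
    have e0 : Conj ρ₀ (hA a) (gr L a 1 2) (faceRes f z.2 a ![1, 2]) :=
      FH2 a ![1, 2]
    have e1 : Conj ρ₀ (hA a) (gr L a 0 2) (faceRes f z.2 a ![0, 2]) :=
      FH2 a ![0, 2]
    have e2 : Conj ρ₀ (hA a) (gr L a 0 1) (faceRes f z.2 a ![0, 1]) :=
      FH2 a ![0, 1]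
    -- θ is transported along g₀₁ g₁₂, once in two steps and once as (1 + c) g₀₂.
    have h := (e0.trans e2).unique (e1.differ (H1 a))
    change _ = (0 : PTensor f x₀ (RingHom.ker D.q) (-2) (⨅ l, U (a l)))
    rw [sub_add_eq_add_sub, h]
    abel

include hA in
-- Independence of choices: `w` measures how far the φ_α fail to commute with the gluing
-- isomorphisms, and `t` is the change of θ under them. The 1-cochain is `(w, -t)` because `t` is
-- defined by φ θ φ⁻¹ = θ' + t.
lemma exists_totD_eq {L L' : LocalLifts f D.q U x}
    (φ : ∀ α, FilIso (L.y α) (L'.y α) (toX f B ⁻¹ᵁ U α) le_rfl le_rfl)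
    {z z' : Tot f x₀ (RingHom.ker D.q) U 1} (H : L.IsObstructionCochain f D.q ρ₀ U z)
    (H' : L'.IsObstructionCochain f D.q ρ₀ U z') : ∃ w, z' = z + totD f x₀ (RingHom.ker D.q) U 0 w := by
  obtain ⟨H1, H2⟩ := (isObstructionCochain_iff hA).mp H
  obtain ⟨H1', H2'⟩ := (isObstructionCochain_iff hA).mp H'
  let φr : ∀ {p : ℕ} (a : Fin (p + 1) → ι) (l : Fin (p + 1)), FilIso (L.y (a l)) (L'.y (a l))
    (toX f B ⁻¹ᵁ (⨅ l, U (a l))) (inter_le f U a l) (inter_le f U a l) :=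
    fun a l => (φ (a l)).restrict (inter_le f U a l)
  choose w hw using fun a : Fin 2 → ι =>
    exists_differ ρ₀ (hA a) ((gr L a 0 1).trans (φr a 0)) ((φr a 1).trans (gr L' a 0 1))
  choose t ht using fun a : Fin 1 → ι => exists_conj ρ₀ (hA a) (φr a 0)
  have Fhw : ∀ {p : ℕ} (a : Fin (p + 1) → ι) (m : Fin 2 → Fin (p + 1)), Differ ρ₀ (hA a)
      ((gr L a (m 0) (m 1)).trans (φr a (m 0))) ((φr a (m 1)).trans (gr L' a (m 0) (m 1)))
      (faceRes f w a m) :=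
    fun a m => (hw (a ∘ m)).restrict (face_le U a m) (hA a)
  have Fht : ∀ {p : ℕ} (a : Fin (p + 1) → ι) (m : Fin 1 → Fin (p + 1)), Conj ρ₀ (hA a)
      (φr a (m 0)) (faceRes f t a m) :=
    fun a m => (ht (a ∘ m)).restrict (face_le U a m) (hA a)
  refine ⟨(w, -t), Prod.ext (funext fun a => ?_) (funext fun a => ?_)⟩
  · change z'.1 a = z.1 a + (totD f x₀ (RingHom.ker D.q) U 0 (w, -t)).1 a
    rw [totD_zero_fst]
    have e0 : Differ ρ₀ (hA a) ((gr L a 1 2).trans (φr a 1)) ((φr a 2).trans (gr L' a 1 2))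
      (faceRes f w a ![1, 2]) := Fhw a ![1, 2]
    have e1 : Differ ρ₀ (hA a) ((gr L a 0 2).trans (φr a 0)) ((φr a 2).trans (gr L' a 0 2))
      (faceRes f w a ![0, 2]) := Fhw a ![0, 2]
    have e2 : Differ ρ₀ (hA a) ((gr L a 0 1).trans (φr a 0)) ((φr a 1).trans (gr L' a 0 1))
      (faceRes f w a ![0, 1]) := Fhw a ![0, 1]
    -- Two paths from φ₀ g₀₂ to g'₀₁ g'₁₂ φ₂: directly through g'₀₂ φ₂, or through φ₀ g₀₁ g₁₂ and
    -- g'₀₁ φ₁ g₁₂.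
    have h := (e1.trans ((H1' a).comp_right (φr a 2))).unique
      ((((H1 a).comp_left (φr a 0)).trans (e2.comp_right (gr L a 1 2))).trans
        (e0.comp_left (gr L' a 0 1)))
    rw [← sub_eq_iff_eq_add'.mpr h.symm]
    abel
  · change z'.2 a = z.2 a + (totD f x₀ (RingHom.ker D.q) U 0 (w, -t)).2 a
    rw [totD_zero_snd]
    have e0 : Conj ρ₀ (hA a) (φr a 1) (faceRes f t a ![1]) :=
      Fht a ![1]
    have e1 : Conj ρ₀ (hA a) (φr a 0) (faceRes f t a ![0]) :=
      Fht a ![0]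
    have h := (e0.trans (H2' a)).unique (((H2 a).trans e1).differ (hw a))
    have hn : ∀ m : Fin 1 → Fin 2, faceRes f (-t) a m = -faceRes f t a m := fun m => map_neg _ _
    change z'.2 a = z.2 a + (-br f w a + (faceRes f (-t) a _ - faceRes f (-t) a _))
    rw [hn, hn, ← sub_eq_iff_eq_add'.mpr h.symm]
    abel

variable (ρ₀) in
include hA ρ₀ in
-- The members of the cover and their pairwise intersections are affine, so local existence and
-- local uniqueness of lifts apply.
lemma nonempty_localLifts (hU : ∀ α, IsAffineOpen (U α)) : Nonempty (LocalLifts f D.q U x) := by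
  have y := fun α => (D.nonempty_liftOn ρ₀ (isAffineOpen_toX (hU α))).some
  refine ⟨⟨y, fun α β => (nonempty_filIso ρ₀ ?_ (y β) (y α) _ _).some⟩⟩
  have h := isAffineOpen_toX (f := f) (B := B) (hA ![α, β])
  convert h using 1
  refine le_antisymm (fun z hz => ?_) (le_inf (inter_le f U ![α, β] 0) (inter_le f U ![α, β] 1))
  have : U α ⊓ U β ≤ ⨅ l, U (![α, β] l) := le_iInf (Fin.forall_fin_two.mpr ⟨inf_le_left, inf_le_right⟩)
  exact this hz

end SmallExt

/-! ## Twisting and gluing local lifts -/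

namespace SmallExt

variable {k : Type u} [Field k] {X : Scheme.{u}} {f : X ⟶ Spec (CommRingCat.of k)}
  {A B : Type u} [CommRing A] [Algebra k A] [CommRing B] [IsLocalRing B]
  [Algebra k B] {D : SmallExt k A B} {r n : ℕ} {x₀ : NilBundle X ⊤ r n}
  {x : NilBundle (XBase f A) ⊤ r n}
  {ρ₀ : Reduction (specialFibre f D.ε) x x₀}
  [IsLocalRing A] [IsArtinianRing A] [IsArtinianRing B] [CharZero k]
  {ι : Type u} {U : ι → X.Opens} (hA : ∀ {p : ℕ} (a : Fin (p + 1) → ι), IsAffineOpen (⨅ l, U (a l)))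

lemma le_preimage_iInf {W : (XBase f B).Opens} {p : ℕ} {a : Fin (p + 1) → ι}
    (h : ∀ l, W ≤ toX f B ⁻¹ᵁ U (a l)) : W ≤ toX f B ⁻¹ᵁ (⨅ l, U (a l)) := fun z hz => by
  have : toX f B z ∈ ⨅ l, U (a l) := by
    rw [← Finset.inf_univ_eq_iInf, ← SetLike.mem_coe, Opens.coe_finset_inf]
    simpa using fun l => h l hz
  exact this

variable {V : (XBase f B).Opens} {y : LiftOn (baseMap f D.q) x V} {j : ℤ}

lemma lact_cochain_congr {p : ℕ} (c : Cochain f x₀ (RingHom.ker D.q) U j p) {a b : Fin (p + 1) → ι}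
    (e : a = b) {hV : toX f B ⁻¹ᵁ (⨅ l, U (a l)) ≤ V} {hV' : toX f B ⁻¹ᵁ (⨅ l, U (b l)) ≤ V}
    {W : (XBase f B).Opens} {h : W ≤ toX f B ⁻¹ᵁ (⨅ l, U (a l))}
    (h' : W ≤ toX f B ⁻¹ᵁ (⨅ l, U (b l))) (s : Γ(y.obj.E, W)) :
    D.lact ρ₀ y (hA a) hV (c a) W h s = D.lact ρ₀ y (hA b) hV' (c b) W h' s := by
  subst e
  rfl

lemma lact_faceRes {p p' : ℕ} (c : Cochain f x₀ (RingHom.ker D.q) U j p') {a : Fin (p + 1) → ι}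
    {m : Fin (p' + 1) → Fin (p + 1)} {b : Fin (p' + 1) → ι}
    (e : a ∘ m = b) {hV : toX f B ⁻¹ᵁ (⨅ l, U (a l)) ≤ V} {hV' : toX f B ⁻¹ᵁ (⨅ l, U (b l)) ≤ V}
    {W : (XBase f B).Opens} {h : W ≤ toX f B ⁻¹ᵁ (⨅ l, U (a l))}
    (h' : W ≤ toX f B ⁻¹ᵁ (⨅ l, U (b l))) (s : Γ(y.obj.E, W)) :
    D.lact ρ₀ y (hA a) hV (faceRes f c a m) W h s = D.lact ρ₀ y (hA b) hV' (c b) W h' s := by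
  subst e
  exact lact_restrict _ _ s

variable (ρ₀)

/-- The local lifts with the isomorphisms `(1 + w_αβ) g_αβ`. -/
def twist (L : LocalLifts f D.q U x) (w : Cochain f x₀ (RingHom.ker D.q) U 0 1) :
    LocalLifts f D.q U x where
  y := L.y
  g α β := ((gr L ![α, β] 0 1).trans
    (D.oneAdd ρ₀ (L.y α) (hA ![α, β]) (inter_le f U ![α, β] 0) (w ![α, β]))).restrict
      (le_preimage_iInf (Fin.forall_fin_two.mpr ⟨inf_le_left, inf_le_right⟩))

lemma differ_twist (L : LocalLifts f D.q U x) (w : Cochain f x₀ (RingHom.ker D.q) U 0 1)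
    (a : Fin 2 → ι) : Differ ρ₀ (hA a) (gr L a 0 1) (gr (twist ρ₀ hA L w) a 0 1) (w a) :=
  fun W h s => by
    have e : ![a 0, a 1] = a := by
      funext l
      fin_cases l <;> rfl
    exact congrArg ((gr L a 0 1).app W h s + ·) (lact_cochain_congr hA w e h _)

lemma differ_twist_face (L : LocalLifts f D.q U x) (w : Cochain f x₀ (RingHom.ker D.q) U 0 1)
    {p : ℕ} (a : Fin (p + 1) → ι) (m : Fin 2 → Fin (p + 1)) : Differ ρ₀ (hA a)
      (gr L a (m 0) (m 1)) (gr (twist ρ₀ hA L w) a (m 0) (m 1)) (faceRes f w a m) :=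
  (differ_twist ρ₀ hA L w (a ∘ m)).restrict (face_le U a m) (hA a)

/-- The factors 1 + w can be moved past the isomorphisms, and together they contribute the
alternating sum dw. -/
lemma differ_twist_comp (L : LocalLifts f D.q U x) {w : Cochain f x₀ (RingHom.ker D.q) U 0 1}
    (a : Fin 3 → ι) {c : PTensor f x₀ (RingHom.ker D.q) 0 (⨅ l, U (a l))}
    (H : Differ ρ₀ (hA a) (gr L a 0 2) ((gr L a 1 2).trans (gr L a 0 1)) c) :
    Differ ρ₀ (hA a) (gr (twist ρ₀ hA L w) a 0 2)
      ((gr (twist ρ₀ hA L w) a 1 2).trans (gr (twist ρ₀ hA L w) a 0 1))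
      (c + cechD f x₀ (RingHom.ker D.q) U 0 1 w a) := by
  have e0 : Differ ρ₀ (hA a) (gr L a 1 2) (gr (twist ρ₀ hA L w) a 1 2) (faceRes f w a ![1, 2]) :=
    differ_twist_face ρ₀ hA L w a ![1, 2]
  have e1 : Differ ρ₀ (hA a) (gr L a 0 2) (gr (twist ρ₀ hA L w) a 0 2) (faceRes f w a ![0, 2]) :=
    differ_twist_face ρ₀ hA L w a ![0, 2]
  have e2 : Differ ρ₀ (hA a) (gr L a 0 1) (gr (twist ρ₀ hA L w) a 0 1) (faceRes f w a ![0, 1]) :=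
    differ_twist_face ρ₀ hA L w a ![0, 1]
  have h := e1.symm.trans ((H.trans (e2.comp_right (gr L a 1 2))).trans
    (e0.comp_left (gr (twist ρ₀ hA L w) a 0 1)))
  rw [cechD_one_apply]
  refine h.of_eq ?_
  abel

/-- The restrictions of a global lift. -/
def ofLift (Y : LiftOn (baseMap f D.q) x ⊤) : LocalLifts f D.q U x where
  y α := Y.restrict le_top
  g α β := ((Y.restrictIso le_top).restrict inf_le_right).trans
    ((Y.restrictIso le_top).restrict inf_le_left).symm

variable {ρ₀}

/-- The gluing isomorphisms of a global lift are identities on sections. -/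
lemma differ_ofLift (Y : LiftOn (baseMap f D.q) x ⊤) (a : Fin 3 → ι) : Differ ρ₀ (hA a)
    (gr (U := U) (ofLift Y) a 0 2) ((gr (ofLift Y) a 1 2).trans (gr (ofLift Y) a 0 1)) 0 :=
  fun W h s => by
    rw [lact_zero, add_zero]
    rfl

lemma conj_ofLift (Y : LiftOn (baseMap f D.q) x ⊤) (a : Fin 2 → ι) : Conj ρ₀ (hA a)
    (gr (U := U) (ofLift Y) a 0 1) 0 := Conj.of_commutes fun _ _ _ => rfl

include hA in
/-- Gluing of local lifts along isomorphisms satisfying the cocycle condition, after a change of the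
endomorphisms. -/
theorem exists_lift_of_conj (hcov : ⨆ α, U α = ⊤) (L : LocalLifts f D.q U x)
    (hg : ∀ a : Fin 3 → ι, Differ ρ₀ (hA a) (gr L a 0 2) ((gr L a 1 2).trans (gr L a 0 1)) 0)
    (t : Cochain f x₀ (RingHom.ker D.q) U (-2) 0)
    (ht : ∀ a : Fin 2 → ι, Conj ρ₀ (hA a) (gr L a 0 1) (faceRes f t a ![0] - faceRes f t a ![1])) :
    ∃ (Z : LiftOn (baseMap f D.q) x ⊤)
      (φ : ∀ α, FilIso Z (L.y α) (toX f B ⁻¹ᵁ U α) le_top le_rfl),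
      (∀ α β W (hα : W ≤ toX f B ⁻¹ᵁ U α) (hβ : W ≤ toX f B ⁻¹ᵁ U β) s,
        (L.g α β).app W (le_inf hα hβ) ((φ β).app W hβ s) = (φ α).app W hα s) ∧
      ∀ a : Fin 1 → ι, Conj ρ₀ (hA a) ((φ (a 0)).restrict (inter_le f U a 0)) (t a) := by
  have hle : ∀ (α : ι) {W : (XBase f B).Opens}, W ≤ toX f B ⁻¹ᵁ U α →
      W ≤ toX f B ⁻¹ᵁ (⨅ l, U ((fun _ : Fin 1 => α) l)) := fun α W h => le_preimage_iInf fun _ => h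
  let δ : ∀ α, Fam (L.y α).obj.E (L.y α).obj.E (toX f B ⁻¹ᵁ (⨅ l, U ((fun _ : Fin 1 => α) l))) :=
    fun α => D.lact ρ₀ (L.y α) (hA _) (inter_le f U (fun _ : Fin 1 => α) 0) (t fun _ => α)
  have hcov' : ⨆ α, toX f B ⁻¹ᵁ U α = ⊤ := by
    rw [← Scheme.Hom.preimage_iSup, hcov]
    rfl
  obtain ⟨Z, φ, h1, h2⟩ := exists_glue_lift ρ₀ hcov' L.y L.g
    (fun α β γ W hα hβ hγ s => by
      have hW : W ≤ toX f B ⁻¹ᵁ (⨅ l, U (![α, β, γ] l)) := le_preimage_iInf (by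
        intro l; fin_cases l <;> assumption)
      have := hg ![α, β, γ] W hW s
      rw [lact_zero, add_zero] at this
      exact this)
    -- The new endomorphisms are θ_α + t_α. The hypothesis on `t` reads g θ_β g⁻¹ = θ_α + t_α - t_β,
    -- which says that they correspond to each other under g_αβ.
    (fun α W h => (L.y α).obj.θ W h + δ α W (hle α h))
    (fun α W W' h h' s => by
      change res _ h' ((L.y α).obj.θ W h s + δ α W (hle α h) s) =
        (L.y α).obj.θ W' (h'.trans h) (res _ h' s) + δ α W' (hle α (h'.trans h)) (res _ h' s)
      rw [map_add, (L.y α).obj.θ_nat, lact_nat])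
    (fun α W h s s' => by
      change (L.y α).obj.form W h s ((L.y α).obj.θ W h s' + δ α W (hle α h) s') =
        -(L.y α).obj.form W h ((L.y α).obj.θ W h s + δ α W (hle α h) s) s'
      rw [map_add, map_add, LinearMap.add_apply, (L.y α).obj.θ_adj, lact_form, neg_add])
    (fun α i W h s hs => add_mem ((L.y α).obj.θ_fil i W h s hs) (lact_fil _ i hs))
    (fun α W h s => by
      change (L.y α).ρ.red W h ((L.y α).obj.θ W h s + δ α W (hle α h) s) = _
      rw [map_add, red_lact, add_zero, (L.y α).ρ.red_θ])
    (fun α β W hα hβ s => by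
      have hW : W ≤ toX f B ⁻¹ᵁ (⨅ l, U (![α, β] l)) := le_preimage_iInf (by
        intro l; fin_cases l <;> assumption)
      have e := ht ![α, β] W hW s
      have e0 := lact_faceRes (ρ₀ := ρ₀) (y := L.y α) hA t (a := ![α, β]) (m := ![0])
        (b := fun _ => α) (by funext l; fin_cases l; rfl) (hV := inter_le f U ![α, β] 0)
        (hV' := inter_le f U (fun _ : Fin 1 => α) 0) (h := hW) (hle α hα)
        ((L.g α β).app W (le_inf hα hβ) s)
      have e1 := lact_faceRes (ρ₀ := ρ₀) (y := L.y β) hA t (a := ![α, β]) (m := ![1])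
        (b := fun _ => β) (by funext l; fin_cases l; rfl) (hV := inter_le f U ![α, β] 1)
        (hV' := inter_le f U (fun _ : Fin 1 => β) 0) (h := hW) (hle β hβ) s
      have e2 := filIso_lact (ρ₀ := ρ₀) (hU := hA ![α, β]) (h := hW) (faceRes f t ![α, β] ![1])
        (L.g α β) (hV₁ := inter_le f U ![α, β] 1) (hV₂ := inter_le f U ![α, β] 0)
        (hW := le_inf hα hβ) s
      rw [lact_sub] at e
      change (L.g α β).app W (le_inf hα hβ) ((L.y β).obj.θ W hβ s) = (L.y α).obj.θ W hα
        ((L.g α β).app W (le_inf hα hβ) s) + (D.lact ρ₀ (L.y α) (hA ![α, β]) (inter_le f U ![α, β] 0)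
          (faceRes f t ![α, β] ![0]) W hW ((L.g α β).app W (le_inf hα hβ) s) -
          D.lact ρ₀ (L.y α) (hA ![α, β]) (inter_le f U ![α, β] 0)
          (faceRes f t ![α, β] ![1]) W hW ((L.g α β).app W (le_inf hα hβ) s)) at e
      change (L.g α β).app W (le_inf hα hβ) ((L.y β).obj.θ W hβ s + δ β W (hle β hβ) s) =
        (L.y α).obj.θ W hα ((L.g α β).app W (le_inf hα hβ) s) +
          δ α W (hle α hα) ((L.g α β).app W (le_inf hα hβ) s)
      rw [map_add, e, e0, ← e2, e1]
      abel)
  refine ⟨Z, φ, h1, fun a W h s => ?_⟩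
  have e : (fun _ => a 0) = a := by
    funext l
    fin_cases l
    rfl
  exact (h2 (a 0) W _ s).trans (congrArg _ (lact_cochain_congr hA t e h _))

end SmallExt

/-! ## The classification of lifts -/

/-- A relation with the formal properties of the graph of a simply transitive action. The action on
isomorphism classes is only available in this form, through choices of lifts, cocycles and local
isomorphisms. -/
lemma exists_addTorsor {G : Type*} {T : Type*} [AddCommGroup G] [Nonempty T]
    (R : G → T → T → Prop) (ex : ∀ g p, ∃ q, R g p q)
    (uniq : ∀ {g p q q'}, R g p q → R g p q' → q = q') (zero : ∀ p, R 0 p p)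
    (hadd : ∀ {g h p q t}, R g p q → R h q t → R (g + h) p t) (ex' : ∀ p q, ∃ g, R g p q)
    (uniq' : ∀ {g g' p q}, R g p q → R g' p q → g = g') :
    ∃ _ : AddTorsor G T, ∀ (g : G) (p q : T), g +ᵥ p = q ↔ R g p q := by
  choose F hF using ex
  choose S hS using ex'
  refine ⟨{ vadd := F
            zero_vadd := fun p => uniq (hF 0 p) (zero p)
            add_vadd := fun g h p => uniq (hF (g + h) p) (add_comm g h ▸ hadd (hF h p) (hF g _))
            vsub := fun p q => S q p
            vsub_vadd' := fun p q => uniq (hF _ q) (hS q p)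
            vadd_vsub' := fun g p => uniq' (hS p _) (hF g p) }, fun g p q => ?_⟩
  exact ⟨fun h => h ▸ hF g p, fun h => uniq (hF g p) h⟩

namespace SmallExt

variable {k : Type u} [Field k] {X : Scheme.{u}} {f : X ⟶ Spec (CommRingCat.of k)}
  {A B : Type u} [CommRing A] [Algebra k A] [CommRing B] [IsLocalRing B]
  [Algebra k B] {D : SmallExt k A B} {r n : ℕ} {x₀ : NilBundle X ⊤ r n}
  {x : NilBundle (XBase f A) ⊤ r n}
  (ρ₀ : Reduction (specialFibre f D.ε) x x₀)
  [IsLocalRing A] [IsArtinianRing A] [IsArtinianRing B] [CharZero k]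
  {ι : Type u} {U : ι → X.Opens} (hA : ∀ {p : ℕ} (a : Fin (p + 1) → ι), IsAffineOpen (⨅ l, U (a l)))
  {y₁ y₂ y₃ : LiftOn (baseMap f D.q) x ⊤}

/-- The restriction of a family of local isomorphisms to an intersection. -/
def rr (φ : ∀ α, FilIso y₁ y₂ (toX f B ⁻¹ᵁ U α) le_top le_top) {p : ℕ} (a : Fin (p + 1) → ι)
    (l : Fin (p + 1)) : FilIso y₁ y₂ (toX f B ⁻¹ᵁ (⨅ l, U (a l))) le_top le_top :=
  (φ (a l)).restrict (inter_le f U a l)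

/-- The 1-cochain `z` describes the difference of `y₂` and `y₁` with respect to local
isomorphisms. -/
def Rel (φ : ∀ α, FilIso y₁ y₂ (toX f B ⁻¹ᵁ U α) le_top le_top)
    (z : Tot f x₀ (RingHom.ker D.q) U 0) : Prop :=
  (∀ a : Fin 2 → ι, Differ ρ₀ (hA a) (rr φ a 0) (rr φ a 1) (z.1 a)) ∧
    ∀ a : Fin 1 → ι, Conj ρ₀ (hA a) (rr φ a 0) (-z.2 a)

lemma isDifferenceCochain_iff {y₁ y₂ : Lift (baseMap f D.q) x}
    {φ : ∀ α, FilIso y₁.1 y₂.1 (toX f B ⁻¹ᵁ U α) le_top le_top}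
    {z : Tot f x₀ (RingHom.ker D.q) U 0} :
    IsDifferenceCochain f D.q ρ₀ U y₁ y₂ φ z ↔ Rel ρ₀ hA φ z :=
  and_congr (forall_congr' fun a => acts_iff_differ_symm (hU := hA a) (g := rr φ a 0)
    (g' := rr φ a 1)) (forall_congr' fun a => acts_iff_conj_symm (hU := hA a) (g := rr φ a 0))

variable {ρ₀ hA} {φ : ∀ α, FilIso y₁ y₂ (toX f B ⁻¹ᵁ U α) le_top le_top}
  {z z' : Tot f x₀ (RingHom.ker D.q) U 0}

lemma Rel.of_eq (H : Rel ρ₀ hA φ z) (e : z = z') : Rel ρ₀ hA φ z' := e ▸ H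

lemma Rel.differ (H : Rel ρ₀ hA φ z) {p : ℕ} (a : Fin (p + 1) → ι) (m : Fin 2 → Fin (p + 1)) :
    Differ ρ₀ (hA a) (rr φ a (m 0)) (rr φ a (m 1)) (faceRes f z.1 a m) :=
  (H.1 (a ∘ m)).restrict (face_le U a m) (hA a)

lemma Rel.conj (H : Rel ρ₀ hA φ z) {p : ℕ} (a : Fin (p + 1) → ι) (m : Fin 1 → Fin (p + 1)) :
    Conj ρ₀ (hA a) (rr φ a (m 0)) (-faceRes f z.2 a m) :=
  ((H.2 (a ∘ m)).restrict (face_le U a m) (hA a)).of_eq (map_neg _ _)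

/-- Passing from φ₀ to φ₂ through φ₁ gives dc = 0, and transporting θ along φ₁ = φ₀(1 + c) gives the
mixed component. -/
lemma Rel.mem_ker (H : Rel ρ₀ hA φ z) : z ∈ LinearMap.ker (totD f x₀ (RingHom.ker D.q) U 0) := by
  refine LinearMap.mem_ker.mpr (Prod.ext (funext fun a => ?_) (funext fun a => ?_))
  · rw [totD_zero_fst]
    change _ = (0 : PTensor f x₀ (RingHom.ker D.q) 0 (⨅ l, U (a l)))
    have e0 : Differ ρ₀ (hA a) (rr φ a 1) (rr φ a 2) (faceRes f z.1 a ![1, 2]) := H.differ a ![1, 2]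
    have e1 : Differ ρ₀ (hA a) (rr φ a 0) (rr φ a 2) (faceRes f z.1 a ![0, 2]) := H.differ a ![0, 2]
    have e2 : Differ ρ₀ (hA a) (rr φ a 0) (rr φ a 1) (faceRes f z.1 a ![0, 1]) := H.differ a ![0, 1]
    rw [e1.unique (e2.trans e0)]
    abel
  · rw [totD_zero_snd]
    change _ = (0 : PTensor f x₀ (RingHom.ker D.q) (-2) (⨅ l, U (a l)))
    have e0 : Conj ρ₀ (hA a) (rr φ a 1) (-faceRes f z.2 a ![1]) := H.conj a ![1]
    have e1 : Conj ρ₀ (hA a) (rr φ a 0) (-faceRes f z.2 a ![0]) := H.conj a ![0]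
    rw [neg_eq_iff_eq_neg.mp (e0.unique (e1.differ (H.1 a)))]
    simp only [br]
    abel

variable (ρ₀ hA) in
lemma exists_rel (hU : ∀ α, IsAffineOpen (U α)) (y₁ y₂ : LiftOn (baseMap f D.q) x ⊤) :
    ∃ (φ : ∀ α, FilIso y₁ y₂ (toX f B ⁻¹ᵁ U α) le_top le_top)
      (z : Tot f x₀ (RingHom.ker D.q) U 0), Rel ρ₀ hA φ z := by
  let φ := fun α => (nonempty_filIso ρ₀ (isAffineOpen_toX (hU α)) y₁ y₂ le_top le_top).some
  choose c hc using fun a : Fin 2 → ι => exists_differ ρ₀ (hA a) (rr φ a 0) (rr φ a 1)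
  choose τ hτ using fun a : Fin 1 → ι => exists_conj ρ₀ (hA a) (rr φ a 0)
  exact ⟨φ, (c, -τ), hc, fun a => (hτ a).of_eq (neg_neg _).symm⟩

/-- When φ is replaced by (1 + w)φ, the differences of `w` enter c, and the brackets [θ₀, w] enter
τ. -/
lemma Rel.of_differ (H : Rel ρ₀ hA φ z) {φ' : ∀ α, FilIso y₁ y₂ (toX f B ⁻¹ᵁ U α) le_top le_top}
    {w : Cochain f x₀ (RingHom.ker D.q) U 0 0}
    (hw : ∀ a : Fin 1 → ι, Differ ρ₀ (hA a) (rr φ a 0) (rr φ' a 0) (w a)) :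
    Rel ρ₀ hA φ' (z + totD₀ f x₀ (RingHom.ker D.q) U w) := by
  have hw' : ∀ {p : ℕ} (a : Fin (p + 1) → ι) (m : Fin 1 → Fin (p + 1)), Differ ρ₀ (hA a)
    (rr φ a (m 0)) (rr φ' a (m 0)) (faceRes f w a m) :=
    fun a m => (hw (a ∘ m)).restrict (face_le U a m) (hA a)
  refine ⟨fun a => ?_, fun a => ?_⟩
  · change Differ ρ₀ (hA a) _ _ (z.1 a + (totD₀ f x₀ (RingHom.ker D.q) U w).1 a)
    rw [totD₀_fst]
    have e0 : Differ ρ₀ (hA a) (rr φ a 1) (rr φ' a 1) (faceRes f w a ![1]) := hw' a ![1]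
    have e1 : Differ ρ₀ (hA a) (rr φ a 0) (rr φ' a 0) (faceRes f w a ![0]) := hw' a ![0]
    refine ((e1.symm.trans (H.1 a)).trans e0).of_eq ?_
    abel
  · change Conj ρ₀ (hA a) _ (-(z.2 a + (totD₀ f x₀ (RingHom.ker D.q) U w).2 a))
    rw [totD₀_snd]
    refine ((H.2 a).differ (hw a)).of_eq ?_
    rw [neg_add, sub_eq_add_neg]

variable (ρ₀ hA φ) in
lemma exists_differ_family (w : Cochain f x₀ (RingHom.ker D.q) U 0 0) :
    ∃ φ' : ∀ α, FilIso y₁ y₂ (toX f B ⁻¹ᵁ U α) le_top le_top,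
      ∀ a : Fin 1 → ι, Differ ρ₀ (hA a) (rr φ a 0) (rr φ' a 0) (w a) := by
  refine ⟨fun α => (φ α).trans ((D.oneAdd ρ₀ y₂ (hA fun _ : Fin 1 => α) le_top
    (w fun _ => α)).restrict (le_preimage_iInf fun _ => le_rfl)), fun a W h s => ?_⟩
  have e : (fun _ => a 0) = a := by
    funext l
    fin_cases l
    rfl
  exact congrArg ((rr φ a 0).app W h s + ·) (lact_cochain_congr hA w e h _)

/-- The local isomorphisms of a lift with itself are changes of the identity, whose cochain is zero.
-/
lemma Rel.eq_totD₀ {φ : ∀ α, FilIso y₁ y₁ (toX f B ⁻¹ᵁ U α) le_top le_top} (H : Rel ρ₀ hA φ z)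
    {w : Cochain f x₀ (RingHom.ker D.q) U 0 0}
    (hw : ∀ a : Fin 1 → ι, Differ ρ₀ (hA a) (FilIso.refl y₁ le_top) (rr φ a 0) (w a)) :
    z = totD₀ f x₀ (RingHom.ker D.q) U w := by
  have h0 : Rel ρ₀ hA (fun α => FilIso.refl y₁ le_top) 0 :=
    ⟨fun a => Differ.refl _, fun a => (Conj.of_commutes fun _ _ _ => rfl).of_eq neg_zero.symm⟩
  have h1 := h0.of_differ hw
  rw [zero_add] at h1
  exact Prod.ext (funext fun a => (H.1 a).unique (h1.1 a))
    (funext fun a => neg_injective ((H.2 a).unique (h1.2 a)))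

lemma Rel.trans (H : Rel ρ₀ hA φ z) {ψ : ∀ α, FilIso y₂ y₃ (toX f B ⁻¹ᵁ U α) le_top le_top}
    (H' : Rel ρ₀ hA ψ z') : Rel ρ₀ hA (fun α => (φ α).trans (ψ α)) (z + z') :=
  ⟨fun a => ((H.1 a).comp_left (rr ψ a 0)).trans ((H'.1 a).comp_right (rr φ a 1)),
    fun a => ((H.2 a).trans (H'.2 a)).of_eq (neg_add _ _).symm⟩

lemma Rel.symm (H : Rel ρ₀ hA φ z) : Rel ρ₀ hA (fun α => (φ α).symm) (-z) :=
  ⟨fun a => (H.1 a).inv, fun a => (H.2 a).symm⟩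

variable (ρ₀ hA) in
lemma rel_of_commutes (Φ : FilIso y₁ y₂ ⊤ le_rfl le_rfl) (hΦ : Φ.CommutesWithθ) :
    Rel ρ₀ hA (fun α => Φ.restrict le_top) 0 :=
  ⟨fun a => Differ.refl _,
    fun a => (Conj.of_commutes fun W _ s => hΦ W le_top s).of_eq neg_zero.symm⟩

lemma eq_of_forall_inter (hcov : ⨆ α, U α = ⊤) {E : (XBase f B).Modules} {W : (XBase f B).Opens}
    {s t : Γ(E, W)} (h : ∀ (α : ι) (W' : (XBase f B).Opens) (h' : W' ≤ W), W' ≤ toX f B ⁻¹ᵁ U α →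
      res E h' s = res E h' t) : s = t :=
  eq_of_locally fun z hz => by
    obtain ⟨α, hα⟩ := Opens.mem_iSup.mp (show toX f B z ∈ ⨆ α, U α from hcov ▸ trivial)
    exact ⟨W ⊓ toX f B ⁻¹ᵁ U α, inf_le_left, ⟨hz, hα⟩, h α _ inf_le_left inf_le_right⟩

/-- c = 0 means that the local isomorphisms agree on overlaps, and τ = 0 that they commute with θ.
-/
lemma Rel.exists_glue (hcov : ⨆ α, U α = ⊤) (H : Rel ρ₀ hA φ 0) :
    ∃ Φ : FilIso y₁ y₂ ⊤ le_rfl le_rfl, Φ.CommutesWithθ ∧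
      ∀ α W h s, Φ.app W le_top s = (φ α).app W h s := by
  have hcov' : ⨆ α, toX f B ⁻¹ᵁ U α = ⊤ := by
    rw [← Scheme.Hom.preimage_iSup, hcov]
    rfl
  obtain ⟨Φ, hΦ⟩ := FilIso.exists_glue hcov' φ fun α β W hα hβ s => by
    have hW : W ≤ toX f B ⁻¹ᵁ (⨅ l, U (![α, β] l)) := le_preimage_iInf (by
      intro l; fin_cases l <;> assumption)
    have e := H.1 ![α, β] W hW s
    change (φ β).app W hβ s = (φ α).app W hα s + D.lact ρ₀ y₂ _ _ 0 W hW _ at e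
    rw [e, lact_zero, add_zero]
  refine ⟨Φ, fun W h s => eq_of_forall_inter hcov fun α W' h' hα => ?_, hΦ⟩
  have hW : W' ≤ toX f B ⁻¹ᵁ (⨅ l, U (![α] l)) := le_preimage_iInf (by
    intro l; fin_cases l; assumption)
  have e := ((H.2 ![α]).of_eq neg_zero).commutes W' hW (res y₁.obj.E h' s)
  change (φ α).app W' hα _ = y₂.obj.θ W' le_top ((φ α).app W' hα _) at e
  rw [Φ.nat' le_top h', y₁.obj.θ_nat, y₂.obj.θ_nat _ _ _ h', Φ.nat' le_top h', hΦ α W' hα,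
    hΦ α W' hα, e]

variable (ρ₀ hA) in
-- A cocycle (c, τ) is realized by regluing the restrictions of `Y` along 1 + c_αβ, with
-- endomorphisms θ + τ_α. The two components of the cocycle equation are the two gluing conditions.
lemma exists_rel_of_mem_ker (hcov : ⨆ α, U α = ⊤) (Y : LiftOn (baseMap f D.q) x ⊤)
    {z : Tot f x₀ (RingHom.ker D.q) U 0}
    (hz : z ∈ LinearMap.ker (totD f x₀ (RingHom.ker D.q) U 0)) :
    ∃ (Z : LiftOn (baseMap f D.q) x ⊤) (φ : ∀ α, FilIso Y Z (toX f B ⁻¹ᵁ U α) le_top le_top),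
      Rel ρ₀ hA φ z := by
  let L := twist ρ₀ hA (ofLift Y) z.1
  have hz1 : ∀ a, cechD f x₀ (RingHom.ker D.q) U 0 1 z.1 a = 0 := fun a =>
    congrFun (congrArg Prod.fst (LinearMap.mem_ker.mp hz)) a
  have hz2 : ∀ a, -br f z.1 a + (faceRes f z.2 a ![1] - faceRes f z.2 a ![0]) = 0 := fun a =>
    (totD_zero_snd f z a).symm.trans (congrFun (congrArg Prod.snd (LinearMap.mem_ker.mp hz)) a)
  obtain ⟨Z, φ, h1, h2⟩ := exists_lift_of_conj hA hcov L
    (fun a => (differ_twist_comp ρ₀ hA (ofLift Y) a (differ_ofLift hA Y a)).of_eq (by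
      rw [hz1, add_zero])) z.2
    (fun a => ((conj_ofLift hA Y a).differ (differ_twist ρ₀ hA (ofLift Y) z.1 a)).of_eq (by
      rw [zero_sub, ← sub_eq_zero, ← hz2 a]
      simp only [br]
      abel))
  -- The gluing yields maps from `Z` to `Y`, and their inverses have the required direction.
  let Φ : ∀ α, FilIso Z Y (toX f B ⁻¹ᵁ U α) le_top le_top := fun α =>
    (φ α).trans (Y.restrictIso le_top)
  refine ⟨Z, fun α => (Φ α).symm, fun a => ?_, fun a => ?_⟩
  · have e : Differ ρ₀ (hA a) (rr Φ a 1) (rr Φ a 0) (z.1 a) := by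
      have e1 := ((differ_twist ρ₀ hA (ofLift Y) z.1 a).comp_right
        ((φ (a 1)).restrict (inter_le f U a 1))).comp_left
          ((Y.restrictIso le_top).restrict (inter_le f U a 0))
      intro W h s
      refine Eq.trans ?_ (e1 W h s)
      exact (h1 (a 0) (a 1) W (h.trans (inter_le f U a 0)) (h.trans (inter_le f U a 1)) s).symm
    exact e.inv.symm.of_eq (neg_neg _)
  · have e : Conj ρ₀ (hA a) ((Y.restrictIso le_top).restrict (inter_le f U a 0)) 0 :=
      Conj.of_commutes fun _ _ _ => rfl
    exact ((h2 a).trans e).symm.of_eq (by rw [add_zero])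

end SmallExt

/-! ## Obstruction, classification and automorphisms -/

namespace SmallExt

variable {k : Type u} [Field k] {X : Scheme.{u}} {f : X ⟶ Spec (CommRingCat.of k)}
  {A B : Type u} [CommRing A] [Algebra k A] [CommRing B] [IsLocalRing B]
  [Algebra k B] {D : SmallExt k A B} {r n : ℕ} {x₀ : NilBundle X ⊤ r n}
  {x : NilBundle (XBase f A) ⊤ r n}
  (ρ₀ : Reduction (specialFibre f D.ε) x x₀)
  [IsLocalRing A] [IsArtinianRing A] [IsArtinianRing B] [CharZero k]
  {ι : Type u} {U : ι → X.Opens} (hA : ∀ {p : ℕ} (a : Fin (p + 1) → ι), IsAffineOpen (⨅ l, U (a l)))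
  (hU : ∀ α, IsAffineOpen (U α)) (hcov : ⨆ α, U α = ⊤)

include hA hcov in
-- If the obstruction cochain is the coboundary of w, twisting the isomorphisms by the negative of
-- the first component and correcting θ by the negative of the second makes the local lifts glue.
lemma nonempty_lift_of_eq_totD {L : LocalLifts f D.q U x} {z : Tot f x₀ (RingHom.ker D.q) U 1}
    (H : L.IsObstructionCochain f D.q ρ₀ U z) {w : Tot f x₀ (RingHom.ker D.q) U 0}
    (hw : totD f x₀ (RingHom.ker D.q) U 0 w = z) : Nonempty (LiftOn (baseMap f D.q) x ⊤) := by
  obtain ⟨H1, H2⟩ := (isObstructionCochain_iff hA).mp H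
  subst hw
  obtain ⟨Z, -⟩ := exists_lift_of_conj hA hcov (twist ρ₀ hA L (-w.1))
    (fun a => (differ_twist_comp ρ₀ hA L a (H1 a)).of_eq (by
      rw [map_neg]
      exact add_neg_cancel _)) (-w.2)
    (fun a => ((H2 a).differ (differ_twist ρ₀ hA L (-w.1) a)).of_eq (by
      have e1 : PTensor.map f x₀ (RingHom.ker D.q) (bracket f x₀ _) ((-w.1) a) = -br f w.1 a :=
        map_neg _ _
      have e2 : ∀ m : Fin 1 → Fin 2, faceRes f (-w.2) a m = -faceRes f w.2 a m := fun m =>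
        map_neg _ _
      rw [e1, e2, e2, totD_zero_snd]
      abel))
  exact ⟨Z⟩

include hA hU hcov in
-- Any two systems of local lifts are locally isomorphic, so their cochains differ by a coboundary.
-- A global lift gives the zero cochain, and conversely a coboundary can be removed by twisting.
theorem exists_obstruction (hx : x.HasOrder) : ∃ ob : HH2 f x₀ (RingHom.ker D.q) U,
    (∀ (L : LocalLifts f D.q U x) (z : Tot f x₀ (RingHom.ker D.q) U 1),
      L.IsObstructionCochain f D.q ρ₀ U z →
      ∃ hz : z ∈ LinearMap.ker (totD f x₀ (RingHom.ker D.q) U 1),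
        HH2.mk f x₀ (RingHom.ker D.q) U ⟨z, hz⟩ = ob) ∧
    (ob = 0 ↔ Nonempty (Lift (baseMap f D.q) x)) := by
  obtain ⟨L₀⟩ := nonempty_localLifts ρ₀ hA hU
  obtain ⟨z₀, hz₀⟩ := exists_isObstructionCochain ρ₀ hA L₀
  have key : ∀ (L : LocalLifts f D.q U x) (z : Tot f x₀ (RingHom.ker D.q) U 1),
      L.IsObstructionCochain f D.q ρ₀ U z →
      ∃ hz : z ∈ LinearMap.ker (totD f x₀ (RingHom.ker D.q) U 1),
        HH2.mk f x₀ (RingHom.ker D.q) U ⟨z, hz⟩ =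
          HH2.mk f x₀ (RingHom.ker D.q) U ⟨z₀, mem_ker_of_isObstructionCochain hA hz₀⟩ := by
    intro L z hz
    obtain ⟨w, hw⟩ := exists_totD_eq hA (fun α =>
      (nonempty_filIso ρ₀ (isAffineOpen_toX (hU α)) (L₀.y α) (L.y α) le_rfl le_rfl).some) hz₀ hz
    refine ⟨mem_ker_of_isObstructionCochain hA hz, (Submodule.Quotient.eq _).mpr ⟨w, ?_⟩⟩
    change _ = z - z₀
    rw [hw, add_sub_cancel_left]
  refine ⟨_, key, fun h0 => ?_, fun ⟨Y⟩ => ?_⟩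
  · obtain ⟨w, hw⟩ := (Submodule.Quotient.mk_eq_zero _).mp h0
    obtain ⟨Z⟩ := nonempty_lift_of_eq_totD ρ₀ hA hcov hz₀ hw
    exact ⟨⟨Z, hasOrder hx Z⟩⟩
  · obtain ⟨hz, e⟩ := key (ofLift Y.1) 0 ((isObstructionCochain_iff hA).mpr
      ⟨fun a => differ_ofLift hA Y.1 a, fun a => conj_ofLift hA Y.1 a⟩)
    rw [← e]
    exact (Submodule.Quotient.mk_eq_zero _).mpr (zero_mem _)

include hA hU hcov in
-- Difference cochains add under composition. Every cocycle occurs, the zero cochain means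
-- isomorphic lifts, and a change of the local isomorphisms changes the cochain by a coboundary.
theorem exists_torsor (hx : x.HasOrder) (hne : Nonempty (Lift (baseMap f D.q) x)) :
    ∃ _ : AddTorsor (HH1 f x₀ (RingHom.ker D.q) U) (LiftClass (baseMap f D.q) x),
      ∀ (y₁ y₂ : Lift (baseMap f D.q) x) (z : LinearMap.ker (totD f x₀ (RingHom.ker D.q) U 0)),
        HH1.mk f x₀ (RingHom.ker D.q) U z +ᵥ y₁.cls = y₂.cls ↔
          ∃ φ, IsDifferenceCochain f D.q ρ₀ U y₁ y₂ φ z.1 := by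
  simp only [isDifferenceCochain_iff ρ₀ hA]
  have mk_eq : ∀ z z' : LinearMap.ker (totD f x₀ (RingHom.ker D.q) U 0),
      HH1.mk f x₀ (RingHom.ker D.q) U z = HH1.mk f x₀ (RingHom.ker D.q) U z' ↔
        ∃ w, totD₀ f x₀ (RingHom.ker D.q) U w = z.1 - z'.1 := fun z z' =>
    Submodule.Quotient.eq _
  have iso_iff : ∀ y₁ y₂ : Lift (baseMap f D.q) x, y₁.cls = y₂.cls ↔
      ∃ φ, Rel ρ₀ hA (U := U) (y₁ := y₁.1) (y₂ := y₂.1) φ 0 := fun y₁ y₂ => by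
    refine Quotient.eq.trans ⟨fun ⟨Φ, hΦ⟩ => ⟨_, rel_of_commutes ρ₀ hA Φ hΦ⟩, fun ⟨φ, hφ⟩ => ?_⟩
    obtain ⟨Φ, hΦ, -⟩ := hφ.exists_glue hcov
    exact ⟨Φ, hΦ⟩
  -- The relation asks for some representatives of the three classes; `R_iff` shows that any
  -- representatives will do.
  let R : HH1 f x₀ (RingHom.ker D.q) U → LiftClass (baseMap f D.q) x →
      LiftClass (baseMap f D.q) x → Prop := fun g p q =>
    ∃ (y₁ y₂ : Lift (baseMap f D.q) x) (z : LinearMap.ker (totD f x₀ (RingHom.ker D.q) U 0)),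
      y₁.cls = p ∧ y₂.cls = q ∧ HH1.mk f x₀ (RingHom.ker D.q) U z = g ∧
        ∃ φ, Rel ρ₀ hA (U := U) (y₁ := y₁.1) (y₂ := y₂.1) φ z.1
  have R_iff : ∀ (y₁ y₂ : Lift (baseMap f D.q) x)
      (z : LinearMap.ker (totD f x₀ (RingHom.ker D.q) U 0)),
      R (HH1.mk f x₀ (RingHom.ker D.q) U z) y₁.cls y₂.cls ↔
        ∃ φ, Rel ρ₀ hA (U := U) (y₁ := y₁.1) (y₂ := y₂.1) φ z.1 := by
    refine fun y₁ y₂ z => ⟨?_, fun h => ⟨y₁, y₂, z, rfl, rfl, rfl, h⟩⟩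
    rintro ⟨y₁', y₂', z', h1, h2, h3, φ, hφ⟩
    obtain ⟨φ₁, hφ₁⟩ := (iso_iff _ _).mp h1.symm
    obtain ⟨φ₂, hφ₂⟩ := (iso_iff _ _).mp h2
    obtain ⟨w, hw⟩ := (mk_eq _ _).mp h3.symm
    -- Isomorphisms to the other representatives of the lifts contribute zero cochains, and the
    -- coboundary between the cocycles is absorbed into the local isomorphisms.
    have h4 := (hφ₁.trans hφ).trans hφ₂
    obtain ⟨φ', hφ'⟩ := exists_differ_family ρ₀ hA
      (fun α => ((φ₁ α).trans (φ α)).trans (φ₂ α)) w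
    refine ⟨φ', (h4.of_differ hφ').of_eq ?_⟩
    rw [hw]
    abel
  have : Nonempty (LiftClass (baseMap f D.q) x) := hne.map Lift.cls
  have hsurj : ∀ p : LiftClass (baseMap f D.q) x, ∃ y : Lift (baseMap f D.q) x, y.cls = p :=
    Quotient.exists_rep
  have hsurj' : ∀ g : HH1 f x₀ (RingHom.ker D.q) U, ∃ z, HH1.mk f x₀ (RingHom.ker D.q) U z = g :=
    Submodule.Quotient.mk_surjective _
  obtain ⟨T, hT⟩ := exists_addTorsor R
    (by
      intro g p
      obtain ⟨y, rfl⟩ := hsurj p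
      obtain ⟨z, rfl⟩ := hsurj' g
      obtain ⟨Z, φ, h⟩ := exists_rel_of_mem_ker ρ₀ hA hcov y.1 z.2
      exact ⟨Lift.cls ⟨Z, hasOrder hx Z⟩, (R_iff y ⟨Z, hasOrder hx Z⟩ z).mpr ⟨φ, h⟩⟩)
    (by
      intro g p q q' h h'
      obtain ⟨y, rfl⟩ := hsurj p
      obtain ⟨y₁, rfl⟩ := hsurj q
      obtain ⟨y₂, rfl⟩ := hsurj q'
      obtain ⟨z, rfl⟩ := hsurj' g
      obtain ⟨φ, hφ⟩ := (R_iff _ _ _).mp h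
      obtain ⟨ψ, hψ⟩ := (R_iff _ _ _).mp h'
      have h1 := hφ.symm.trans hψ
      rw [neg_add_cancel] at h1
      exact (iso_iff _ _).mpr ⟨_, h1⟩)
    (by
      intro p
      obtain ⟨y, rfl⟩ := hsurj p
      exact (R_iff y y 0).mpr ((iso_iff y y).mp rfl))
    (by
      intro g h p q t hg hh
      obtain ⟨y₁, rfl⟩ := hsurj p
      obtain ⟨y₂, rfl⟩ := hsurj q
      obtain ⟨y₃, rfl⟩ := hsurj t
      obtain ⟨z, rfl⟩ := hsurj' g
      obtain ⟨z', rfl⟩ := hsurj' h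
      obtain ⟨φ, hφ⟩ := (R_iff _ _ _).mp hg
      obtain ⟨ψ, hψ⟩ := (R_iff _ _ _).mp hh
      exact (R_iff y₁ y₃ (z + z')).mpr ⟨_, hφ.trans hψ⟩)
    (by
      intro p q
      obtain ⟨y₁, rfl⟩ := hsurj p
      obtain ⟨y₂, rfl⟩ := hsurj q
      obtain ⟨φ, z, h⟩ := exists_rel ρ₀ hA hU y₁.1 y₂.1
      exact ⟨HH1.mk f x₀ _ U ⟨z, h.mem_ker⟩, (R_iff y₁ y₂ ⟨z, h.mem_ker⟩).mpr ⟨φ, h⟩⟩)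
    (by
      intro g g' p q h h'
      obtain ⟨y₁, rfl⟩ := hsurj p
      obtain ⟨y₂, rfl⟩ := hsurj q
      obtain ⟨z, rfl⟩ := hsurj' g
      obtain ⟨z', rfl⟩ := hsurj' g'
      obtain ⟨φ, hφ⟩ := (R_iff _ _ _).mp h
      obtain ⟨ψ, hψ⟩ := (R_iff _ _ _).mp h'
      -- Both cocycles compare the same two lifts, so their difference comes from local
      -- automorphisms of `y₁` and is a coboundary.
      have h1 := hψ.trans hφ.symm
      choose w hw using fun a : Fin 1 → ι => exists_differ ρ₀ (hA a)
        (FilIso.refl y₁.1 le_top) (rr (fun α => (ψ α).trans (φ α).symm) a 0)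
      refine ((mk_eq _ _).mpr ⟨w, ?_⟩).symm
      rw [← h1.eq_totD₀ hw, sub_eq_add_neg])
  exact ⟨T, fun y₁ y₂ z => (hT _ _ _).trans (R_iff y₁ y₂ z)⟩

/-- The automorphism `Φ` is `1 + z`. -/
def One {y : LiftOn (baseMap f D.q) x ⊤} (Φ : FilIso y y ⊤ le_rfl le_rfl)
    (z : Cochain f x₀ (RingHom.ker D.q) U 0 0) : Prop :=
  ∀ a : Fin 1 → ι, Differ ρ₀ (hA a) (FilIso.refl y le_top) (Φ.restrict le_top) (z a)

include hA hcov in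
-- For a 0-cocycle z the local automorphisms 1 + z_α agree on overlaps and commute with θ, so they
-- glue. Conversely an automorphism is locally 1 + z_α, and its being global and commuting with θ
-- makes z a cocycle.
theorem exists_mulEquiv_aut (y : Lift (baseMap f D.q) x) :
    ∃ e : Multiplicative (HH0 f x₀ (RingHom.ker D.q) U) ≃* y.aut,
      ∀ z : HH0 f x₀ (RingHom.ker D.q) U,
        IsOneAdd f D.q ρ₀ U y (e (Multiplicative.ofAdd z)) z.1 := by
  have ex : ∀ z : HH0 f x₀ (RingHom.ker D.q) U, ∃ g : y.aut,
      ∃ Φ : FilIso y.1 y.1 ⊤ le_rfl le_rfl, (∀ W, Φ.app W le_top = g.1 W) ∧ One ρ₀ hA Φ z.1 := by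
    intro z
    obtain ⟨φ, hφ⟩ := exists_differ_family ρ₀ hA (fun α => FilIso.refl y.1 (le_top (a :=
      toX f B ⁻¹ᵁ U α))) z.1
    -- The identity has zero cochain, so the twisted family has the coboundary of z as its cochain,
    -- which is zero by hypothesis.
    have h1 := (rel_of_commutes ρ₀ hA (FilIso.refl y.1 le_rfl) fun _ _ _ => rfl).of_differ hφ
    rw [LinearMap.mem_ker.mp z.2, add_zero] at h1
    obtain ⟨Φ, hΦ, e⟩ := h1.exists_glue hcov
    refine ⟨⟨fun W => Φ.app W le_top, Φ, hΦ, fun _ => rfl⟩, Φ, fun _ => rfl, fun a W h s => ?_⟩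
    exact (e (a 0) W _ s).trans (hφ a W h s)
  choose g Φ hΦ hone using ex
  have ext : ∀ {Φ₁ Φ₂ : FilIso y.1 y.1 ⊤ le_rfl le_rfl} {z : Cochain f x₀ (RingHom.ker D.q) U 0 0},
      One ρ₀ hA Φ₁ z → One ρ₀ hA Φ₂ z → ∀ W, Φ₁.app W le_top = Φ₂.app W le_top := by
    intro Φ₁ Φ₂ z h1 h2 W
    refine LinearEquiv.ext fun s => eq_of_forall_inter hcov fun α W' h' hα => ?_
    rw [Φ₁.nat' le_top h', Φ₂.nat' le_top h']
    exact (h1 fun _ => α).eq (h2 fun _ => α) W' (le_preimage_iInf fun _ => hα) _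
  have hg : ∀ z (g' : y.aut) (Φ' : FilIso y.1 y.1 ⊤ le_rfl le_rfl),
      (∀ W, Φ'.app W le_top = g'.1 W) → One ρ₀ hA Φ' z.1 → g z = g' := fun z g' Φ' h h1 =>
    Subtype.ext (funext fun W => by rw [← hΦ, ← h, ext (hone z) h1])
  let e : Multiplicative (HH0 f x₀ (RingHom.ker D.q) U) →* y.aut :=
    MonoidHom.mk' (fun z => g z.toAdd) fun z z' => by
      refine hg _ _ ((Φ z'.toAdd).trans (Φ z.toAdd)) (fun W => ?_) fun a => ?_
      · change (Φ z'.toAdd).app W le_top ≪≫ₗ (Φ z.toAdd).app W le_top = _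
        rw [hΦ, hΦ]
        rfl
      · have h1 := (hone z'.toAdd a).comp_left ((Φ z.toAdd).restrict le_top)
        exact (hone z.toAdd a).trans h1
  have hinj : Function.Injective e := fun z z' h => by
    refine Multiplicative.toAdd.injective (Subtype.ext (funext fun a => ?_))
    have h1 : ∀ W, (Φ z.toAdd).app W le_top = (Φ z'.toAdd).app W le_top := fun W => by
      rw [hΦ, hΦ]
      exact congrFun (congrArg Subtype.val h) W
    refine (hone z.toAdd a).unique fun W hW s => ?_
    refine Eq.trans ?_ (hone z'.toAdd a W hW s)
    exact congrArg (· s) (h1 W)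
  have hsurj : Function.Surjective e := fun g' => by
    obtain ⟨Φ', hΦ', h'⟩ := g'.2
    choose w hw using fun a : Fin 1 → ι => exists_differ ρ₀ (hA a)
      (FilIso.refl y.1 le_top) (Φ'.restrict le_top)
    have h1 := (rel_of_commutes ρ₀ hA Φ' hΦ').eq_totD₀ hw
    exact ⟨Multiplicative.ofAdd ⟨w, LinearMap.mem_ker.mpr h1.symm⟩, hg _ _ Φ' h' hw⟩
  refine ⟨MulEquiv.ofBijective e ⟨hinj, hsurj⟩, fun z a => ?_⟩
  have h1 := (acts_iff_differ_symm (hU := hA a)).mpr (hone z a)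
  have h2 : (Φ z).app _ le_top = (g z).1 (toX f B ⁻¹ᵁ (⨅ l, U (a l))) := hΦ z _
  change Acts f D.q ρ₀ y.1 _ le_top (z.1 a) (fun s => (g z).1 _ s - s)
  rw [← h2]
  exact h1

end SmallExt

end NilDef

end

theorem theoremt {k : Type u} [Field k] [IsAlgClosed k] [CharZero k]
    {X : Scheme.{u}} (f : X ⟶ Spec (CommRingCat.of k))
    [IsProper f] [SmoothOfRelativeDimension 1 f] [GeometricallyConnected f]
    (r n : ℕ) (hn : 0 < n)
    {A B : Type u} [CommRing A] [IsLocalRing A] [IsArtinianRing A] [Algebra k A]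
    [CommRing B] [IsLocalRing B] [IsArtinianRing B] [Algebra k B]
    (ε : A →ₐ[k] k) (q : B →ₐ[k] A) (hq : Function.Surjective q)
    (hsmall : IsLocalRing.maximalIdeal B * RingHom.ker q = ⊥)
    (x₀ : NilBundle X ⊤ r n) (hx₀ : x₀.HasOrder)
    (x : NilBundle (XBase f A) ⊤ r n) (hx : x.HasOrder)
    (ρ₀ : Reduction (specialFibre f ε) x x₀)
    {ι : Type u} (U : ι → X.Opens) (hU : ∀ α, IsAffineOpen (U α)) (hcov : ⨆ α, U α = ⊤) :
    (∃ ob : HH2 f x₀ (RingHom.ker q) U,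
      Nonempty (LocalLifts f q U x) ∧
      (∀ L : LocalLifts f q U x, ∃ z : Tot f x₀ (RingHom.ker q) U 1,
        L.IsObstructionCochain f q ρ₀ U z) ∧
      (∀ (L : LocalLifts f q U x) (z : Tot f x₀ (RingHom.ker q) U 1),
        L.IsObstructionCochain f q ρ₀ U z →
        ∃ hz : z ∈ LinearMap.ker (totD f x₀ (RingHom.ker q) U 1),
          HH2.mk f x₀ (RingHom.ker q) U ⟨z, hz⟩ = ob) ∧
      (ob = 0 ↔ Nonempty (Lift (baseMap f q) x)) ∧
      (ob = 0 → ∃ _ : AddTorsor (HH1 f x₀ (RingHom.ker q) U) (LiftClass (baseMap f q) x),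
        ∀ (y₁ y₂ : Lift (baseMap f q) x)
          (z : LinearMap.ker (totD f x₀ (RingHom.ker q) U 0)),
          HH1.mk f x₀ (RingHom.ker q) U z +ᵥ y₁.cls = y₂.cls ↔
            ∃ φ, IsDifferenceCochain f q ρ₀ U y₁ y₂ φ z.1)) ∧
    (∀ y : Lift (baseMap f q) x,
      ∃ e : Multiplicative (HH0 f x₀ (RingHom.ker q) U) ≃* y.aut,
        ∀ z : HH0 f x₀ (RingHom.ker q) U,
          IsOneAdd f q ρ₀ U y (e (Multiplicative.ofAdd z)) z.1) := by
  -- Bases adapted to the extension are fixed once, with ε and q as part of the data.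
  obtain ⟨D, rfl, rfl⟩ := SmallExt.exists_eq ε q hq hsmall
  -- X is separated because it is proper over `k`, so finite intersections of affine opens are
  -- affine and the local results apply to every term of the Čech complex.
  have : X.IsSeparated := ⟨by
    rw [← terminal.comp_from f]
    infer_instance⟩
  have hA : ∀ {p : ℕ} (a : Fin (p + 1) → ι), IsAffineOpen (⨅ l, U (a l)) := fun a =>
    IsAffineOpen.iInf fun l => hU (a l)
  obtain ⟨ob, hob, hob0⟩ := SmallExt.exists_obstruction ρ₀ hA hU hcov hx
  exact ⟨⟨ob, SmallExt.nonempty_localLifts ρ₀ hA hU, SmallExt.exists_isObstructionCochain ρ₀ hA,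
    hob, hob0, fun h => SmallExt.exists_torsor ρ₀ hA hU hcov hx (hob0.mp h)⟩,
    SmallExt.exists_mulEquiv_aut ρ₀ hA hcov⟩
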